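/- **Setting.** Let $d,N_{\rm b}\in\mathbb N_0$ and let $S$ be a set of atomic species. A configuration on an index set $\Lambda$ is a family ${\bm u}_\ell=({\bm r}_\ell,v_\ell,Z_\ell)\in\mathbb R^d\times\mathbb R\times S$, $\ell\in\Lambda$; write ${\bm r}_{\ell k}={\bm r}_k-{\bm r}_\ell$, $r_{\ell k}=|{\bm r}_{\ell k}|$ and ${\bm u}_{\ell k}=({\bm r}_{\ell k},v_\ell,v_k,Z_\ell,Z_k)$. A (three-centre) tight binding model with constants $h_0,\gamma_0>0$ consists of $C^1$ functions (for each choice of species) $h_{ZZ'}(\xi)$ and $t_{ZZ'Z''}(\xi,\zeta)$ of $\xi,\zeta\in\mathbb R^d$ with values in $\mathbb R^{N_{\rm b}\times N_{\rm b}}$, with $|h|+|\nabla h|\le h_0e^{-\gamma_0|\xi|}$, $|t|+|\nabla t|\le h_0e^{-\gamma_0(|\xi|+|\zeta|)}$, $h_{ZZ'}(\xi)=h_{Z'Z}(-\xi)^{\rm T}$ and $t_{ZZ'Z''}(\xi,\zeta)=t_{Z'ZZ''}(\zeta,\xi)^{\rm T}$. Its Hamiltonian is the self-adjoint operator $\mathcal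 H({\bm u})$ on $\ell^2(\Lambda\times\{1,\dots,N_{\rm b}\})$ with blocks $$\mathcal H({\bm u})_{\ell k}=h_{Z_\ell Z_k}({\bm r}_{\ell k})+\sum_{m\notin\{\ell,k\}}t_{Z_\ell Z_kZ_m}({\bm r}_{\ell m},{\bm r}_{km})+\delta_{\ell k}v_\ell\,{\rm Id}.$$ Configurations are assumed to satisfy $r_{\ell k}\ge r_0$ for all $\ell\ne k$ (with some $r_0>0$) and $\sup_\ell|v_\ell|<\infty$, so that $\mathcal H({\bm u})$ is bounded. For $0<\beta\le\infty$ and $\mu\in\mathbb R$ let $O^\beta$ be either $F^\beta$ or $G^\beta$, where $F^\beta(z)=(1+e^{\beta(z-\mu)})^{-1}$ and $G^\beta(z)=\frac2\beta\log(1-F^\beta(z))$ for $\beta<\infty$, and $F^\infty=\chi_{(-\infty,\mu)}+\frac12\chi_{\{\mu\}}$, $G^\infty(z)=2(z-\mu)\chi_{(-\infty,\mu)}(z)$. Put $O^\beta_\ell({\bm u})={\rm tr}[O^\beta(\mathcal H({\bm u}))_{\ell\ell}]$ and, for a finite set $X\subset\mathbb R$, $I_XO^\beta_\ell({\bm u})={\rm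 tr}[(I_XO^\beta)(\mathcal H({\bm u}))_{\ell\ell}]$, where $I_XO^\beta$ is the polynomial of degree at most $|X|-1$ interpolating $O^\beta$ on $X$. Write $\partial/\partial{\bm u}_m=(\partial/\partial{\bm r}_m,\partial/\partial v_m)$. Let $I_-,I_+$ be compact intervals of non-zero length with $\max I_-\le\min I_+$ and let $\mathsf g=\min I_+-\max I_-\ge0$. **Theorem.** For all $I_-,I_+$ as above there are sets $X_N\subset I_-\cup I_+$ with $|X_N|=N+1$ ($N\in\mathbb N_0$), depending only on $I_-,I_+$, such that the following holds. Fix $d,N_{\rm b},h_0,\gamma_0,r_0$. For all $I_-,I_+$, all $\mu\in[\max I_-,\min I_+]$ and all $0<\beta\le\infty$ such that $\beta<\infty$ or $\mathsf g>0$, there are constants $\gamma_N>0$ with $\gamma:=\lim_{N\to\infty}\gamma_N>0$, and $C_1,C_2,\eta>0$ independent of $N$, such that for every tight binding model with constants $h_0,\gamma_0$, and for $O^\beta=F^\beta$ and $O^\beta=G^\beta$: 1. $I_{X_N}O^\beta_\ell$ has finite body order: there are $N'\in\mathbb N_0$ and $(n+1)$-body potentials $V_n$, $0\le n<N'$, not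 depending on $\ell$, $\Lambda$ or ${\bm u}$, such that $I_{X_N}O^\beta_\ell({\bm u})=\sum_{n<N'}\sum_{k_1<\dots<k_n,\;k_i\ne\ell}V_n({\bm u}_\ell;{\bm u}_{\ell k_1},\dots,{\bm u}_{\ell k_n})$ (an absolutely convergent sum) for all configurations ${\bm u}$ as above. 2. For every configuration ${\bm u}^{\rm ref}$ with $r_{\ell k}\ge r_0$ $(\ell\neq k)$, $\sup_\ell|v_\ell|<\infty$ and $\sigma(\mathcal H({\bm u}^{\rm ref}))\subset I_-\cup I_+$, and, if $\beta=\infty$, $\mu\notin\sigma(\mathcal H({\bm u}^{\rm ref}))$, and for all $N,\ell,m$, the functions $O^\beta_\ell$ and $I_{X_N}O^\beta_\ell$ are differentiable in ${\bm u}_m$ at ${\bm u}^{\rm ref}$ and $$\big|O^\beta_\ell({\bm u}^{\rm ref})-I_{X_N}O^\beta_\ell({\bm u}^{\rm ref})\big|\le C_1e^{-\gamma_NN},\qquad \Big|\frac{\partial O^\beta_\ell}{\partial{\bm u}_m}({\bm u}^{\rm ref})-\frac{\partial I_{X_N}O^\beta_\ell}{\partial{\bm u}_m}({\bm u}^{\rm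 ref})\Big|\le C_2e^{-\frac12\gamma_NN}e^{-\eta r_{\ell m}}.$$ Moreover the constants can be chosen such that, for fixed outer endpoints $\min I_-<\mu<\max I_+$ and gap symmetric about $\mu$ (that is, $\mu-\max I_-=\min I_+-\mu$), as $\mathsf g+\beta^{-1}\to0$, $$C_1\sim(\mathsf g+\beta^{-1})^{-1},\qquad C_2\sim(\mathsf g+\beta^{-1})^{-3},\qquad \gamma,\eta\sim\mathsf g+\beta^{-1},$$ where $f\sim g$ means $c_1g\le f\le c_2g$ with constants $c_1,c_2>0$ once $\mathsf g+\beta^{-1}$ is positive and small enough ($c_1,c_2$ and the smallness threshold depend only on $d,N_{\rm b},h_0,\gamma_0,r_0,\mu$ and the outer endpoints). -/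

import Mathlib

open Set Filter Topology
open scoped ENNReal

universe u v

noncomputable section

namespace TightBinding

/-! ### Configurations -/

/-- The state `(r, v, Z)` of an atom: position, effective potential, species. -/
structure AtomState (d : ℕ) (S : Type u) where
  pos : EuclideanSpace ℝ (Fin d)
  pot : ℝ
  species : S

/-- The relative state `(r_k - r_ℓ, v_ℓ, v_k, Z_ℓ, Z_k)` of a pair of atoms. -/
structure RelState (d : ℕ) (S : Type u) where
  disp : EuclideanSpace ℝ (Fin d)
  pot₁ : ℝ
  pot₂ : ℝ
  species₁ : S
  species₂ : S

/-- A configuration of atoms indexed by `Λ`. -/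
abbrev Config (d : ℕ) (S : Type u) (Λ : Type v) := Λ → AtomState d S

namespace Config

variable {d : ℕ} {S : Type u} {Λ : Type v}

/-- The relative state of the pair `(ℓ, k)`. -/
def rel (c : Config d S Λ) (ℓ k : Λ) : RelState d S :=
  ⟨(c k).pos - (c ℓ).pos, (c ℓ).pot, (c k).pot, (c ℓ).species, (c k).species⟩

/-- The interatomic distance between `ℓ` and `k`. -/
def r (c : Config d S Λ) (ℓ k : Λ) : ℝ := ‖(c k).pos - (c ℓ).pos‖

/-- Distinct atoms have distance at least `r₀` (non-interpenetration), and the effective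
potential is bounded. -/
structure IsRegular (c : Config d S Λ) (r₀ : ℝ) : Prop where
  separated : ∀ ℓ k, ℓ ≠ k → r₀ ≤ c.r ℓ k
  bounded : ∃ B : ℝ, ∀ ℓ, |(c ℓ).pot| ≤ B

open Classical in
/-- The configuration in which position and potential of atom `m` are replaced by `y.1`, `y.2`. -/
def move (c : Config d S Λ) (m : Λ) (y : EuclideanSpace ℝ (Fin d) × ℝ) : Config d S Λ :=
  Function.update c m ⟨y.1, y.2, (c m).species⟩

/-- The actual position and potential of atom `m`. -/
def coord (c : Config d S Λ) (m : Λ) : EuclideanSpace ℝ (Fin d) × ℝ := ((c m).pos, (c m).pot)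

end Config

/-! ### The tight binding Hamiltonian -/

/-- Real `n × n` matrices, indexed by pairs of orbitals, with the Frobenius norm. -/
abbrev Block (n : ℕ) := EuclideanSpace ℝ (Fin n × Fin n)

/-- A three-centre tight binding model with `Nb` orbitals per atom. `h Z_ℓ Z_k ξ` is the two-centre
term at displacement `ξ = r_k - r_ℓ`; `t Z_ℓ Z_k Z_m (ξ, ζ)` is the three-centre term at
displacements `ξ = r_m - r_ℓ`, `ζ = r_m - r_k`. Both are continuously differentiable,
exponentially localised and symmetric. -/
structure TBModel (d Nb : ℕ) (S : Type u) (h₀ γ₀ : ℝ) where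
  h : S → S → EuclideanSpace ℝ (Fin d) → Block Nb
  t : S → S → S → EuclideanSpace ℝ (Fin d) × EuclideanSpace ℝ (Fin d) → Block Nb
  contDiff_h : ∀ Z Z', ContDiff ℝ 1 (h Z Z')
  contDiff_t : ∀ Z Z' Z'', ContDiff ℝ 1 (t Z Z' Z'')
  bound_h : ∀ Z Z' ξ, ‖h Z Z' ξ‖ + ‖fderiv ℝ (h Z Z') ξ‖ ≤ h₀ * Real.exp (-γ₀ * ‖ξ‖)
  bound_t : ∀ Z Z' Z'' ξ ζ, ‖t Z Z' Z'' (ξ, ζ)‖ + ‖fderiv ℝ (t Z Z' Z'') (ξ, ζ)‖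
    ≤ h₀ * Real.exp (-γ₀ * (‖ξ‖ + ‖ζ‖))
  symm_h : ∀ Z Z' ξ a b, h Z Z' ξ (a, b) = h Z' Z (-ξ) (b, a)
  symm_t : ∀ Z Z' Z'' ξ ζ a b, t Z Z' Z'' (ξ, ζ) (a, b) = t Z' Z Z'' (ζ, ξ) (b, a)

/-! ### Functions of an operator on a complex Hilbert space -/

section Hilbert

variable {H : Type v} [NormedAddCommGroup H] [InnerProductSpace ℂ H] [CompleteSpace H]

/-- The real spectrum of `T`; for self-adjoint `T` this is the spectrum of `T`. -/
def realSpectrum (T : H →L[ℂ] H) : Set ℝ := spectrum ℝ T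

/-- `f(T)` for a self-adjoint `T` and a function `f` continuous on the spectrum of `T`. -/
def applyFun (f : ℝ → ℝ) (T : H →L[ℂ] H) : H →L[ℂ] H := cfc f T

/-- `q(T)` for a polynomial `q`. -/
def applyPoly (q : Polynomial ℝ) (T : H →L[ℂ] H) : H →L[ℂ] H := Polynomial.aeval T q

end Hilbert

section Operators

variable {d Nb : ℕ} {S : Type u} {h₀ γ₀ : ℝ} {Λ : Type v}

open Classical in
/-- The matrix entry `H(c)_{ℓk}^{ab}` of the Hamiltonian, with `i = (ℓ, a)` and `j = (k, b)`. -/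
def hamEntry (M : TBModel d Nb S h₀ γ₀) (c : Config d S Λ) (i j : Λ × Fin Nb) : ℝ :=
  M.h (c i.1).species (c j.1).species ((c j.1).pos - (c i.1).pos) (i.2, j.2)
  + ∑' m : {m : Λ // m ≠ i.1 ∧ m ≠ j.1},
      M.t (c i.1).species (c j.1).species (c m).species
        ((c m).pos - (c i.1).pos, (c m).pos - (c j.1).pos) (i.2, j.2)
  + if i = j then (c i.1).pot else 0

/-- The Hilbert space `ℓ²(Λ × {1, …, Nb})`. -/
abbrev StateSpace (Λ : Type v) (Nb : ℕ) : Type v := lp (fun _ : Λ × Fin Nb => ℂ) 2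

open Classical in
/-- The standard basis vector. -/
def basisVec (i : Λ × Fin Nb) : StateSpace Λ Nb := lp.single 2 i (1 : ℂ)

/-- `T` is a bounded operator whose matrix in the standard basis is `A`. -/
def HasMatrix (T : StateSpace Λ Nb →L[ℂ] StateSpace Λ Nb) (A : Λ × Fin Nb → Λ × Fin Nb → ℝ) :
    Prop :=
  ∀ i j, inner ℂ (basisVec i) (T (basisVec j)) = (A i j : ℂ)

/-- A bounded operator is determined by its matrix. -/
theorem HasMatrix.unique {T T' : StateSpace Λ Nb →L[ℂ] StateSpace Λ Nb}
    {A : Λ × Fin Nb → Λ × Fin Nb → ℝ} (hT : HasMatrix T A) (hT' : HasMatrix T' A) : T = T' := by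
  classical
  have key : ∀ j, T (basisVec j) = T' (basisVec j) := by
    intro j
    ext i
    have h1 := (hT i j).trans (hT' i j).symm
    simpa [basisVec, lp.inner_single_left] using h1
  refine ContinuousLinearMap.ext fun f => ?_
  have hf := lp.hasSum_single (p := 2) (by norm_num) f
  have e : ∀ i, (lp.single 2 i (f i) : StateSpace Λ Nb) = (f i : ℂ) • basisVec i := by
    intro i
    rw [basisVec, ← lp.single_smul, smul_eq_mul, mul_one]
  have h1 := T.hasSum hf
  have h2 := T'.hasSum hf
  refine h1.unique ?_
  convert h2 using 2 with i
  rw [e, map_smul, map_smul, key]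

open Classical in
/-- The Hamiltonian `H(c)` as an operator on `ℓ²(Λ × {1, …, Nb})`: the unique bounded operator with
matrix `hamEntry M c`. (It exists for every regular configuration, by exponential localisation;
the value `0` is a placeholder for configurations whose matrix is not bounded.) -/
def hamiltonian (M : TBModel d Nb S h₀ γ₀) (c : Config d S Λ) :
    StateSpace Λ Nb →L[ℂ] StateSpace Λ Nb :=
  if hex : ∃ T : StateSpace Λ Nb →L[ℂ] StateSpace Λ Nb, HasMatrix T (hamEntry M c) then
    hex.choose
  else 0

/-- The trace `tr [T_{ℓℓ}]` of the `ℓ`-th diagonal `Nb × Nb` block of (a self-adjoint) `T`. -/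
def siteTrace (T : StateSpace Λ Nb →L[ℂ] StateSpace Λ Nb) (ℓ : Λ) : ℝ :=
  ∑ a : Fin Nb, (inner ℂ (basisVec (ℓ, a)) (T (basisVec (ℓ, a)))).re

/-- The local observable `O_ℓ(c) = tr [O(H(c))_{ℓℓ}]`, through the functional calculus of the
self-adjoint operator `H(c)`. -/
def localObs (M : TBModel d Nb S h₀ γ₀) (O : ℝ → ℝ) (c : Config d S Λ) (ℓ : Λ) : ℝ :=
  siteTrace (applyFun O (hamiltonian M c)) ℓ

/-- `tr [q(H(c))_{ℓℓ}]` for a polynomial `q`. -/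
def localPoly (M : TBModel d Nb S h₀ γ₀) (q : Polynomial ℝ) (c : Config d S Λ) (ℓ : Λ) : ℝ :=
  siteTrace (applyPoly q (hamiltonian M c)) ℓ

/-- The polynomial of degree at most `|X| - 1` interpolating `O` on `X`. -/
def interp (X : Finset ℝ) (O : ℝ → ℝ) : Polynomial ℝ := Lagrange.interpolate X id O

/-- `c ↦ tr [q(H(c))_{ℓℓ}]` has finite body order: there are `N` and `(n+1)`-body potentials
`V_n`, `n < N`, not depending on the configuration, the index set or the site, with
`tr [q(H(c))_{ℓℓ}] = ∑_{n < N} ∑_{k_1 < ⋯ < k_n, k_i ≠ ℓ} V_n(c_ℓ; c_{ℓk_1}, …, c_{ℓk_n})`.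
`V_n` is the restriction of `V (c_ℓ)` to multisets of `n` relative states, and the sum over
`k_1 < ⋯ < k_n` is written as the (unconditionally convergent) sum over the sets
`K = {k_1, …, k_n}`. -/
def HasFiniteBodyOrder (M : TBModel d Nb S h₀ γ₀) (q : Polynomial ℝ) : Prop :=
  ∃ (N : ℕ) (V : AtomState d S → Multiset (RelState d S) → ℝ),
    ∀ (Λ : Type v) (c : Config d S Λ) (r₀ : ℝ), 0 < r₀ → c.IsRegular r₀ → ∀ ℓ : Λ,
      HasSum (fun K : {K : Finset Λ // ℓ ∉ K ∧ K.card < N} => V (c ℓ) (K.1.val.map (c.rel ℓ)))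
        (localPoly M q c ℓ)

end Operators

/-! ### Observables -/

/-- The Fermi–Dirac distribution at inverse temperature `β ∈ (0, ∞]` and chemical potential `μ`. -/
def fermiDirac (β : ℝ≥0∞) (μ z : ℝ) : ℝ :=
  if β = ∞ then (if z < μ then 1 else if z = μ then 1 / 2 else 0)
  else (1 + Real.exp (β.toReal * (z - μ)))⁻¹

/-- The grand potential function at inverse temperature `β ∈ (0, ∞]`, chemical potential `μ`. -/
def grandPotential (β : ℝ≥0∞) (μ z : ℝ) : ℝ :=
  if β = ∞ then (if z < μ then 2 * (z - μ) else 0)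
  else 2 / β.toReal * Real.log (1 - fermiDirac β μ z)

/-! ### Spectral windows -/

/-- A pair of compact intervals `I₋ = [minMinus, maxMinus]`, `I₊ = [minPlus, maxPlus]` of non-zero
length, with `max I₋ ≤ min I₊`. -/
structure Window where
  minMinus : ℝ
  maxMinus : ℝ
  minPlus : ℝ
  maxPlus : ℝ
  minus_lt : minMinus < maxMinus
  gap_nonneg : maxMinus ≤ minPlus
  plus_lt : minPlus < maxPlus

namespace Window

/-- The set `I₋ ∪ I₊`. -/
def bands (W : Window) : Set ℝ := Icc W.minMinus W.maxMinus ∪ Icc W.minPlus W.maxPlus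

/-- The gap `min I₊ - max I₋`. -/
def gap (W : Window) : ℝ := W.minPlus - W.maxMinus

end Window

end TightBinding

end

/-!
# Body-ordered approximation of local observables in tight binding models

A power of the Hamiltonian is a sum over paths of atoms, and a path of length `n` meets at most
`2 n` atoms besides its end point (the three-centre terms contribute one extra atom per step).
Grouping the paths by the set of atoms that they meet shows that every polynomial of the Hamiltonian
has finite body order (`hasFiniteBodyOrder`). What remains is to choose interpolation nodes for
which the interpolants are good approximations of the observable `O`.

Two facts turn operator estimates into scalar ones. The error of the local observable at the
reference configuration is at most the error `O - q` on the bands (`abs_localObs_sub_localPoly_le`).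
For the derivatives, `O - q` is written as a Cauchy integral over a contour at distance `δ` from the
spectrum. The derivative of a resolvent is `R H' R`, the matrix elements of a resolvent decay
exponentially at a rate proportional to `δ` by the argument of Combes and Thomas
(`norm_inner_resolvent_le`), and the derivative `H'` of the Hamiltonian in the state of the atom `m`
is concentrated near `m`; this bounds the derivative of the local error by `δ⁻²` times the error on
the contour, with a factor decaying exponentially in the distance to `m`
(`norm_fderiv_localObs_sub_le`).

The scalar problem is to interpolate `O` in a complex neighbourhood of width `δ` of the two bands.
The partial fractions of the Fermi function express `O` through Cauchy kernels with poles `ν ± i y`,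
`y ≥ y₀`, on a vertical line through the gap, where `y₀ = π / β` and `ν = μ`, or `y₀ = 0` and `ν` is
any point of the gap at zero temperature. A linear functional that kills constants is therefore
bounded on `O` by its values on these kernels and on affine functions (`exists_continuation`). The
interpolation error of the kernel `(z - ζ)⁻¹` is `ω(z) / (ω(ζ) (z - ζ))` with the nodal polynomial
`ω` (`cauchy_sub_sum_basis`).

It remains to find nodes in the bands such that `|ω(z)| / |ω(ζ)|` is at most a constant times
`exp (-c S N)`, for `z` near the bands and `ζ` on the line, where `S² = y₀² + (ν - p) (q - ν)` and
`p ≤ q` are the inner band edges (`exists_nodes`). The quadratic map `z ↦ 1 - κ (z - p) (z - q)`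
sends both inner edges to `1`, the adjacent parts of the bands into `[-1, 1]`, and the points `ζ` to
the right of `1 + κ S²`. A Chebyshev polynomial of this map grows by `exp (c S n)` between the two
regions, the square root of `κ S²` being due to the behaviour of Chebyshev polynomials at the edge.
Away from the inner edges it is large, and this is compensated by two clusters of nodes at
the outer ends of the bands, in a proportion for which their contribution is equal at `p` and `q`
and decreases from there into the bands.

The width `δ` is a small multiple of `S² / (gap + S)`. The bounds are then `C₁ ∼ δ⁻¹`,
`C₂ ∼ δ⁻³`, `γ ∼ S`, `η ∼ δ`, and for a gap symmetric about `μ` both `S` and `δ` are comparable to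
`gap + β⁻¹` (`Window.scales_of_symm`).
-/

open Set Filter Topology
open scoped ENNReal

noncomputable section

namespace TightBinding

/-! ### Exponentially weighted sums over separated sets -/

theorem integrable_exp_neg_mul_norm (d : ℕ) {γ : ℝ} (hγ : 0 < γ) :
    MeasureTheory.Integrable (fun y : EuclideanSpace ℝ (Fin d) => Real.exp (-γ * ‖y‖)) := by
  have h1 := integrable_one_add_norm (E := EuclideanSpace ℝ (Fin d)) (r := (d : ℝ) + 1)
    (μ := MeasureTheory.volume) (by simp)
  -- `(1 + t) ^ (d + 1)` is dominated by the exponential, through the power series of `exp`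
  have hC : ∀ t : ℝ, 0 ≤ t → Real.exp (-γ * t) ≤
      ((d + 1).factorial * Real.exp γ / γ ^ (d + 1)) * (1 + t) ^ (-((d : ℝ) + 1)) := by
    intro t ht
    have h2 := Real.pow_div_factorial_le_exp (γ * (1 + t)) (by positivity) (d + 1)
    have h3 : (1 + t) ^ (-((d : ℝ) + 1)) = ((1 + t) ^ (d + 1))⁻¹ := by
      rw [Real.rpow_neg (by positivity)]
      congr 1
      exact_mod_cast Real.rpow_natCast (1 + t) (d + 1)
    rw [h3, show -γ * t = γ - γ * (1 + t) by ring, Real.exp_sub]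
    rw [mul_pow] at h2
    have hp : 0 < Real.exp (γ * (1 + t)) := Real.exp_pos _
    have hf : (0 : ℝ) < (d + 1).factorial := by exact_mod_cast Nat.factorial_pos _
    rw [div_le_iff₀ hf] at h2
    rw [div_le_iff₀ hp]
    have h1t : 0 < (1 + t) ^ (d + 1) := by positivity
    have hg : 0 < γ ^ (d + 1) := by positivity
    rw [show ((d + 1).factorial * Real.exp γ / γ ^ (d + 1)) * ((1 + t) ^ (d + 1))⁻¹ *
      Real.exp (γ * (1 + t)) = Real.exp γ * ((Real.exp (γ * (1 + t)) * (d + 1).factorial)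
        / (γ ^ (d + 1) * (1 + t) ^ (d + 1))) by field_simp]
    exact le_mul_of_one_le_right (Real.exp_pos _).le ((one_le_div (by positivity)).2 h2)
  refine (h1.const_mul ((d + 1).factorial * Real.exp γ / γ ^ (d + 1))).mono'
    (by fun_prop) (Eventually.of_forall fun y => ?_)
  rw [Real.norm_of_nonneg (Real.exp_pos _).le]
  exact hC _ (norm_nonneg y)

/-- Exponentially weighted sums over `r₀`-separated families of points are bounded uniformly in
the family: compare with the integral over the disjoint balls of radius `r₀ / 2`. -/
theorem exists_packing_bound (d : ℕ) {γ r₀ : ℝ} (hγ : 0 < γ) (hr₀ : 0 < r₀) :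
    ∃ C : ℝ, 0 < C ∧ ∀ (Λ : Type v) (x : Λ → EuclideanSpace ℝ (Fin d)),
      (∀ i j, i ≠ j → r₀ ≤ ‖x j - x i‖) → ∀ p : EuclideanSpace ℝ (Fin d),
      Summable (fun k => Real.exp (-γ * ‖x k - p‖)) ∧
        ∑' k, Real.exp (-γ * ‖x k - p‖) ≤ C := by
  classical
  set E := EuclideanSpace ℝ (Fin d)
  set I : ℝ := ∫ y : E, Real.exp (-γ * ‖y‖)
  set vB : ℝ := MeasureTheory.volume.real (Metric.ball (0 : E) (r₀ / 2))
  have hvB : 0 < vB := by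
    refine ENNReal.toReal_pos (Metric.measure_ball_pos _ _ (by positivity)).ne' ?_
    exact MeasureTheory.measure_ball_lt_top.ne
  have hI : 0 ≤ I := MeasureTheory.integral_nonneg fun y => (Real.exp_pos _).le
  refine ⟨Real.exp (γ * (r₀ / 2)) * I / vB + 1, by positivity, fun Λ x hx p => ?_⟩
  have hint : MeasureTheory.Integrable (fun y : E => Real.exp (-γ * ‖y - p‖)) :=
    (integrable_exp_neg_mul_norm d hγ).comp_sub_right p
  have key : ∀ F : Finset Λ, ∑ k ∈ F, Real.exp (-γ * ‖x k - p‖) ≤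
      Real.exp (γ * (r₀ / 2)) * I / vB + 1 := by
    intro F
    have h1 : ∀ k, Real.exp (-γ * ‖x k - p‖) * vB ≤
        Real.exp (γ * (r₀ / 2)) * ∫ y in Metric.ball (x k) (r₀ / 2), Real.exp (-γ * ‖y - p‖) := by
      intro k
      rw [← MeasureTheory.integral_const_mul]
      have hv : vB = MeasureTheory.volume.real (Metric.ball (x k) (r₀ / 2)) := by
        simp only [vB, MeasureTheory.Measure.real]
        rw [MeasureTheory.Measure.addHaar_ball_center _ (x k)]
      have : Real.exp (-γ * ‖x k - p‖) * vB =
          ∫ y in Metric.ball (x k) (r₀ / 2), Real.exp (-γ * ‖x k - p‖) := by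
        rw [MeasureTheory.setIntegral_const, smul_eq_mul, hv, mul_comm]
      rw [this]
      refine MeasureTheory.setIntegral_mono_on ?_ (hint.integrableOn.const_mul _)
        Metric.isOpen_ball.measurableSet ?_
      · exact MeasureTheory.integrableOn_const MeasureTheory.measure_ball_lt_top.ne
      · intro y hy
        rw [← Real.exp_add]
        apply Real.exp_le_exp.2
        have h2 : ‖y - p‖ ≤ ‖x k - p‖ + r₀ / 2 := by
          have h3 : ‖y - x k‖ < r₀ / 2 := by simpa [dist_eq_norm] using hy
          have h4 : y - p = (x k - p) + (y - x k) := by abel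
          rw [h4]
          linarith [norm_add_le (x k - p) (y - x k)]
        nlinarith
    have h2 : ∑ k ∈ F, ∫ y in Metric.ball (x k) (r₀ / 2), Real.exp (-γ * ‖y - p‖) ≤ I := by
      rw [← MeasureTheory.integral_biUnion_finset F
        (fun k _ => Metric.isOpen_ball.measurableSet) ?_ (fun k _ => hint.integrableOn)]
      · have : I = ∫ y : E, Real.exp (-γ * ‖y - p‖) :=
          (MeasureTheory.integral_sub_right_eq_self (fun y : E => Real.exp (-γ * ‖y‖)) p).symm
        rw [this]
        exact MeasureTheory.setIntegral_le_integral hint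
          (Eventually.of_forall fun y => (Real.exp_pos _).le)
      · intro i _ j _ hij
        refine Metric.ball_disjoint_ball ?_
        have := hx i j hij
        rw [dist_eq_norm, norm_sub_rev]
        linarith
    have h3 : (∑ k ∈ F, Real.exp (-γ * ‖x k - p‖)) * vB ≤ Real.exp (γ * (r₀ / 2)) * I := by
      rw [Finset.sum_mul]
      refine (Finset.sum_le_sum fun k _ => h1 k).trans ?_
      rw [← Finset.mul_sum]
      exact mul_le_mul_of_nonneg_left h2 (Real.exp_pos _).le
    have := (le_div_iff₀ hvB).2 h3
    linarith
  have hs : Summable (fun k => Real.exp (-γ * ‖x k - p‖)) :=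
    summable_of_sum_le (fun k => (Real.exp_pos _).le) key
  exact ⟨hs, hs.tsum_le_of_sum_le key⟩

/-! ### Schur's test -/

section Schur

variable {ι : Type v}

/-- The standard unit vectors of `ℓ²`. -/
abbrev unitVec [DecidableEq ι] (i : ι) : lp (fun _ : ι => ℂ) 2 := lp.single 2 i (1 : ℂ)

theorem hasSum_norm_sq (f : lp (fun _ : ι => ℂ) 2) : HasSum (fun i => ‖f i‖ ^ 2) (‖f‖ ^ 2) := by
  have := lp.hasSum_norm (p := 2) (by norm_num) f
  simpa using this

/-- A weighted sum over pairs, row by row: the rows of `B` are summable with sums at most `K`. -/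
theorem summable_tsum_prod_le {κ : Type*} {B : ι → κ → ℝ} {K : ℝ} (hB : ∀ i j, 0 ≤ B i j)
    (hrow : ∀ i, Summable (B i)) (hsum : ∀ i, ∑' j, B i j ≤ K) {g : ι → ℝ}
    (hg : ∀ i, 0 ≤ g i) (hgs : Summable g) :
    Summable (fun x : ι × κ => B x.1 x.2 * g x.1) ∧
      ∑' x : ι × κ, B x.1 x.2 * g x.1 ≤ K * ∑' i, g i := by
  have hle : ∀ i, ∑' j, B i j * g i ≤ K * g i := fun i => by
    rw [tsum_mul_right]
    exact mul_le_mul_of_nonneg_right (hsum i) (hg i)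
  have hsf : Summable (fun i => K * g i) := hgs.mul_left K
  have h1 : Summable (fun x : ι × κ => B x.1 x.2 * g x.1) := by
    refine (summable_prod_of_nonneg (f := fun x : ι × κ => B x.1 x.2 * g x.1)
      fun x => mul_nonneg (hB _ _) (hg _)).2 ⟨fun i => (hrow i).mul_right (g i), ?_⟩
    exact hsf.of_nonneg_of_le (fun i => tsum_nonneg fun j => mul_nonneg (hB _ _) (hg _)) hle
  refine ⟨h1, ?_⟩
  rw [h1.tsum_prod, ← tsum_mul_left]
  exact h1.prod.tsum_le_tsum hle hsf

/-- Schur's test: a matrix dominated by a symmetric matrix with row sums at most `K` is the matrix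
of an operator of norm at most `K`. -/
theorem exists_operator_of_schur [DecidableEq ι] {A : ι → ι → ℂ} {B : ι → ι → ℝ} {K : ℝ}
    (hK : 0 ≤ K) (hAB : ∀ i j, ‖A i j‖ ≤ B i j) (hsymm : ∀ i j, B i j = B j i)
    (hrow : ∀ i, Summable (B i)) (hsum : ∀ i, ∑' j, B i j ≤ K) :
    ∃ T : lp (fun _ : ι => ℂ) 2 →L[ℂ] lp (fun _ : ι => ℂ) 2,
      ‖T‖ ≤ K ∧ ∀ i j, inner ℂ (unitVec i) (T (unitVec j)) = A i j := by
  have hB : ∀ i j, 0 ≤ B i j := fun i j => (norm_nonneg _).trans (hAB i j)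
  -- summability of `B i j * ‖f i‖ ^ 2` over all pairs
  have hs1 : ∀ f : lp (fun _ : ι => ℂ) 2,
      Summable (fun x : ι × ι => B x.1 x.2 * ‖f x.1‖ ^ 2) ∧
        ∑' x : ι × ι, B x.1 x.2 * ‖f x.1‖ ^ 2 ≤ K * ‖f‖ ^ 2 := by
    intro f
    have h := summable_tsum_prod_le hB hrow hsum (fun i => sq_nonneg ‖f i‖)
      (hasSum_norm_sq f).summable
    rwa [(hasSum_norm_sq f).tsum_eq] at h
  have hs2 : ∀ f : lp (fun _ : ι => ℂ) 2,
      Summable (fun x : ι × ι => B x.1 x.2 * ‖f x.2‖ ^ 2) ∧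
        ∑' x : ι × ι, B x.1 x.2 * ‖f x.2‖ ^ 2 ≤ K * ‖f‖ ^ 2 := by
    intro f
    have e : (fun x : ι × ι => B x.1 x.2 * ‖f x.2‖ ^ 2) =
        (fun x : ι × ι => B x.1 x.2 * ‖f x.1‖ ^ 2) ∘ (Equiv.prodComm ι ι) := by
      ext x
      simp [hsymm x.1 x.2]
    rw [e]
    refine ⟨(Equiv.summable_iff _).2 (hs1 f).1, ?_⟩
    have h2 := (Equiv.prodComm ι ι).tsum_eq (fun x : ι × ι => B x.1 x.2 * ‖f x.1‖ ^ 2)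
    refine le_trans (le_of_eq ?_) (hs1 f).2
    simpa [Function.comp_def] using h2
  set F : lp (fun _ : ι => ℂ) 2 → lp (fun _ : ι => ℂ) 2 → ι × ι → ℂ :=
    fun f g x => starRingEnd ℂ (f x.2 * A x.1 x.2) * g x.1 with hF
  have hFle : ∀ f g x, ‖F f g x‖ ≤
      (B x.1 x.2 * ‖f x.2‖ ^ 2 + B x.1 x.2 * ‖g x.1‖ ^ 2) / 2 := by
    intro f g x
    simp only [hF, norm_mul, RCLike.norm_conj]
    have h1 := hAB x.1 x.2
    have h2 : 0 ≤ ‖f x.2‖ * ‖g x.1‖ := by positivity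
    nlinarith [mul_le_mul_of_nonneg_left h1 h2, sq_nonneg (‖f x.2‖ - ‖g x.1‖),
      mul_nonneg (hB x.1 x.2) (sq_nonneg (‖f x.2‖ - ‖g x.1‖))]
  have hbsum : ∀ f g : lp (fun _ : ι => ℂ) 2, Summable (fun x : ι × ι =>
      (B x.1 x.2 * ‖f x.2‖ ^ 2 + B x.1 x.2 * ‖g x.1‖ ^ 2) / 2) :=
    fun f g => ((hs2 f).1.add (hs1 g).1).div_const 2
  have hFs : ∀ f g, Summable (F f g) := fun f g =>
    Summable.of_norm_bounded (hbsum f g) (hFle f g)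
  have hFb : ∀ f g, ‖∑' x, F f g x‖ ≤ K * (‖f‖ ^ 2 + ‖g‖ ^ 2) / 2 := by
    intro f g
    refine (tsum_of_norm_bounded (hbsum f g).hasSum (hFle f g)).trans ?_
    rw [tsum_div_const, (hs2 f).1.tsum_add (hs1 g).1]
    have h1 := (hs2 f).2
    have h2 := (hs1 g).2
    linarith
  set L : lp (fun _ : ι => ℂ) 2 →ₗ⋆[ℂ] lp (fun _ : ι => ℂ) 2 →ₗ[ℂ] ℂ :=
    LinearMap.mk₂'ₛₗ (starRingEnd ℂ) (RingHom.id ℂ) (fun f g => ∑' x, F f g x)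
      (fun f f' g => by
        rw [← (hFs f g).tsum_add (hFs f' g)]
        exact tsum_congr fun x => by simp [hF]; ring)
      (fun c f g => by
        rw [smul_eq_mul, ← tsum_mul_left]
        exact tsum_congr fun x => by simp [hF]; ring)
      (fun f g g' => by
        rw [← (hFs f g).tsum_add (hFs f g')]
        exact tsum_congr fun x => by simp [hF]; ring)
      (fun c f g => by
        rw [RingHom.id_apply, smul_eq_mul, ← tsum_mul_left]
        exact tsum_congr fun x => by simp [hF]; ring) with hL
  have hLapp : ∀ f g, L f g = ∑' x, F f g x := fun f g => rfl
  -- rescaling both arguments to norm one turns the arithmetic mean into the product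
  have hLb : ∀ f g, ‖L f g‖ ≤ K * ‖f‖ * ‖g‖ := by
    intro f g
    rcases eq_or_ne f 0 with rfl | hf
    · simp
    rcases eq_or_ne g 0 with rfl | hg
    · simp
    have hf' : 0 < ‖f‖ := norm_pos_iff.2 hf
    have hg' : 0 < ‖g‖ := norm_pos_iff.2 hg
    have h1 := hFb (((‖f‖⁻¹ : ℝ) : ℂ) • f) (((‖g‖⁻¹ : ℝ) : ℂ) • g)
    have e1 : L (((‖f‖⁻¹ : ℝ) : ℂ) • f) (((‖g‖⁻¹ : ℝ) : ℂ) • g) =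
        ((‖g‖⁻¹ : ℝ) : ℂ) * (((‖f‖⁻¹ : ℝ) : ℂ) * L f g) := by
      rw [L.map_smulₛₗ, LinearMap.map_smul, LinearMap.smul_apply, Complex.conj_ofReal,
        smul_eq_mul, smul_eq_mul]
    rw [← hLapp, e1] at h1
    simp only [norm_smul, norm_mul, Complex.norm_real, Real.norm_eq_abs, abs_inv, abs_norm] at h1
    rw [inv_mul_cancel₀ hf'.ne', inv_mul_cancel₀ hg'.ne'] at h1
    have h2 : ‖g‖⁻¹ * (‖f‖⁻¹ * ‖L f g‖) ≤ K := h1.trans (by linarith)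
    rw [← mul_assoc, ← mul_inv, inv_mul_le_iff₀ (by positivity)] at h2
    linarith
  set T := InnerProductSpace.continuousLinearMapOfBilin (𝕜 := ℂ) (L.mkContinuous₂ K hLb) with hT
  have hTapp : ∀ f g, inner ℂ (T f) g = ∑' x, F f g x := fun f g => by
    rw [hT, InnerProductSpace.continuousLinearMapOfBilin_apply, LinearMap.mkContinuous₂_apply,
      hLapp]
  refine ⟨T, ?_, fun i j => ?_⟩
  · refine ContinuousLinearMap.opNorm_le_bound _ hK fun f => ?_
    rcases eq_or_ne (T f) 0 with h0 | h0
    · rw [h0, norm_zero]; positivity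
    have h1 := hLb f (T f)
    rw [hLapp, ← hTapp, inner_self_eq_norm_sq_to_K] at h1
    have h2 : ‖T f‖ * ‖T f‖ ≤ K * ‖f‖ * ‖T f‖ := by
      simpa [sq] using h1
    exact le_of_mul_le_mul_right h2 (norm_pos_iff.2 h0)
  · rw [← inner_conj_symm, hTapp, tsum_eq_single (i, j)]
    · simp [hF, unitVec]
    · intro x hx
      by_cases h1 : x.1 = i
      · have h2 : x.2 ≠ j := fun h => hx (Prod.ext h1 h)
        simp [hF, unitVec, lp.single_apply, h2]
      · simp [hF, unitVec, lp.single_apply, h1]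

end Schur

/-! ### The Hamiltonian of a regular configuration -/

section Hamiltonian

variable {d Nb : ℕ} {S : Type u} {h₀ γ₀ : ℝ} {Λ : Type v}

theorem Config.r_nonneg (c : Config d S Λ) (ℓ k : Λ) : 0 ≤ c.r ℓ k := norm_nonneg _

theorem Config.r_self (c : Config d S Λ) (ℓ : Λ) : c.r ℓ ℓ = 0 := by simp [Config.r]

theorem Config.r_comm (c : Config d S Λ) (ℓ k : Λ) : c.r ℓ k = c.r k ℓ := by
  simp only [Config.r]; exact norm_sub_rev _ _

theorem Config.r_triangle (c : Config d S Λ) (ℓ k m : Λ) : c.r ℓ k ≤ c.r ℓ m + c.r m k := by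
  simp only [Config.r]
  have : (c k).pos - (c ℓ).pos = ((c m).pos - (c ℓ).pos) + ((c k).pos - (c m).pos) := by abel
  rw [this]
  exact norm_add_le _ _

/-- A bound for exponentially weighted sums over `r₀`-separated configurations. -/
def packConst (d : ℕ) (γ r₀ : ℝ) : ℝ :=
  if h : 0 < γ ∧ 0 < r₀ then (exists_packing_bound.{v} d h.1 h.2).choose else 1

theorem packConst_pos (d : ℕ) (γ r₀ : ℝ) : 0 < packConst.{v} d γ r₀ := by
  unfold packConst
  split_ifs with h
  · exact (exists_packing_bound.{v} d h.1 h.2).choose_spec.1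
  · exact one_pos

section Sums

variable {c : Config d S Λ} {r₀ : ℝ}

theorem summable_exp_r (hc : c.IsRegular r₀) (hr₀ : 0 < r₀) {γ : ℝ} (hγ : 0 < γ) (ℓ : Λ) :
    Summable (fun k => Real.exp (-γ * c.r ℓ k)) ∧
      ∑' k, Real.exp (-γ * c.r ℓ k) ≤ packConst.{v} d γ r₀ := by
  have h := (exists_packing_bound.{v} d hγ hr₀).choose_spec.2 Λ (fun k => (c k).pos)
    (fun i j hij => hc.separated i j hij) (c ℓ).pos
  unfold packConst
  rw [dif_pos ⟨hγ, hr₀⟩]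
  exact h

theorem summable_exp_r_orbital (hc : c.IsRegular r₀) (hr₀ : 0 < r₀) {γ : ℝ} (hγ : 0 < γ) (ℓ : Λ) :
    Summable (fun j : Λ × Fin Nb => Real.exp (-γ * c.r ℓ j.1)) ∧
      ∑' j : Λ × Fin Nb, Real.exp (-γ * c.r ℓ j.1) ≤ Nb * packConst.{v} d γ r₀ := by
  obtain ⟨h1, h2⟩ := summable_exp_r hc hr₀ hγ ℓ
  have h3 : Summable (fun j : Λ × Fin Nb => Real.exp (-γ * c.r ℓ j.1)) := by
    refine (summable_prod_of_nonneg (f := fun j : Λ × Fin Nb => Real.exp (-γ * c.r ℓ j.1))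
      fun j => (Real.exp_pos _).le).2 ⟨fun k => Summable.of_finite, ?_⟩
    simpa using h1.mul_left (Nb : ℝ)
  refine ⟨h3, ?_⟩
  rw [h3.tsum_prod]
  simp only [tsum_fintype, Finset.sum_const, Finset.card_univ, Fintype.card_fin, nsmul_eq_mul]
  rw [tsum_mul_left]
  exact mul_le_mul_of_nonneg_left h2 (by positivity)

end Sums

theorem Block.abs_apply_le {n : ℕ} (A : Block n) (x : Fin n × Fin n) : |A x| ≤ ‖A‖ := by
  simpa using PiLp.norm_apply_le A x

theorem TBModel.h₀_nonneg (M : TBModel d Nb S h₀ γ₀) (Z : S) : 0 ≤ h₀ := by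
  have h1 := M.bound_h Z Z 0
  have h2 : 0 ≤ ‖M.h Z Z 0‖ + ‖fderiv ℝ (M.h Z Z) 0‖ := by positivity
  exact nonneg_of_mul_nonneg_left (h2.trans h1) (Real.exp_pos _)

theorem TBModel.abs_h_le (M : TBModel d Nb S h₀ γ₀) (Z Z' : S) (ξ : EuclideanSpace ℝ (Fin d))
    (x : Fin Nb × Fin Nb) : |M.h Z Z' ξ x| ≤ h₀ * Real.exp (-γ₀ * ‖ξ‖) :=
  (Block.abs_apply_le _ _).trans
    ((le_add_of_nonneg_right (norm_nonneg _)).trans (M.bound_h Z Z' ξ))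

theorem TBModel.abs_t_le (M : TBModel d Nb S h₀ γ₀) (Z Z' Z'' : S)
    (ξ ζ : EuclideanSpace ℝ (Fin d)) (x : Fin Nb × Fin Nb) :
    |M.t Z Z' Z'' (ξ, ζ) x| ≤ h₀ * Real.exp (-γ₀ * (‖ξ‖ + ‖ζ‖)) :=
  (Block.abs_apply_le _ _).trans
    ((le_add_of_nonneg_right (norm_nonneg _)).trans (M.bound_t Z Z' Z'' ξ ζ))

open Classical in
/-- The contribution of atom `m` to the matrix entry `H(c)_{ij}`. The two-centre term and the
potential are attributed to `m = i.1`, so that an entry is the sum of its contributions over all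
atoms `m`, without exceptions. -/
def hamTerm (M : TBModel d Nb S h₀ γ₀) (c : Config d S Λ) (i j : Λ × Fin Nb) (m : Λ) : ℝ :=
  if m = i.1 then
    M.h (c i.1).species (c j.1).species ((c j.1).pos - (c i.1).pos) (i.2, j.2)
      + if i = j then (c i.1).pot else 0
  else if m = j.1 then 0
  else M.t (c i.1).species (c j.1).species (c m).species
    ((c m).pos - (c i.1).pos, (c m).pos - (c j.1).pos) (i.2, j.2)

variable {M : TBModel d Nb S h₀ γ₀} {c : Config d S Λ} {r₀ : ℝ}

open Classical in
theorem abs_hamTerm_le (hγ₀ : 0 < γ₀) (i j : Λ × Fin Nb) (m : Λ) :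
    |hamTerm M c i j m| ≤
      h₀ * Real.exp (-(γ₀ / 2) * c.r i.1 j.1) * Real.exp (-(γ₀ / 2) * c.r i.1 m)
        + if m = i.1 then (if i = j then |(c i.1).pot| else 0) else 0 := by
  have hh₀ := M.h₀_nonneg (c i.1).species
  unfold hamTerm
  split_ifs with h1 h2 h3
  · subst h1
    refine (abs_add_le _ _).trans (add_le_add ?_ le_rfl)
    refine (M.abs_h_le _ _ _ _).trans ?_
    rw [Config.r_self, mul_zero, Real.exp_zero, mul_one]
    refine mul_le_mul_of_nonneg_left (Real.exp_le_exp.2 ?_) hh₀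
    have := norm_nonneg ((c j.1).pos - (c i.1).pos)
    simp only [Config.r]
    nlinarith
  · subst h1
    rw [add_zero, add_zero]
    refine (M.abs_h_le _ _ _ _).trans ?_
    rw [Config.r_self, mul_zero, Real.exp_zero, mul_one]
    refine mul_le_mul_of_nonneg_left (Real.exp_le_exp.2 ?_) hh₀
    have := norm_nonneg ((c j.1).pos - (c i.1).pos)
    simp only [Config.r]
    nlinarith
  · rw [abs_zero, add_zero]
    positivity
  · rw [add_zero]
    refine (M.abs_t_le _ _ _ _ _ _).trans ?_
    rw [mul_assoc, ← Real.exp_add]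
    refine mul_le_mul_of_nonneg_left (Real.exp_le_exp.2 ?_) hh₀
    have h4 := c.r_triangle i.1 j.1 m
    have h5 := c.r_nonneg j.1 m
    rw [c.r_comm m j.1] at h4
    change -γ₀ * (c.r i.1 m + c.r j.1 m) ≤ _
    nlinarith

open Classical in
theorem summable_hamTerm (hγ₀ : 0 < γ₀) (hr₀ : 0 < r₀) (hc : c.IsRegular r₀) (i j : Λ × Fin Nb) :
    Summable (fun m => |hamTerm M c i j m|) ∧
      ∑' m, |hamTerm M c i j m| ≤
        h₀ * packConst.{v} d (γ₀ / 2) r₀ * Real.exp (-(γ₀ / 2) * c.r i.1 j.1)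
          + if i = j then |(c i.1).pot| else 0 := by
  have hh₀ := M.h₀_nonneg (c i.1).species
  obtain ⟨h1, h2⟩ := summable_exp_r hc hr₀ (half_pos hγ₀) i.1
  have h3 := (h1.mul_left (h₀ * Real.exp (-(γ₀ / 2) * c.r i.1 j.1))).hasSum.add
    (hasSum_ite_eq i.1 (if i = j then |(c i.1).pot| else 0))
  have hs : Summable (fun m => |hamTerm M c i j m|) :=
    h3.summable.of_nonneg_of_le (fun m => abs_nonneg _) (fun m => abs_hamTerm_le hγ₀ i j m)
  refine ⟨hs, (hs.tsum_le_tsum (fun m => abs_hamTerm_le hγ₀ i j m) h3.summable).trans ?_⟩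
  rw [h3.tsum_eq, tsum_mul_left]
  refine add_le_add ?_ le_rfl
  nlinarith [mul_le_mul_of_nonneg_left h2
    (mul_nonneg hh₀ (Real.exp_pos (-(γ₀ / 2) * c.r i.1 j.1)).le)]

theorem hasSum_hamTerm (hγ₀ : 0 < γ₀) (hr₀ : 0 < r₀) (hc : c.IsRegular r₀) (i j : Λ × Fin Nb) :
    HasSum (hamTerm M c i j) (hamEntry M c i j) := by
  classical
  have hs : Summable (hamTerm M c i j) := (summable_hamTerm hγ₀ hr₀ hc i j).1.of_abs
  set s : Set Λ := {m | m ≠ i.1 ∧ m ≠ j.1}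
  set T : Λ → ℝ := fun m => M.t (c i.1).species (c j.1).species (c m).species
    ((c m).pos - (c i.1).pos, (c m).pos - (c j.1).pos) (i.2, j.2)
  set a : ℝ := M.h (c i.1).species (c j.1).species ((c j.1).pos - (c i.1).pos) (i.2, j.2)
    + if i = j then (c i.1).pot else 0 with ha
  have e : hamTerm M c i j = fun m => s.indicator T m + if m = i.1 then a else 0 := by
    ext m
    unfold hamTerm
    by_cases h1 : m = i.1
    · simp [h1, s, Set.indicator, ha]
    · by_cases h2 : m = j.1
      · have h3 : j.1 ≠ i.1 := h2 ▸ h1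
        simp [h2, h3, s, Set.indicator]
      · simp [h1, h2, s, Set.indicator, T]
  have h2 := hasSum_ite_eq i.1 a
  have hT : Summable (s.indicator T) := by
    have h3 := hs.sub h2.summable
    refine h3.congr fun m => ?_
    rw [e]
    simp
  have hT' : HasSum (s.indicator T) (∑' m : s, T m) := by
    rw [tsum_subtype]; exact hT.hasSum
  have h4 := hT'.add h2
  rw [← e] at h4
  have h5 : HasSum (hamTerm M c i j) ((∑' m : {m : Λ // m ≠ i.1 ∧ m ≠ j.1}, T m) + a) := h4
  have h6 : hamEntry M c i j = (∑' m : {m : Λ // m ≠ i.1 ∧ m ≠ j.1}, T m) + a := by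
    unfold hamEntry
    rw [ha]
    ring
  rw [h6]
  exact h5

open Classical in
theorem abs_hamEntry_le (hγ₀ : 0 < γ₀) (hr₀ : 0 < r₀) (hc : c.IsRegular r₀) (i j : Λ × Fin Nb) :
    |hamEntry M c i j| ≤ h₀ * packConst.{v} d (γ₀ / 2) r₀ * Real.exp (-(γ₀ / 2) * c.r i.1 j.1)
          + if i = j then |(c i.1).pot| else 0 := by
  obtain ⟨h1, h2⟩ := summable_hamTerm (M := M) hγ₀ hr₀ hc i j
  have h3 : |∑' m, hamTerm M c i j m| ≤ ∑' m, |hamTerm M c i j m| :=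
    norm_tsum_le_tsum_norm (f := hamTerm M c i j) h1
  have h4 := (hasSum_hamTerm (M := M) hγ₀ hr₀ hc i j).tsum_eq
  exact (congrArg abs h4.symm).le.trans (h3.trans h2)

theorem hamEntry_symm (M : TBModel d Nb S h₀ γ₀) (c : Config d S Λ) (i j : Λ × Fin Nb) :
    hamEntry M c i j = hamEntry M c j i := by
  unfold hamEntry
  congr 1
  · congr 1
    · rw [M.symm_h, neg_sub]
    · rw [← (Equiv.subtypeEquivRight (p := fun m => m ≠ i.1 ∧ m ≠ j.1)
        (q := fun m => m ≠ j.1 ∧ m ≠ i.1) (fun m => and_comm)).tsum_eq]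
      refine tsum_congr fun m => ?_
      rw [M.symm_t]
      rfl
  · by_cases h : i = j
    · simp [h]
    · simp [h, Ne.symm h]

theorem basisVec_eq_unitVec [DecidableEq (Λ × Fin Nb)] (i : Λ × Fin Nb) :
    (basisVec i : StateSpace Λ Nb) = unitVec i := by
  unfold basisVec unitVec
  congr!

/-- Schur's test for real symmetric matrices indexed by orbitals. -/
theorem exists_hasMatrix_of_schur {A B : Λ × Fin Nb → Λ × Fin Nb → ℝ} {K : ℝ}
    (hK : 0 ≤ K) (hAB : ∀ i j, |A i j| ≤ B i j) (hsymm : ∀ i j, B i j = B j i)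
    (hrow : ∀ i, Summable (B i)) (hsum : ∀ i, ∑' j, B i j ≤ K) :
    ∃ T : StateSpace Λ Nb →L[ℂ] StateSpace Λ Nb, ‖T‖ ≤ K ∧ HasMatrix T A := by
  classical
  obtain ⟨T, hT, h⟩ := exists_operator_of_schur (A := fun i j => (A i j : ℂ)) hK
    (fun i j => by simpa using hAB i j) hsymm hrow hsum
  refine ⟨T, hT, fun i j => ?_⟩
  rw [basisVec_eq_unitVec, basisVec_eq_unitVec]
  exact h i j

theorem hasMatrix_hamiltonian (hγ₀ : 0 < γ₀) (hr₀ : 0 < r₀) (hc : c.IsRegular r₀) :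
    HasMatrix (hamiltonian M c) (hamEntry M c) := by
  classical
  have hex : ∃ T : StateSpace Λ Nb →L[ℂ] StateSpace Λ Nb, HasMatrix T (hamEntry M c) := by
    rcases isEmpty_or_nonempty (Λ × Fin Nb) with he | ⟨⟨i₀⟩⟩
    · exact ⟨0, fun i => he.elim i⟩
    have hh₀ := M.h₀_nonneg (c i₀.1).species
    obtain ⟨P, hP⟩ := hc.bounded
    have hP0 : 0 ≤ P := (abs_nonneg _).trans (hP i₀.1)
    have hp := packConst_pos.{v} d (γ₀ / 2) r₀
    set B : Λ × Fin Nb → Λ × Fin Nb → ℝ := fun i j =>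
      h₀ * packConst.{v} d (γ₀ / 2) r₀ * Real.exp (-(γ₀ / 2) * c.r i.1 j.1)
        + if j = i then P else 0
    have hB : ∀ i, HasSum (B i) (h₀ * packConst.{v} d (γ₀ / 2) r₀ *
        (∑' j : Λ × Fin Nb, Real.exp (-(γ₀ / 2) * c.r i.1 j.1)) + P) := fun i =>
      ((summable_exp_r_orbital hc hr₀ (half_pos hγ₀) i.1).1.hasSum.mul_left _).add
        (hasSum_ite_eq i P)
    obtain ⟨T, -, hT⟩ := exists_hasMatrix_of_schur (A := hamEntry M c) (B := B)
      (K := h₀ * packConst.{v} d (γ₀ / 2) r₀ * (Nb * packConst.{v} d (γ₀ / 2) r₀) + P)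
      (by positivity) (fun i j => by
        refine (abs_hamEntry_le hγ₀ hr₀ hc i j).trans (add_le_add le_rfl ?_)
        by_cases h : i = j
        · simp [h, hP]
        · simp [h, Ne.symm h])
      (fun i j => by
        simp only [B]
        rw [c.r_comm]
        by_cases h : i = j
        · simp [h]
        · simp [h, Ne.symm h]) (fun i => (hB i).summable) (fun i => by
        rw [(hB i).tsum_eq]
        have := (summable_exp_r_orbital (Nb := Nb) hc hr₀ (half_pos hγ₀) i.1).2
        gcongr)
    exact ⟨T, hT⟩
  unfold hamiltonian
  rw [dif_pos hex]
  exact hex.choose_spec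

theorem HasMatrix.isSelfAdjoint {T : StateSpace Λ Nb →L[ℂ] StateSpace Λ Nb}
    {A : Λ × Fin Nb → Λ × Fin Nb → ℝ} (hT : HasMatrix T A) (hA : ∀ i j, A i j = A j i) :
    IsSelfAdjoint T := by
  have h : HasMatrix (ContinuousLinearMap.adjoint T) A := fun i j => by
    rw [ContinuousLinearMap.adjoint_inner_right, ← inner_conj_symm, hT, hA]
    simp
  exact h.unique hT

theorem isSelfAdjoint_hamiltonian (hγ₀ : 0 < γ₀) (hr₀ : 0 < r₀) (hc : c.IsRegular r₀) :
    IsSelfAdjoint (hamiltonian M c) :=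
  (hasMatrix_hamiltonian hγ₀ hr₀ hc).isSelfAdjoint (hamEntry_symm M c)

end Hamiltonian

/-! ### Finite body order of polynomials of the Hamiltonian -/

section BodyOrder

variable {d Nb : ℕ} {S : Type u} {h₀ γ₀ : ℝ} {Λ : Type v} {Λ' : Type*}

open Classical in
/-- The weight of the path `i → τ 0 → ⋯ → τ (n - 1) = j` in the expansion of the matrix entry
`(i, j)` of the `n`-th power of the Hamiltonian. Each step records the next index of the matrix
and the atom whose contribution to the entry is taken. -/
def pathWeight (M : TBModel d Nb S h₀ γ₀) (c : Config d S Λ) :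
    (n : ℕ) → (i j : Λ × Fin Nb) → (Fin n → (Λ × Fin Nb) × Λ) → ℝ
  | 0, i, j, _ => if i = j then 1 else 0
  | n + 1, i, j, τ =>
      hamTerm M c i (τ 0).1 (τ 0).2 * pathWeight M c n (τ 0).1 j (Fin.tail τ)

variable {M : TBModel d Nb S h₀ γ₀} {c : Config d S Λ} {r₀ : ℝ}

/-- The steps `(j, m)` that leave an orbital `i` have absolutely summable amplitudes, uniformly in `i`.
This makes all path expansions absolutely convergent. -/
theorem exists_hamTerm_row_bound (hγ₀ : 0 < γ₀) (hr₀ : 0 < r₀) (hc : c.IsRegular r₀) :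
    ∃ K : ℝ, 0 ≤ K ∧ ∀ i : Λ × Fin Nb,
      Summable (fun x : (Λ × Fin Nb) × Λ => |hamTerm M c i x.1 x.2|) ∧
        ∑' x : (Λ × Fin Nb) × Λ, |hamTerm M c i x.1 x.2| ≤ K := by
  classical
  rcases isEmpty_or_nonempty (Λ × Fin Nb) with he | ⟨⟨i₀⟩⟩
  · exact ⟨0, le_rfl, fun i => he.elim i⟩
  have hh₀ := M.h₀_nonneg (c i₀.1).species
  obtain ⟨P, hP⟩ := hc.bounded
  have hP0 : 0 ≤ P := (abs_nonneg _).trans (hP i₀.1)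
  have hp := packConst_pos.{v} d (γ₀ / 2) r₀
  refine ⟨h₀ * packConst.{v} d (γ₀ / 2) r₀ * (Nb * packConst.{v} d (γ₀ / 2) r₀) + P,
    by positivity, fun i => ?_⟩
  obtain ⟨ho1, ho2⟩ := summable_exp_r_orbital (Nb := Nb) hc hr₀ (half_pos hγ₀) i.1
  have hb : HasSum (fun j => h₀ * packConst.{v} d (γ₀ / 2) r₀ *
      Real.exp (-(γ₀ / 2) * c.r i.1 j.1) + if j = i then P else 0)
      (h₀ * packConst.{v} d (γ₀ / 2) r₀ *
        (∑' j : Λ × Fin Nb, Real.exp (-(γ₀ / 2) * c.r i.1 j.1)) + P) :=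
    (ho1.hasSum.mul_left _).add (hasSum_ite_eq i P)
  have hle : ∀ j : Λ × Fin Nb, ∑' m, |hamTerm M c i j m| ≤
      h₀ * packConst.{v} d (γ₀ / 2) r₀ * Real.exp (-(γ₀ / 2) * c.r i.1 j.1)
        + if j = i then P else 0 := fun j => by
    refine (summable_hamTerm hγ₀ hr₀ hc i j).2.trans (add_le_add le_rfl ?_)
    by_cases h : i = j
    · simp [h, hP]
    · simp [h, Ne.symm h]
  have hs : Summable (fun x : (Λ × Fin Nb) × Λ => |hamTerm M c i x.1 x.2|) := by
    refine (summable_prod_of_nonneg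
      (f := fun x : (Λ × Fin Nb) × Λ => |hamTerm M c i x.1 x.2|) fun x => abs_nonneg _).2
      ⟨fun j => (summable_hamTerm hγ₀ hr₀ hc i j).1, ?_⟩
    exact hb.summable.of_nonneg_of_le (fun j => tsum_nonneg fun m => abs_nonneg _) hle
  refine ⟨hs, ?_⟩
  rw [hs.tsum_prod]
  refine (hs.prod.tsum_le_tsum hle hb.summable).trans ?_
  rw [hb.tsum_eq]
  gcongr

/-- The path expansion converges absolutely. -/
theorem summable_pathWeight {K : ℝ} (hK : 0 ≤ K)
    (hrow : ∀ i : Λ × Fin Nb, Summable (fun x : (Λ × Fin Nb) × Λ => |hamTerm M c i x.1 x.2|) ∧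
        ∑' x : (Λ × Fin Nb) × Λ, |hamTerm M c i x.1 x.2| ≤ K) (n : ℕ) (i j : Λ × Fin Nb) :
    Summable (fun τ => |pathWeight M c n i j τ|) ∧ ∑' τ, |pathWeight M c n i j τ| ≤ K ^ n := by
  induction n generalizing i with
  | zero =>
    refine ⟨(hasSum_fintype _).summable, ?_⟩
    rw [tsum_fintype]
    simp only [Finset.univ_unique, Finset.sum_singleton, pow_zero, pathWeight]
    split_ifs <;> simp
  | succ n ih =>
    set e := Fin.consEquiv (fun _ : Fin (n + 1) => (Λ × Fin Nb) × Λ)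
    have he : ∀ x : ((Λ × Fin Nb) × Λ) × (Fin n → (Λ × Fin Nb) × Λ),
        |pathWeight M c (n + 1) i j (e x)| =
          |hamTerm M c i x.1.1 x.1.2| * |pathWeight M c n x.1.1 j x.2| := fun x => by
      rw [← abs_mul]
      simp [e, pathWeight, Fin.consEquiv]
    obtain ⟨hs, hle⟩ := summable_tsum_prod_le (fun (y : (Λ × Fin Nb) × Λ) τ => abs_nonneg _)
      (fun y => (ih y.1).1) (fun y => (ih y.1).2)
      (fun y : (Λ × Fin Nb) × Λ => abs_nonneg (hamTerm M c i y.1 y.2)) (hrow i).1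
    constructor
    · rw [← e.summable_iff]
      exact hs.congr fun x => ((he x).trans (mul_comm _ _)).symm
    · rw [← e.tsum_eq]
      simp_rw [he, mul_comm (|hamTerm M c i _ _|)]
      rw [pow_succ]
      exact hle.trans (mul_le_mul_of_nonneg_left (hrow i).2 (by positivity))

/-- The matrix of a product is the product of the matrices. -/
theorem hasSum_inner_mul {T : StateSpace Λ Nb →L[ℂ] StateSpace Λ Nb}
    {A : Λ × Fin Nb → Λ × Fin Nb → ℝ} (hT : HasMatrix T A) (i : Λ × Fin Nb)
    (f : StateSpace Λ Nb) :
    HasSum (fun k => (A i k : ℂ) * inner ℂ (basisVec k) f) (inner ℂ (basisVec i) (T f)) := by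
  classical
  have hf := lp.hasSum_single (p := 2) (by norm_num) f
  have h1 := (innerSL ℂ (basisVec i : StateSpace Λ Nb)).hasSum (T.hasSum hf)
  have e0 : (fun k => (A i k : ℂ) * inner ℂ (basisVec k) f) =
      fun k => innerSL ℂ (basisVec i : StateSpace Λ Nb) (T (lp.single 2 k (f k))) := ?_
  · rw [e0]
    exact h1
  funext k
  have e1 : (lp.single 2 k (f k) : StateSpace Λ Nb) = (f k : ℂ) • basisVec k := by
    rw [basisVec_eq_unitVec, unitVec, ← lp.single_smul, smul_eq_mul, mul_one]
  have e2 : inner ℂ (basisVec k) f = f k := by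
    rw [basisVec_eq_unitVec, unitVec, lp.inner_single_left]
    simp
  rw [innerSL_apply_apply, e1, map_smul, inner_smul_right, hT, e2, mul_comm]

theorem inner_basisVec_basisVec [DecidableEq (Λ × Fin Nb)] (i j : Λ × Fin Nb) :
    inner ℂ (basisVec i : StateSpace Λ Nb) (basisVec j) = if i = j then (1 : ℂ) else 0 := by
  rw [basisVec_eq_unitVec, basisVec_eq_unitVec, unitVec, unitVec, lp.inner_single_left]
  by_cases h : i = j
  · simp [h]
  · simp [h, lp.single_apply]

theorem hasSum_hamEntry_mul (hγ₀ : 0 < γ₀) (hr₀ : 0 < r₀) (hc : c.IsRegular r₀) (i : Λ × Fin Nb)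
    {w : Λ × Fin Nb → ℂ} {z : ℂ}
    (h : HasSum (fun y : (Λ × Fin Nb) × Λ => (hamTerm M c i y.1 y.2 : ℂ) * w y.1) z) :
    HasSum (fun k => (hamEntry M c i k : ℂ) * w k) z := by
  refine HasSum.prod_fiberwise h fun k => ?_
  have h1 : HasSum (fun m => (hamTerm M c i k m : ℂ)) (hamEntry M c i k : ℂ) :=
    Complex.hasSum_ofReal.2 (hasSum_hamTerm hγ₀ hr₀ hc i k)
  exact h1.mul_right (w k)

/-- Expansion of the entries of a power of the Hamiltonian over paths. -/
theorem hasSum_pathWeight (hγ₀ : 0 < γ₀) (hr₀ : 0 < r₀) (hc : c.IsRegular r₀) (n : ℕ)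
    (i j : Λ × Fin Nb) :
    HasSum (fun τ => (pathWeight M c n i j τ : ℂ))
      (inner ℂ (basisVec i) ((hamiltonian M c ^ n) (basisVec j))) := by
  classical
  obtain ⟨K, hK, hrow⟩ := exists_hamTerm_row_bound (M := M) hγ₀ hr₀ hc
  induction n generalizing i with
  | zero =>
    rw [pow_zero, one_apply_eq_self, inner_basisVec_basisVec]
    have h := hasSum_fintype (fun τ : Fin 0 → (Λ × Fin Nb) × Λ => (pathWeight M c 0 i j τ : ℂ))
    have e1 : ∑ τ : Fin 0 → (Λ × Fin Nb) × Λ, (pathWeight M c 0 i j τ : ℂ) =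
        if i = j then 1 else 0 := by
      simp only [Finset.univ_unique, Finset.sum_singleton, pathWeight]
      split_ifs <;> simp
    rwa [e1] at h
  | succ n ih =>
    set e := Fin.consEquiv (fun _ : Fin (n + 1) => (Λ × Fin Nb) × Λ)
    rw [← e.hasSum_iff]
    have he : ((fun τ => (pathWeight M c (n + 1) i j τ : ℂ)) ∘ e) =
        fun x : ((Λ × Fin Nb) × Λ) × (Fin n → (Λ × Fin Nb) × Λ) =>
          (hamTerm M c i x.1.1 x.1.2 : ℂ) * (pathWeight M c n x.1.1 j x.2 : ℂ) := by
      ext x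
      simp [e, pathWeight, Fin.consEquiv]
    have hs : Summable ((fun τ => (pathWeight M c (n + 1) i j τ : ℂ)) ∘ e) := by
      rw [e.summable_iff]
      refine Summable.of_norm ?_
      simpa using (summable_pathWeight hK hrow (n + 1) i j).1
    rw [he] at hs ⊢
    have h1 : HasSum (fun y : (Λ × Fin Nb) × Λ => (hamTerm M c i y.1 y.2 : ℂ) *
        inner ℂ (basisVec y.1) ((hamiltonian M c ^ n) (basisVec j)))
        (∑' x : ((Λ × Fin Nb) × Λ) × (Fin n → (Λ × Fin Nb) × Λ),
          (hamTerm M c i x.1.1 x.1.2 : ℂ) * (pathWeight M c n x.1.1 j x.2 : ℂ)) :=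
      hs.hasSum.prod_fiberwise fun y => (ih y.1).mul_left _
    have h2 : HasSum (fun k : Λ × Fin Nb => (hamEntry M c i k : ℂ) *
        inner ℂ (basisVec k) ((hamiltonian M c ^ n) (basisVec j)))
        (∑' x : ((Λ × Fin Nb) × Λ) × (Fin n → (Λ × Fin Nb) × Λ),
          (hamTerm M c i x.1.1 x.1.2 : ℂ) * (pathWeight M c n x.1.1 j x.2 : ℂ)) :=
      hasSum_hamEntry_mul hγ₀ hr₀ hc i h1
    have h3 := hasSum_inner_mul (hasMatrix_hamiltonian (M := M) hγ₀ hr₀ hc) i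
      ((hamiltonian M c ^ n) (basisVec j))
    have h4 : inner ℂ (basisVec i) ((hamiltonian M c ^ (n + 1)) (basisVec j)) =
        inner ℂ (basisVec i) (hamiltonian M c ((hamiltonian M c ^ n) (basisVec j))) := by
      rw [pow_succ']
      rfl
    rw [h4, h3.unique h2]
    exact hs.hasSum

/-- Transport of a path along a map of index sets. -/
def mapPath (e : Λ' → Λ) {n : ℕ} (τ : Fin n → (Λ' × Fin Nb) × Λ') :
    Fin n → (Λ × Fin Nb) × Λ :=
  fun s => ((e (τ s).1.1, (τ s).1.2), e (τ s).2)

theorem hamTerm_comp {e : Λ' → Λ} (he : Function.Injective e) (i j : Λ' × Fin Nb) (m : Λ') :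
    hamTerm M (c ∘ e) i j m = hamTerm M c (e i.1, i.2) (e j.1, j.2) (e m) := by
  unfold hamTerm
  have h1 : ((e i.1, i.2) = (e j.1, j.2)) ↔ i = j := by
    rw [Prod.mk.injEq, he.eq_iff, Prod.ext_iff]
  classical
  simp only [Function.comp_apply, he.eq_iff, h1]

/-- The weight of a path depends only on the atoms that the path meets; hence it can be computed in
the subconfiguration consisting of these atoms. -/
theorem pathWeight_comp {e : Λ' → Λ} (he : Function.Injective e) (n : ℕ) (i j : Λ' × Fin Nb)
    (τ : Fin n → (Λ' × Fin Nb) × Λ') :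
    pathWeight M (c ∘ e) n i j τ = pathWeight M c n (e i.1, i.2) (e j.1, j.2) (mapPath e τ) := by
  induction n generalizing i with
  | zero =>
    have h1 : ((e i.1, i.2) = (e j.1, j.2)) ↔ i = j := by
      rw [Prod.mk.injEq, he.eq_iff, Prod.ext_iff]
    classical
    simp only [pathWeight, h1]
  | succ n ih =>
    simp only [pathWeight]
    rw [hamTerm_comp he, ih]
    rfl

open Classical in
/-- The atoms visited by a path. -/
def pathSites {n : ℕ} (τ : Fin n → (Λ × Fin Nb) × Λ) : Finset Λ :=
  Finset.univ.image (fun s => (τ s).1.1) ∪ Finset.univ.image (fun s => (τ s).2)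

theorem card_pathSites_le {n : ℕ} (τ : Fin n → (Λ × Fin Nb) × Λ) :
    (pathSites τ).card ≤ 2 * n := by
  classical
  unfold pathSites
  refine (Finset.card_union_le _ _).trans ?_
  have h1 := Finset.card_image_le (s := Finset.univ) (f := fun s => (τ s).1.1)
  have h2 := Finset.card_image_le (s := Finset.univ) (f := fun s => (τ s).2)
  simp only [Finset.card_univ, Fintype.card_fin] at h1 h2
  lia

open Classical in
theorem pathSites_mapPath (e : Λ' → Λ) {n : ℕ} (τ : Fin n → (Λ' × Fin Nb) × Λ') :
    pathSites (mapPath e τ) = (pathSites τ).image e := by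
  unfold pathSites
  rw [Finset.image_union, Finset.image_image, Finset.image_image]
  rfl

open Classical in
/-- The part of the expansion of `(H ^ n)_{ℓℓ}^{aa}` over paths that visit, apart from `ℓ`,
exactly the atoms in `K`. -/
def clusterSum (M : TBModel d Nb S h₀ γ₀) (c : Config d S Λ) (n : ℕ) (a : Fin Nb) (ℓ : Λ)
    (K : Finset Λ) : ℝ :=
  ∑' τ, if (pathSites τ).erase ℓ = K then pathWeight M c n (ℓ, a) (ℓ, a) τ else 0

/-- The contribution of a cluster depends only on the states of its atoms. This is what makes it a
body potential. -/
theorem clusterSum_comp {e : Λ' → Λ} (he : Function.Injective e) (n : ℕ) (a : Fin Nb)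
    {ℓ : Λ'} {K' : Finset Λ'} {K : Finset Λ} (hK : ∀ x, x ∈ K ↔ ∃ y ∈ K', e y = x) :
    clusterSum M (c ∘ e) n a ℓ K' = clusterSum M c n a (e ℓ) K := by
  classical
  have hKi : K = K'.image e := by
    ext x
    rw [hK, Finset.mem_image]
  have hinj : Function.Injective (mapPath (Nb := Nb) e (n := n)) := by
    intro τ τ' h
    funext s
    have h1 := congrFun h s
    simp only [mapPath, Prod.mk.injEq] at h1
    exact Prod.ext (Prod.ext (he h1.1.1) h1.1.2) (he h1.2)
  unfold clusterSum
  rw [← hinj.tsum_eq]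
  · refine tsum_congr fun τ => ?_
    have h1 : (pathSites (mapPath e τ)).erase (e ℓ) = K ↔ (pathSites τ).erase ℓ = K' := by
      rw [pathSites_mapPath, ← Finset.image_erase he, hKi, (Finset.image_injective he).eq_iff]
    rw [pathWeight_comp he]
    simp only [h1]
  · intro τ hτ
    simp only [Function.mem_support, ne_eq, ite_eq_right_iff, Classical.not_imp] at hτ
    have hmem : ∀ x ∈ pathSites τ, ∃ y, e y = x := by
      intro x hx
      by_cases h : x = e ℓ
      · exact ⟨ℓ, h.symm⟩
      · have : x ∈ K := by rw [← hτ.1]; exact Finset.mem_erase.2 ⟨h, hx⟩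
        obtain ⟨y, -, hy⟩ := (hK x).1 this
        exact ⟨y, hy⟩
    have h1 : ∀ s, ∃ y, e y = (τ s).1.1 := fun s => hmem _ (by
      unfold pathSites
      exact Finset.mem_union_left _ (Finset.mem_image_of_mem _ (Finset.mem_univ s)))
    have h2 : ∀ s, ∃ y, e y = (τ s).2 := fun s => hmem _ (by
      unfold pathSites
      exact Finset.mem_union_right _ (Finset.mem_image_of_mem _ (Finset.mem_univ s)))
    choose f hf using h1
    choose g hg using h2
    exact ⟨fun s => ((f s, (τ s).1.2), g s), by funext s; simp [mapPath, hf, hg]⟩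

/-- The configuration consisting of an atom `x` and of the atoms whose states relative to `x` are
listed in `s`. -/
def clusterConfig (x : AtomState d S) (s : Multiset (RelState d S)) :
    Config d S (Option (Fin s.toList.length))
  | none => x
  | some i => ⟨x.pos + (s.toList.get i).disp, (s.toList.get i).pot₂, (s.toList.get i).species₂⟩

/-- The `(|s| + 1)`-body potential of the polynomial `q`. -/
def bodyPotential (M : TBModel d Nb S h₀ γ₀) (q : Polynomial ℝ) (x : AtomState d S)
    (s : Multiset (RelState d S)) : ℝ :=
  ∑ n ∈ Finset.range (q.natDegree + 1), q.coeff n *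
    ∑ a : Fin Nb, clusterSum M (clusterConfig x s) n a none (Finset.univ.erase none)

/-- The configuration rebuilt from the relative states of the atoms in `K` is the subconfiguration
on `K ∪ {ℓ}`, up to a relabelling of its atoms. -/
theorem exists_clusterConfig_embedding (c : Config d S Λ) (ℓ : Λ) (K : Finset Λ) (hℓ : ℓ ∉ K) :
    ∃ e : Option (Fin (K.val.map (c.rel ℓ)).toList.length) → Λ, Function.Injective e ∧
      e none = ℓ ∧ (∀ x, x ∈ K ↔ ∃ y ∈ Finset.univ.erase none, e y = x) ∧
      clusterConfig (c ℓ) (K.val.map (c.rel ℓ)) = c ∘ e := by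
  classical
  set s := K.val.map (c.rel ℓ) with hs
  -- order `K` compatibly with the chosen ordering of the multiset of relative states
  have hperm : s.toList.Perm (K.toList.map (c.rel ℓ)) := by
    rw [← Multiset.coe_eq_coe, Multiset.coe_toList, ← Multiset.map_coe, Finset.coe_toList]
  have hfor : List.Forall₂ (fun (y : RelState d S) (x : Λ) => y = c.rel ℓ x)
      (K.toList.map (c.rel ℓ)) K.toList := by
    rw [List.forall₂_map_left_iff]
    exact List.forall₂_same.2 fun x _ => rfl
  obtain ⟨l, hl1, hl2⟩ := List.perm_comp_forall₂ hperm hfor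
  have hlen : s.toList.length = l.length := hl1.length_eq
  have hget : ∀ i : Fin s.toList.length, s.toList.get i = c.rel ℓ (l.get (i.cast hlen)) := by
    intro i
    exact (List.forall₂_iff_get.1 hl1).2 i.1 i.2 (hlen ▸ i.2)
  have hnd : l.Nodup := hl2.nodup_iff.2 K.nodup_toList
  have hmem : ∀ x, x ∈ l ↔ x ∈ K := fun x => by rw [hl2.mem_iff, Finset.mem_toList]
  refine ⟨fun o => o.elim ℓ (fun i => l.get (i.cast hlen)), ?_, rfl, ?_, ?_⟩
  · rintro (_ | i) (_ | j) h
    · rfl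
    · refine absurd ?_ hℓ
      have h' : ℓ = l.get (j.cast hlen) := h
      rw [h', ← hmem]
      exact List.get_mem _ _
    · refine absurd ?_ hℓ
      have h' : l.get (i.cast hlen) = ℓ := h
      rw [← h', ← hmem]
      exact List.get_mem _ _
    · have h' : l.get (i.cast hlen) = l.get (j.cast hlen) := h
      have := hnd.injective_get h'
      simpa [Fin.ext_iff] using this
  · intro x
    rw [← hmem, List.mem_iff_get]
    constructor
    · rintro ⟨i, rfl⟩
      exact ⟨some (i.cast hlen.symm), by simp, by simp⟩
    · rintro ⟨o, ho, rfl⟩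
      rcases o with _ | i
      · simp at ho
      · exact ⟨i.cast hlen, rfl⟩
  · funext o
    rcases o with _ | i
    · rfl
    · simp only [clusterConfig, hget, Config.rel, Function.comp_apply, Option.elim]
      rw [add_sub_cancel]

/-- Polynomials of the Hamiltonian have finite body order: the diagonal blocks of a power are
absolutely convergent sums over closed paths, and the paths are grouped by the atoms they meet. -/
theorem hasFiniteBodyOrder (hγ₀ : 0 < γ₀) (M : TBModel d Nb S h₀ γ₀) (q : Polynomial ℝ) :
    HasFiniteBodyOrder.{u, v} M q := by
  classical
  refine ⟨2 * q.natDegree + 1, bodyPotential M q, fun Λ c r₀ hr₀ hc ℓ => ?_⟩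
  have hV : ∀ K : {K : Finset Λ // ℓ ∉ K ∧ K.card < 2 * q.natDegree + 1},
      bodyPotential M q (c ℓ) (K.1.val.map (c.rel ℓ)) =
        ∑ n ∈ Finset.range (q.natDegree + 1), q.coeff n *
          ∑ a : Fin Nb, clusterSum M c n a ℓ K.1 := by
    intro K
    obtain ⟨e, he, h1, h2, h3⟩ := exists_clusterConfig_embedding c ℓ K.1 K.2.1
    unfold bodyPotential
    rw [h3]
    refine Finset.sum_congr rfl fun n _ => ?_
    congr 1
    refine Finset.sum_congr rfl fun a _ => ?_
    rw [clusterSum_comp he n a h2, h1]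
  simp_rw [hV]
  have hmain : ∀ n ∈ Finset.range (q.natDegree + 1), ∀ a : Fin Nb,
      HasSum (fun K : {K : Finset Λ // ℓ ∉ K ∧ K.card < 2 * q.natDegree + 1} =>
        clusterSum M c n a ℓ K.1)
        (inner ℂ (basisVec (ℓ, a)) ((hamiltonian M c ^ n) (basisVec (ℓ, a)))).re := by
    intro n hn a
    have h1 := Complex.hasSum_re (hasSum_pathWeight (M := M) hγ₀ hr₀ hc n (ℓ, a) (ℓ, a))
    simp only [Complex.ofReal_re] at h1
    set g : (Fin n → (Λ × Fin Nb) × Λ) →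
        {K : Finset Λ // ℓ ∉ K ∧ K.card < 2 * q.natDegree + 1} := fun τ =>
      ⟨(pathSites τ).erase ℓ, Finset.notMem_erase _ _, by
        have h2 := card_pathSites_le τ
        have h3 := Finset.card_erase_le (s := pathSites τ) (a := ℓ)
        have h4 := Finset.mem_range.1 hn
        lia⟩ with hg
    have h2 := h1.tsum_fiberwise g
    have e0 : (fun K : {K : Finset Λ // ℓ ∉ K ∧ K.card < 2 * q.natDegree + 1} =>
        clusterSum M c n a ℓ K.1) =
        fun K => ∑' τ : g ⁻¹' {K}, pathWeight M c n (ℓ, a) (ℓ, a) τ := ?_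
    · rw [e0]
      exact h2
    funext K
    rw [tsum_subtype, clusterSum]
    refine tsum_congr fun τ => ?_
    simp only [Set.indicator, Set.mem_preimage, Set.mem_singleton_iff, hg, Subtype.ext_iff]
  have h5 := hasSum_sum fun n hn =>
    (hasSum_sum fun a (_ : a ∈ Finset.univ) => hmain n hn a).mul_left (q.coeff n)
  have h7 : localPoly M q c ℓ = ∑ n ∈ Finset.range (q.natDegree + 1), q.coeff n *
      ∑ a : Fin Nb,
        (inner ℂ (basisVec (ℓ, a)) ((hamiltonian M c ^ n) (basisVec (ℓ, a)))).re := by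
    unfold localPoly siteTrace applyPoly
    rw [Polynomial.aeval_eq_sum_range]
    simp_rw [Finset.mul_sum]
    rw [Finset.sum_comm]
    refine Finset.sum_congr rfl fun a _ => ?_
    rw [sum_apply, inner_sum, Complex.re_sum]
    refine Finset.sum_congr rfl fun n _ => ?_
    change (inner ℂ _ (((q.coeff n : ℂ) • hamiltonian M c ^ n) _)).re = _
    rw [smul_apply, inner_smul_right, Complex.re_ofReal_mul]
  rw [h7]
  exact h5

end BodyOrder

/-! ### Differentiability of the Hamiltonian in the state of one atom -/

section Derivative

variable {d Nb : ℕ} {S : Type u} {h₀ γ₀ : ℝ} {Λ : Type v}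
variable {M : TBModel d Nb S h₀ γ₀} {c : Config d S Λ} {r₀ : ℝ}

theorem Config.move_coord (c : Config d S Λ) (m : Λ) : c.move m (c.coord m) = c := by
  classical
  unfold Config.move Config.coord
  exact Function.update_eq_self m c

theorem Config.species_move (c : Config d S Λ) (m : Λ) (y : EuclideanSpace ℝ (Fin d) × ℝ)
    (k : Λ) : (c.move m y k).species = (c k).species := by
  classical
  by_cases h : k = m
  · subst h; simp [Config.move]
  · simp [Config.move, h]

open Classical in
theorem Config.pos_move (c : Config d S Λ) (m : Λ) (y : EuclideanSpace ℝ (Fin d) × ℝ) (k : Λ) :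
    (c.move m y k).pos = if k = m then y.1 else (c k).pos := by
  by_cases h : k = m
  · subst h; simp [Config.move]
  · simp [Config.move, h]

open Classical in
theorem Config.pot_move (c : Config d S Λ) (m : Λ) (y : EuclideanSpace ℝ (Fin d) × ℝ) (k : Λ) :
    (c.move m y k).pot = if k = m then y.2 else (c k).pot := by
  by_cases h : k = m
  · subst h; simp [Config.move]
  · simp [Config.move, h]

theorem Config.r_move_ge (c : Config d S Λ) (m : Λ) (y : EuclideanSpace ℝ (Fin d) × ℝ)
    (i j : Λ) : c.r i j - dist y (c.coord m) ≤ (c.move m y).r i j := by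
  classical
  have hd : ‖y.1 - (c m).pos‖ ≤ dist y (c.coord m) := by
    rw [dist_eq_norm]; exact norm_fst_le (y - c.coord m)
  have h0 : 0 ≤ dist y (c.coord m) := dist_nonneg
  simp only [Config.r, Config.pos_move]
  by_cases hi : i = m <;> by_cases hj : j = m
  · subst hi; subst hj; simp
  · subst hi
    simp only [hj, if_true, if_false]
    have e : (c j).pos - (c i).pos = ((c j).pos - y.1) + (y.1 - (c i).pos) := by abel
    have := norm_add_le ((c j).pos - y.1) (y.1 - (c i).pos)
    rw [← e] at this
    linarith
  · subst hj
    simp only [hi, if_true, if_false]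
    have e : (c j).pos - (c i).pos = (y.1 - (c i).pos) - (y.1 - (c j).pos) := by abel
    have := norm_sub_le (y.1 - (c i).pos) (y.1 - (c j).pos)
    rw [← e] at this
    linarith
  · simp only [hi, hj, if_false]
    linarith

theorem Config.IsRegular.move (hc : c.IsRegular r₀) (hr₀ : 0 < r₀) (m : Λ)
    {y : EuclideanSpace ℝ (Fin d) × ℝ} (hy : dist y (c.coord m) < r₀ / 4) :
    (c.move m y).IsRegular (r₀ / 2) := by
  classical
  refine ⟨fun i j hij => ?_, ?_⟩
  · have h1 := c.r_move_ge m y i j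
    have h2 := hc.separated i j hij
    linarith
  · obtain ⟨B, hB⟩ := hc.bounded
    refine ⟨max B |y.2|, fun ℓ => ?_⟩
    rw [Config.pot_move]
    split_ifs
    · exact le_max_right _ _
    · exact (hB ℓ).trans (le_max_left _ _)

open Classical in
theorem hasFDerivAt_pos_move (c : Config d S Λ) (m k : Λ) (y : EuclideanSpace ℝ (Fin d) × ℝ) :
    HasFDerivAt (fun y => (c.move m y k).pos)
      (if k = m then ContinuousLinearMap.fst ℝ (EuclideanSpace ℝ (Fin d)) ℝ else 0) y := by
  simp only [Config.pos_move]
  split_ifs with h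
  · exact hasFDerivAt_fst
  · exact hasFDerivAt_const _ _

open Classical in
theorem hasFDerivAt_pot_move (c : Config d S Λ) (m k : Λ) (y : EuclideanSpace ℝ (Fin d) × ℝ) :
    HasFDerivAt (fun y => (c.move m y k).pot)
      (if k = m then ContinuousLinearMap.snd ℝ (EuclideanSpace ℝ (Fin d)) ℝ else 0) y := by
  simp only [Config.pot_move]
  split_ifs with h
  · exact hasFDerivAt_snd
  · exact hasFDerivAt_const _ _

open Classical in
/-- The displacement between two atoms has a derivative of norm at most one in the position of an
atom, and zero unless this atom is one of the two. -/
theorem exists_hasFDerivAt_disp (c : Config d S Λ) (m i k : Λ)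
    (y : EuclideanSpace ℝ (Fin d) × ℝ) :
    ∃ P : EuclideanSpace ℝ (Fin d) × ℝ →L[ℝ] EuclideanSpace ℝ (Fin d),
      HasFDerivAt (fun y => (c.move m y k).pos - (c.move m y i).pos) P y ∧
        ‖P‖ ≤ if i = m ∨ k = m then 1 else 0 := by
  refine ⟨_, (hasFDerivAt_pos_move c m k y).sub (hasFDerivAt_pos_move c m i y), ?_⟩
  have h1 := ContinuousLinearMap.norm_fst_le ℝ (EuclideanSpace ℝ (Fin d)) ℝ
  by_cases hi : i = m <;> by_cases hk : k = m
  · simp [hi, hk]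
  · simpa [hi, hk] using h1
  · simpa [hi, hk] using h1
  · simp [hi, hk]

/-- The bound for the derivative, in the state of atom `m`, of the contribution of atom `k` to the
matrix entry `(i, j)`. -/
def derivBound (h₀ γ₀ r₀ : ℝ) (c : Config d S Λ) (m : Λ)
    (x : ((Λ × Fin Nb) × (Λ × Fin Nb)) × Λ) : ℝ :=
  (h₀ * Real.exp (γ₀ * r₀) + 1) *
    Real.exp (-(γ₀ / 2) * (c.r m x.1.1.1 + c.r m x.1.2.1 + c.r m x.2))

theorem norm_proj_comp_le {n : ℕ} {E : Type*} [NormedAddCommGroup E] [NormedSpace ℝ E]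
    (x : Fin n × Fin n) (L : E →L[ℝ] Block n) :
    ‖(EuclideanSpace.proj (𝕜 := ℝ) x).comp L‖ ≤ ‖L‖ :=
  ContinuousLinearMap.opNorm_le_bound _ (norm_nonneg _) fun v => by
    simpa using (Block.abs_apply_le (L v) x).trans (L.le_opNorm v)

/-- The derivative of a term of a matrix entry in the state of the atom `m` decays exponentially in
the distances of its atoms from `m`; the bound is summable over all terms. -/
theorem exists_hasFDerivAt_hamTerm (hγ₀ : 0 < γ₀) (hr₀ : 0 < r₀) (m : Λ)
    (x : ((Λ × Fin Nb) × (Λ × Fin Nb)) × Λ) {y : EuclideanSpace ℝ (Fin d) × ℝ}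
    (hy : dist y (c.coord m) < r₀ / 4) :
    ∃ L : EuclideanSpace ℝ (Fin d) × ℝ →L[ℝ] ℝ,
      HasFDerivAt (fun y => hamTerm M (c.move m y) x.1.1 x.1.2 x.2) L y ∧
        ‖L‖ ≤ derivBound h₀ γ₀ r₀ c m x := by
  classical
  obtain ⟨⟨i, j⟩, k⟩ := x
  have hh₀ := M.h₀_nonneg (c i.1).species
  have hrm : ∀ a b, c.r a b - r₀ / 4 ≤ (c.move m y).r a b := fun a b => by
    have := c.r_move_ge m y a b
    linarith
  have hu0 : 0 ≤ derivBound h₀ γ₀ r₀ c m ((i, j), k) := by unfold derivBound; positivity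
  -- a term that decays in `s ≥ (r m i + r m j + r m k) / 2 - r₀` is below the bound
  have hfin : ∀ s : ℝ, c.r m i.1 + c.r m j.1 + c.r m k ≤ 2 * (s + r₀) →
      h₀ * Real.exp (-γ₀ * s) ≤ derivBound h₀ γ₀ r₀ c m ((i, j), k) := by
    intro s hs
    unfold derivBound
    have h1 : Real.exp (-γ₀ * s) ≤ Real.exp (γ₀ * r₀) *
        Real.exp (-(γ₀ / 2) * (c.r m i.1 + c.r m j.1 + c.r m k)) := by
      rw [← Real.exp_add]
      exact Real.exp_le_exp.2 (by nlinarith)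
    have h2 := Real.exp_pos (-(γ₀ / 2) * (c.r m i.1 + c.r m j.1 + c.r m k))
    nlinarith [mul_le_mul_of_nonneg_left h1 hh₀]
  by_cases hk : k = i.1
  · obtain ⟨P, hP, hPn⟩ := exists_hasFDerivAt_disp c m i.1 j.1 y
    have hh := ((M.contDiff_h (c i.1).species (c j.1).species).differentiable (by norm_num)
      ((c.move m y j.1).pos - (c.move m y i.1).pos)).hasFDerivAt
    have h1 := (EuclideanSpace.proj (𝕜 := ℝ) (i.2, j.2)).hasFDerivAt.comp y (hh.comp y hP)
    set L₁ := (EuclideanSpace.proj (𝕜 := ℝ) (i.2, j.2)).comp ((fderiv ℝ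
      (M.h (c i.1).species (c j.1).species)
      ((c.move m y j.1).pos - (c.move m y i.1).pos)).comp P)
    have hL₁ : ‖L₁‖ ≤ (h₀ * Real.exp (-γ₀ * (c.move m y).r i.1 j.1)) *
        if i.1 = m ∨ j.1 = m then 1 else 0 := by
      refine (norm_proj_comp_le _ _).trans ((ContinuousLinearMap.opNorm_comp_le _ _).trans ?_)
      have hb := M.bound_h (c i.1).species (c j.1).species
        ((c.move m y j.1).pos - (c.move m y i.1).pos)
      have hn := norm_nonneg (M.h (c i.1).species (c j.1).species
        ((c.move m y j.1).pos - (c.move m y i.1).pos))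
      exact mul_le_mul (by simp only [Config.r]; linarith) hPn (norm_nonneg _) (by positivity)
    by_cases hij : i = j
    · refine ⟨L₁ + (if i.1 = m then
        ContinuousLinearMap.snd ℝ (EuclideanSpace ℝ (Fin d)) ℝ else 0), ?_, ?_⟩
      · have h2 := h1.add (hasFDerivAt_pot_move c m i.1 y)
        refine h2.congr_of_eventuallyEq (Eventually.of_forall fun y => ?_)
        simp only [hamTerm, hk, hij, if_true, Config.species_move, Pi.add_apply,
          Function.comp_apply]
        rfl
      · subst hij
        by_cases hm : i.1 = m
        · rw [if_pos hm]
          have e0 : L₁ = 0 := by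
            have : P = 0 := by
              have h3 : (fun y => (c.move m y i.1).pos - (c.move m y i.1).pos) =
                  fun _ => 0 := by funext; simp
              rw [h3] at hP
              exact hP.unique (hasFDerivAt_const _ _)
            simp [L₁, this]
          rw [e0, zero_add]
          refine (ContinuousLinearMap.norm_snd_le _ _ _).trans ?_
          unfold derivBound
          rw [hk, hm, c.r_self]
          simp only [add_zero, mul_zero, Real.exp_zero, mul_one]
          have := Real.exp_pos (γ₀ * r₀)
          nlinarith [mul_nonneg hh₀ this.le]
        · rw [if_neg hm, add_zero]
          rw [if_neg (by tauto), mul_zero] at hL₁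
          exact hL₁.trans hu0
    · refine ⟨L₁, ?_, ?_⟩
      · refine h1.congr_of_eventuallyEq (Eventually.of_forall fun y => ?_)
        simp only [hamTerm, hk, hij, if_true, if_false, Config.species_move,
          Function.comp_apply, add_zero]
        rfl
      · refine hL₁.trans ?_
        split_ifs with hm
        · rw [mul_one]
          refine hfin _ ?_
          have h5 := hrm i.1 j.1
          have h6 := c.r_nonneg i.1 j.1
          subst hk
          rcases hm with hm | hm
          · have e1 : c.r m i.1 = 0 := by rw [hm]; exact c.r_self m
            have e2 : c.r m j.1 = c.r i.1 j.1 := by rw [hm]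
            rw [e1, e2]
            linarith
          · have e1 : c.r m j.1 = 0 := by rw [hm]; exact c.r_self m
            have e2 : c.r m i.1 = c.r i.1 j.1 := by rw [c.r_comm, hm]
            rw [e1, e2]
            linarith
        · rw [mul_zero]
          exact hu0
  · by_cases hkj : k = j.1
    · refine ⟨0, ?_, by simpa using hu0⟩
      refine (hasFDerivAt_const (0 : ℝ) y).congr_of_eventuallyEq
        (Eventually.of_forall fun y => ?_)
      have : j.1 ≠ i.1 := hkj ▸ hk
      simp [hamTerm, hkj, this]
    · obtain ⟨P, hP, hPn⟩ := exists_hasFDerivAt_disp c m i.1 k y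
      obtain ⟨P', hP', hPn'⟩ := exists_hasFDerivAt_disp c m j.1 k y
      have hh := ((M.contDiff_t (c i.1).species (c j.1).species (c k).species).differentiable
        (by norm_num) ((c.move m y k).pos - (c.move m y i.1).pos,
          (c.move m y k).pos - (c.move m y j.1).pos)).hasFDerivAt
      have h1 := (EuclideanSpace.proj (𝕜 := ℝ) (i.2, j.2)).hasFDerivAt.comp y
        (hh.comp y (hP.prodMk hP'))
      refine ⟨_, h1.congr_of_eventuallyEq (Eventually.of_forall fun y => ?_), ?_⟩
      · simp only [hamTerm, hk, hkj, if_false, Config.species_move,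
          Function.comp_apply]
        rfl
      · refine (norm_proj_comp_le _ _).trans ((ContinuousLinearMap.opNorm_comp_le _ _).trans ?_)
        have hb := M.bound_t (c i.1).species (c j.1).species (c k).species
          ((c.move m y k).pos - (c.move m y i.1).pos)
          ((c.move m y k).pos - (c.move m y j.1).pos)
        have hn := norm_nonneg (M.t (c i.1).species (c j.1).species (c k).species
          ((c.move m y k).pos - (c.move m y i.1).pos,
          (c.move m y k).pos - (c.move m y j.1).pos))
        have hPP : ‖P.prod P'‖ ≤ if i.1 = m ∨ j.1 = m ∨ k = m then 1 else 0 := by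
          rw [ContinuousLinearMap.opNorm_prod]
          refine (max_le (hPn.trans ?_) (hPn'.trans ?_))
          · split_ifs with h2 h3 <;> first | exact le_rfl | exact zero_le_one | (exfalso; tauto)
          · split_ifs with h2 h3 <;> first | exact le_rfl | exact zero_le_one | (exfalso; tauto)
        have hle : ‖fderiv ℝ (M.t (c i.1).species (c j.1).species (c k).species)
            ((c.move m y k).pos - (c.move m y i.1).pos,
              (c.move m y k).pos - (c.move m y j.1).pos)‖ ≤
            h₀ * Real.exp (-γ₀ * ((c.move m y).r i.1 k + (c.move m y).r j.1 k)) := by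
          simp only [Config.r]
          linarith
        refine (mul_le_mul hle hPP (norm_nonneg _) (by positivity)).trans ?_
        split_ifs with hm
        · rw [mul_one]
          refine hfin _ ?_
          have h5 := hrm i.1 k
          have h6 := hrm j.1 k
          have h7 := c.r_nonneg i.1 k
          have h8 := c.r_nonneg j.1 k
          rcases hm with hm | hm | hm
          · have := c.r_triangle i.1 j.1 k
            rw [c.r_comm k j.1] at this
            have e1 : c.r m i.1 = 0 := by rw [hm]; exact c.r_self m
            have e2 : c.r m j.1 = c.r i.1 j.1 := by rw [hm]
            have e3 : c.r m k = c.r i.1 k := by rw [hm]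
            rw [e1, e2, e3]
            linarith
          · have := c.r_triangle j.1 i.1 k
            rw [c.r_comm k i.1] at this
            have e1 : c.r m j.1 = 0 := by rw [hm]; exact c.r_self m
            have e2 : c.r m i.1 = c.r j.1 i.1 := by rw [hm]
            have e3 : c.r m k = c.r j.1 k := by rw [hm]
            rw [e1, e2, e3]
            linarith
          · have e1 : c.r m k = 0 := by rw [hm]; exact c.r_self m
            have e2 : c.r m i.1 = c.r i.1 k := by rw [c.r_comm, hm]
            have e3 : c.r m j.1 = c.r j.1 k := by rw [c.r_comm, hm]
            rw [e1, e2, e3]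
            linarith
        · rw [mul_zero]
          exact hu0

theorem summable_exp_r_triple (hc : c.IsRegular r₀) (hr₀ : 0 < r₀) {γ : ℝ} (hγ : 0 < γ) (m : Λ) :
    Summable (fun x : ((Λ × Fin Nb) × (Λ × Fin Nb)) × Λ =>
      Real.exp (-γ * (c.r m x.1.1.1 + c.r m x.1.2.1 + c.r m x.2))) ∧
    ∑' x : ((Λ × Fin Nb) × (Λ × Fin Nb)) × Λ,
      Real.exp (-γ * (c.r m x.1.1.1 + c.r m x.1.2.1 + c.r m x.2)) ≤
        (Nb * packConst.{v} d γ r₀) ^ 2 * packConst.{v} d γ r₀ := by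
  obtain ⟨h1, h2⟩ := summable_exp_r_orbital (Nb := Nb) hc hr₀ hγ m
  obtain ⟨h3, h4⟩ := summable_exp_r hc hr₀ hγ m
  have hp := packConst_pos.{v} d γ r₀
  obtain ⟨ha, ha'⟩ := summable_tsum_prod_le (fun (_ j : Λ × Fin Nb) => (Real.exp_pos _).le)
    (fun _ => h1) (fun _ => h2) (fun i : Λ × Fin Nb => (Real.exp_pos (-γ * c.r m i.1)).le) h1
  obtain ⟨hb, hb'⟩ := summable_tsum_prod_le
    (fun (_ : (Λ × Fin Nb) × (Λ × Fin Nb)) (k : Λ) => (Real.exp_pos (-γ * c.r m k)).le)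
    (fun _ => h3) (fun _ => h4) (fun i : (Λ × Fin Nb) × (Λ × Fin Nb) =>
      mul_nonneg (Real.exp_pos (-γ * c.r m i.2.1)).le (Real.exp_pos (-γ * c.r m i.1.1)).le) ha
  have e : (fun x : ((Λ × Fin Nb) × (Λ × Fin Nb)) × Λ =>
      Real.exp (-γ * (c.r m x.1.1.1 + c.r m x.1.2.1 + c.r m x.2))) =
      fun x => Real.exp (-γ * c.r m x.2) *
        (Real.exp (-γ * c.r m x.1.2.1) * Real.exp (-γ * c.r m x.1.1.1)) := by
    funext x
    rw [← Real.exp_add, ← Real.exp_add]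
    congr 1
    ring
  rw [e]
  refine ⟨hb, hb'.trans ?_⟩
  rw [mul_comm]
  refine mul_le_mul_of_nonneg_right (ha'.trans ?_) hp.le
  rw [sq]
  exact mul_le_mul_of_nonneg_left h2 (by positivity)

/-- The matrix units as operators on `ℓ²`. -/
def matrixUnit (i j : Λ × Fin Nb) : StateSpace Λ Nb →L[ℂ] StateSpace Λ Nb :=
  InnerProductSpace.rankOne ℂ (basisVec i) (basisVec j)

theorem norm_basisVec (i : Λ × Fin Nb) : ‖(basisVec i : StateSpace Λ Nb)‖ = 1 := by
  classical
  rw [basisVec_eq_unitVec, unitVec, lp.norm_single (by norm_num)]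
  simp

theorem norm_matrixUnit (i j : Λ × Fin Nb) :
    ‖(matrixUnit i j : StateSpace Λ Nb →L[ℂ] StateSpace Λ Nb)‖ = 1 := by
  unfold matrixUnit
  rw [InnerProductSpace.norm_rankOne, norm_basisVec, norm_basisVec, mul_one]

theorem inner_matrixUnit [DecidableEq (Λ × Fin Nb)] (i j i' j' : Λ × Fin Nb) :
    inner ℂ (basisVec i') (matrixUnit i j (basisVec j')) =
      if (i', j') = (i, j) then (1 : ℂ) else 0 := by
  unfold matrixUnit
  rw [InnerProductSpace.rankOne_apply, inner_smul_right, inner_basisVec_basisVec,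
    inner_basisVec_basisVec]
  by_cases h1 : i' = i <;> by_cases h2 : j' = j
  · simp [h1, h2]
  · simp [h1, h2, Ne.symm h2]
  · simp [h1, h2]
  · simp [h1, h2]

end Derivative

/-! ### The derivative of the Hamiltonian in operator norm -/

/-- Termwise differentiation of a series of multiples of fixed vectors, normalised to vanish at the
point of differentiation. -/
theorem exists_hasFDerivAt_tsum_smul {X E F : Type*} [NormedAddCommGroup E] [NormedSpace ℝ E]
    [NormedAddCommGroup F] [NormedSpace ℝ F] [CompleteSpace F] {g : X → E → ℝ} {e : X → F}
    {b : X → ℝ} {y₀ : E} {ε : ℝ} (hε : 0 < ε) (he : ∀ x, ‖e x‖ ≤ 1) (hb : Summable b)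
    (hg : ∀ x, ∀ y ∈ Metric.ball y₀ ε, ∃ L : E →L[ℝ] ℝ, HasFDerivAt (g x) L y ∧ ‖L‖ ≤ b x) :
    ∃ T' : E →L[ℝ] F, HasFDerivAt (fun y => ∑' x, (g x y - g x y₀) • e x) T' y₀ ∧
      (∀ y ∈ Metric.ball y₀ ε, Summable fun x => (g x y - g x y₀) • e x) ∧
      ∀ v, ∃ A : X → ℝ, (∀ x, |A x| ≤ b x * ‖v‖) ∧ HasSum (fun x => A x • e x) (T' v) := by
  have hy₀B : y₀ ∈ Metric.ball y₀ ε := Metric.mem_ball_self hε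
  have hex : ∀ (x : X) (y : E), ∃ L : E →L[ℝ] ℝ, y ∈ Metric.ball y₀ ε →
      HasFDerivAt (g x) L y ∧ ‖L‖ ≤ b x := by
    intro x y
    by_cases hy : y ∈ Metric.ball y₀ ε
    · obtain ⟨L, h⟩ := hg x y hy
      exact ⟨L, fun _ => h⟩
    · exact ⟨0, fun h => absurd h hy⟩
  choose L hL using hex
  have h1 : ∀ x y, y ∈ Metric.ball y₀ ε →
      HasFDerivAt (fun y => (g x y - g x y₀) • e x) ((L x y).smulRight (e x)) y := fun x y hy =>
    ((hL x y hy).1.sub_const (g x y₀)).smul_const (e x)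
  have h2 : ∀ x y, y ∈ Metric.ball y₀ ε → ‖(L x y).smulRight (e x)‖ ≤ b x := by
    intro x y hy
    rw [ContinuousLinearMap.norm_smulRight_apply]
    exact (mul_le_of_le_one_right (norm_nonneg _) (he x)).trans (hL x y hy).2
  have hB' : IsPreconnected (Metric.ball y₀ ε) := (convex_ball _ _).isPreconnected
  have hf0 : Summable (fun x => (g x y₀ - g x y₀) • e x) := by simp
  refine ⟨∑' x, (L x y₀).smulRight (e x), hasFDerivAt_tsum_of_isPreconnected hb
    Metric.isOpen_ball hB' h1 h2 hy₀B hf0 hy₀B, fun y hy =>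
    summable_of_summable_hasFDerivAt_of_isPreconnected hb Metric.isOpen_ball hB' h1 h2 hy₀B hf0 hy,
    fun v => ⟨fun x => L x y₀ v, fun x => ?_, ?_⟩⟩
  · rw [← Real.norm_eq_abs]
    exact ((L x y₀).le_opNorm v).trans
      (mul_le_mul_of_nonneg_right (hL x y₀ hy₀B).2 (norm_nonneg _))
  · exact (Summable.of_norm_bounded hb (fun x => h2 x y₀ hy₀B)).hasSum.mapL
      (ContinuousLinearMap.apply ℝ F v)

section HamiltonianDerivative

variable {d Nb : ℕ} {S : Type u} {h₀ γ₀ : ℝ} {Λ : Type v}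
variable {M : TBModel d Nb S h₀ γ₀} {c : Config d S Λ} {r₀ : ℝ}

/-- The Hamiltonian is differentiable, in operator norm, in the state of one atom, and its
derivative is a series of matrix units with exponentially localised coefficients. -/
theorem exists_hasFDerivAt_hamiltonian (hγ₀ : 0 < γ₀) (hr₀ : 0 < r₀) (hc : c.IsRegular r₀) (m : Λ) :
    ∃ T' : (EuclideanSpace ℝ (Fin d) × ℝ) →L[ℝ] (StateSpace Λ Nb →L[ℂ] StateSpace Λ Nb),
      HasFDerivAt (fun y => hamiltonian M (c.move m y)) T' (c.coord m) ∧
      ∀ v, ∃ A : ((Λ × Fin Nb) × (Λ × Fin Nb)) × Λ → ℝ,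
        (∀ x, |A x| ≤ derivBound h₀ γ₀ r₀ c m x * ‖v‖) ∧
        HasSum (fun x => (A x : ℂ) • matrixUnit x.1.1 x.1.2) (T' v) := by
  classical
  obtain ⟨T', hT', hs, hv⟩ := exists_hasFDerivAt_tsum_smul
    (F := StateSpace Λ Nb →L[ℂ] StateSpace Λ Nb)
    (g := fun (x : ((Λ × Fin Nb) × (Λ × Fin Nb)) × Λ) y =>
      hamTerm M (c.move m y) x.1.1 x.1.2 x.2) (e := fun x => matrixUnit x.1.1 x.1.2)
    (b := derivBound h₀ γ₀ r₀ c m) (y₀ := c.coord m) (ε := r₀ / 4) (by positivity)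
    (fun x => (norm_matrixUnit _ _).le)
    ((summable_exp_r_triple hc hr₀ (half_pos hγ₀) m).1.mul_left _)
    (fun x y hy => exists_hasFDerivAt_hamTerm hγ₀ hr₀ m x hy)
  refine ⟨T', ?_, hv⟩
  simp only [c.move_coord] at hT' hs
  refine (hT'.const_add (hamiltonian M c)).congr_of_eventuallyEq ?_
  filter_upwards [Metric.ball_mem_nhds _ (show 0 < r₀ / 4 by positivity)] with y hy
  have hcm := hc.move hr₀ m hy
  refine (hasMatrix_hamiltonian (M := M) hγ₀ (half_pos hr₀) hcm).unique ?_
  intro i j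
  -- near the reference configuration, the Hamiltonian is its reference value plus the series; both
  -- sides have the same matrix elements
  set F : ((Λ × Fin Nb) × (Λ × Fin Nb)) × Λ → (EuclideanSpace ℝ (Fin d) × ℝ) →
      (StateSpace Λ Nb →L[ℂ] StateSpace Λ Nb) := fun x y =>
    (hamTerm M (c.move m y) x.1.1 x.1.2 x.2 - hamTerm M c x.1.1 x.1.2 x.2) •
      matrixUnit x.1.1 x.1.2 with hF
  rw [add_apply, inner_add_right, hasMatrix_hamiltonian hγ₀ hr₀ hc i j]
  have h3 : HasSum (fun x => inner ℂ (basisVec i) (F x y (basisVec j)))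
      (inner ℂ (basisVec i) ((∑' x, F x y) (basisVec j))) := by
    have h4 := (hs y hy).hasSum
    have h5 := h4.mapL (ContinuousLinearMap.apply ℂ (StateSpace Λ Nb)
      (basisVec j : StateSpace Λ Nb))
    exact h5.mapL (innerSL ℂ (basisVec i))
  have h6 : HasSum (fun k => ((hamTerm M (c.move m y) i j k - hamTerm M c i j k : ℝ) : ℂ))
      ((hamEntry M (c.move m y) i j - hamEntry M c i j : ℝ) : ℂ) :=
    Complex.hasSum_ofReal.2 ((hasSum_hamTerm hγ₀ (half_pos hr₀) hcm i j).sub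
      (hasSum_hamTerm hγ₀ hr₀ hc i j))
  have hval : ∀ x, inner ℂ (basisVec i) (F x y (basisVec j)) =
      if (i, j) = x.1 then ((hamTerm M (c.move m y) i j x.2 - hamTerm M c i j x.2 : ℝ) : ℂ)
        else 0 := by
    intro x
    have e1 : F x y (basisVec j) = ((hamTerm M (c.move m y) x.1.1 x.1.2 x.2 -
        hamTerm M c x.1.1 x.1.2 x.2 : ℝ) : ℂ) • matrixUnit x.1.1 x.1.2 (basisVec j) := rfl
    rw [e1, inner_smul_right, inner_matrixUnit]
    obtain ⟨⟨i', j'⟩, k⟩ := x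
    split_ifs with h
    · simp only [Prod.mk.injEq] at h
      obtain ⟨rfl, rfl⟩ := h
      simp
    · simp
  have hinj : Function.Injective (fun k : Λ => ((i, j), k)) := fun k k' h => by
    simpa using h
  have h7 : HasSum (fun x => inner ℂ (basisVec i) (F x y (basisVec j)))
      ((hamEntry M (c.move m y) i j - hamEntry M c i j : ℝ) : ℂ) := by
    refine (hinj.hasSum_iff (fun x hx => ?_)).1 ?_
    · rw [hval, if_neg]
      rintro h
      exact hx ⟨x.2, by rw [h]⟩
    · have e2 : ((fun x => inner ℂ (basisVec i) (F x y (basisVec j))) ∘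
          fun k : Λ => ((i, j), k)) = fun k =>
            ((hamTerm M (c.move m y) i j k - hamTerm M c i j k : ℝ) : ℂ) := by
        funext k
        rw [Function.comp_apply, hval, if_pos rfl]
      rw [e2]
      exact h6
  rw [h3.unique h7]
  push_cast
  ring

/-- Sandwiching the derivative of the Hamiltonian between two exponentially localised operators
gives a diagonal entry that is exponentially small in the distance to the moved atom. -/
theorem norm_inner_sandwich_le (hγ₀ : 0 < γ₀) (hr₀ : 0 < r₀) (hh₀ : 0 ≤ h₀) (hc : c.IsRegular r₀)
    (m : Λ) {V : ℝ} {A : ((Λ × Fin Nb) × (Λ × Fin Nb)) × Λ → ℝ}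
    (hA : ∀ x, |A x| ≤ derivBound h₀ γ₀ r₀ c m x * V)
    {T : StateSpace Λ Nb →L[ℂ] StateSpace Λ Nb}
    (hT : HasSum (fun x => (A x : ℂ) • matrixUnit x.1.1 x.1.2) T)
    {R R' : StateSpace Λ Nb →L[ℂ] StateSpace Λ Nb} {B η : ℝ} (hB : 0 ≤ B) (hη : 0 ≤ η)
    (hηγ : η ≤ γ₀ / 4)
    (hR : ∀ i j, ‖inner ℂ (basisVec i) (R (basisVec j))‖ ≤ B * Real.exp (-η * c.r i.1 j.1))
    (hR' : ∀ i j, ‖inner ℂ (basisVec i) (R' (basisVec j))‖ ≤ B * Real.exp (-η * c.r i.1 j.1))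
    (i : Λ × Fin Nb) :
    ‖inner ℂ (basisVec i) (R (T (R' (basisVec i))))‖ ≤
      B ^ 2 * (h₀ * Real.exp (γ₀ * r₀) + 1) *
        ((Nb * packConst.{v} d (γ₀ / 4) r₀) ^ 2 * packConst.{v} d (γ₀ / 4) r₀) * V *
          Real.exp (-η * c.r i.1 m) := by
  have hV : ∀ x, 0 ≤ derivBound h₀ γ₀ r₀ c m x * V := fun x => (abs_nonneg _).trans (hA x)
  have h1 : HasSum (fun x => inner ℂ (basisVec i)
      (R (((A x : ℂ) • matrixUnit x.1.1 x.1.2) (R' (basisVec i)))))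
      (inner ℂ (basisVec i) (R (T (R' (basisVec i))))) := by
    have h5 := hT.mapL (ContinuousLinearMap.apply ℂ (StateSpace Λ Nb)
        (R' (basisVec i) : StateSpace Λ Nb))
    exact (h5.mapL R).mapL (innerSL ℂ (basisVec i))
  obtain ⟨h2, h3⟩ := summable_exp_r_triple (Nb := Nb) hc hr₀ (show 0 < γ₀ / 4 by positivity) m
  set G := B ^ 2 * (h₀ * Real.exp (γ₀ * r₀) + 1) * V * Real.exp (-η * c.r i.1 m) with hG
  have hbound : ∀ x : ((Λ × Fin Nb) × (Λ × Fin Nb)) × Λ, ‖inner ℂ (basisVec i)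
      (R (((A x : ℂ) • matrixUnit x.1.1 x.1.2) (R' (basisVec i))))‖ ≤
      G * Real.exp (-(γ₀ / 4) * (c.r m x.1.1.1 + c.r m x.1.2.1 + c.r m x.2)) := by
    intro x
    have e1 : inner ℂ (basisVec i) (R (((A x : ℂ) • matrixUnit x.1.1 x.1.2) (R' (basisVec i)))) =
        (A x : ℂ) * (inner ℂ (basisVec x.1.2) (R' (basisVec i)) *
          inner ℂ (basisVec i) (R (basisVec x.1.1))) := by
      rw [smul_apply, map_smul, inner_smul_right, matrixUnit, InnerProductSpace.rankOne_apply,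
        map_smul, inner_smul_right]
    rw [e1, norm_mul, norm_mul, Complex.norm_real, Real.norm_eq_abs]
    have h4 : ‖inner ℂ (basisVec x.1.2) (R' (basisVec i : StateSpace Λ Nb))‖ ≤ B := by
      refine (hR' _ _).trans (mul_le_of_le_one_right hB (Real.exp_le_one_iff.2 ?_))
      have := c.r_nonneg x.1.2.1 i.1
      nlinarith
    have h5 := mul_le_mul (hA x) (mul_le_mul h4 (hR i x.1.1) (norm_nonneg _) hB)
      (by positivity) (hV x)
    refine h5.trans ?_
    have hV' : 0 ≤ V := by
      have h6 := hV x
      have h7 : 0 < derivBound h₀ γ₀ r₀ c m x := by unfold derivBound; positivity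
      exact nonneg_of_mul_nonneg_right h6 h7
    -- half of the decay away from `m` is traded for decay between `i` and `m`
    have e2 : Real.exp (-(γ₀ / 2) * (c.r m x.1.1.1 + c.r m x.1.2.1 + c.r m x.2)) *
        Real.exp (-η * c.r i.1 x.1.1.1) ≤ Real.exp (-η * c.r i.1 m) *
        Real.exp (-(γ₀ / 4) * (c.r m x.1.1.1 + c.r m x.1.2.1 + c.r m x.2)) := by
      rw [← Real.exp_add, ← Real.exp_add]
      refine Real.exp_le_exp.2 ?_
      have t1 := c.r_triangle i.1 m x.1.1.1
      rw [c.r_comm x.1.1.1 m] at t1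
      have t2 := c.r_nonneg m x.1.1.1
      have t3 := c.r_nonneg m x.1.2.1
      have t4 := c.r_nonneg m x.2
      have t5 := mul_le_mul_of_nonneg_left t1 hη
      have t6 := mul_le_mul_of_nonneg_right hηγ t2
      have t7 : 0 ≤ γ₀ / 4 * (c.r m x.1.2.1 + c.r m x.2) := by positivity
      nlinarith
    have e3 := mul_le_mul_of_nonneg_left e2
      (show 0 ≤ B ^ 2 * (h₀ * Real.exp (γ₀ * r₀) + 1) * V by positivity)
    unfold derivBound
    rw [hG]
    nlinarith [e3]
  have h6 := tsum_of_norm_bounded ((h2.mul_left G).hasSum) hbound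
  rw [h1.tsum_eq, tsum_mul_left] at h6
  refine h6.trans ?_
  have hG0 : 0 ≤ G := by
    by_cases hx : Nonempty (((Λ × Fin Nb) × (Λ × Fin Nb)) × Λ)
    · have hV' : 0 ≤ V := by
        have h6 := hV hx.some
        have h7 : 0 < derivBound h₀ γ₀ r₀ c m hx.some := by unfold derivBound; positivity
        exact nonneg_of_mul_nonneg_right h6 h7
      positivity
    · exact absurd ⟨((i, i), m)⟩ hx
  refine (mul_le_mul_of_nonneg_left h3 hG0).trans (le_of_eq ?_)
  rw [hG]
  ring

end HamiltonianDerivative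

/-! ### Resolvent integrals and the functional calculus -/

section Resolvent

open MeasureTheory

variable {A : Type*} [NormedRing A] [NormedAlgebra ℂ A] [CompleteSpace A]

theorem continuousOn_resolvent_comp {T : A} {γ : ℝ → ℂ} {s : Set ℝ} (hγ : ContinuousOn γ s)
    (hu : ∀ t ∈ s, IsUnit (algebraMap ℂ A (γ t) - T)) :
    ContinuousOn (fun t => resolvent T (γ t)) s := by
  intro t ht
  obtain ⟨U, hU⟩ := hu t ht
  have h1 := NormedRing.inverse_continuousAt U
  rw [hU] at h1
  have h2 : ContinuousWithinAt (fun t => algebraMap ℂ A (γ t) - T) s t :=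
    ((continuous_algebraMap ℂ A).continuousAt.comp_continuousWithinAt (hγ t ht)).sub
      continuousWithinAt_const
  exact ContinuousAt.comp_continuousWithinAt (f := fun t => algebraMap ℂ A (γ t) - T)
    (g := Ring.inverse) h1 h2

/-- Perturbation of the resolvent: a bound on the perturbed resolvent and the second order Taylor
estimate. -/
theorem resolvent_perturbation {T T₀ : A} {z : ℂ} {δ : ℝ} (hδ : 0 < δ)
    (hu : IsUnit (algebraMap ℂ A z - T₀)) (hR : ‖resolvent T₀ z‖ ≤ 1 / δ)
    (hT : ‖T - T₀‖ ≤ δ / 2) :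
    IsUnit (algebraMap ℂ A z - T) ∧ ‖resolvent T z‖ ≤ 2 / δ ∧
      ‖resolvent T z - resolvent T₀ z - resolvent T₀ z * (T - T₀) * resolvent T₀ z‖ ≤
        2 / δ ^ 3 * ‖T - T₀‖ ^ 2 := by
  obtain ⟨U, hU⟩ := hu
  have hRU : resolvent T₀ z = ↑U⁻¹ := by
    rw [resolvent, ← hU, Ring.inverse_unit]
  have hX : ‖resolvent T₀ z * (T - T₀)‖ ≤ 1 / 2 := by
    refine (norm_mul_le _ _).trans ((mul_le_mul hR hT (norm_nonneg _) (by positivity)).trans ?_)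
    rw [div_mul_div_comm, one_mul]
    rw [div_le_div_iff₀ (by positivity) (by norm_num)]
    linarith
  have hu1 : IsUnit (1 - resolvent T₀ z * (T - T₀)) :=
    isUnit_one_sub_of_norm_lt_one (hX.trans_lt (by norm_num))
  have e : algebraMap ℂ A z - T = U * (1 - resolvent T₀ z * (T - T₀)) := by
    rw [mul_sub, mul_one, hRU, Units.mul_inv_cancel_left, hU]
    abel
  have hu2 : IsUnit (algebraMap ℂ A z - T) := by
    rw [e]
    exact U.isUnit.mul hu1
  have hid : resolvent T z - resolvent T₀ z = resolvent T₀ z * (T - T₀) * resolvent T z := by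
    have h := spectrum.resolvent_sub_resolvent (a := T₀) (b := T) (r := z) ⟨U, hU⟩ hu2
    have h' := congrArg Neg.neg h
    rw [neg_sub] at h'
    rw [h', ← neg_sub T T₀, mul_neg, neg_mul, neg_neg]
  have hle : ‖resolvent T z‖ ≤ 2 / δ := by
    have h1 : ‖resolvent T z‖ ≤ 1 / δ + 1 / 2 * ‖resolvent T z‖ := by
      have h2 : resolvent T z = resolvent T₀ z + resolvent T₀ z * (T - T₀) * resolvent T z := by
        rw [← hid]; abel
      calc ‖resolvent T z‖ = ‖resolvent T₀ z + resolvent T₀ z * (T - T₀) * resolvent T z‖ :=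
            congrArg _ h2
        _ ≤ _ := (norm_add_le _ _).trans (add_le_add hR ((norm_mul_le _ _).trans
            (mul_le_mul_of_nonneg_right hX (norm_nonneg _))))
    have : (2 : ℝ) / δ = 2 * (1 / δ) := by ring
    linarith
  refine ⟨hu2, hle, ?_⟩
  have e2 : resolvent T z - resolvent T₀ z - resolvent T₀ z * (T - T₀) * resolvent T₀ z =
      resolvent T₀ z * (T - T₀) * (resolvent T₀ z * (T - T₀) * resolvent T z) := by
    rw [← hid, mul_sub (resolvent T₀ z * (T - T₀)) (resolvent T z) (resolvent T₀ z), ← hid]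
  rw [e2]
  have h3 : ‖resolvent T₀ z * (T - T₀)‖ ≤ 1 / δ * ‖T - T₀‖ :=
    (norm_mul_le _ _).trans (mul_le_mul_of_nonneg_right hR (norm_nonneg _))
  calc _ ≤ (1 / δ * ‖T - T₀‖) * ((1 / δ * ‖T - T₀‖) * (2 / δ)) :=
        (norm_mul_le _ _).trans (mul_le_mul h3 ((norm_mul_le _ _).trans
          (mul_le_mul h3 hle (norm_nonneg _) (by positivity))) (norm_nonneg _) (by positivity))
    _ = _ := by ring

/-- The integral of the resolvent of `T` along the finite family of curves `γ j`, with weights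
`ψ j`. -/
def resolventIntegral {J : Type*} [Fintype J] (γ ψ : J → ℝ → ℂ) (T : A) : A :=
  ∑ j, ∫ t in Icc (0 : ℝ) 1, ψ j t • resolvent T (γ j t)

/-- The integral of the resolvent along curves at distance from the spectrum is differentiable,
with the derivative obtained by differentiating the integrand. -/
theorem hasFDerivAt_resolventIntegral {J : Type*} [Fintype J] {γ ψ : J → ℝ → ℂ} {T₀ : A} {δ : ℝ}
    (hδ : 0 < δ) (hγ : ∀ j, ContinuousOn (γ j) (Icc 0 1))
    (hψ : ∀ j, ContinuousOn (ψ j) (Icc 0 1))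
    (hu : ∀ j, ∀ t ∈ Icc (0 : ℝ) 1, IsUnit (algebraMap ℂ A (γ j t) - T₀))
    (hR : ∀ j, ∀ t ∈ Icc (0 : ℝ) 1, ‖resolvent T₀ (γ j t)‖ ≤ 1 / δ) :
    ∃ Φ : A →L[ℂ] A, HasFDerivAt (resolventIntegral γ ψ) Φ T₀ ∧
      ∀ Δ, Φ Δ = ∑ j, ∫ t in Icc (0 : ℝ) 1,
        ψ j t • (resolvent T₀ (γ j t) * Δ * resolvent T₀ (γ j t)) := by
  have hc0 : ∀ j, ContinuousOn (fun t => resolvent T₀ (γ j t)) (Icc 0 1) := fun j =>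
    continuousOn_resolvent_comp (hγ j) (hu j)
  set m : J → ℝ → A →L[ℂ] A := fun j t => ψ j t •
    ContinuousLinearMap.mulLeftRight ℂ A (resolvent T₀ (γ j t)) (resolvent T₀ (γ j t)) with hm
  have hcm : ∀ j, ContinuousOn (m j) (Icc 0 1) := fun j =>
    (hψ j).smul ((((ContinuousLinearMap.mulLeftRight ℂ A).continuous.comp_continuousOn
      (hc0 j))).clm_apply (hc0 j))
  have him : ∀ j, IntegrableOn (m j) (Icc 0 1) := fun j => (hcm j).integrableOn_compact isCompact_Icc
  have happ : ∀ j Δ, (∫ t in Icc (0 : ℝ) 1, m j t) Δ = ∫ t in Icc (0 : ℝ) 1,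
      ψ j t • (resolvent T₀ (γ j t) * Δ * resolvent T₀ (γ j t)) := by
    intro j Δ
    rw [ContinuousLinearMap.integral_apply (him j)]
    rfl
  have hone : ∀ j, HasFDerivAt (fun T : A => ∫ t in Icc (0 : ℝ) 1, ψ j t • resolvent T (γ j t))
      (∫ t in Icc (0 : ℝ) 1, m j t) T₀ := by
    intro j
    obtain ⟨C, hC⟩ := isCompact_Icc.exists_bound_of_continuousOn (hψ j)
    have hC0 : 0 ≤ C := (norm_nonneg _).trans (hC 0 (by simp))
    refine HasFDerivAt.of_isLittleO ?_
    have hO : (fun T : A => (∫ t in Icc (0 : ℝ) 1, ψ j t • resolvent T (γ j t)) -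
        (∫ t in Icc (0 : ℝ) 1, ψ j t • resolvent T₀ (γ j t)) -
        (∫ t in Icc (0 : ℝ) 1, m j t) (T - T₀)) =O[𝓝 T₀] fun T => ‖T - T₀‖ ^ 2 := by
      refine Asymptotics.IsBigO.of_bound (C * (2 / δ ^ 3)) ?_
      filter_upwards [Metric.ball_mem_nhds T₀ (half_pos hδ)] with T hT
      have hT' : ‖T - T₀‖ ≤ δ / 2 := by
        rw [← dist_eq_norm]; exact (Metric.mem_ball.1 hT).le
      have hp := fun t ht => resolvent_perturbation hδ (hu j t ht) (hR j t ht) hT'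
      have hc1 : ContinuousOn (fun t => resolvent T (γ j t)) (Icc 0 1) :=
        continuousOn_resolvent_comp (hγ j) fun t ht => (hp t ht).1
      rw [happ, ← integral_sub, ← integral_sub]
      · refine (norm_setIntegral_le_of_norm_le_const (C := C * (2 / δ ^ 3 * ‖T - T₀‖ ^ 2))
          (by simp) fun t ht => ?_).trans (le_of_eq ?_)
        · rw [← smul_sub, ← smul_sub]
          refine (norm_smul_le _ _).trans (mul_le_mul (hC t ht) (hp t ht).2.2 (norm_nonneg _) hC0)
        · simp
          ring
      · exact (((hψ j).smul hc1).sub ((hψ j).smul (hc0 j))).integrableOn_compact isCompact_Icc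
      · exact ((hψ j).smul (((hc0 j).mul continuousOn_const).mul (hc0 j))).integrableOn_compact
          isCompact_Icc
      · exact ((hψ j).smul hc1).integrableOn_compact isCompact_Icc
      · exact ((hψ j).smul (hc0 j)).integrableOn_compact isCompact_Icc
    refine hO.trans_isLittleO ?_
    have h := (Asymptotics.isLittleO_norm_pow_id (E' := A) (n := 2) (by norm_num))
    have ht : Tendsto (fun T : A => T - T₀) (𝓝 T₀) (𝓝 0) := by
      have : ContinuousAt (fun T : A => T - T₀) T₀ := by fun_prop
      simpa [ContinuousAt] using this
    exact h.comp_tendsto ht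
  refine ⟨∑ j, ∫ t in Icc (0 : ℝ) 1, m j t, ?_, fun Δ => ?_⟩
  · have := HasFDerivAt.fun_sum (u := Finset.univ) fun j _ => hone j
    exact this
  · rw [_root_.sum_apply]
    exact Finset.sum_congr rfl fun j _ => happ j Δ

end Resolvent

section Calculus

open MeasureTheory

variable {A : Type*} [CStarAlgebra A]

/-- The resolvent of a self-adjoint element in the functional calculus. -/
theorem resolvent_eq_cfc {T : A} (hT : IsSelfAdjoint T) {z : ℂ} {δ : ℝ} (hδ : 0 < δ)
    (hz : ∀ x ∈ spectrum ℝ T, δ ≤ ‖z - x‖) :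
    IsUnit (algebraMap ℂ A z - T) ∧ resolvent T z = cfc (fun w => (z - w)⁻¹) T ∧
      ‖resolvent T z‖ ≤ 1 / δ := by
  have hz' : ∀ w ∈ spectrum ℂ T, δ ≤ ‖z - w‖ := by
    intro w hw
    have h1 := hT.mem_spectrum_eq_re hw
    have h2 : w.re ∈ spectrum ℝ T := by
      rw [← spectrum.algebraMap_mem_iff ℂ]
      change ((w.re : ℝ) : ℂ) ∈ _
      rw [← h1]
      exact hw
    rw [h1]
    exact hz _ h2
  have hne : ∀ w ∈ spectrum ℂ T, z - w ≠ 0 := fun w hw h => by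
    have := hz' w hw
    rw [h, norm_zero] at this
    linarith
  have hTn : IsStarNormal T := hT.isStarNormal
  have hu : IsUnit (algebraMap ℂ A z - T) := by
    by_contra h
    exact hne z h (sub_self z)
  have e1 : cfc (fun w => z - w) T = algebraMap ℂ A z - T := by
    rw [cfc_sub (fun _ => z) (fun w => w) T, cfc_const z T, cfc_id' ℂ T]
  have e2 : resolvent T z = cfc (fun w => (z - w)⁻¹) T := by
    rw [cfc_inv (fun w => z - w) T hne, e1, resolvent]
  refine ⟨hu, e2, ?_⟩
  rw [e2]
  refine norm_cfc_le (by positivity) fun w hw => ?_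
  rw [norm_inv, one_div]
  exact inv_anti₀ hδ (hz' w hw)

/-- Cauchy's formula for the functional calculus. -/
theorem cfc_eq_resolventIntegral {J : Type*} [Fintype J] {γ ψ : J → ℝ → ℂ} {T : A}
    (hT : IsSelfAdjoint T) {δ : ℝ} (hδ : 0 < δ) (hγ : ∀ j, ContinuousOn (γ j) (Icc 0 1))
    (hψ : ∀ j, ContinuousOn (ψ j) (Icc 0 1))
    (hz : ∀ j, ∀ t ∈ Icc (0 : ℝ) 1, ∀ x ∈ spectrum ℝ T, δ ≤ ‖γ j t - x‖) {f : ℝ → ℝ}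
    (hf : ∀ x ∈ spectrum ℝ T,
      (f x : ℂ) = ∑ j, ∫ t in Icc (0 : ℝ) 1, ψ j t * (γ j t - x)⁻¹) :
    cfc f T = resolventIntegral γ ψ T := by
  have hTn : IsStarNormal T := hT.isStarNormal
  have hre : ∀ w ∈ spectrum ℂ T, w = w.re ∧ w.re ∈ spectrum ℝ T := by
    intro w hw
    have h1 := hT.mem_spectrum_eq_re hw
    refine ⟨h1, ?_⟩
    rw [← spectrum.algebraMap_mem_iff ℂ]
    change ((w.re : ℝ) : ℂ) ∈ _
    rw [← h1]
    exact hw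
  have hne : ∀ j, ∀ t ∈ Icc (0 : ℝ) 1, ∀ w ∈ spectrum ℂ T, δ ≤ ‖γ j t - w‖ := by
    intro j t ht w hw
    obtain ⟨h1, h2⟩ := hre w hw
    rw [h1]
    exact hz j t ht _ h2
  have hcont : ∀ j, ContinuousOn (Function.uncurry fun (t : ℝ) (w : ℂ) => ψ j t * (γ j t - w)⁻¹)
      (Icc (0 : ℝ) 1 ×ˢ spectrum ℂ T) := by
    intro j
    have h1 : ContinuousOn (fun x : ℝ × ℂ => ψ j x.1) (Icc (0 : ℝ) 1 ×ˢ spectrum ℂ T) :=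
      (hψ j).comp continuousOn_fst fun x hx => hx.1
    have h2 : ContinuousOn (fun x : ℝ × ℂ => γ j x.1) (Icc (0 : ℝ) 1 ×ˢ spectrum ℂ T) :=
      (hγ j).comp continuousOn_fst fun x hx => hx.1
    refine h1.mul ((h2.sub continuousOn_snd).inv₀ fun x hx h => ?_)
    have h3 := hne j x.1 hx.1 x.2 hx.2
    have h4 : γ j x.1 - x.2 = 0 := h
    rw [h4, norm_zero] at h3
    linarith
  choose C hC using fun j => isCompact_Icc.exists_bound_of_continuousOn (hψ j)
  have hC0 : ∀ j, 0 ≤ C j := fun j => (norm_nonneg _).trans (hC j 0 (by simp))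
  have hbound : ∀ j, ∀ t ∈ Icc (0 : ℝ) 1, ∀ w ∈ spectrum ℂ T,
      ‖ψ j t * (γ j t - w)⁻¹‖ ≤ C j * δ⁻¹ := by
    intro j t ht w hw
    rw [norm_mul, norm_inv]
    exact mul_le_mul (hC j t ht) (inv_anti₀ hδ (hne j t ht w hw)) (by positivity) (hC0 j)
  have hcont' : ∀ j, ContinuousOn (fun w : ℂ => ∫ t in Icc (0 : ℝ) 1, ψ j t * (γ j t - w)⁻¹)
      (spectrum ℂ T) := by
    intro j
    refine continuousOn_of_dominated (bound := fun _ => C j * δ⁻¹) (fun w hw => ?_)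
      (fun w hw => ?_) (integrable_const _) ?_
    · refine ContinuousOn.aestronglyMeasurable ?_ measurableSet_Icc
      exact (hcont j).comp (f := fun t : ℝ => (t, w)) (by fun_prop) fun t ht => ⟨ht, hw⟩
    · filter_upwards [ae_restrict_mem measurableSet_Icc] with t ht
      exact hbound j t ht w hw
    · filter_upwards [ae_restrict_mem measurableSet_Icc] with t ht
      exact (hcont j).comp (f := fun w : ℂ => (t, w)) (by fun_prop) fun w hw => ⟨ht, hw⟩
  rw [cfc_real_eq_complex f hT]
  have h1 : cfc (fun w : ℂ => (f w.re : ℂ)) T =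
      cfc (∑ j, fun w : ℂ => ∫ t in Icc (0 : ℝ) 1, ψ j t * (γ j t - w)⁻¹) T := by
    refine cfc_congr fun w hw => ?_
    obtain ⟨h1, h2⟩ := hre w hw
    rw [Finset.sum_apply]
    simp only [hf _ h2, ← h1]
  rw [h1, cfc_sum_univ _ _ (fun j => hcont' j)]
  refine Finset.sum_congr rfl fun j _ => ?_
  rw [cfc_setIntegral measurableSet_Icc _ (fun _ => C j * δ⁻¹) T (hcont j)]
  · refine setIntegral_congr_fun measurableSet_Icc fun t ht => ?_
    obtain ⟨-, h3, -⟩ := resolvent_eq_cfc hT hδ (hz j t ht)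
    change cfc (fun w : ℂ => ψ j t * (γ j t - w)⁻¹) T = ψ j t • resolvent T (γ j t)
    rw [h3]
    refine cfc_const_mul (ψ j t) _ T (ContinuousOn.inv₀ (by fun_prop) fun w hw h => ?_)
    have h4 := hne j t ht w hw
    rw [h, norm_zero] at h4
    linarith
  · filter_upwards [ae_restrict_mem measurableSet_Icc] with t ht w hw
    exact hbound j t ht w hw
  · exact hasFiniteIntegral_const _

end Calculus

/-! ### The Combes–Thomas estimate -/

section CombesThomas

variable {d Nb : ℕ} {S : Type u} {h₀ γ₀ : ℝ} {Λ : Type v}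
variable {M : TBModel d Nb S h₀ γ₀} {c : Config d S Λ} {r₀ : ℝ}

theorem abs_exp_sub_one_le_mul_exp (x : ℝ) : |Real.exp x - 1| ≤ |x| * Real.exp |x| := by
  rcases le_total 0 x with h | h
  · have h1 : 1 ≤ Real.exp x := Real.one_le_exp h
    rw [abs_of_nonneg (by linarith), abs_of_nonneg h]
    have h2 := Real.add_one_le_exp (-x)
    have h3 : Real.exp (-x) * Real.exp x = 1 := by rw [← Real.exp_add]; simp
    nlinarith [Real.exp_pos x]
  · have h1 : Real.exp x ≤ 1 := Real.exp_le_one_iff.2 h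
    rw [abs_of_nonpos (by linarith), abs_of_nonpos h]
    have h2 := Real.add_one_le_exp x
    have h3 : 1 ≤ Real.exp (-x) := Real.one_le_exp (by linarith)
    nlinarith

/-- The bound for the change of the Hamiltonian under conjugation by an exponential weight, per
unit of the exponent. -/
def weightConst (d Nb : ℕ) (h₀ γ₀ r₀ : ℝ) : ℝ :=
  h₀ * packConst.{v} d (γ₀ / 2) r₀ * (8 / γ₀) * (Nb * packConst.{v} d (γ₀ / 4) r₀)

theorem weightConst_nonneg (d Nb : ℕ) {h₀ γ₀ : ℝ} (hh₀ : 0 ≤ h₀) (hγ₀ : 0 < γ₀) (r₀ : ℝ) :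
    0 ≤ weightConst.{v} d Nb h₀ γ₀ r₀ := by
  have := packConst_pos.{v} d (γ₀ / 2) r₀
  have := packConst_pos.{v} d (γ₀ / 4) r₀
  unfold weightConst
  positivity

/-- Conjugation of the Hamiltonian by the weight `e^φ`, for bounded `φ` with Lipschitz constant
`η`, changes it by `O(η)` in norm. -/
theorem exists_conj_perturbation (hγ₀ : 0 < γ₀) (hh₀ : 0 ≤ h₀) (hr₀ : 0 < r₀)
    (hc : c.IsRegular r₀) {η : ℝ} (hη : 0 ≤ η) (hηγ : η ≤ γ₀ / 8) {φ : Λ → ℝ} {L : ℝ}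
    (hφL : ∀ k, φ k ≤ L) (hφ : ∀ k l, |φ k - φ l| ≤ η * c.r k l) :
    ∃ E D : StateSpace Λ Nb →L[ℂ] StateSpace Λ Nb,
      ‖E‖ ≤ η * weightConst.{v} d Nb h₀ γ₀ r₀ ∧
      HasMatrix D (fun i j => open Classical in if i = j then Real.exp (φ i.1) else 0) ∧
      D * hamiltonian M c = (hamiltonian M c + E) * D := by
  classical
  have hp := packConst_pos.{v} d (γ₀ / 2) r₀
  have hp4 := packConst_pos.{v} d (γ₀ / 4) r₀
  set B : Λ × Fin Nb → Λ × Fin Nb → ℝ := fun i j =>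
    (η * (h₀ * packConst.{v} d (γ₀ / 2) r₀ * (8 / γ₀))) * Real.exp (-(γ₀ / 4) * c.r i.1 j.1)
    with hB
  have hsum := fun i : Λ × Fin Nb =>
    summable_exp_r_orbital (Nb := Nb) hc hr₀ (show 0 < γ₀ / 4 by positivity) i.1
  have hH := hasMatrix_hamiltonian (M := M) hγ₀ hr₀ hc
  obtain ⟨E, hE, hE'⟩ := exists_hasMatrix_of_schur
    (A := fun i j => hamEntry M c i j * (Real.exp (φ i.1 - φ j.1) - 1)) (B := B)
    (K := η * weightConst.{v} d Nb h₀ γ₀ r₀)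
    (mul_nonneg hη (weightConst_nonneg d Nb hh₀ hγ₀ r₀)) (fun i j => by
      have hr := c.r_nonneg i.1 j.1
      have h1 : |hamEntry M c i j * (Real.exp (φ i.1 - φ j.1) - 1)| ≤
          (h₀ * packConst.{v} d (γ₀ / 2) r₀ * Real.exp (-(γ₀ / 2) * c.r i.1 j.1)) *
            |Real.exp (φ i.1 - φ j.1) - 1| := by
        rw [abs_mul]
        by_cases h : i = j
        · simp [h]
        · have h2 := abs_hamEntry_le (M := M) hγ₀ hr₀ hc i j
          rw [if_neg h, add_zero] at h2
          exact mul_le_mul_of_nonneg_right h2 (abs_nonneg _)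
      refine h1.trans ?_
      have h3 : |Real.exp (φ i.1 - φ j.1) - 1| ≤
          (η * c.r i.1 j.1) * Real.exp (γ₀ / 8 * c.r i.1 j.1) := by
        refine (abs_exp_sub_one_le_mul_exp _).trans (mul_le_mul (hφ _ _)
          (Real.exp_le_exp.2 ((hφ _ _).trans ?_)) (Real.exp_pos _).le (by positivity))
        exact mul_le_mul_of_nonneg_right hηγ hr
      have h4 : c.r i.1 j.1 ≤ 8 / γ₀ * Real.exp (γ₀ / 8 * c.r i.1 j.1) := by
        have h5 := Real.add_one_le_exp (γ₀ / 8 * c.r i.1 j.1)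
        have h6 : c.r i.1 j.1 = 8 / γ₀ * (γ₀ / 8 * c.r i.1 j.1) := by field_simp
        have h7 : 0 < 8 / γ₀ := by positivity
        calc c.r i.1 j.1 = 8 / γ₀ * (γ₀ / 8 * c.r i.1 j.1) := h6
          _ ≤ _ := mul_le_mul_of_nonneg_left (by linarith) h7.le
      have h8 : Real.exp (-(γ₀ / 2) * c.r i.1 j.1) * (Real.exp (γ₀ / 8 * c.r i.1 j.1) *
          Real.exp (γ₀ / 8 * c.r i.1 j.1)) = Real.exp (-(γ₀ / 4) * c.r i.1 j.1) := by
        rw [← Real.exp_add, ← Real.exp_add]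
        congr 1
        ring
      have h9 := Real.exp_pos (γ₀ / 8 * c.r i.1 j.1)
      have h10 := Real.exp_pos (-(γ₀ / 2) * c.r i.1 j.1)
      calc _ ≤ (h₀ * packConst.{v} d (γ₀ / 2) r₀ * Real.exp (-(γ₀ / 2) * c.r i.1 j.1)) *
            ((η * (8 / γ₀ * Real.exp (γ₀ / 8 * c.r i.1 j.1))) *
              Real.exp (γ₀ / 8 * c.r i.1 j.1)) := by
            refine mul_le_mul_of_nonneg_left (h3.trans ?_) (by positivity)
            exact mul_le_mul_of_nonneg_right (mul_le_mul_of_nonneg_left h4 hη) h9.le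
        _ = B i j := by
            rw [hB]
            simp only
            rw [← h8]
            ring)
    (fun i j => by simp only [hB]; rw [c.r_comm])
    (fun i => (hsum i).1.mul_left _) (fun i => by
      simp only [hB]
      rw [tsum_mul_left]
      refine (mul_le_mul_of_nonneg_left (hsum i).2 (by positivity)).trans (le_of_eq ?_)
      unfold weightConst
      ring)
  obtain ⟨D, -, hD⟩ := exists_hasMatrix_of_schur (Λ := Λ) (Nb := Nb)
    (A := fun i j => if i = j then Real.exp (φ i.1) else 0)
    (B := fun i j => if j = i then Real.exp L else 0)
    (K := Real.exp L) (Real.exp_pos _).le (fun i j => by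
      by_cases h : i = j
      · simp [h, hφL]
      · simp [h, Ne.symm h])
    (fun i j => by
      by_cases h : i = j
      · simp [h]
      · simp [h, Ne.symm h])
    (fun i => (hasSum_ite_eq i (Real.exp L)).summable)
    (fun i => (hasSum_ite_eq i (Real.exp L)).tsum_eq.le)
  refine ⟨E, D, hE, hD, ?_⟩
  have hDb : ∀ j, D (basisVec j) = (Real.exp (φ j.1) : ℂ) • basisVec j := by
    intro j
    ext i
    have h1 := hD i j
    have h2 := inner_basisVec_basisVec i j
    have h3 : ∀ f : StateSpace Λ Nb, inner ℂ (basisVec i) f = f i := fun f => by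
      simp [basisVec, lp.inner_single_left]
    rw [h3] at h1 h2
    rw [h1, lp.coeFn_smul, Pi.smul_apply, h2]
    by_cases h : i = j
    · simp [h]
    · simp [h]
  refine HasMatrix.unique (A := fun i j => Real.exp (φ i.1) * hamEntry M c i j) ?_ ?_
  · intro i j
    have h1 := hasSum_inner_mul hD i (hamiltonian M c (basisVec j))
    have h2 : HasSum (fun k => ((if i = k then Real.exp (φ i.1) else 0 : ℝ) : ℂ) *
        inner ℂ (basisVec k) (hamiltonian M c (basisVec j)))
        ((Real.exp (φ i.1) * hamEntry M c i j : ℝ) : ℂ) := by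
      have h3 := hasSum_single i (f := fun k => ((if i = k then Real.exp (φ i.1) else 0 : ℝ) : ℂ) *
        inner ℂ (basisVec k) (hamiltonian M c (basisVec j))) (fun k hk => by simp [Ne.symm hk])
      simp only [if_true] at h3
      rw [hH i j, ← Complex.ofReal_mul] at h3
      exact h3
    exact h1.unique h2
  · intro i j
    change inner ℂ (basisVec i) ((hamiltonian M c + E) (D (basisVec j))) = _
    rw [hDb, map_smul, inner_smul_right, add_apply, inner_add_right, hH i j, hE' i j,
      ← Complex.ofReal_add, ← Complex.ofReal_mul]
    congr 1
    have : Real.exp (φ i.1) = Real.exp (φ j.1) * Real.exp (φ i.1 - φ j.1) := by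
      rw [← Real.exp_add]; congr 1; ring
    simp only
    rw [this]
    ring

/-- **Combes–Thomas estimate**: the resolvent at distance `δ` from the spectrum is exponentially
localised, with an exponent proportional to `δ`. -/
theorem norm_inner_resolvent_le (hγ₀ : 0 < γ₀) (hh₀ : 0 ≤ h₀) (hr₀ : 0 < r₀)
    (hc : c.IsRegular r₀) {z : ℂ} {δ : ℝ} (hδ : 0 < δ)
    (hz : ∀ x ∈ spectrum ℝ (hamiltonian M c), δ ≤ ‖z - x‖) {η : ℝ} (hη : 0 ≤ η)
    (hηγ : η ≤ γ₀ / 8) (hηδ : η * weightConst.{v} d Nb h₀ γ₀ r₀ ≤ δ / 2) (i j : Λ × Fin Nb) :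
    ‖inner ℂ (basisVec i) (resolvent (hamiltonian M c) z (basisVec j))‖ ≤
      2 / δ * Real.exp (-η * c.r i.1 j.1) := by
  classical
  -- the weight `φ` is the distance to `j` times `η`, cut off at its value `L` at `i` to be bounded
  set L := η * c.r i.1 j.1 with hL
  set φ : Λ → ℝ := fun k => min (η * c.r k j.1) L with hφ
  obtain ⟨E, D, hE, hD, hcomm⟩ := exists_conj_perturbation (M := M) hγ₀ hh₀ hr₀ hc hη hηγ (φ := φ)
    (L := L) (fun k => min_le_right _ _) (fun k l => by
      refine (abs_min_sub_min_le_max _ _ _ _).trans ?_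
      rw [sub_self, abs_zero, max_eq_left (abs_nonneg _), ← mul_sub, abs_mul, abs_of_nonneg hη]
      refine mul_le_mul_of_nonneg_left (abs_le.2 ⟨?_, ?_⟩) hη
      · have := c.r_triangle l j.1 k
        rw [c.r_comm l k] at this
        linarith
      · have := c.r_triangle k j.1 l
        linarith)
  set T := hamiltonian M c with hT
  obtain ⟨hu, -, hR⟩ := resolvent_eq_cfc (isSelfAdjoint_hamiltonian (M := M) hγ₀ hr₀ hc) hδ hz
  obtain ⟨hu', hR', -⟩ := resolvent_perturbation (T := T + E) (T₀ := T) hδ hu hR (by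
    rw [add_sub_cancel_left]; exact hE.trans hηδ)
  obtain ⟨U, hU⟩ := hu
  obtain ⟨U', hU'⟩ := hu'
  -- the weight turns the matrix element at `(i, j)` into `exp L` times itself, and the resolvent into
  -- that of a small perturbation
  have e1 : D * resolvent T z = resolvent (T + E) z * D := by
    rw [resolvent, resolvent, ← hU, ← hU', Ring.inverse_unit, Ring.inverse_unit,
      Units.eq_inv_mul_iff_mul_eq, ← mul_assoc, Units.mul_inv_eq_iff_eq_mul, hU, hU', sub_mul,
      mul_sub, hcomm, Algebra.commutes]
  have hφj : φ j.1 = 0 := by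
    simp only [hφ, c.r_self, mul_zero]
    exact min_eq_left (mul_nonneg hη (c.r_nonneg _ _))
  have hφi : φ i.1 = L := min_self _
  have h3 : ∀ (k : Λ × Fin Nb) (f : StateSpace Λ Nb), inner ℂ (basisVec k) f = f k := fun k f => by
    simp [basisVec, lp.inner_single_left]
  have hDb : D (basisVec j) = basisVec j := by
    ext k
    have h1 := hD k j
    have h2 := inner_basisVec_basisVec k j
    rw [h3] at h1 h2
    rw [h1, h2]
    by_cases h : k = j
    · simp [h, hφj]
    · simp [h]
  have hDi : inner ℂ (basisVec i) (D (resolvent T z (basisVec j))) =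
      (Real.exp L : ℂ) * inner ℂ (basisVec i) (resolvent T z (basisVec j)) := by
    have h1 := hasSum_inner_mul hD i (resolvent T z (basisVec j))
    refine h1.unique ?_
    have h4 := hasSum_single i (f := fun k => ((if i = k then Real.exp (φ i.1) else 0 : ℝ) : ℂ) *
        inner ℂ (basisVec k) (resolvent T z (basisVec j))) (fun k hk => by simp [Ne.symm hk])
    simp only [if_true, hφi] at h4 ⊢
    exact h4
  have e2 : inner ℂ (basisVec i) (D (resolvent T z (basisVec j))) =
      inner ℂ (basisVec i) (resolvent (T + E) z (basisVec j)) := by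
    have h5 := congrArg (fun X : StateSpace Λ Nb →L[ℂ] StateSpace Λ Nb => X (basisVec j)) e1
    change D (resolvent T z (basisVec j)) = resolvent (T + E) z (D (basisVec j)) at h5
    rw [h5, hDb]
  have h6 : ‖inner ℂ (basisVec i) (resolvent (T + E) z (basisVec j))‖ ≤ 2 / δ := by
    refine (norm_inner_le_norm _ _).trans ?_
    rw [norm_basisVec, one_mul]
    refine (ContinuousLinearMap.le_opNorm _ _).trans ?_
    rw [norm_basisVec, mul_one]
    exact hR'
  rw [← e2, hDi, norm_mul, Complex.norm_real, Real.norm_eq_abs, abs_of_pos (Real.exp_pos _)] at h6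
  have h7 : Real.exp (-η * c.r i.1 j.1) = (Real.exp L)⁻¹ := by
    rw [← Real.exp_neg, hL]; congr 1; ring
  rw [h7, ← div_eq_mul_inv, le_div_iff₀ (Real.exp_pos _), mul_comm]
  exact h6

end CombesThomas

/-! ### Local observables of functions and polynomials -/

theorem cfc_sub_aeval {A : Type*} [CStarAlgebra A] {T : A} (hT : IsSelfAdjoint T) {f : ℝ → ℝ}
    (hf : ContinuousOn f (spectrum ℝ T)) (q : Polynomial ℝ) :
    cfc f T - Polynomial.aeval T q = cfc (fun x => f x - q.eval x) T := by
  rw [cfc_sub f (fun x => q.eval x) T hf, cfc_polynomial q T hT]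

section SiteTrace

open MeasureTheory

variable {d Nb : ℕ} {S : Type u} {h₀ γ₀ : ℝ} {Λ : Type v}
variable {M : TBModel d Nb S h₀ γ₀} {c : Config d S Λ} {r₀ : ℝ}

theorem siteTrace_add (T T' : StateSpace Λ Nb →L[ℂ] StateSpace Λ Nb) (ℓ : Λ) :
    siteTrace (T + T') ℓ = siteTrace T ℓ + siteTrace T' ℓ := by
  simp only [siteTrace, add_apply, inner_add_right, Complex.add_re, Finset.sum_add_distrib]

theorem siteTrace_sub (T T' : StateSpace Λ Nb →L[ℂ] StateSpace Λ Nb) (ℓ : Λ) :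
    siteTrace (T - T') ℓ = siteTrace T ℓ - siteTrace T' ℓ := by
  simp only [siteTrace, sub_apply, inner_sub_right, Complex.sub_re, Finset.sum_sub_distrib]

theorem abs_siteTrace_le {T : StateSpace Λ Nb →L[ℂ] StateSpace Λ Nb} {ℓ : Λ} {C : ℝ}
    (hT : ∀ a, ‖inner ℂ (basisVec (ℓ, a)) (T (basisVec (ℓ, a)))‖ ≤ C) :
    |siteTrace T ℓ| ≤ Nb * C := by
  refine (Finset.abs_sum_le_sum_abs _ _).trans ((Finset.sum_le_sum fun a _ =>
    (Complex.abs_re_le_norm _).trans (hT a)).trans ?_)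
  simp

theorem abs_siteTrace_le_norm (T : StateSpace Λ Nb →L[ℂ] StateSpace Λ Nb) (ℓ : Λ) :
    |siteTrace T ℓ| ≤ Nb * ‖T‖ := by
  refine abs_siteTrace_le fun a => (norm_inner_le_norm _ _).trans ?_
  rw [norm_basisVec, one_mul]
  refine (ContinuousLinearMap.le_opNorm _ _).trans ?_
  rw [norm_basisVec, mul_one]

/-- The trace of a diagonal block as a bounded real linear functional. -/
def siteTraceCLM (ℓ : Λ) : (StateSpace Λ Nb →L[ℂ] StateSpace Λ Nb) →L[ℝ] ℝ :=
  LinearMap.mkContinuous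
    { toFun := fun T => siteTrace T ℓ
      map_add' := fun T T' => siteTrace_add T T' ℓ
      map_smul' := fun r T => by
        have e : ∀ f, (r • T) f = (r : ℂ) • T f := fun f => rfl
        simp only [siteTrace, e, inner_smul_right, Complex.re_ofReal_mul, RingHom.id_apply,
          smul_eq_mul, Finset.mul_sum] }
    Nb fun T => abs_siteTrace_le_norm T ℓ

theorem siteTraceCLM_apply (ℓ : Λ) (T : StateSpace Λ Nb →L[ℂ] StateSpace Λ Nb) :
    siteTraceCLM ℓ T = siteTrace T ℓ := rfl

theorem differentiableAt_localPoly (hγ₀ : 0 < γ₀) (hr₀ : 0 < r₀) (hc : c.IsRegular r₀)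
    (q : Polynomial ℝ) (ℓ m : Λ) :
    DifferentiableAt ℝ (fun y => localPoly M q (c.move m y) ℓ) (c.coord m) := by
  obtain ⟨T', hT', -⟩ := exists_hasFDerivAt_hamiltonian (M := M) hγ₀ hr₀ hc m
  have h1 : DifferentiableAt ℝ (fun y => applyPoly q (hamiltonian M (c.move m y))) (c.coord m) := by
    simp only [applyPoly, Polynomial.aeval_eq_sum_range]
    exact DifferentiableAt.fun_sum fun i _ =>
      (hT'.differentiableAt.fun_pow i).fun_const_smul (q.coeff i)
  exact (siteTraceCLM ℓ).differentiableAt.comp _ h1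

/-- The error of a local observable is bounded by the scalar error on the spectrum, once for each
orbital of the atom. -/
theorem abs_localObs_sub_localPoly_le (hγ₀ : 0 < γ₀) (hr₀ : 0 < r₀) (hc : c.IsRegular r₀)
    {O : ℝ → ℝ} {q : Polynomial ℝ}
    (hO : ContinuousOn O (realSpectrum (hamiltonian M c))) {ε : ℝ} (hε : 0 ≤ ε)
    (hq : ∀ x ∈ realSpectrum (hamiltonian M c), |O x - q.eval x| ≤ ε) (ℓ : Λ) :
    |localObs M O c ℓ - localPoly M q c ℓ| ≤ Nb * ε := by
  have hT := isSelfAdjoint_hamiltonian (M := M) hγ₀ hr₀ hc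
  have e : applyFun O (hamiltonian M c) - applyPoly q (hamiltonian M c) =
      applyFun (fun x => O x - q.eval x) (hamiltonian M c) := by
    exact cfc_sub_aeval hT hO q
  rw [localObs, localPoly, ← siteTrace_sub, e]
  refine (abs_siteTrace_le_norm _ _).trans (mul_le_mul_of_nonneg_left ?_ (Nat.cast_nonneg _))
  exact norm_cfc_le hε hq

/-- If the error `O - q` is given near the spectrum by a Cauchy integral over curves at distance
`δ`, then the local observables of `O` are differentiable, and the derivatives of the local error
are bounded by the weights of the Cauchy integral and exponentially localised. -/
theorem norm_fderiv_localObs_sub_le (hγ₀ : 0 < γ₀) (hh₀ : 0 ≤ h₀) (hr₀ : 0 < r₀)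
    (hc : c.IsRegular r₀) {O : ℝ → ℝ} {q : Polynomial ℝ} {U : Set ℝ} (hU : IsOpen U)
    (hσ : realSpectrum (hamiltonian M c) ⊆ U) (hO : ContinuousOn O U)
    {J : Type*} [Fintype J] {γ ψ : J → ℝ → ℂ} {Ψ δ η : ℝ} (hδ : 0 < δ)
    (hγ : ∀ j, ContinuousOn (γ j) (Icc 0 1)) (hψ : ∀ j, ContinuousOn (ψ j) (Icc 0 1))
    (hΨ : ∀ j, ∀ t ∈ Icc (0 : ℝ) 1, ‖ψ j t‖ ≤ Ψ)
    (hdist : ∀ j, ∀ t ∈ Icc (0 : ℝ) 1, ∀ x ∈ U, δ ≤ ‖γ j t - x‖)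
    (hf : ∀ x ∈ U, ((O x - q.eval x : ℝ) : ℂ) =
      ∑ j, ∫ t in Icc (0 : ℝ) 1, ψ j t * (γ j t - x)⁻¹)
    (hη : 0 ≤ η) (hηγ : η ≤ γ₀ / 8) (hηδ : η * weightConst.{v} d Nb h₀ γ₀ r₀ ≤ δ / 2) (ℓ m : Λ) :
    DifferentiableAt ℝ (fun y => localObs M O (c.move m y) ℓ) (c.coord m) ∧
    DifferentiableAt ℝ (fun y => localPoly M q (c.move m y) ℓ) (c.coord m) ∧
    ‖fderiv ℝ (fun y => localObs M O (c.move m y) ℓ) (c.coord m)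
      - fderiv ℝ (fun y => localPoly M q (c.move m y) ℓ) (c.coord m)‖ ≤
      Nb * (Fintype.card J * (Ψ * ((2 / δ) ^ 2 * (h₀ * Real.exp (γ₀ * r₀) + 1) *
        ((Nb * packConst.{v} d (γ₀ / 4) r₀) ^ 2 * packConst.{v} d (γ₀ / 4) r₀)))) *
          Real.exp (-η * c.r ℓ m) := by
  have hp := packConst_pos.{v} d (γ₀ / 4) r₀
  set G := (2 / δ) ^ 2 * (h₀ * Real.exp (γ₀ * r₀) + 1) *
        ((Nb * packConst.{v} d (γ₀ / 4) r₀) ^ 2 * packConst.{v} d (γ₀ / 4) r₀) with hG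
  have hG0 : 0 ≤ G := by positivity
  have hT := isSelfAdjoint_hamiltonian (M := M) hγ₀ hr₀ hc
  set y₀ := c.coord m with hy₀
  have hcy : c.move m y₀ = c := c.move_coord m
  obtain ⟨T', hT', hT'v⟩ := exists_hasFDerivAt_hamiltonian (M := M) hγ₀ hr₀ hc m
  have hres : ∀ j, ∀ t ∈ Icc (0 : ℝ) 1, _ := fun j t ht =>
    resolvent_eq_cfc hT hδ (fun x hx => hdist j t ht x (hσ hx))
  obtain ⟨Φ, hΦ, hΦv⟩ := hasFDerivAt_resolventIntegral (T₀ := hamiltonian M c) hδ hγ hψ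
    (fun j t ht => (hres j t ht).1) (fun j t ht => (hres j t ht).2.2)
  -- the spectrum is upper semicontinuous
  have hcont : ContinuousAt (fun y => hamiltonian M (c.move m y)) y₀ := hT'.continuousAt
  have hev : ∀ᶠ y in 𝓝 y₀, spectrum ℝ (hamiltonian M (c.move m y)) ⊆ U := by
    have h1 := (upperHemicontinuous_spectrum ℝ (StateSpace Λ Nb →L[ℂ] StateSpace Λ Nb)).forall_isOpen
      (hamiltonian M c) U hU hσ
    have h2 : Tendsto (fun y => hamiltonian M (c.move m y)) (𝓝 y₀) (𝓝 (hamiltonian M c)) := by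
      have := hcont.tendsto
      rwa [hcy] at this
    exact h2.eventually h1
  -- hence the error is a resolvent integral for all configurations near the reference one
  have hev2 : ∀ᶠ y in 𝓝 y₀, localObs M O (c.move m y) ℓ - localPoly M q (c.move m y) ℓ =
      siteTraceCLM ℓ (resolventIntegral γ ψ (hamiltonian M (c.move m y))) := by
    filter_upwards [hev, Metric.ball_mem_nhds y₀ (show 0 < r₀ / 4 by positivity)] with y hy hyb
    have hTy := isSelfAdjoint_hamiltonian (M := M) hγ₀ (half_pos hr₀) (hc.move hr₀ m hyb)
    have e : applyFun O (hamiltonian M (c.move m y)) - applyPoly q (hamiltonian M (c.move m y)) =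
        applyFun (fun x => O x - q.eval x) (hamiltonian M (c.move m y)) := by
      exact cfc_sub_aeval hTy (hO.mono hy) q
    rw [localObs, localPoly, ← siteTrace_sub, e, siteTraceCLM_apply]
    exact congrArg (fun T => siteTrace T ℓ) (cfc_eq_resolventIntegral hTy hδ hγ hψ
      (fun j t ht x hx => hdist j t ht x (hy hx)) (fun x hx => hf x (hy hx)))
  have hd : HasFDerivAt (fun y => localObs M O (c.move m y) ℓ - localPoly M q (c.move m y) ℓ)
      ((siteTraceCLM ℓ).comp ((Φ.restrictScalars ℝ).comp T')) y₀ := by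
    refine HasFDerivAt.congr_of_eventuallyEq ?_ hev2
    have h1 : HasFDerivAt (resolventIntegral γ ψ) (Φ.restrictScalars ℝ)
        (hamiltonian M (c.move m y₀)) := by
      rw [hcy]
      exact hΦ.restrictScalars ℝ
    have h2 : HasFDerivAt (fun y => resolventIntegral γ ψ (hamiltonian M (c.move m y)))
        ((Φ.restrictScalars ℝ).comp T') y₀ :=
      HasFDerivAt.comp (f := fun y => hamiltonian M (c.move m y)) y₀ h1 hT'
    exact (siteTraceCLM ℓ).hasFDerivAt.comp y₀ h2
  have hpoly := differentiableAt_localPoly (M := M) hγ₀ hr₀ hc q ℓ m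
  have hobs : DifferentiableAt ℝ (fun y => localObs M O (c.move m y) ℓ) y₀ := by
    have h1 := hd.differentiableAt.add hpoly
    refine h1.congr_of_eventuallyEq (Eventually.of_forall fun y => ?_)
    simp
  refine ⟨hobs, hpoly, ?_⟩
  rw [← fderiv_fun_sub hobs hpoly, hd.fderiv]
  refine ContinuousLinearMap.opNorm_le_bound _ ?_ fun v => ?_
  · have hJ : 0 ≤ (Fintype.card J : ℝ) * Ψ := by
      rcases isEmpty_or_nonempty J with h | ⟨⟨j⟩⟩
      · simp
      · exact mul_nonneg (Nat.cast_nonneg _) ((norm_nonneg _).trans (hΨ j 0 (by simp)))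
    have : 0 ≤ (Fintype.card J : ℝ) * (Ψ * G) := by
      rw [← mul_assoc]; exact mul_nonneg hJ hG0
    positivity
  · obtain ⟨A, hA, hAs⟩ := hT'v v
    change |siteTrace (Φ (T' v)) ℓ| ≤ _
    refine (abs_siteTrace_le (C := Fintype.card J * (Ψ * G) * Real.exp (-η * c.r ℓ m) * ‖v‖)
      fun a => ?_).trans (le_of_eq (by ring))
    set b : StateSpace Λ Nb := basisVec (ℓ, a) with hb
    set R := fun j t => resolvent (hamiltonian M c) (γ j t) with hRdef
    have hRc : ∀ j, ContinuousOn (R j) (Icc 0 1) := fun j =>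
      continuousOn_resolvent_comp (hγ j) (fun t ht => (hres j t ht).1)
    have hint : ∀ j, IntegrableOn (fun t => ψ j t • (R j t * T' v * R j t)) (Icc 0 1) := fun j =>
      ((hψ j).smul (((hRc j).mul continuousOn_const).mul (hRc j))).integrableOn_compact
        isCompact_Icc
    have hfun : inner ℂ b (Φ (T' v) b) = ∑ j, ∫ t in Icc (0 : ℝ) 1,
        ψ j t * inner ℂ b (R j t (T' v (R j t b))) := by
      set F : (StateSpace Λ Nb →L[ℂ] StateSpace Λ Nb) →L[ℂ] ℂ :=
        (innerSL ℂ b).comp (ContinuousLinearMap.apply ℂ (StateSpace Λ Nb) b) with hF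
      change F (Φ (T' v)) = _
      rw [hΦv, map_sum]
      refine Finset.sum_congr rfl fun j _ => ?_
      refine (F.integral_comp_comm (hint j)).symm.trans ?_
      refine integral_congr_ae (Eventually.of_forall fun t => ?_)
      change F (ψ j t • (R j t * T' v * R j t)) = _
      rw [map_smul, smul_eq_mul]
      rfl
    rw [hfun]
    refine (norm_sum_le _ _).trans ?_
    have hone : ∀ j ∈ (Finset.univ : Finset J), ‖∫ t in Icc (0 : ℝ) 1,
        ψ j t * inner ℂ b (R j t (T' v (R j t b)))‖ ≤
        Ψ * G * Real.exp (-η * c.r ℓ m) * ‖v‖ := by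
      intro j _
      refine (norm_setIntegral_le_of_norm_le_const
        (C := Ψ * (G * ‖v‖ * Real.exp (-η * c.r ℓ m))) (by simp) fun t ht => ?_).trans
        (le_of_eq ?_)
      · have hCT := norm_inner_resolvent_le (M := M) (z := γ j t) hγ₀ hh₀ hr₀ hc hδ
          (fun x hx => hdist j t ht x (hσ hx)) hη hηγ hηδ
        have h2 := norm_inner_sandwich_le hγ₀ hr₀ hh₀ hc m hA hAs (show 0 ≤ 2 / δ by positivity) hη
          (hηγ.trans (by linarith)) hCT hCT (ℓ, a)
        rw [norm_mul]
        exact mul_le_mul (hΨ j t ht) h2 (norm_nonneg _)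
          ((norm_nonneg _).trans (hΨ j t ht))
      · simp
        ring
    refine (Finset.sum_le_sum hone).trans (le_of_eq ?_)
    rw [Finset.sum_const, Finset.card_univ, nsmul_eq_mul]
    ring

end SiteTrace

/-! ### Cauchy's formula on rectangles -/

section Rectangle

open Complex MeasureTheory

/-- The sides (bottom, right, top, left) of the rectangle `[l, r] × [-δ, δ]`, each parametrised by
`[0, 1]` in increasing direction. -/
def rectSide (l r δ : ℝ) : Fin 4 → ℝ → ℂ :=
  ![fun t => ((l + (r - l) * t : ℝ) : ℂ) + (-δ : ℝ) * I,
    fun t => (r : ℂ) + ((-δ + (2 * δ) * t : ℝ) : ℂ) * I,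
    fun t => ((l + (r - l) * t : ℝ) : ℂ) + (δ : ℝ) * I,
    fun t => (l : ℂ) + ((-δ + (2 * δ) * t : ℝ) : ℂ) * I]

/-- The velocities of the sides of a rectangle, with the sign of their orientation. -/
def rectVelocity (l r δ : ℝ) : Fin 4 → ℂ :=
  ![((r - l : ℝ) : ℂ), ((2 * δ : ℝ) : ℂ) * I, -((r - l : ℝ) : ℂ), -(((2 * δ : ℝ) : ℂ) * I)]

theorem continuous_rectSide (l r δ : ℝ) (j : Fin 4) : Continuous (rectSide l r δ j) := by
  fin_cases j <;> simp [rectSide] <;> fun_prop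

/-- The sum of the side integrals is the boundary integral. -/
theorem sum_rectSide_eq (l r δ : ℝ) (g : ℂ → ℂ) :
    ∑ j, ∫ t in Icc (0 : ℝ) 1, rectVelocity l r δ j * g (rectSide l r δ j t) =
      (∫ x : ℝ in l..r, g (x + (-δ : ℝ) * I)) - (∫ x : ℝ in l..r, g (x + δ * I)) +
      I * (∫ y : ℝ in -δ..δ, g (r + y * I)) - I * (∫ y : ℝ in -δ..δ, g (l + y * I)) := by
  have h0 : ∀ (k : ℂ) (f : ℝ → ℂ), ∫ t in Icc (0 : ℝ) 1, k * f t = k * ∫ t in (0 : ℝ)..1, f t := by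
    intro k f
    rw [integral_Icc_eq_integral_Ioc, ← intervalIntegral.integral_of_le zero_le_one,
      intervalIntegral.integral_const_mul]
  have h1 : ∀ (f : ℝ → ℂ) (a k : ℝ), (k : ℂ) * ∫ t in (0 : ℝ)..1, f (a + k * t) =
      ∫ x in a..(a + k), f x := by
    intro f a k
    have := intervalIntegral.smul_integral_comp_add_mul (a := 0) (b := 1) f k a
    rw [mul_zero, mul_one, add_zero] at this
    rw [← this]
    rfl
  have e1 := h1 (fun x => g (x + (-δ : ℝ) * I)) l (r - l)
  have e2 := h1 (fun x => g (x + δ * I)) l (r - l)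
  have e3 := h1 (fun y => g (r + y * I)) (-δ) (2 * δ)
  have e4 := h1 (fun y => g (l + y * I)) (-δ) (2 * δ)
  rw [show l + (r - l) = r by ring] at e1 e2
  rw [show -δ + 2 * δ = δ by ring] at e3 e4
  rw [← e1, ← e2, ← e3, ← e4, Fin.sum_univ_four]
  simp only [rectSide, rectVelocity, Matrix.cons_val_zero, Matrix.cons_val_one, Matrix.cons_val]
  rw [h0, h0, h0, h0]
  ring

theorem sum_rectSide_eq_zero {l r δ : ℝ} (hlr : l ≤ r) (hδ : 0 ≤ δ) {g : ℂ → ℂ}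
    (hg : DifferentiableOn ℂ g (Icc l r ×ℂ Icc (-δ) δ)) :
    ∑ j, ∫ t in Icc (0 : ℝ) 1, rectVelocity l r δ j * g (rectSide l r δ j t) = 0 := by
  rw [sum_rectSide_eq]
  have h := integral_boundary_rect_eq_zero_of_differentiableOn g (⟨l, -δ⟩ : ℂ) ⟨r, δ⟩ (by
    simpa only [uIcc_of_le hlr, uIcc_of_le (show -δ ≤ δ by linarith)] using hg)
  simpa only [smul_eq_mul] using h

theorem hasDerivAt_log_mul_add {c z v : ℂ} {t : ℝ} (h : 0 < (c * (z + t * v)).re) :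
    HasDerivAt (fun t : ℝ => log (c * (z + t * v))) (v / (z + t * v)) t := by
  have h1 : HasDerivAt (fun t : ℝ => c * (z + t * v)) (c * v) t := by
    have h2 := ((hasDerivAt_id t).ofReal_comp.mul_const v).const_add z
    simpa using h2.const_mul c
  have h3 := h1.clog_real (Or.inl h)
  have hc : c ≠ 0 := fun h0 => by simp [h0] at h
  rwa [mul_div_mul_left _ _ hc] at h3

theorem integral_div_add_mul {c z v : ℂ} {a b : ℝ} (hab : a ≤ b)
    (h : ∀ t ∈ Icc a b, 0 < (c * (z + t * v)).re) :
    ∫ t in a..b, v / (z + t * v) = log (c * (z + b * v)) - log (c * (z + a * v)) := by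
  have hne : ∀ t ∈ Icc a b, z + t * v ≠ 0 := fun t ht h0 => by
    have := h t ht
    rw [h0] at this
    simp at this
  refine intervalIntegral.integral_eq_sub_of_hasDerivAt
    (f := fun t : ℝ => log (c * (z + t * v))) (fun t ht => ?_) ?_
  · rw [uIcc_of_le hab] at ht
    exact hasDerivAt_log_mul_add (h t ht)
  · refine ContinuousOn.intervalIntegrable ?_
    rw [uIcc_of_le hab]
    exact ContinuousOn.div continuousOn_const (by fun_prop) hne

theorem log_I_mul {w : ℂ} (hw : 0 < w.re) : log (I * w) = Real.pi / 2 * I + log w := by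
  have hw0 : w ≠ 0 := fun h => by simp [h] at hw
  rw [(log_mul_eq_add_log_iff I_ne_zero hw0).2, log_I]
  rw [arg_I]
  have := abs_lt.1 (abs_arg_lt_pi_div_two_iff.2 (Or.inl hw))
  constructor <;> linarith [Real.pi_pos]

theorem log_neg_I_mul {w : ℂ} (hw : 0 < w.re) : log (-I * w) = -(Real.pi / 2 * I) + log w := by
  have hw0 : w ≠ 0 := fun h => by simp [h] at hw
  rw [(log_mul_eq_add_log_iff (neg_ne_zero.2 I_ne_zero) hw0).2, log_neg_I]
  · congr 1
    ring
  rw [arg_neg_I]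
  have := abs_lt.1 (abs_arg_lt_pi_div_two_iff.2 (Or.inl hw))
  constructor <;> linarith [Real.pi_pos]

/-- The winding number of a rectangle about a real point in its interior. -/
theorem sum_rectSide_inv {l r δ x : ℝ} (hl : l < x) (hr : x < r) (hδ : 0 < δ) :
    ∑ j, ∫ t in Icc (0 : ℝ) 1, rectVelocity l r δ j * (rectSide l r δ j t - x)⁻¹ =
      2 * Real.pi * I := by
  rw [sum_rectSide_eq l r δ (fun z => (z - x)⁻¹)]
  have e1 := integral_div_add_mul (c := I) (z := -x + (-δ : ℝ) * I) (v := 1) (a := l) (b := r)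
    (by linarith) (fun t _ => by simpa using hδ)
  have e2 := integral_div_add_mul (c := -I) (z := -x + δ * I) (v := 1) (a := l) (b := r)
    (by linarith) (fun t _ => by simpa using hδ)
  have e3 := integral_div_add_mul (c := 1) (z := r - x) (v := I) (a := -δ) (b := δ)
    (by linarith) (fun t _ => by simpa using hr)
  have e4 := integral_div_add_mul (c := -1) (z := l - x) (v := I) (a := -δ) (b := δ)
    (by linarith) (fun t _ => by simpa using hl)
  have f1 : ∫ t in l..r, ((t : ℂ) + (-δ : ℝ) * I - x)⁻¹ =
      ∫ t in l..r, 1 / (-x + (-δ : ℝ) * I + t * 1 : ℂ) := by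
    congr 1; funext t; rw [one_div]; congr 1; ring
  have f2 : ∫ t in l..r, ((t : ℂ) + δ * I - x)⁻¹ = ∫ t in l..r, 1 / (-x + δ * I + t * 1 : ℂ) := by
    congr 1; funext t; rw [one_div]; congr 1; ring
  have f3 : I * ∫ y in -δ..δ, ((r : ℂ) + y * I - x)⁻¹ =
      ∫ y in -δ..δ, I / (r - x + y * I : ℂ) := by
    rw [← intervalIntegral.integral_const_mul]
    congr 1; funext t; rw [div_eq_mul_inv]; congr 2; ring
  have f4 : I * ∫ y in -δ..δ, ((l : ℂ) + y * I - x)⁻¹ =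
      ∫ y in -δ..δ, I / (l - x + y * I : ℂ) := by
    rw [← intervalIntegral.integral_const_mul]
    congr 1; funext t; rw [div_eq_mul_inv]; congr 2; ring
  rw [f1, f2, f3, f4, e1, e2, e3, e4]
  have g1 := log_I_mul (w := (r - x) + (-δ : ℝ) * I) (by simpa using hr)
  have g2 := log_neg_I_mul (w := (x - l) + δ * I) (by simpa using hl)
  have g3 := log_neg_I_mul (w := (r - x) + δ * I) (by simpa using hr)
  have g4 := log_I_mul (w := (x - l) + (-δ : ℝ) * I) (by simpa using hl)
  have i1 : I * (-x + (-δ : ℝ) * I + r * 1 : ℂ) = I * ((r - x) + (-δ : ℝ) * I) := by ring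
  have i2 : I * (-x + (-δ : ℝ) * I + l * 1 : ℂ) = -I * ((x - l) + δ * I) := by push_cast; ring
  have i3 : -I * (-x + δ * I + r * 1 : ℂ) = -I * ((r - x) + δ * I) := by ring
  have i4 : -I * (-x + δ * I + l * 1 : ℂ) = I * ((x - l) + (-δ : ℝ) * I) := by push_cast; ring
  have i5 : -1 * ((l : ℂ) - x + δ * I) = (x - l) + (-δ : ℝ) * I := by push_cast; ring
  have i6 : -1 * ((l : ℂ) - x + (-δ : ℝ) * I) = (x - l) + δ * I := by push_cast; ring
  have i7 : 1 * ((r : ℂ) - x + δ * I) = (r - x) + δ * I := by ring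
  have i8 : 1 * ((r : ℂ) - x + (-δ : ℝ) * I) = (r - x) + (-δ : ℝ) * I := by ring
  rw [i1, i2, i3, i4, i5, i6, i7, i8, g1, g2, g3, g4]
  ring

theorem rectSide_mem {l r δ : ℝ} (hlr : l ≤ r) (hδ : 0 ≤ δ) (j : Fin 4) {t : ℝ}
    (ht : t ∈ Icc (0 : ℝ) 1) : rectSide l r δ j t ∈ Icc l r ×ℂ Icc (-δ) δ := by
  have h1 : 0 ≤ (r - l) * t := mul_nonneg (by linarith) ht.1
  have h2 : (r - l) * t ≤ (r - l) := mul_le_of_le_one_right (by linarith) ht.2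
  have h3 : 0 ≤ 2 * δ * t := mul_nonneg (by linarith) ht.1
  have h4 : 2 * δ * t ≤ 2 * δ := mul_le_of_le_one_right (by linarith) ht.2
  rw [mem_reProdIm]
  fin_cases j <;> simp [rectSide] <;> constructor <;> first | constructor <;> linarith | linarith

/-- The sides of a rectangle have distance at least `δ` to a real point whose distance to the
vertical sides is at least `δ`. -/
theorem le_norm_rectSide_sub {l r δ x : ℝ} (hδ : 0 ≤ δ) (hl : δ ≤ |l - x|) (hr : δ ≤ |r - x|)
    (j : Fin 4) (t : ℝ) : δ ≤ ‖rectSide l r δ j t - x‖ := by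
  have him := abs_im_le_norm (rectSide l r δ j t - x)
  have hre := abs_re_le_norm (rectSide l r δ j t - x)
  fin_cases j
  · refine le_trans ?_ him
    simp [rectSide, abs_of_nonneg hδ]
  · refine le_trans ?_ hre
    simpa [rectSide] using hr
  · refine le_trans ?_ him
    simp [rectSide, abs_of_nonneg hδ]
  · refine le_trans ?_ hre
    simpa [rectSide] using hl

theorem norm_rectVelocity_le {l r δ : ℝ} (hlr : l ≤ r) (hδ : 0 ≤ δ) (j : Fin 4) :
    ‖rectVelocity l r δ j‖ ≤ (r - l) + 2 * δ := by
  have h : ‖((r - l : ℝ) : ℂ)‖ = r - l := by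
    rw [norm_real, Real.norm_eq_abs, abs_of_nonneg (by linarith)]
  have h' : ‖((2 * δ : ℝ) : ℂ) * I‖ = 2 * δ := by
    rw [norm_mul, norm_I, mul_one, norm_real, Real.norm_eq_abs, abs_of_nonneg (by linarith)]
  fin_cases j
  · change ‖((r - l : ℝ) : ℂ)‖ ≤ _
    rw [h]; linarith
  · change ‖((2 * δ : ℝ) : ℂ) * I‖ ≤ _
    rw [h']; linarith
  · change ‖-((r - l : ℝ) : ℂ)‖ ≤ _
    rw [norm_neg, h]; linarith
  · change ‖-(((2 * δ : ℝ) : ℂ) * I)‖ ≤ _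
    rw [norm_neg, h']; linarith

/-- Cauchy's formula on a rectangle symmetric about the real axis. -/
theorem sum_rectSide_cauchy {l r δ x : ℝ} (hl : l < x) (hr : x < r) (hδ : 0 < δ) {f : ℂ → ℂ}
    (hf : DifferentiableOn ℂ f (Icc l r ×ℂ Icc (-δ) δ)) :
    ∑ j, ∫ t in Icc (0 : ℝ) 1, ((2 * Real.pi * I)⁻¹ * rectVelocity l r δ j *
      f (rectSide l r δ j t)) * (rectSide l r δ j t - x)⁻¹ = f x := by
  have hmem : Icc l r ×ℂ Icc (-δ) δ ∈ 𝓝 (x : ℂ) := by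
    rw [mem_nhds_iff]
    refine ⟨Ioo l r ×ℂ Ioo (-δ) δ, ?_, isOpen_Ioo.reProdIm isOpen_Ioo, ?_⟩
    · intro z hz
      rw [mem_reProdIm] at hz ⊢
      exact ⟨Ioo_subset_Icc_self hz.1, Ioo_subset_Icc_self hz.2⟩
    · rw [mem_reProdIm]
      simp [hl, hr, hδ]
  have h0 := sum_rectSide_eq_zero (g := dslope f x) (by linarith : l ≤ r) hδ.le
    ((differentiableOn_dslope hmem).2 hf)
  have hne : ∀ j t, rectSide l r δ j t - x ≠ 0 := by
    intro j t h
    fin_cases j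
    · have := congrArg Complex.im h
      simp [rectSide] at this
      linarith
    · have := congrArg Complex.re h
      simp [rectSide] at this
      linarith
    · have := congrArg Complex.im h
      simp [rectSide] at this
      linarith
    · have := congrArg Complex.re h
      simp [rectSide] at this
      linarith
  have hcf : ∀ j, ContinuousOn (fun t => f (rectSide l r δ j t)) (Icc 0 1) := fun j =>
    hf.continuousOn.comp (continuous_rectSide l r δ j).continuousOn
      (fun t ht => rectSide_mem (by linarith) hδ.le j ht)
  have hinv : ∀ j, Continuous (fun t => (rectSide l r δ j t - x)⁻¹) := fun j =>
    ((continuous_rectSide l r δ j).sub continuous_const).inv₀ (hne j)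
  have hsplit : ∀ j, ∫ t in Icc (0 : ℝ) 1, rectVelocity l r δ j * dslope f x (rectSide l r δ j t) =
      (∫ t in Icc (0 : ℝ) 1, rectVelocity l r δ j * f (rectSide l r δ j t) *
        (rectSide l r δ j t - x)⁻¹) -
      f x * ∫ t in Icc (0 : ℝ) 1, rectVelocity l r δ j * (rectSide l r δ j t - x)⁻¹ := by
    intro j
    rw [← integral_const_mul, ← integral_sub]
    · refine integral_congr_ae (Eventually.of_forall fun t => ?_)
      simp only
      rw [dslope_of_ne _ (sub_ne_zero.1 (hne j t)), slope_def_field, div_eq_mul_inv]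
      ring
    · exact ((continuousOn_const.mul (hcf j)).mul (hinv j).continuousOn).integrableOn_compact
        isCompact_Icc
    · exact (continuous_const.mul (continuous_const.mul (hinv j))).continuousOn.integrableOn_compact
        isCompact_Icc
  rw [Finset.sum_congr rfl fun j _ => hsplit j, Finset.sum_sub_distrib, ← Finset.mul_sum,
    sum_rectSide_inv hl hr hδ, sub_eq_zero] at h0
  have h2 : (2 * Real.pi * I : ℂ) ≠ 0 := by simp [Real.pi_ne_zero]
  have h3 : ∀ j, ∫ t in Icc (0 : ℝ) 1, ((2 * Real.pi * I)⁻¹ * rectVelocity l r δ j *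
      f (rectSide l r δ j t)) * (rectSide l r δ j t - x)⁻¹ = (2 * Real.pi * I)⁻¹ *
      ∫ t in Icc (0 : ℝ) 1, rectVelocity l r δ j * f (rectSide l r δ j t) *
        (rectSide l r δ j t - x)⁻¹ := by
    intro j
    rw [← integral_const_mul]
    congr 1
    funext t
    ring
  rw [Finset.sum_congr rfl fun j _ => h3 j, ← Finset.mul_sum, h0]
  field_simp

/-- Cauchy's theorem for a real point outside a rectangle. -/
theorem sum_rectSide_cauchy_eq_zero {l r δ x : ℝ} (hlr : l ≤ r) (hx : x ∉ Icc l r) (hδ : 0 ≤ δ)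
    {f : ℂ → ℂ} (hf : DifferentiableOn ℂ f (Icc l r ×ℂ Icc (-δ) δ)) :
    ∑ j, ∫ t in Icc (0 : ℝ) 1, ((2 * Real.pi * I)⁻¹ * rectVelocity l r δ j *
      f (rectSide l r δ j t)) * (rectSide l r δ j t - x)⁻¹ = 0 := by
  have h0 := sum_rectSide_eq_zero (g := fun z => (2 * Real.pi * I)⁻¹ * f z * (z - x)⁻¹) hlr hδ
    (((differentiableOn_const _).mul hf).mul
      ((differentiableOn_id.sub (differentiableOn_const _)).inv fun z hz h => by
        have h1 : z = x := sub_eq_zero.1 h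
        rw [h1, mem_reProdIm] at hz
        exact hx hz.1))
  rw [← h0]
  refine Finset.sum_congr rfl fun j _ => ?_
  congr 1
  funext t
  ring

end Rectangle

/-! ### Partial fractions of the Fermi function and duality -/

section Fermi

open Complex

theorem hasSum_cot {x : ℂ} (hx : x ∈ Complex.integerComplement) :
    HasSum (fun n : ℕ => 1 / (x - (n + 1)) + 1 / (x + (n + 1)))
      (Real.pi * I * (1 + 2 * (exp (2 * Real.pi * I * x) - 1)⁻¹) - 1 / x) := by
  have h1 := (summable_cotTerm hx).hasSum
  have h2 := cot_series_rep' hx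
  have h3 : (∑' n : ℕ, cotTerm x n) = ∑' n : ℕ, (1 / (x - (n + 1)) + 1 / (x + (n + 1))) := rfl
  rw [h3, ← h2, cot_pi_eq_exp_ratio] at h1
  have hne : exp (2 * Real.pi * I * x) - 1 ≠ 0 := by
    intro h
    obtain ⟨n, hn⟩ := exp_eq_one_iff.1 (sub_eq_zero.1 h)
    have h4 : x = n := by
      have : (2 * Real.pi * I : ℂ) ≠ 0 := by simp [Real.pi_ne_zero]
      exact mul_left_cancel₀ this (by rw [hn]; ring)
    exact hx ⟨n, h4.symm⟩
  convert h1 using 1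
  have h5 : I * (1 - exp (2 * Real.pi * I * x)) ≠ 0 := by
    refine mul_ne_zero I_ne_zero ?_
    rw [← neg_sub]
    exact neg_ne_zero.2 hne
  congr 1
  rw [mul_assoc]
  congr 1
  rw [eq_div_iff h5]
  have hJ := inv_mul_cancel₀ hne
  set E := exp (2 * Real.pi * I * x)
  linear_combination (-2 * I ^ 2) * hJ - (1 + E) * I_sq

/-- The partial fraction expansion of the Fermi function. -/
theorem hasSum_fermi {v : ℂ} (hv : v.re ≠ 0 ∨ |v.im| < Real.pi) :
    HasSum (fun k : ℕ => 2 * v / (v ^ 2 + ((2 * k + 1) * Real.pi) ^ 2)) (1 / 2 - (1 + exp v)⁻¹) := by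
  by_cases h0 : v = 0
  · subst h0
    have e : (1 / 2 - (1 + exp (0 : ℂ))⁻¹) = 0 := by rw [exp_zero]; norm_num
    rw [e]
    simp
  -- the sum over odd multiples of `π` is the difference of the cotangent series at `2 x` and at `x`
  set x : ℂ := v / (2 * Real.pi * I) with hx
  have hpi : (Real.pi : ℂ) ≠ 0 := by simp [Real.pi_ne_zero]
  have hvx : v = 2 * Real.pi * I * x := by
    rw [hx]
    field_simp
  have hx0 : x ≠ 0 := fun h => h0 (by rw [hvx, h, mul_zero])
  have hx2 : 2 * x ∈ Complex.integerComplement := by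
    rintro ⟨n, hn⟩
    have h1 : v = ((Real.pi * n : ℝ) : ℂ) * I := by
      rw [hvx]; push_cast; rw [hn]; ring
    have hre : v.re = 0 := by rw [h1]; simp
    have him : v.im = Real.pi * n := by rw [h1]; simp
    rcases hv with h | h
    · exact h hre
    · rw [him, abs_mul, abs_of_pos Real.pi_pos] at h
      have h2 : |(n : ℝ)| < 1 := by
        by_contra h3
        push Not at h3
        nlinarith [Real.pi_pos]
      have h3 : n = 0 := by
        have : |n| < 1 := by exact_mod_cast h2
        exact Int.abs_lt_one_iff.1 this
      rw [h3] at h1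
      exact h0 (by rw [h1]; simp)
  have hx1 : x ∈ Complex.integerComplement := by
    rintro ⟨n, hn⟩
    exact hx2 ⟨2 * n, by rw [← hn]; push_cast; ring⟩
  have H1 := hasSum_cot hx1
  have H2 := (hasSum_cot hx2).mul_left 2
  set a : ℕ → ℂ := fun n => 2 * (1 / (2 * x - (n + 1)) + 1 / (2 * x + (n + 1))) with ha
  have hodd : HasSum (fun k : ℕ => a (2 * k + 1))
      (Real.pi * I * (1 + 2 * (exp (2 * Real.pi * I * x) - 1)⁻¹) - 1 / x) := by
    have e : (fun k : ℕ => a (2 * k + 1)) =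
        fun n : ℕ => 1 / (x - (n + 1)) + 1 / (x + (n + 1)) := by
      funext k
      simp only [ha]
      push_cast
      rw [show 2 * x - (2 * (k : ℂ) + 1 + 1) = 2 * (x - (k + 1)) by ring,
        show 2 * x + (2 * (k : ℂ) + 1 + 1) = 2 * (x + (k + 1)) by ring, one_div, one_div, mul_inv,
        mul_inv]
      ring
    rw [e]
    exact H1
  have hes : Summable (fun k : ℕ => a (2 * k)) :=
    H2.summable.comp_injective (mul_right_injective₀ (by norm_num : (2 : ℕ) ≠ 0))
  have hsum := tsum_even_add_odd hes hodd.summable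
  rw [hodd.tsum_eq, H2.tsum_eq] at hsum
  have heven := hes.hasSum
  rw [eq_sub_of_add_eq hsum] at heven
  have h3 := heven.mul_left (-(I / (2 * Real.pi)))
  have e1 : (fun k : ℕ => 2 * v / (v ^ 2 + ((2 * k + 1) * Real.pi) ^ 2)) =
      fun k : ℕ => -(I / (2 * Real.pi)) * a (2 * k) := by
    funext k
    have hm : 2 * x - (2 * k + 1) ≠ 0 := fun h =>
      hx2 ⟨2 * k + 1, by push_cast; exact (sub_eq_zero.1 h).symm⟩
    have hp : 2 * x + (2 * k + 1) ≠ 0 := fun h =>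
      hx2 ⟨-(2 * k + 1), by push_cast; exact (eq_neg_of_add_eq_zero_left h).symm⟩
    have hd : v ^ 2 + ((2 * k + 1) * Real.pi) ^ 2 =
        -(Real.pi ^ 2 * ((2 * x - (2 * k + 1)) * (2 * x + (2 * k + 1)))) := by
      rw [hvx]
      linear_combination (4 * Real.pi ^ 2 * x ^ 2) * I_sq
    rw [hd]
    simp only [ha]
    push_cast
    rw [hvx]
    field_simp
    ring
  rw [e1]
  have key : (1 / 2 - (1 + exp v)⁻¹ : ℂ) = -(I / (2 * Real.pi)) *
      (2 * (Real.pi * I * (1 + 2 * (exp (2 * Real.pi * I * (2 * x)) - 1)⁻¹) - 1 / (2 * x)) -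
        (Real.pi * I * (1 + 2 * (exp (2 * Real.pi * I * x) - 1)⁻¹) - 1 / x)) := by
    have he2 : exp (2 * Real.pi * I * (2 * x)) = exp v ^ 2 := by
      rw [← exp_nat_mul, hvx]; congr 1; push_cast; ring
    rw [he2, ← hvx]
    have hE1 : exp v - 1 ≠ 0 := by
      intro h
      obtain ⟨n, hn⟩ := exp_eq_one_iff.1 (sub_eq_zero.1 h)
      refine hx1 ⟨n, ?_⟩
      rw [hx, hn]
      field_simp
    have hE2 : 1 + exp v ≠ 0 := by
      intro h
      have h4 : exp (2 * v) = 1 := by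
        rw [two_mul, exp_add, eq_neg_of_add_eq_zero_right h]; norm_num
      obtain ⟨n, hn⟩ := exp_eq_one_iff.1 h4
      refine hx2 ⟨n, ?_⟩
      rw [hx]
      field_simp
      linear_combination (-1 / 2 : ℂ) * hn
    have hE3 : exp v ^ 2 - 1 ≠ 0 := by
      rw [show exp v ^ 2 - 1 = (exp v - 1) * (1 + exp v) by ring]
      exact mul_ne_zero hE1 hE2
    set E := exp v
    have hE3' : E ^ 2 - 1 = (E - 1) * (1 + E) := by ring
    rw [hE3']
    field_simp
    linear_combination ((E - 1) ^ 2 * Real.pi * x) * I_sq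
  rw [key]
  exact h3

theorem hasSum_fermi_real (v : ℝ) :
    HasSum (fun k : ℕ => 2 * v / (v ^ 2 + ((2 * k + 1) * Real.pi) ^ 2))
      (1 / 2 - (1 + Real.exp v)⁻¹) := by
  have h := hasSum_fermi (v := v) (Or.inr (by simpa using Real.pi_pos))
  rw [← Complex.hasSum_ofReal]
  push_cast
  exact h

theorem one_add_exp_ne_zero {v : ℂ} (hv : v.re ≠ 0 ∨ |v.im| < Real.pi) : 1 + exp v ≠ 0 := by
  intro h
  have h1 : exp (v - Real.pi * I) = 1 := by
    rw [exp_sub, exp_pi_mul_I, eq_neg_of_add_eq_zero_right h]; norm_num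
  obtain ⟨n, hn⟩ := exp_eq_one_iff.1 h1
  have h2 : v = (((2 * n + 1) * Real.pi : ℝ) : ℂ) * I := by
    push_cast
    linear_combination hn
  have hre : v.re = 0 := by rw [h2]; simp
  have him : v.im = (2 * n + 1) * Real.pi := by rw [h2]; simp
  rcases hv with h | h
  · exact h hre
  · rw [him, abs_mul, abs_of_pos Real.pi_pos] at h
    have h3 : (1 : ℝ) ≤ |2 * (n : ℝ) + 1| := by
      have : (1 : ℤ) ≤ |2 * n + 1| := Int.one_le_abs (by omega)
      exact_mod_cast this
    nlinarith [Real.pi_pos]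

/-- The complex plane without the two half-lines `ν ± i y`, `y ≥ y₀`. -/
def cutPlane (ν y₀ : ℝ) : Set ℂ := {z | z.re ≠ ν ∨ |z.im| < y₀}

theorem smul_mem_cutPlane {w : ℂ} {β : ℝ} (hβ : 0 < β) (hw : w ∈ cutPlane 0 (Real.pi / β)) {s : ℝ}
    (hs : s ∈ Icc (0 : ℝ) 1) : (β * s * w : ℂ).re ≠ 0 ∨ |(β * s * w : ℂ).im| < Real.pi := by
  have e1 : (β * s * w : ℂ).re = β * s * w.re := by simp [mul_assoc]
  have e2 : (β * s * w : ℂ).im = β * s * w.im := by simp [mul_assoc]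
  rw [e1, e2]
  rcases eq_or_lt_of_le hs.1 with h0 | h0
  · right
    rw [← h0]
    simpa using Real.pi_pos
  · rcases hw with h | h
    · left
      positivity
    · right
      rw [abs_mul, abs_mul, abs_of_pos hβ, abs_of_pos h0]
      rw [lt_div_iff₀ hβ] at h
      have := mul_le_of_le_one_left (mul_nonneg (abs_nonneg w.im) hβ.le) hs.2
      nlinarith

section Duality

variable {ι : Type} [Fintype ι] {c w : ι → ℂ} {E E₁ : ℝ}

/-- A linear functional with vanishing total mass is bounded on the Fermi function by its values on
the Lorentzians `w / (w² + y²)`. -/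
theorem norm_sum_fermi_le {β : ℝ} (hβ : 0 < β) (hw : ∀ i, w i ∈ cutPlane 0 (Real.pi / β))
    (hE : 0 ≤ E) (hc : ∑ i, c i = 0)
    (hk : ∀ y : ℝ, Real.pi / β ≤ y → ‖∑ i, c i * (w i / (w i ^ 2 + y ^ 2))‖ ≤ E / (1 + y ^ 2)) :
    ‖∑ i, c i * (1 + exp (β * w i))⁻¹‖ ≤ E / 2 := by
  have h1 : HasSum (fun k : ℕ => ∑ i, c i * (2 * (β * w i) /
      ((β * w i) ^ 2 + ((2 * k + 1) * Real.pi) ^ 2)))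
      (∑ i, c i * (1 / 2 - (1 + exp (β * w i))⁻¹)) := by
    refine hasSum_sum fun i _ => (hasSum_fermi ?_).mul_left (c i)
    have := smul_mem_cutPlane hβ (hw i) (s := 1) (by simp)
    simpa using this
  have e1 : ∑ i, c i * (1 / 2 - (1 + exp (β * w i))⁻¹) = -∑ i, c i * (1 + exp (β * w i))⁻¹ := by
    simp only [mul_sub, Finset.sum_sub_distrib, ← Finset.sum_mul, hc]
    simp
  have h2 := ((hasSum_fermi_real β).mul_left E)
  have h3 := tsum_of_norm_bounded h2 (f := fun k : ℕ => ∑ i, c i * (2 * (β * w i) /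
      ((β * w i) ^ 2 + ((2 * k + 1) * Real.pi) ^ 2))) fun k => by
    have hy : Real.pi / β ≤ (2 * k + 1) * Real.pi / β := by
      gcongr
      nlinarith [Real.pi_pos, mul_nonneg (Nat.cast_nonneg (α := ℝ) k) Real.pi_pos.le]
    have e2 : ∑ i, c i * (2 * (β * w i) / ((β * w i) ^ 2 + ((2 * k + 1) * Real.pi) ^ 2)) =
        (2 / β : ℂ) * ∑ i, c i * (w i / (w i ^ 2 + ((((2 * k + 1) * Real.pi / β : ℝ) : ℂ)) ^ 2)) := by
      rw [Finset.mul_sum]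
      refine Finset.sum_congr rfl fun i _ => ?_
      have hb : (β : ℂ) ≠ 0 := by exact_mod_cast hβ.ne'
      have e3 : (β * w i) ^ 2 + ((2 * k + 1) * Real.pi) ^ 2 =
          (β : ℂ) ^ 2 * (w i ^ 2 + ((((2 * k + 1) * Real.pi / β : ℝ) : ℂ)) ^ 2) := by
        push_cast
        field_simp
      rw [e3, div_mul_eq_div_div]
      field_simp
    rw [e2, norm_mul]
    refine (mul_le_mul_of_nonneg_left (hk _ hy) (norm_nonneg _)).trans (le_of_eq ?_)
    have e4 : ‖(2 / β : ℂ)‖ = 2 / β := by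
      rw [norm_div, norm_real, Real.norm_eq_abs, abs_of_pos hβ]; norm_num
    rw [e4]
    have : 0 < β ^ 2 + ((2 * k + 1) * Real.pi) ^ 2 := by positivity
    field_simp
  rw [h1.tsum_eq, e1, norm_neg] at h3
  refine h3.trans ?_
  have := Real.exp_pos β
  have h5 : 0 < (1 + Real.exp β)⁻¹ := by positivity
  nlinarith [mul_nonneg hE h5.le]

/-- The analogue for the function `w ↦ 2 w / (1 + exp (β s w))`, whose integral over `s` is the grand
potential function up to a constant. The bound is uniform in `s`, because `s` only moves the poles away from `0`. -/
theorem norm_sum_mul_fermi_le {β : ℝ} (hβ : 0 < β) (hw : ∀ i, w i ∈ cutPlane 0 (Real.pi / β))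
    (hE : 0 ≤ E) (hc : ‖∑ i, c i * w i‖ ≤ E₁)
    (hk : ∀ y : ℝ, Real.pi / β ≤ y → ‖∑ i, c i * (w i ^ 2 / (w i ^ 2 + y ^ 2))‖ ≤ E / (1 + y ^ 2))
    {s : ℝ} (hs : s ∈ Ioc (0 : ℝ) 1) :
    ‖∑ i, c i * (2 * w i * (1 + exp (β * s * w i))⁻¹)‖ ≤ E₁ + E := by
  have hs0 := hs.1
  have h1 : HasSum (fun k : ℕ => ∑ i, c i * (2 * w i) * (2 * (β * s * w i) /
      ((β * s * w i) ^ 2 + ((2 * k + 1) * Real.pi) ^ 2)))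
      (∑ i, c i * (2 * w i) * (1 / 2 - (1 + exp (β * s * w i))⁻¹)) := by
    refine hasSum_sum fun i _ => (hasSum_fermi ?_).mul_left _
    exact smul_mem_cutPlane hβ (hw i) ⟨hs.1.le, hs.2⟩
  have e1 : ∑ i, c i * (2 * w i * (1 + exp (β * s * w i))⁻¹) = (∑ i, c i * w i) -
      ∑ i, c i * (2 * w i) * (1 / 2 - (1 + exp (β * s * w i))⁻¹) := by
    rw [← Finset.sum_sub_distrib]
    refine Finset.sum_congr rfl fun i _ => ?_
    ring
  have h2 := ((hasSum_fermi_real (β * s)).mul_left (2 * E))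
  have h3 := tsum_of_norm_bounded h2 (f := fun k : ℕ => ∑ i, c i * (2 * w i) * (2 * (β * s * w i) /
      ((β * s * w i) ^ 2 + ((2 * k + 1) * Real.pi) ^ 2))) fun k => by
    have hy : Real.pi / β ≤ (2 * k + 1) * Real.pi / (β * s) := by
      have hp := Real.pi_pos
      have h5 : Real.pi ≤ (2 * k + 1) * Real.pi := by
        nlinarith [mul_nonneg (Nat.cast_nonneg (α := ℝ) k) hp.le]
      have h6 : β * s ≤ β := mul_le_of_le_one_right hβ.le hs.2
      exact div_le_div₀ (by positivity) h5 (by positivity) h6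
    have e2 : ∑ i, c i * (2 * w i) * (2 * (β * s * w i) /
        ((β * s * w i) ^ 2 + ((2 * k + 1) * Real.pi) ^ 2)) =
        (4 / (β * s) : ℂ) * ∑ i, c i * (w i ^ 2 /
          (w i ^ 2 + ((((2 * k + 1) * Real.pi / (β * s) : ℝ) : ℂ)) ^ 2)) := by
      rw [Finset.mul_sum]
      refine Finset.sum_congr rfl fun i _ => ?_
      have hb : (β : ℂ) ≠ 0 := by exact_mod_cast hβ.ne'
      have hb' : (s : ℂ) ≠ 0 := by exact_mod_cast hs0.ne'
      have e3 : (β * s * w i) ^ 2 + ((2 * k + 1) * Real.pi) ^ 2 =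
          ((β : ℂ) * s) ^ 2 * (w i ^ 2 + ((((2 * k + 1) * Real.pi / (β * s) : ℝ) : ℂ)) ^ 2) := by
        push_cast
        field_simp
      rw [e3, div_mul_eq_div_div]
      field_simp
      ring
    rw [e2, norm_mul]
    refine (mul_le_mul_of_nonneg_left (hk _ hy) (norm_nonneg _)).trans (le_of_eq ?_)
    have e4 : ‖(4 / (β * s) : ℂ)‖ = 4 / (β * s) := by
      rw [norm_div, norm_mul, norm_real, norm_real, Real.norm_eq_abs, Real.norm_eq_abs,
        abs_of_pos hβ, abs_of_pos hs0]
      norm_num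
    rw [e4]
    have : 0 < (β * s) ^ 2 + ((2 * k + 1) * Real.pi) ^ 2 := by positivity
    field_simp
    ring
  rw [h1.tsum_eq] at h3
  rw [e1]
  refine (norm_sub_le _ _).trans (add_le_add hc (h3.trans ?_))
  have := Real.exp_pos (β * s)
  have h5 : 0 < (1 + Real.exp (β * s))⁻¹ := by positivity
  nlinarith [mul_nonneg hE h5.le]

/-- The Fermi function tends to a step function off the imaginary axis, so the bounds pass to zero
temperature. -/
theorem tendsto_fermi {z : ℂ} (hz : z.re ≠ 0) :
    Tendsto (fun β : ℝ => (1 + exp (β * z))⁻¹) atTop (𝓝 (if z.re < 0 then 1 else 0)) := by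
  have hn : ∀ β : ℝ, ‖exp (β * z)‖ = Real.exp (z.re * β) := fun β => by
    rw [norm_exp]; simp [mul_comm]
  split_ifs with h
  · have h1 : Tendsto (fun β : ℝ => exp (β * z)) atTop (𝓝 0) := by
      rw [tendsto_zero_iff_norm_tendsto_zero]
      simp only [hn]
      exact Real.tendsto_exp_atBot.comp (tendsto_id.const_mul_atTop_of_neg h)
    have h2 := (h1.const_add 1).inv₀ (by norm_num)
    simpa using h2
  · have h0 : 0 < z.re := lt_of_le_of_ne (not_lt.1 h) (Ne.symm hz)
    have h1 : Tendsto (fun β : ℝ => Real.exp (z.re * β) - 1) atTop atTop :=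
      tendsto_atTop_add_const_right _ _
        (Real.tendsto_exp_atTop.comp (tendsto_id.const_mul_atTop h0))
    rw [tendsto_zero_iff_norm_tendsto_zero]
    refine squeeze_zero' (Eventually.of_forall fun β => norm_nonneg _) ?_ h1.inv_tendsto_atTop
    filter_upwards [h1.eventually_gt_atTop 0] with β hβ
    rw [norm_inv]
    refine inv_anti₀ hβ ?_
    have := norm_sub_norm_le (exp (β * z)) (-1)
    rw [hn, norm_neg, norm_one, sub_neg_eq_add, add_comm (exp _) 1] at this
    exact this

theorem norm_sum_step_le (hw : ∀ i, (w i).re ≠ 0) (hE : 0 ≤ E) (hc : ∑ i, c i = 0)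
    (hk : ∀ y : ℝ, 0 < y → ‖∑ i, c i * (w i / (w i ^ 2 + y ^ 2))‖ ≤ E / (1 + y ^ 2)) :
    ‖∑ i, c i * (if (w i).re < 0 then 1 else 0)‖ ≤ E / 2 := by
  have h1 : Tendsto (fun β : ℝ => ‖∑ i, c i * (1 + exp (β * w i))⁻¹‖) atTop
      (𝓝 ‖∑ i, c i * (if (w i).re < 0 then 1 else 0)‖) :=
    (tendsto_finsetSum _ fun i _ => (tendsto_fermi (hw i)).const_mul (c i)).norm
  refine le_of_tendsto h1 ?_
  filter_upwards [eventually_gt_atTop 0] with β hβ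
  exact norm_sum_fermi_le hβ (fun i => Or.inl (hw i)) hE hc
    fun y hy => hk y ((div_pos Real.pi_pos hβ).trans_le hy)

theorem norm_sum_mul_step_le (hw : ∀ i, (w i).re ≠ 0) (hE : 0 ≤ E) (hc : ‖∑ i, c i * w i‖ ≤ E₁)
    (hk : ∀ y : ℝ, 0 < y → ‖∑ i, c i * (w i ^ 2 / (w i ^ 2 + y ^ 2))‖ ≤ E / (1 + y ^ 2)) :
    ‖∑ i, c i * (2 * w i * (if (w i).re < 0 then 1 else 0))‖ ≤ E₁ + E := by
  have h1 : Tendsto (fun β : ℝ => ‖∑ i, c i * (2 * w i * (1 + exp (β * w i))⁻¹)‖) atTop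
      (𝓝 ‖∑ i, c i * (2 * w i * (if (w i).re < 0 then 1 else 0))‖) :=
    (tendsto_finsetSum _ fun i _ =>
      ((tendsto_fermi (hw i)).const_mul (2 * w i)).const_mul (c i)).norm
  refine le_of_tendsto h1 ?_
  filter_upwards [eventually_gt_atTop 0] with β hβ
  have := norm_sum_mul_fermi_le hβ (fun i => Or.inl (hw i)) hE hc
    (fun y hy => hk y ((div_pos Real.pi_pos hβ).trans_le hy)) (s := 1) (by simp)
  simpa using this

end Duality

end Fermi

/-! ### Holomorphic continuation of the observables -/

section Continuation

open Complex MeasureTheory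

theorem isOpen_cutPlane (ν y₀ : ℝ) : IsOpen (cutPlane ν y₀) :=
  (isOpen_ne_fun continuous_re continuous_const).union
    (isOpen_lt continuous_im.abs continuous_const)

/-- The grand potential function as an integral of the Fermi function along a segment, as a function
of `w = z - μ`. -/
def grandPotentialExt (β : ℝ) (w : ℂ) : ℂ :=
  (2 / β * Real.log (1 / 2) : ℝ) + ∫ s in (0 : ℝ)..1, 2 * w * (1 + exp (β * s * w))⁻¹

theorem continuousOn_segment_fermi {β : ℝ} (hβ : 0 < β) :
    ContinuousOn (fun x : ℂ × ℝ => 2 * x.1 * (1 + exp (β * x.2 * x.1))⁻¹)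
      (cutPlane 0 (Real.pi / β) ×ˢ Icc (0 : ℝ) 1) := by
  refine ContinuousOn.mul (by fun_prop) (ContinuousOn.inv₀ (by fun_prop) fun x hx => ?_)
  exact one_add_exp_ne_zero (smul_mem_cutPlane hβ hx.1 hx.2)

theorem intervalIntegrable_segment_fermi {β : ℝ} (hβ : 0 < β) {w : ℂ}
    (hw : w ∈ cutPlane 0 (Real.pi / β)) :
    IntervalIntegrable (fun s : ℝ => 2 * w * (1 + exp (β * s * w))⁻¹) volume 0 1 := by
  refine ContinuousOn.intervalIntegrable ?_
  rw [uIcc_of_le zero_le_one]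
  exact (continuousOn_segment_fermi hβ).comp (f := fun s : ℝ => (w, s)) (by fun_prop)
    fun s hs => ⟨hw, hs⟩

theorem differentiableOn_grandPotentialExt {β : ℝ} (hβ : 0 < β) :
    DifferentiableOn ℂ (grandPotentialExt β) (cutPlane 0 (Real.pi / β)) := by
  intro w₀ hw₀
  obtain ⟨r, hr, hball⟩ := Metric.isOpen_iff.1 (isOpen_cutPlane 0 (Real.pi / β)) w₀ hw₀
  have hsub : Metric.closedBall w₀ (r / 2) ⊆ cutPlane 0 (Real.pi / β) :=
    (Metric.closedBall_subset_ball (by linarith)).trans hball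
  set F' : ℂ → ℝ → ℂ := fun w s => 2 * (1 + exp (β * s * w))⁻¹ +
    2 * w * (-(exp (β * s * w) * (β * s)) / (1 + exp (β * s * w)) ^ 2) with hF'
  have hne : ∀ x ∈ Metric.closedBall w₀ (r / 2) ×ˢ Icc (0 : ℝ) 1,
      1 + exp (β * x.2 * x.1) ≠ 0 := fun x hx =>
    one_add_exp_ne_zero (smul_mem_cutPlane hβ (hsub hx.1) hx.2)
  have hcont : ContinuousOn (fun x : ℂ × ℝ => F' x.1 x.2)
      (Metric.closedBall w₀ (r / 2) ×ˢ Icc (0 : ℝ) 1) := by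
    refine ContinuousOn.add (ContinuousOn.mul (by fun_prop) (ContinuousOn.inv₀ (by fun_prop) hne))
      (ContinuousOn.mul (by fun_prop) (ContinuousOn.div (by fun_prop) (by fun_prop) fun x hx => ?_))
    exact pow_ne_zero 2 (hne x hx)
  obtain ⟨C, hC⟩ := ((isCompact_closedBall w₀ (r / 2)).prod isCompact_Icc).exists_bound_of_continuousOn
    hcont
  have hsu : uIoc (0 : ℝ) 1 ⊆ Icc 0 1 := by
    rw [uIoc_of_le zero_le_one]; exact Ioc_subset_Icc_self
  have hmeas : ∀ (f : ℝ → ℂ), ContinuousOn f (Icc 0 1) →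
      AEStronglyMeasurable f (volume.restrict (uIoc (0 : ℝ) 1)) := fun f hf =>
    (hf.mono hsu).aestronglyMeasurable measurableSet_uIoc
  have h := intervalIntegral.hasDerivAt_integral_of_dominated_loc_of_deriv_le (𝕜 := ℂ)
    (μ := volume) (a := 0) (b := 1) (F := fun (w : ℂ) (s : ℝ) => 2 * w * (1 + exp (β * s * w))⁻¹)
    (F' := F') (x₀ := w₀) (s := Metric.closedBall w₀ (r / 2)) (bound := fun _ => C)
    (Metric.closedBall_mem_nhds _ (by positivity)) ?_ (intervalIntegrable_segment_fermi hβ hw₀)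
    ?_ ?_ (by simp) ?_
  · exact (h.2.const_add _).differentiableAt.differentiableWithinAt
  · filter_upwards [Metric.closedBall_mem_nhds w₀ (show 0 < r / 2 by positivity)] with w hw
    refine hmeas _ ?_
    exact (continuousOn_segment_fermi hβ).comp (f := fun s : ℝ => (w, s)) (by fun_prop)
      fun s hs => ⟨hsub hw, hs⟩
  · refine hmeas _ ?_
    exact hcont.comp (f := fun s : ℝ => (w₀, s)) (by fun_prop)
      fun s hs => ⟨Metric.mem_closedBall_self (by positivity), hs⟩
  · exact Eventually.of_forall fun s hs w hw => hC (w, s) ⟨hw, hsu hs⟩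
  · refine Eventually.of_forall fun s hs w hw => ?_
    have h1 : HasDerivAt (fun w : ℂ => β * s * w) (β * s : ℂ) w := by
      simpa using (hasDerivAt_id w).const_mul (β * s : ℂ)
    have h2 := (h1.cexp.const_add 1).inv (hne (w, s) ⟨hw, hsu hs⟩)
    have h3 : HasDerivAt (fun w : ℂ => 2 * w) 2 w := by
      simpa using (hasDerivAt_id w).const_mul (2 : ℂ)
    exact h3.mul h2

/-- An expression for the grand potential function without a logarithm of a small quantity. -/
theorem grandPotential_eq {β : ℝ≥0∞} (hβ : 0 < β) (hβ' : β ≠ ∞) (μ z : ℝ) :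
    grandPotential β μ z = 2 * (z - μ) -
      2 / β.toReal * Real.log (1 + Real.exp (β.toReal * (z - μ))) := by
  have hb := ENNReal.toReal_pos hβ.ne' hβ'
  unfold grandPotential fermiDirac
  rw [if_neg hβ', if_neg hβ']
  have h1 := Real.exp_pos (β.toReal * (z - μ))
  have h2 : 1 - (1 + Real.exp (β.toReal * (z - μ)))⁻¹ =
      Real.exp (β.toReal * (z - μ)) / (1 + Real.exp (β.toReal * (z - μ))) := by
    field_simp
    ring
  rw [h2, Real.log_div h1.ne' (by positivity), Real.log_exp]
  field_simp

/-- The derivative of the grand potential function is twice the Fermi function, and its value at `μ`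
is the constant in `grandPotentialExt`. -/
theorem grandPotentialExt_ofReal {β : ℝ≥0∞} (hβ : 0 < β) (hβ' : β ≠ ∞) (μ z : ℝ) :
    grandPotentialExt β.toReal (z - μ) = grandPotential β μ z := by
  have hb := ENNReal.toReal_pos hβ.ne' hβ'
  set b := β.toReal with hbdef
  set w := z - μ with hw
  have hd : ∀ s : ℝ, HasDerivAt (fun s : ℝ => 2 * (s * w) - 2 / b * Real.log (1 + Real.exp (b * (s * w))))
      (2 * w * (1 + Real.exp (b * s * w))⁻¹) s := by
    intro s
    have h0 : HasDerivAt (fun s : ℝ => s * w) w s := by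
      simpa using (hasDerivAt_id s).mul_const w
    have hpos : 0 < 1 + Real.exp (b * (s * w)) := by positivity
    have h1 := (h0.const_mul 2).sub ((((h0.const_mul b).exp.const_add 1).log hpos.ne').const_mul (2 / b))
    have key : 2 * w * (1 + Real.exp (b * s * w))⁻¹ =
        2 * w - 2 / b * (Real.exp (b * (s * w)) * (b * w) / (1 + Real.exp (b * (s * w)))) := by
      rw [show b * s * w = b * (s * w) by ring]
      field_simp
      ring
    rw [key]
    exact h1
  have hcont : Continuous (fun s : ℝ => 2 * w * (1 + Real.exp (b * s * w))⁻¹) := by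
    refine Continuous.mul continuous_const (Continuous.inv₀ (by fun_prop) fun s => ?_)
    positivity
  have h2 := intervalIntegral.integral_eq_sub_of_hasDerivAt (a := 0) (b := 1) (fun s _ => hd s)
    (hcont.intervalIntegrable _ _)
  have h3 : ∫ s in (0 : ℝ)..1, 2 * ((w : ℝ) : ℂ) * (1 + exp (b * s * (w : ℝ)))⁻¹ =
      ((∫ s in (0 : ℝ)..1, 2 * w * (1 + Real.exp (b * s * w))⁻¹ : ℝ) : ℂ) := by
    rw [← intervalIntegral.integral_ofReal]
    refine intervalIntegral.integral_congr fun s _ => ?_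
    push_cast
    rfl
  have e1 : ((z : ℂ) - μ) = ((w : ℝ) : ℂ) := by rw [hw]; push_cast; rfl
  rw [e1, grandPotentialExt, h3, h2, grandPotential_eq hβ hβ', ← ofReal_add]
  congr 1
  have h4 : Real.log (1 / 2) = -Real.log 2 := by rw [one_div, Real.log_inv]
  rw [h4]
  simp only [one_mul, zero_mul, mul_zero, Real.exp_zero]
  rw [show (1 : ℝ) + 1 = 2 by norm_num]
  ring

/-- A linear functional with vanishing total mass is bounded on the grand potential function by its
values on the kernels `w² / (w² + y²)` and on `w`. -/
theorem norm_sum_grandPotentialExt_le {ι : Type} [Fintype ι] {c w : ι → ℂ} {E E₁ β : ℝ}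
    (hβ : 0 < β) (hw : ∀ i, w i ∈ cutPlane 0 (Real.pi / β))
    (hE : 0 ≤ E) (hc : ∑ i, c i = 0) (hc1 : ‖∑ i, c i * w i‖ ≤ E₁)
    (hk : ∀ y : ℝ, Real.pi / β ≤ y →
      ‖∑ i, c i * (w i ^ 2 / (w i ^ 2 + y ^ 2))‖ ≤ E / (1 + y ^ 2)) :
    ‖∑ i, c i * grandPotentialExt β (w i)‖ ≤ E₁ + E := by
  have e : ∑ i, c i * grandPotentialExt β (w i) =
      ∫ s in (0 : ℝ)..1, ∑ i, c i * (2 * w i * (1 + exp (β * s * w i))⁻¹) := by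
    rw [intervalIntegral.integral_finsetSum fun i _ =>
      (intervalIntegrable_segment_fermi hβ (hw i)).const_mul (c i)]
    simp only [grandPotentialExt, mul_add, Finset.sum_add_distrib, ← Finset.sum_mul, hc, zero_mul,
      zero_add, intervalIntegral.integral_const_mul]
  rw [e]
  have h := intervalIntegral.norm_integral_le_of_norm_le_const (a := 0) (b := 1) (C := E₁ + E)
    (f := fun s : ℝ => ∑ i, c i * (2 * w i * (1 + exp (β * s * w i))⁻¹)) fun s hs => by
      rw [uIoc_of_le zero_le_one] at hs
      exact norm_sum_mul_fermi_le hβ hw hE hc1 hk hs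
  simpa using h

/-- The observables have a holomorphic continuation to the plane cut along two half-lines, and
linear functionals with vanishing total mass are bounded on it by their values on the kernels
`w / (w² + y²)` and `w² / (w² + y²)`. For `β = ∞` the cut is the line `Re z = ν`, for any `ν`. -/
theorem exists_continuation {β : ℝ≥0∞} {μ ν y₀ : ℝ} {O : ℝ → ℝ} (hβ : 0 < β)
    (hO : O = fermiDirac β μ ∨ O = grandPotential β μ)
    (hν : if β = ∞ then y₀ = 0 else ν = μ ∧ y₀ = Real.pi / β.toReal) :
    ∃ f : ℂ → ℂ, DifferentiableOn ℂ f (cutPlane ν y₀) ∧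
      (∀ (ι : Type) [Fintype ι] (c z : ι → ℂ) (E₁ E : ℝ), (∀ i, z i ∈ cutPlane ν y₀) → 0 ≤ E →
        ∑ i, c i = 0 → ‖∑ i, c i * (z i - ν)‖ ≤ E₁ →
        (∀ y : ℝ, 0 < y → y₀ ≤ y →
          ‖∑ i, c i * ((z i - ν) / ((z i - ν) ^ 2 + y ^ 2))‖ ≤ E / (1 + y ^ 2) ∧
          ‖∑ i, c i * ((z i - ν) ^ 2 / ((z i - ν) ^ 2 + y ^ 2))‖ ≤ E / (1 + y ^ 2)) →
        ‖∑ i, c i * f (z i)‖ ≤ E₁ + (1 + |ν - μ|) * E) ∧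
      (β ≠ ∞ → ∀ x : ℝ, f x = O x) ∧
      (β = ∞ → ∀ x : ℝ, (x < μ ∧ x < ν ∨ μ < x ∧ ν < x) → f x = O x) := by
  by_cases hβ' : β = ∞
  · rw [if_pos hβ'] at hν
    subst hν
    have hcut : ∀ z ∈ cutPlane ν 0, (z - ν).re ≠ 0 := by
      intro z hz
      rcases hz with h | h
      · simpa [sub_eq_zero] using h
      · exact absurd h (not_lt.2 (abs_nonneg _))
    set g : ℂ → ℂ := fun z => if (z - ν).re < 0 then 1 else 0 with hg
    have hgd : DifferentiableOn ℂ g (cutPlane ν 0) := by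
      intro z hz
      have hz' := hcut z hz
      refine DifferentiableAt.differentiableWithinAt ?_
      rcases lt_or_gt_of_ne hz' with h | h
      · refine (differentiableAt_const (1 : ℂ)).congr_of_eventuallyEq ?_
        have : ∀ᶠ x : ℂ in 𝓝 z, (x - (ν : ℂ)).re < 0 :=
          (isOpen_lt (by fun_prop : Continuous fun x : ℂ => (x - ν).re) continuous_const).mem_nhds h
        filter_upwards [this] with x hx
        simp only [hg, if_pos hx]
      · refine (differentiableAt_const (0 : ℂ)).congr_of_eventuallyEq ?_
        have : ∀ᶠ x : ℂ in 𝓝 z, 0 < (x - (ν : ℂ)).re :=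
          (isOpen_lt continuous_const (by fun_prop : Continuous fun x : ℂ => (x - ν).re)).mem_nhds h
        filter_upwards [this] with x hx
        simp only [hg, if_neg (not_lt.2 hx.le)]
    have hgr : ∀ x : ℝ, g x = if x < ν then 1 else 0 := by
      intro x
      simp only [hg, sub_re, ofReal_re, sub_neg]
    rcases hO with rfl | rfl
    · refine ⟨g, hgd, ?_, fun h => absurd hβ' h, fun _ x hx => ?_⟩
      · intro ι _ c z E₁ E hz hE hc hc1 hk
        have h1 := norm_sum_step_le (c := c) (w := fun i => z i - ν) (fun i => hcut _ (hz i)) hE hc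
          fun y hy => (hk y hy hy.le).1
        have h2 := (norm_nonneg _).trans hc1
        have h3 := mul_nonneg (abs_nonneg (ν - μ)) hE
        refine h1.trans ?_
        linarith
      · rw [hgr, fermiDirac, if_pos hβ']
        rcases hx with hx | hx
        · simp [hx.1, hx.2]
        · simp [not_lt.2 hx.1.le, not_lt.2 hx.2.le, hx.1.ne']
    · refine ⟨fun z => 2 * (z - ν) * g z + 2 * (ν - μ) * g z, ?_, ?_, fun h => absurd hβ' h,
        fun _ x hx => ?_⟩
      · exact (DifferentiableOn.mul (by fun_prop) hgd).add
          (DifferentiableOn.mul (by fun_prop) hgd)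
      · intro ι _ c z E₁ E hz hE hc hc1 hk
        have h1 := norm_sum_step_le (c := c) (w := fun i => z i - ν) (fun i => hcut _ (hz i)) hE hc
          fun y hy => (hk y hy hy.le).1
        have h2 := norm_sum_mul_step_le (c := c) (w := fun i => z i - ν) (fun i => hcut _ (hz i)) hE
          hc1 fun y hy => (hk y hy hy.le).2
        have e : ∑ i, c i * (2 * (z i - ν) * g (z i) + 2 * (ν - μ) * g (z i)) =
            ∑ i, c i * (2 * (z i - ν) * g (z i)) + 2 * (ν - μ) * ∑ i, c i * g (z i) := by
          rw [Finset.mul_sum, ← Finset.sum_add_distrib]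
          refine Finset.sum_congr rfl fun i _ => ?_
          ring
        rw [e]
        refine (norm_add_le _ _).trans ?_
        have h3 : ‖(2 * (ν - μ) * ∑ i, c i * g (z i) : ℂ)‖ ≤ 2 * |ν - μ| * (E / 2) := by
          rw [norm_mul, norm_mul, ← ofReal_sub, norm_real, Real.norm_eq_abs]
          have : ‖(2 : ℂ)‖ = 2 := by norm_num
          rw [this]
          exact mul_le_mul_of_nonneg_left h1 (by positivity)
        refine (add_le_add h2 h3).trans (le_of_eq ?_)
        ring
      · simp only [hgr, grandPotential, if_pos hβ']
        rcases hx with hx | hx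
        · simp only [hx.1, hx.2, if_true]
          push_cast
          ring
        · simp [not_lt.2 hx.1.le, not_lt.2 hx.2.le]
  · rw [if_neg hβ'] at hν
    obtain ⟨rfl, rfl⟩ := hν
    have hb := ENNReal.toReal_pos hβ.ne' hβ'
    have hcut : ∀ z ∈ cutPlane ν (Real.pi / β.toReal), z - ν ∈ cutPlane 0 (Real.pi / β.toReal) := by
      intro z hz
      rcases hz with h | h
      · left
        simpa [sub_eq_zero] using h
      · right
        simpa using h
    have hy0 : 0 < Real.pi / β.toReal := div_pos Real.pi_pos hb
    rcases hO with rfl | rfl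
    · refine ⟨fun z => (1 + exp (β.toReal * (z - ν)))⁻¹, ?_, ?_, fun _ x => ?_,
        fun h => absurd h hβ'⟩
      · refine DifferentiableOn.inv (by fun_prop) fun z hz => ?_
        have := one_add_exp_ne_zero (smul_mem_cutPlane hb (hcut z hz) (s := 1) (by simp))
        simpa using this
      · intro ι _ c z E₁ E hz hE hc hc1 hk
        have h1 := norm_sum_fermi_le (c := c) (w := fun i => z i - ν) hb (fun i => hcut _ (hz i)) hE
          hc fun y hy => (hk y (hy0.trans_le hy) hy).1
        have h2 := (norm_nonneg _).trans hc1
        have h3 := mul_nonneg (abs_nonneg (ν - ν)) hE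
        refine h1.trans ?_
        linarith
      · rw [fermiDirac, if_neg hβ']
        push_cast
        rfl
    · refine ⟨fun z => grandPotentialExt β.toReal (z - ν), ?_, ?_, fun _ x => ?_,
        fun h => absurd h hβ'⟩
      · exact (differentiableOn_grandPotentialExt hb).comp (by fun_prop) fun z hz => hcut z hz
      · intro ι _ c z E₁ E hz hE hc hc1 hk
        have h1 := norm_sum_grandPotentialExt_le (c := c) (w := fun i => z i - ν) hb
          (fun i => hcut _ (hz i)) hE hc hc1 fun y hy => (hk y (hy0.trans_le hy) hy).2
        have h3 := mul_nonneg (abs_nonneg (ν - ν)) hE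
        refine h1.trans ?_
        linarith
      · exact grandPotentialExt_ofReal hβ hβ' ν x

end Continuation

/-! ### Growth of Chebyshev polynomials in the complex plane -/

section Chebyshev

open Polynomial Complex

/-- The factorisation of `T_n` over its `n` distinct real zeros. -/
theorem exists_roots_chebyshev (n : ℕ) : ∃ R : Finset ℝ, R.card = n ∧ (∀ c ∈ R, -1 < c ∧ c < 1) ∧
    ∀ w : ℂ, (Chebyshev.T ℂ n).eval w = 2 ^ (n - 1) * ∏ c ∈ R, (w - c) := by
  have hroots := Chebyshev.roots_T_real n
  set R := (Finset.range n).image (fun k : ℕ => Real.cos ((2 * k + 1) * Real.pi / (2 * n))) with hR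
  have hcard : R.card = n := by
    have h1 := Chebyshev.roots_T_real_nodup n
    have h2 : Set.InjOn (fun k : ℕ => Real.cos ((2 * k + 1) * Real.pi / (2 * n)))
        (Finset.range n : Set ℕ) := (Finset.range n).nodup_map_iff_injOn.1 h1
    rw [hR, Finset.card_image_of_injOn h2, Finset.card_range]
  refine ⟨R, hcard, fun c hc => ?_, fun w => ?_⟩
  · have h1 : c ∈ (Chebyshev.T ℝ n).roots := by rw [hroots]; exact hc
    have h2 : (Chebyshev.T ℝ n).eval c = 0 := (mem_roots'.1 h1).2
    rw [← abs_lt]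
    by_contra! h
    have := Chebyshev.one_le_abs_eval_T_real n h
    rw [h2] at this
    norm_num at this
  · have h1 := C_leadingCoeff_mul_prod_multiset_X_sub_C (p := Chebyshev.T ℝ n) (by
      rw [hroots, Chebyshev.natDegree_T]
      simpa using hcard)
    rw [hroots] at h1
    rw [← Chebyshev.map_T (algebraMap ℝ ℂ), ← h1]
    simp only [Chebyshev.leadingCoeff_T, Int.natAbs_natCast, Polynomial.map_mul, eval_mul, map_pow,
      map_ofNat]
    congr 1
    · simp
    · change Polynomial.eval w (Polynomial.map _ (∏ c ∈ R, (X - C c))) = _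
      simp [Polynomial.map_prod, eval_prod]

/-- The image under `cos` of a horizontal line is an ellipse with foci `±1`. -/
theorem norm_cos_sub_one_add (z : ℂ) : ‖cos z - 1‖ + ‖cos z + 1‖ = 2 * Real.cosh z.im := by
  have e0 : z = 2 * (z / 2) := by ring
  have e1 : cos z - 1 = -2 * sin (z / 2) ^ 2 := by
    conv_lhs => rw [e0, cos_two_mul]
    rw [sin_sq]; ring
  have e2 : cos z + 1 = 2 * cos (z / 2) ^ 2 := by
    conv_lhs => rw [e0, cos_two_mul]
    ring
  have hs : ‖sin (z / 2)‖ ^ 2 + ‖cos (z / 2)‖ ^ 2 = Real.cosh z.im := by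
    set x := (z / 2).re
    set y := (z / 2).im with hy
    have h0 : z / 2 = x + y * I := (re_add_im _).symm
    have hz : z.im = 2 * y := by
      rw [hy, div_ofNat_im]; ring
    have hsin : sin (z / 2) = (Real.sin x * Real.cosh y : ℝ) + (Real.cos x * Real.sinh y : ℝ) * I := by
      rw [h0, sin_add, cos_mul_I, sin_mul_I]
      push_cast
      ring
    have hcos : cos (z / 2) = (Real.cos x * Real.cosh y : ℝ) + (-(Real.sin x * Real.sinh y) : ℝ) * I := by
      rw [h0, cos_add, cos_mul_I, sin_mul_I]
      push_cast
      ring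
    rw [hsin, hcos, ← normSq_eq_norm_sq, ← normSq_eq_norm_sq, normSq_add_mul_I, normSq_add_mul_I,
      hz, Real.cosh_two_mul]
    linear_combination (Real.cosh y ^ 2 + Real.sinh y ^ 2) * Real.sin_sq_add_cos_sq x
  rw [e1, e2, norm_mul, norm_mul, norm_pow, norm_pow, ← hs]
  norm_num
  ring

theorem norm_cos_le_exp (z : ℂ) : ‖cos z‖ ≤ Real.exp |z.im| := by
  rw [cos]
  have h1 : ‖exp (z * I)‖ ≤ Real.exp |z.im| := by
    rw [norm_exp]
    exact Real.exp_le_exp.2 (by simpa using neg_le_abs _)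
  have h2 : ‖exp (-z * I)‖ ≤ Real.exp |z.im| := by
    rw [norm_exp]
    exact Real.exp_le_exp.2 (by simpa using le_abs_self _)
  have h3 := norm_add_le (exp (z * I)) (exp (-z * I))
  have h4 : ‖(2 : ℂ)‖ = 2 := by norm_num
  rw [norm_div, h4, div_le_iff₀ (by norm_num)]
  linarith

/-- The level lines of the growth of `T_n` are the ellipses with foci `±1`. -/
theorem exists_norm_eval_chebyshev_le (w : ℂ) : ∃ θ : ℝ, 0 ≤ θ ∧
    2 * Real.cosh θ = ‖w - 1‖ + ‖w + 1‖ ∧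
    ∀ n : ℕ, ‖(Chebyshev.T ℂ n).eval w‖ ≤ Real.exp (n * θ) := by
  obtain ⟨z, rfl⟩ := cos_surjective w
  refine ⟨|z.im|, abs_nonneg _, ?_, fun n => ?_⟩
  · rw [Real.cosh_abs, norm_cos_sub_one_add]
  · rw [Chebyshev.T_complex_cos]
    refine (norm_cos_le_exp _).trans (Real.exp_le_exp.2 (le_of_eq ?_))
    simp [abs_mul]

/-- Growth of `T_n` to the right of `1`. As the zeros of `T_n` are real, only the real part of the
argument matters. -/
theorem le_norm_eval_chebyshev {w : ℂ} {x : ℝ} (hx : 0 ≤ x) (hw : 1 + x ≤ w.re) (n : ℕ) :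
    (1 + Real.sqrt (2 * x)) ^ n / 2 ≤ ‖(Chebyshev.T ℂ n).eval w‖ := by
  obtain ⟨R, -, hR, hT⟩ := exists_roots_chebyshev n
  have h1 : ‖(Chebyshev.T ℂ n).eval ((1 + x : ℝ) : ℂ)‖ ≤ ‖(Chebyshev.T ℂ n).eval w‖ := by
    rw [hT, hT, norm_mul, norm_mul, norm_prod, norm_prod]
    refine mul_le_mul_of_nonneg_left (Finset.prod_le_prod (fun _ _ => norm_nonneg _) fun c hc => ?_)
      (norm_nonneg _)
    rw [← ofReal_sub, norm_real, Real.norm_of_nonneg (by linarith [(hR c hc).2])]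
    refine le_trans ?_ (re_le_norm _)
    simp only [sub_re, ofReal_re]
    linarith
  refine le_trans ?_ h1
  set y := Real.arcosh (1 + x) with hy
  have hc : Real.cosh y = 1 + x := Real.cosh_arcosh (by linarith)
  have hy0 : 0 ≤ y := Real.arcosh_nonneg (by linarith)
  have hs : Real.sqrt (2 * x) ≤ Real.sinh y := by
    rw [Real.sqrt_le_left (Real.sinh_nonneg_iff.2 hy0)]
    nlinarith [Real.sinh_sq y]
  have h2 : (1 + Real.sqrt (2 * x)) ≤ Real.exp y := by
    rw [← Real.cosh_add_sinh, hc]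
    linarith
  have h3 : (Chebyshev.T ℂ n).eval ((1 + x : ℝ) : ℂ) = (Real.cosh (n * y) : ℝ) := by
    rw [← hc, ofReal_cosh, Chebyshev.T_complex_cosh]
    push_cast
    rfl
  rw [h3, norm_real, Real.norm_of_nonneg (Real.cosh_pos _).le]
  calc (1 + Real.sqrt (2 * x)) ^ n / 2 ≤ Real.exp y ^ n / 2 := by
        have := pow_le_pow_left₀ (by positivity) h2 n
        linarith
    _ = Real.exp (n * y) / 2 := by rw [Real.exp_nat_mul]
    _ ≤ _ := by
        rw [Real.cosh_eq]
        linarith [Real.exp_pos (-(n * y))]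

/-- Between a point `w` near `[-1, 1]` and a point `w'` to the right of `1`, `T_n` grows
exponentially; the rate is the square root of the distance of `w'` from `1`. -/
theorem norm_eval_chebyshev_le_near {w w' : ℂ} {x : ℝ} (hx : 0 ≤ x) (hx' : x ≤ 1 / 2)
    (hw : ‖w - 1‖ + ‖w + 1‖ ≤ 2 + x / 8) (hw' : 1 + x ≤ w'.re) (n : ℕ) :
    ‖(Chebyshev.T ℂ n).eval w‖ ≤
      2 * Real.exp (-(n * Real.sqrt (2 * x) / 4)) * ‖(Chebyshev.T ℂ n).eval w'‖ := by
  obtain ⟨θ, hθ, hθw, hT⟩ := exists_norm_eval_chebyshev_le w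
  set r := Real.sqrt (2 * x) with hr
  have hr0 : 0 ≤ r := Real.sqrt_nonneg _
  have hr2 : r ^ 2 = 2 * x := Real.sq_sqrt (by linarith)
  have hr1 : r ≤ 1 := by nlinarith
  have h1 : θ ≤ r / 4 := by
    have hc : 1 + θ ^ 2 / 2 ≤ Real.cosh θ := by
      have e : Real.cosh θ = 1 + 2 * Real.sinh (θ / 2) ^ 2 := by
        rw [show θ = 2 * (θ / 2) by ring, Real.cosh_two_mul, Real.cosh_sq]
        ring_nf
      have := Real.self_le_sinh_iff.2 (show 0 ≤ θ / 2 by linarith)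
      rw [e]
      nlinarith
    refine (pow_le_pow_iff_left₀ hθ (by positivity) two_ne_zero).1 ?_
    nlinarith
  have h2 : Real.exp (r / 2) ≤ 1 + r := by
    have := Real.abs_exp_sub_one_sub_id_le (x := r / 2) (by rw [abs_of_nonneg (by linarith)]; linarith)
    have := (abs_le.1 this).2
    nlinarith
  have h3 := le_norm_eval_chebyshev hx hw' n
  rw [← hr] at h3
  have h4 : Real.exp (n * (r / 2)) ≤ (1 + r) ^ n := by
    rw [Real.exp_nat_mul]
    exact pow_le_pow_left₀ (Real.exp_pos _).le h2 n
  have h5 : Real.exp (n * θ) ≤ Real.exp (-(n * r / 4)) * Real.exp (n * (r / 2)) := by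
    rw [← Real.exp_add]
    refine Real.exp_le_exp.2 ?_
    have : (n : ℝ) * θ ≤ n * (r / 4) := mul_le_mul_of_nonneg_left h1 (Nat.cast_nonneg _)
    linarith
  have h6 := Real.exp_pos (-(n * r / 4))
  calc _ ≤ Real.exp (n * θ) := hT n
    _ ≤ Real.exp (-(n * r / 4)) * (2 * ‖(Chebyshev.T ℂ n).eval w'‖) :=
        h5.trans (mul_le_mul_of_nonneg_left (by linarith) h6.le)
    _ = _ := by ring

/-- A crude comparison of the values of `T_n` inside an ellipse with those to the right of `1`. -/
theorem norm_eval_chebyshev_le_far {w w' : ℂ} {R : ℝ} (hw : ‖w - 1‖ + ‖w + 1‖ ≤ R)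
    (hw' : 1 ≤ w'.re) (n : ℕ) :
    ‖(Chebyshev.T ℂ n).eval w‖ ≤ 2 * R ^ n * ‖(Chebyshev.T ℂ n).eval w'‖ := by
  obtain ⟨θ, hθ, hθw, hT⟩ := exists_norm_eval_chebyshev_le w
  have h1 := le_norm_eval_chebyshev (w := w') (x := 0) le_rfl (by simpa using hw') n
  simp at h1
  have h2 : Real.exp θ ≤ R := by
    refine le_trans ?_ hw
    rw [← hθw, Real.cosh_eq]
    linarith [Real.exp_pos (-θ)]
  calc _ ≤ Real.exp (n * θ) := hT n
    _ = Real.exp θ ^ n := Real.exp_nat_mul _ _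
    _ ≤ R ^ n := pow_le_pow_left₀ (Real.exp_pos _).le h2 n
    _ ≤ R ^ n * (2 * ‖(Chebyshev.T ℂ n).eval w'‖) := by
        refine le_mul_of_one_le_right ?_ (by linarith)
        exact pow_nonneg ((Real.exp_pos _).le.trans h2) _
    _ = _ := by ring

end Chebyshev

/-! ### A quadratic map sending both inner band edges to `1` -/

section Quadratic

open Complex

theorem norm_sq_eq_re_im (z : ℂ) : ‖z‖ ^ 2 = z.re ^ 2 + z.im ^ 2 := by
  rw [← normSq_eq_norm_sq, normSq_apply]
  ring

/-- In a strip of width `δ` around the band `u ≤ 0`, the modulus of `u (u - g)` exceeds its value at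
the real part by at most a multiple of `δ (δ + g)`. -/
theorem norm_mul_sub_le {u : ℂ} {g δ : ℝ} (hg : 0 ≤ g) (hδ : 0 ≤ δ) (hre : u.re ≤ 2 * δ)
    (him : |u.im| ≤ δ) : ‖u * (u - g)‖ ≤ u.re * (u.re - g) + 50 * (δ * (δ + g)) := by
  set ξ := -u.re with hξ
  set B := δ * (δ + g) with hB
  have hB0 : 0 ≤ B := by positivity
  have e0 : u.re * (u.re - g) = ξ * (ξ + g) := by rw [hξ]; ring
  rw [e0]
  have hξ2 : -(2 * δ) ≤ ξ := by rw [hξ]; linarith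
  have hw : -(4 * B) ≤ ξ * (ξ + g) := by
    rcases le_or_gt 0 ξ with h | h
    · have : 0 ≤ ξ * (ξ + g) := by positivity
      linarith
    · rw [hB]
      nlinarith [mul_nonneg hg (by linarith : 0 ≤ ξ + 2 * δ), sq_nonneg ξ, mul_nonneg hδ hg]
  have hv : u.im ^ 2 ≤ δ ^ 2 := by
    rw [← sq_abs]
    exact pow_le_pow_left₀ (abs_nonneg _) him 2
  have hδB : δ ^ 2 ≤ B := by rw [hB]; nlinarith [mul_nonneg hδ hg]
  have hgB : (δ * g) ^ 2 ≤ B ^ 2 := by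
    refine pow_le_pow_left₀ (by positivity) ?_ 2
    rw [hB]; nlinarith
  refine (pow_le_pow_iff_left₀ (norm_nonneg _) (by linarith) two_ne_zero).1 ?_
  rw [norm_mul, mul_pow, norm_sq_eq_re_im, norm_sq_eq_re_im]
  simp only [sub_re, sub_im, ofReal_re, ofReal_im, sub_zero]
  have e : (u.re ^ 2 + u.im ^ 2) * ((u.re - g) ^ 2 + u.im ^ 2) =
      (ξ * (ξ + g)) ^ 2 + u.im ^ 2 * (2 * (ξ * (ξ + g)) + g ^ 2) + u.im ^ 2 * u.im ^ 2 := by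
    rw [hξ]; ring
  rw [e]
  set w := ξ * (ξ + g) with hwdef
  have h0 : 0 ≤ u.im ^ 2 := sq_nonneg _
  have h1 : u.im ^ 2 * u.im ^ 2 ≤ B ^ 2 := by
    rw [sq B]
    exact mul_le_mul (hv.trans hδB) (hv.trans hδB) h0 hB0
  have h2 : u.im ^ 2 * g ^ 2 ≤ B ^ 2 := by
    refine le_trans ?_ hgB
    rw [mul_pow]
    exact mul_le_mul_of_nonneg_right hv (sq_nonneg _)
  have h3 : u.im ^ 2 * (2 * w) ≤ 2 * B * (w + 4 * B) := by
    have h4 : u.im ^ 2 * (2 * (w + 4 * B)) ≤ B * (2 * (w + 4 * B)) :=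
      mul_le_mul_of_nonneg_right (hv.trans hδB) (by linarith)
    have h5 : 0 ≤ u.im ^ 2 * (2 * (4 * B)) := by positivity
    linarith
  have h6 : -(4 * B) * B ≤ w * B := mul_le_mul_of_nonneg_right hw hB0
  nlinarith

/-- The companion of `norm_mul_sub_le` for the distance to the other focus. -/
theorem norm_two_sub_le {u : ℂ} {g δ t κ : ℝ} (hg : 0 ≤ g) (hδ : 0 ≤ δ) (ht : 0 < t)
    (hκ : κ = 2 / (t * (t + g))) (hδt : δ ≤ t / 8)
    (hre' : -(t / 2) ≤ u.re) (hre : u.re ≤ 2 * δ) (him : |u.im| ≤ δ) :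
    ‖2 - κ * (u * (u - g))‖ ≤ 2 - κ * (u.re * (u.re - g)) + κ * (10 * (δ * (δ + g))) := by
  have htg : 0 < t * (t + g) := by positivity
  have hκ0 : 0 < κ := by rw [hκ]; positivity
  have hκ2 : κ * (t * (t + g)) = 2 := by rw [hκ]; field_simp
  set B := δ * (δ + g) with hB
  have hB0 : 0 ≤ B := by positivity
  have hv : u.im ^ 2 ≤ δ ^ 2 := by
    rw [← sq_abs]
    exact pow_le_pow_left₀ (abs_nonneg _) him 2
  have hδB : δ ^ 2 ≤ B := by rw [hB]; nlinarith [mul_nonneg hδ hg]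
  have h0 : 0 ≤ u.im ^ 2 := sq_nonneg _
  set w := u.re * (u.re - g) with hw
  have hw1 : w ≤ t * (t + g) / 2 := by
    rw [hw]
    rcases le_or_gt u.re 0 with h | h
    · nlinarith [mul_nonneg (by linarith : 0 ≤ -u.re) hg, mul_nonneg (by linarith : 0 ≤ -u.re) (by linarith : 0 ≤ t / 2 + u.re)]
    · nlinarith [mul_nonneg h.le hg, mul_nonneg h.le (by linarith : 0 ≤ t / 4 - u.re), mul_nonneg ht.le hg]
  have hA : 1 ≤ 2 - κ * w := by nlinarith [mul_le_mul_of_nonneg_left hw1 hκ0.le]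
  refine (pow_le_pow_iff_left₀ (norm_nonneg _) (by positivity) two_ne_zero).1 ?_
  have e1 : (2 - κ * (u * (u - g))).re = 2 - κ * w + κ * u.im ^ 2 := by
    simp [hw]; ring
  have e2 : (2 - κ * (u * (u - g))).im = -(κ * u.im * (2 * u.re - g)) := by
    simp; ring
  rw [norm_sq_eq_re_im, e1, e2]
  set A := 2 - κ * w with hAdef
  have h4 : κ * (u.im ^ 2 * (2 * u.re - g) ^ 2) ≤ 6 * B := by
    have e3 : (2 * u.re - g) ^ 2 = 4 * w + g ^ 2 := by rw [hw]; ring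
    rw [e3]
    have h5 : κ * (4 * w) ≤ 4 := by linarith
    have h6 : δ ^ 2 * (κ * g ^ 2) ≤ 2 * B := by
      have : κ * (t * g) ≤ 2 := by
        rw [← hκ2]
        exact mul_le_mul_of_nonneg_left (by nlinarith) hκ0.le
      have h7 : κ * (δ * g) ≤ 2 := by
        refine le_trans ?_ this
        exact mul_le_mul_of_nonneg_left (mul_le_mul_of_nonneg_right (by linarith) hg) hκ0.le
      calc δ ^ 2 * (κ * g ^ 2) = (κ * (δ * g)) * (δ * g) := by ring
        _ ≤ 2 * (δ * g) := mul_le_mul_of_nonneg_right h7 (by positivity)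
        _ ≤ 2 * B := by rw [hB]; nlinarith
    have h8 : u.im ^ 2 * (κ * (4 * w)) ≤ u.im ^ 2 * 4 := mul_le_mul_of_nonneg_left h5 h0
    have h9 : u.im ^ 2 * (κ * g ^ 2) ≤ δ ^ 2 * (κ * g ^ 2) :=
      mul_le_mul_of_nonneg_right hv (by positivity)
    nlinarith
  have h10 : κ * u.im ^ 2 ≤ 1 := by
    have : κ * (t * t) ≤ 2 := by
      rw [← hκ2]
      exact mul_le_mul_of_nonneg_left (by nlinarith) hκ0.le
    have h11 : κ * u.im ^ 2 ≤ κ * (t * t / 64) := mul_le_mul_of_nonneg_left (by nlinarith) hκ0.le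
    linarith
  have h12 : κ * u.im ^ 2 ≤ κ * B := mul_le_mul_of_nonneg_left (hv.trans hδB) hκ0.le
  have h13 : (κ * u.im ^ 2) ^ 2 ≤ κ * B := by
    have : 0 ≤ κ * u.im ^ 2 := by positivity
    nlinarith
  have h14 : (κ * u.im * (2 * u.re - g)) ^ 2 ≤ κ * (6 * B) := by
    calc _ = κ * (κ * (u.im ^ 2 * (2 * u.re - g) ^ 2)) := by ring
      _ ≤ _ := mul_le_mul_of_nonneg_left h4 hκ0.le
  have hκB : 0 ≤ κ * B := by positivity
  have h15 : A * (κ * u.im ^ 2) ≤ A * (κ * B) := mul_le_mul_of_nonneg_left h12 (by linarith)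
  have h16 : κ * B ≤ A * (κ * B) := le_mul_of_one_le_left hκB hA
  have h17 : 0 ≤ (κ * B) ^ 2 := sq_nonneg _
  nlinarith

/-- `P ↦ 1 - P` with `P = κ u (u - g)`: close to the inner band edge `u = 0` the image of the band
stays close to `[-1, 1]`. -/
theorem norm_add_norm_two_sub_le {u : ℂ} {g δ t κ : ℝ} (hg : 0 ≤ g) (hδ : 0 ≤ δ) (ht : 0 < t)
    (hκ : κ = 2 / (t * (t + g))) (hδt : δ ≤ t / 8)
    (hre' : -(t / 2) ≤ u.re) (hre : u.re ≤ 2 * δ) (him : |u.im| ≤ δ) :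
    ‖(κ * (u * (u - g)) : ℂ)‖ + ‖2 - κ * (u * (u - g))‖ ≤ 2 + κ * (60 * (δ * (δ + g))) := by
  have hκ0 : 0 < κ := by rw [hκ]; positivity
  have h1 := mul_le_mul_of_nonneg_left (norm_mul_sub_le hg hδ hre him) hκ0.le
  have h2 := norm_two_sub_le hg hδ ht hκ hδt hre' hre him
  rw [norm_mul, norm_real, Real.norm_of_nonneg hκ0.le]
  linarith

end Quadratic

/-! ### Interpolation nodes -/

section Nodes

open Complex

/-- The preimages of the zeros of `T_n` under the quadratic map `1 - κ (z - p) (z - q)`. -/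
theorem exists_chebyshev_nodes {p q t κ : ℝ} (hpq : p ≤ q) (ht : 0 < t)
    (hκ : κ = 2 / (t * (t + (q - p)))) (n : ℕ) :
    ∃ T : Finset ℝ, T.card = 2 * n ∧ (∀ x ∈ T, x ∈ Ioo (p - t) p ∪ Ioo q (q + t)) ∧
      ∃ A : ℝ, 0 < A ∧ ∀ z : ℂ, ∏ x ∈ T, ‖z - x‖ =
        A * ‖(Polynomial.Chebyshev.T ℂ n).eval (1 - κ * ((z - p) * (z - q)))‖ := by
  classical
  obtain ⟨R, hcard, hR, hT⟩ := exists_roots_chebyshev n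
  set g := q - p with hg
  have hg0 : 0 ≤ g := by rw [hg]; linarith
  have hκ0 : 0 < κ := by rw [hκ]; positivity
  have hκi : 1 / κ = t * (t + g) / 2 := by rw [hκ, one_div_div]
  set ρ : ℝ → ℝ := fun c => Real.sqrt (g ^ 2 / 4 + (1 - c) / κ) with hρ
  have hρ2 : ∀ c ∈ R, ρ c ^ 2 = g ^ 2 / 4 + (1 - c) / κ := fun c hc => by
    have := (hR c hc).2
    exact Real.sq_sqrt (add_nonneg (by positivity) (div_nonneg (by linarith) hκ0.le))
  have hlow : ∀ c ∈ R, g / 2 < ρ c := fun c hc => by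
    refine (pow_lt_pow_iff_left₀ (by positivity) (Real.sqrt_nonneg _) two_ne_zero).1 ?_
    rw [hρ2 c hc]
    have := div_pos (show 0 < 1 - c by linarith [(hR c hc).2]) hκ0
    linarith
  have hup : ∀ c ∈ R, ρ c < g / 2 + t := fun c hc => by
    refine (pow_lt_pow_iff_left₀ (Real.sqrt_nonneg _) (by positivity) two_ne_zero).1 ?_
    rw [hρ2 c hc]
    have h1 : (1 - c) / κ < t * (t + g) := by
      have : (1 - c) / κ < 2 / κ := div_lt_div_of_pos_right (by linarith [(hR c hc).1]) hκ0
      have e : 2 / κ = 2 * (1 / κ) := by ring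
      rw [e, hκi] at this
      linarith
    nlinarith
  have hinj : Set.InjOn ρ R := fun c hc c' hc' h => by
    have h1 := hρ2 c hc
    rw [h, hρ2 c' hc'] at h1
    have h2 : (1 - c') / κ = (1 - c) / κ := by linarith
    have h3 : 1 - c' = 1 - c := by
      have := congrArg (· * κ) h2
      simpa [div_mul_cancel₀ _ hκ0.ne'] using this
    linarith
  set m := (p + q) / 2 with hm
  have hinj1 : Set.InjOn (fun c => m + ρ c) R := fun c hc c' hc' h =>
    hinj hc hc' (by simpa using h)
  have hinj2 : Set.InjOn (fun c => m - ρ c) R := fun c hc c' hc' h =>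
    hinj hc hc' (by simpa using h)
  have hdisj : Disjoint (R.image fun c => m + ρ c) (R.image fun c => m - ρ c) := by
    rw [Finset.disjoint_left]
    intro x hx hx'
    obtain ⟨c, hc, rfl⟩ := Finset.mem_image.1 hx
    obtain ⟨c', hc', h⟩ := Finset.mem_image.1 hx'
    have h1 := hlow c hc
    have h2 := hlow c' hc'
    linarith
  refine ⟨(R.image fun c => m + ρ c) ∪ (R.image fun c => m - ρ c), ?_, ?_, ?_⟩
  · rw [Finset.card_union_of_disjoint hdisj, Finset.card_image_of_injOn hinj1,
      Finset.card_image_of_injOn hinj2, hcard, two_mul]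
  · intro x hx
    rcases Finset.mem_union.1 hx with hx | hx
    · obtain ⟨c, hc, rfl⟩ := Finset.mem_image.1 hx
      have h1 := hlow c hc
      have h2 := hup c hc
      right
      constructor <;> linarith
    · obtain ⟨c, hc, rfl⟩ := Finset.mem_image.1 hx
      have h1 := hlow c hc
      have h2 := hup c hc
      left
      constructor <;> linarith
  · refine ⟨((1 / κ) ^ n) * (2 ^ (n - 1))⁻¹, by positivity, fun z => ?_⟩
    rw [Finset.prod_union hdisj, Finset.prod_image hinj1, Finset.prod_image hinj2,
      ← Finset.prod_mul_distrib, hT, norm_mul, norm_prod]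
    have e : ∀ c ∈ R, ‖z - (m + ρ c : ℝ)‖ * ‖z - (m - ρ c : ℝ)‖ =
        (1 / κ) * ‖1 - κ * ((z - p) * (z - q)) - c‖ := by
      intro c hc
      have h2 : ((ρ c : ℝ) : ℂ) ^ 2 = (g : ℂ) ^ 2 / 4 + (1 - c) / κ := by
        rw [← ofReal_pow, hρ2 c hc]
        push_cast
        rfl
      have hκc : (κ : ℂ) ≠ 0 := ofReal_ne_zero.2 hκ0.ne'
      have h3 : (z - (m + ρ c : ℝ)) * (z - (m - ρ c : ℝ)) =
          (-(1 / κ) : ℝ) * (1 - κ * ((z - p) * (z - q)) - c) := by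
        have e1 : (z - (m + ρ c : ℝ)) * (z - (m - ρ c : ℝ)) = (z - m) ^ 2 - (ρ c : ℂ) ^ 2 := by
          push_cast
          ring
        rw [e1, h2, hm, hg]
        push_cast
        field_simp
        ring
      rw [← norm_mul, h3, norm_mul, norm_real, norm_neg, Real.norm_of_nonneg (by positivity)]
    rw [Finset.prod_congr rfl e, Finset.prod_mul_distrib, Finset.prod_const, hcard, norm_pow]
    have h2 : ‖(2 : ℂ)‖ = 2 := by norm_num
    rw [h2]
    field_simp

/-- A weight balancing the two clusters of nodes: `α log |x - a| + (1 - α) log |x - b|` takes equal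
values at `p` and `q`, is increasing to the left of `p` and decreasing to the right of `q`. -/
theorem exists_balancing_weight {a p q b : ℝ} (hap : a < p) (hpq : p ≤ q) (hqb : q < b) :
    ∃ α : ℝ, (1 - α) / (b - p) ≤ α / (p - a) ∧ α / (q - a) ≤ (1 - α) / (b - q) ∧
      α * Real.log (p - a) + (1 - α) * Real.log (b - p) =
        α * Real.log (q - a) + (1 - α) * Real.log (b - q) := by
  rcases hpq.eq_or_lt with rfl | hpq
  · have h1 : 0 < b - a := by linarith
    have h2 : 0 < p - a := by linarith
    have h3 : 0 < b - p := by linarith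
    have h4 : (p - a) / (b - a) / (p - a) = (1 - (p - a) / (b - a)) / (b - p) := by
      field_simp
      ring
    exact ⟨(p - a) / (b - a), h4.ge, h4.le, rfl⟩
  · have h1 : 0 < p - a := by linarith
    have h2 : 0 < b - q := by linarith
    have h3 : 0 < q - a := by linarith
    have h4 : 0 < b - p := by linarith
    set A := Real.log ((q - a) / (p - a)) with hA
    set B := Real.log ((b - p) / (b - q)) with hB
    have hA0 : 0 < A := Real.log_pos (by rw [one_lt_div h1]; linarith)
    have hB0 : 0 < B := Real.log_pos (by rw [one_lt_div h2]; linarith)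
    -- `1 - x⁻¹ ≤ log x ≤ x - 1`, applied to both quotients
    have hA1 : A * (p - a) ≤ q - p := by
      have := Real.log_le_sub_one_of_pos (div_pos h3 h1)
      have h5 := mul_le_mul_of_nonneg_right this h1.le
      have e : ((q - a) / (p - a) - 1) * (p - a) = q - p := by field_simp; ring
      linarith
    have hA2 : q - p ≤ A * (q - a) := by
      have := Real.one_sub_inv_le_log_of_pos (div_pos h3 h1)
      have h5 := mul_le_mul_of_nonneg_right this h3.le
      have e : (1 - ((q - a) / (p - a))⁻¹) * (q - a) = q - p := by field_simp; ring
      linarith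
    have hB1 : B * (b - q) ≤ q - p := by
      have := Real.log_le_sub_one_of_pos (div_pos h4 h2)
      have h5 := mul_le_mul_of_nonneg_right this h2.le
      have e : ((b - p) / (b - q) - 1) * (b - q) = q - p := by field_simp; ring
      linarith
    have hB2 : q - p ≤ B * (b - p) := by
      have := Real.one_sub_inv_le_log_of_pos (div_pos h4 h2)
      have h5 := mul_le_mul_of_nonneg_right this h4.le
      have e : (1 - ((b - p) / (b - q))⁻¹) * (b - p) = q - p := by field_simp; ring
      linarith
    have hAB : 0 < A + B := by positivity
    have e1 : 1 - B / (A + B) = A / (A + B) := by field_simp; ring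
    refine ⟨B / (A + B), ?_, ?_, ?_⟩
    · rw [e1, div_div, div_div, div_le_div_iff₀ (by positivity) (by positivity)]
      nlinarith
    · rw [e1, div_div, div_div, div_le_div_iff₀ (by positivity) (by positivity)]
      nlinarith
    · have eA : A = Real.log (q - a) - Real.log (p - a) := Real.log_div h3.ne' h1.ne'
      have eB : B = Real.log (b - p) - Real.log (b - q) := Real.log_div h4.ne' h2.ne'
      have : B / (A + B) * A = (1 - B / (A + B)) * B := by rw [e1]; ring
      linear_combination -this + (B / (A + B)) * eA - (1 - B / (A + B)) * eB

/-- The second order term in the exponent yields the strict decrease of the clusters away from the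
inner band edges. -/
theorem log_one_sub_le {h : ℝ} (h0 : 0 ≤ h) (h1 : h < 1) : 1 - h ≤ Real.exp (-h - h ^ 2 / 2) := by
  have hs := Real.hasSum_pow_div_log_of_abs_lt_one (x := h) (by rwa [abs_of_nonneg h0])
  have h2 := sum_le_hasSum (Finset.range 2) (fun i _ => by positivity) hs
  simp [Finset.sum_range_succ] at h2
  rw [← Real.exp_log (show 0 < 1 - h by linarith)]
  refine Real.exp_le_exp.2 ?_
  norm_num at h2
  linarith

/-- Both clusters together decrease when one moves from the inner band edge into the band. The
lengths `L`, `M` are the distances of that edge from the clusters, `s` is the distance from the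
edge, and `e` is an error. -/
theorem cluster_pow_le {L M lam D α s e : ℝ} {k k' : ℕ} (hlam : 0 < lam) (hL : lam ≤ L)
    (hM : lam ≤ M) (hLD : L ≤ D) (hα : (1 - α) / M ≤ α / L) (hk : |k - α * (k + k')| ≤ 1)
    (hk' : |k' - (1 - α) * (k + k')| ≤ 1) (hs : 0 ≤ s) (hsL : s ≤ L) (he : 0 ≤ e) :
    (L - s + e) ^ k * (M + s + e) ^ k' ≤
        L ^ k * M ^ k' * Real.exp (e * (k + k') / lam + 2 * D / lam) ∧
      (e < s → (L - s + e) ^ k * (M + s + e) ^ k' ≤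
        L ^ k * M ^ k' * Real.exp (e * (k + k') / lam + 2 * D / lam) *
          Real.exp (-(k * (s - e) ^ 2 / (2 * D ^ 2)))) := by
  have hL0 : 0 < L := hlam.trans_le hL
  have hM0 : 0 < M := hlam.trans_le hM
  have hD0 : 0 < D := hL0.trans_le hLD
  have h1 : M + s + e ≤ M * Real.exp ((s + e) / M) := by
    have := mul_le_mul_of_nonneg_left (Real.add_one_le_exp ((s + e) / M)) hM0.le
    have e1 : M * ((s + e) / M + 1) = M + s + e := by field_simp; ring
    linarith
  have h1' : (M + s + e) ^ k' ≤ M ^ k' * Real.exp (k' * ((s + e) / M)) := by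
    rw [Real.exp_nat_mul, ← mul_pow]
    exact pow_le_pow_left₀ (by positivity) h1 k'
  have hexp : (k : ℝ) * ((e - s) / L) + k' * ((s + e) / M) ≤
      e * (k + k') / lam + 2 * D / lam := by
    have a1 : (k : ℝ) / L ≤ k / lam := div_le_div_of_nonneg_left (Nat.cast_nonneg _) hlam hL
    have a2 : (k' : ℝ) / M ≤ k' / lam := div_le_div_of_nonneg_left (Nat.cast_nonneg _) hlam hM
    have a3 : -(2 / lam) ≤ (k : ℝ) / L - k' / M := by
      have b1 : (α * (k + k') - 1) / L ≤ k / L :=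
        div_le_div_of_nonneg_right (by linarith [(abs_le.1 hk).1]) hL0.le
      have b2 : (k' : ℝ) / M ≤ ((1 - α) * (k + k') + 1) / M :=
        div_le_div_of_nonneg_right (by linarith [(abs_le.1 hk').2]) hM0.le
      have b3 : (1 - α) / M * (k + k') ≤ α / L * (k + k') :=
        mul_le_mul_of_nonneg_right hα (by positivity)
      have b4 : 1 / L ≤ 1 / lam := one_div_le_one_div_of_le hlam hL
      have b5 : 1 / M ≤ 1 / lam := one_div_le_one_div_of_le hlam hM
      have e1 : (α * (k + k') - 1) / L = α / L * (k + k') - 1 / L := by ring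
      have e2 : ((1 - α) * (k + k') + 1) / M = (1 - α) / M * (k + k') + 1 / M := by ring
      have e3 : 2 / lam = 1 / lam + 1 / lam := by ring
      linarith
    have a4 : e * ((k : ℝ) / L + k' / M) ≤ e * ((k + k') / lam) := by
      refine mul_le_mul_of_nonneg_left ?_ he
      rw [add_div]
      linarith
    have a5 : s * -(2 / lam) ≤ s * ((k : ℝ) / L - k' / M) := mul_le_mul_of_nonneg_left a3 hs
    have a6 : s * (2 / lam) ≤ D * (2 / lam) :=
      mul_le_mul_of_nonneg_right (hsL.trans hLD) (by positivity)
    have e4 : (k : ℝ) * ((e - s) / L) + k' * ((s + e) / M) =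
        e * ((k : ℝ) / L + k' / M) - s * ((k : ℝ) / L - k' / M) := by ring
    have e5 : e * (k + k') / lam = e * ((k + k') / lam) := by ring
    have e6 : 2 * D / lam = D * (2 / lam) := by ring
    linarith
  have hLs : 0 ≤ L - s + e := by linarith
  constructor
  · have h2 : L - s + e ≤ L * Real.exp ((e - s) / L) := by
      have := mul_le_mul_of_nonneg_left (Real.add_one_le_exp ((e - s) / L)) hL0.le
      have e1 : L * ((e - s) / L + 1) = L - s + e := by field_simp; ring
      linarith
    have h2' : (L - s + e) ^ k ≤ L ^ k * Real.exp (k * ((e - s) / L)) := by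
      rw [Real.exp_nat_mul, ← mul_pow]
      exact pow_le_pow_left₀ hLs h2 k
    calc _ ≤ (L ^ k * Real.exp (k * ((e - s) / L))) * (M ^ k' * Real.exp (k' * ((s + e) / M))) :=
          mul_le_mul h2' h1' (by positivity) (by positivity)
      _ = L ^ k * M ^ k' * Real.exp (k * ((e - s) / L) + k' * ((s + e) / M)) := by
          rw [Real.exp_add]; ring
      _ ≤ _ := mul_le_mul_of_nonneg_left (Real.exp_le_exp.2 hexp) (by positivity)
  · intro hes
    set h := (s - e) / L with hh
    have hh0 : 0 ≤ h := div_nonneg (by linarith) hL0.le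
    have hh1 : h ≤ 1 := by rw [hh, div_le_one hL0]; linarith
    have h2 : L - s + e ≤ L * Real.exp (-h - h ^ 2 / 2) := by
      have e1 : L - s + e = L * (1 - h) := by rw [hh]; field_simp; ring
      rw [e1]
      refine mul_le_mul_of_nonneg_left ?_ hL0.le
      rcases hh1.eq_or_lt with h3 | h3
      · rw [h3, sub_self]
        exact (Real.exp_pos _).le
      · exact log_one_sub_le hh0 h3
    have h2' : (L - s + e) ^ k ≤ L ^ k * Real.exp (k * (-h - h ^ 2 / 2)) := by
      rw [Real.exp_nat_mul, ← mul_pow]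
      exact pow_le_pow_left₀ hLs h2 k
    have h3 : (s - e) ^ 2 / (2 * D ^ 2) ≤ h ^ 2 / 2 := by
      rw [hh, div_pow, div_div, mul_comm (L ^ 2)]
      refine div_le_div_of_nonneg_left (sq_nonneg _) (by positivity) ?_
      have := pow_le_pow_left₀ hL0.le hLD 2
      linarith
    have h4 : (k : ℝ) * ((s - e) ^ 2 / (2 * D ^ 2)) ≤ k * (h ^ 2 / 2) :=
      mul_le_mul_of_nonneg_left h3 (Nat.cast_nonneg _)
    have h5 : -h = (e - s) / L := by rw [hh]; ring
    calc _ ≤ (L ^ k * Real.exp (k * (-h - h ^ 2 / 2))) *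
          (M ^ k' * Real.exp (k' * ((s + e) / M))) :=
          mul_le_mul h2' h1' (by positivity) (by positivity)
      _ = L ^ k * M ^ k' * Real.exp ((k * ((e - s) / L) + k' * ((s + e) / M)) +
            -(k * (h ^ 2 / 2))) := by
          rw [← h5, mul_mul_mul_comm, ← Real.exp_add]
          congr 2
          ring
      _ ≤ L ^ k * M ^ k' * (Real.exp (e * (k + k') / lam + 2 * D / lam) *
          Real.exp (-(k * (s - e) ^ 2 / (2 * D ^ 2)))) := by
          rw [← Real.exp_add]
          refine mul_le_mul_of_nonneg_left (Real.exp_le_exp.2 ?_) (by positivity)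
          have : (k : ℝ) * (s - e) ^ 2 / (2 * D ^ 2) = k * ((s - e) ^ 2 / (2 * D ^ 2)) := by ring
          linarith
      _ = _ := by ring

/-- In the gap, both clusters together are not smaller than at the band edges, up to a constant
from the rounding of the numbers of nodes. -/
theorem cluster_pow_gap_le {a p q b ν lam D α : ℝ} {k k' : ℕ} (hlam : 0 < lam) (hap : lam ≤ p - a)
    (hqb : lam ≤ b - q) (hbD : b - a ≤ D) (hpν : p ≤ ν) (hνq : ν ≤ q) (hα0 : 0 ≤ α) (hα1 : α ≤ 1)
    (hα : α * Real.log (p - a) + (1 - α) * Real.log (b - p) =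
        α * Real.log (q - a) + (1 - α) * Real.log (b - q))
    (hk : |k - α * (k + k')| ≤ 1) (hk' : |k' - (1 - α) * (k + k')| ≤ 1) :
    (p - a) ^ k * (b - p) ^ k' ≤ (D / lam) ^ 2 * ((ν - a) ^ k * (b - ν) ^ k') ∧
      (q - a) ^ k * (b - q) ^ k' ≤ (D / lam) ^ 2 * ((ν - a) ^ k * (b - ν) ^ k') := by
  have hD : 0 < D := by linarith
  have key : ∀ x ∈ Icc p q, α * Real.log (x - a) + (1 - α) * Real.log (b - x) ≤
      α * Real.log (ν - a) + (1 - α) * Real.log (b - ν) →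
      (x - a) ^ k * (b - x) ^ k' ≤ (D / lam) ^ 2 * ((ν - a) ^ k * (b - ν) ^ k') := by
    intro x hx hφ
    have hlen : ∀ y ∈ Icc p q, lam ≤ y - a ∧ y - a ≤ D ∧ lam ≤ b - y ∧ b - y ≤ D := fun y hy =>
      ⟨by linarith [hy.1], by linarith [hy.2], by linarith [hy.2], by linarith [hy.1]⟩
    obtain ⟨x1, x2, x3, x4⟩ := hlen x hx
    obtain ⟨v1, v2, v3, v4⟩ := hlen ν ⟨hpν, hνq⟩
    have hlog : ∀ y z : ℝ, lam ≤ y → y ≤ D → lam ≤ z → z ≤ D →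
        |Real.log y - Real.log z| ≤ Real.log (D / lam) := by
      intro y z hy hy' hz hz'
      rw [Real.log_div hD.ne' hlam.ne', abs_le]
      have a1 := Real.log_le_log hlam hy
      have a2 := Real.log_le_log hlam hz
      have a3 := Real.log_le_log (hlam.trans_le hy) hy'
      have a4 := Real.log_le_log (hlam.trans_le hz) hz'
      constructor <;> linarith
    have l1 := hlog _ _ x1 x2 v1 v2
    have l2 := hlog _ _ x3 x4 v3 v4
    have m1 : (k - α * (k + k')) * (Real.log (x - a) - Real.log (ν - a)) ≤ Real.log (D / lam) := by
      refine (le_abs_self _).trans ?_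
      rw [abs_mul]
      calc _ ≤ 1 * Real.log (D / lam) := mul_le_mul hk l1 (abs_nonneg _) zero_le_one
        _ = _ := one_mul _
    have m2 : (k' - (1 - α) * (k + k')) * (Real.log (b - x) - Real.log (b - ν)) ≤
        Real.log (D / lam) := by
      refine (le_abs_self _).trans ?_
      rw [abs_mul]
      calc _ ≤ 1 * Real.log (D / lam) := mul_le_mul hk' l2 (abs_nonneg _) zero_le_one
        _ = _ := one_mul _
    have m3 := mul_le_mul_of_nonneg_left hφ (show (0 : ℝ) ≤ k + k' by positivity)
    have px : 0 < x - a := hlam.trans_le x1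
    have px' : 0 < b - x := hlam.trans_le x3
    have pv : 0 < ν - a := hlam.trans_le v1
    have pv' : 0 < b - ν := hlam.trans_le v3
    have hDl : 0 < D / lam := by positivity
    refine (Real.log_le_log_iff (by positivity) (by positivity)).1 ?_
    rw [Real.log_mul (by positivity) (by positivity), Real.log_mul (by positivity) (by positivity),
      Real.log_mul (by positivity) (by positivity), Real.log_pow, Real.log_pow, Real.log_pow,
      Real.log_pow, Real.log_pow]
    push_cast
    nlinarith
  have hconc : α * Real.log (p - a) + (1 - α) * Real.log (b - p) ≤
      α * Real.log (ν - a) + (1 - α) * Real.log (b - ν) := by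
    rcases hpν.eq_or_lt with rfl | h1
    · rfl
    have hpq : 0 < q - p := by linarith
    set w := (ν - p) / (q - p) with hw
    have hw0 : 0 ≤ w := div_nonneg (by linarith) hpq.le
    have hw1 : 0 ≤ 1 - w := by rw [hw, sub_nonneg, div_le_one hpq]; linarith
    have hν : ν = (1 - w) * p + w * q := by rw [hw]; field_simp; ring
    have hc := strictConcaveOn_log_Ioi.concaveOn
    have c1 := hc.2 (x := p - a) (y := q - a) (by simp; linarith) (by simp; linarith) hw1 hw0
      (by ring)
    have c2 := hc.2 (x := b - p) (y := b - q) (by simp; linarith) (by simp; linarith) hw1 hw0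
      (by ring)
    simp only [smul_eq_mul] at c1 c2
    have e1 : (1 - w) * (p - a) + w * (q - a) = ν - a := by rw [hν]; ring
    have e2 : (1 - w) * (b - p) + w * (b - q) = b - ν := by rw [hν]; ring
    rw [e1] at c1
    rw [e2] at c2
    have c3 := mul_le_mul_of_nonneg_left c1 hα0
    have c4 := mul_le_mul_of_nonneg_left c2 (sub_nonneg.2 hα1)
    linear_combination c3 + c4 + w * hα
  exact ⟨key p ⟨le_rfl, hpν.trans hνq⟩ hconc, key q ⟨hpν.trans hνq, le_rfl⟩ (hα ▸ hconc)⟩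

end Nodes

/-! ### Decay of the nodal polynomial -/

section Nodes

open Complex

/-- The gain of the clusters of nodes in the part of the bands away from the inner edges. -/
def clusterGain (lam D : ℝ) : ℝ := lam ^ 2 / (512 * D ^ 2)

/-- A bound for the growth of the Chebyshev factor over the whole bands. -/
def chebyshevGrowth (lam D : ℝ) : ℝ := 2 + 96 * D ^ 2 / lam ^ 2

/-- The proportion of nodes in the Chebyshev factor; it is so small that the clusters dominate away
from the inner band edges. -/
def nodeRatio (lam D : ℝ) : ℝ := clusterGain lam D * lam / (8 * D * chebyshevGrowth lam D)

theorem clusterGain_pos {lam D : ℝ} (hlam : 0 < lam) (hD : lam ≤ D) : 0 < clusterGain lam D := by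
  have : 0 < D := hlam.trans_le hD
  unfold clusterGain
  positivity

theorem clusterGain_le {lam D : ℝ} (hlam : 0 < lam) (hD : lam ≤ D) :
    clusterGain lam D ≤ 1 / 512 := by
  have : 0 < D := hlam.trans_le hD
  unfold clusterGain
  rw [div_le_div_iff₀ (by positivity) (by norm_num)]
  nlinarith [pow_le_pow_left₀ hlam.le hD 2]

theorem two_le_chebyshevGrowth {lam D : ℝ} : 2 ≤ chebyshevGrowth lam D := by
  unfold chebyshevGrowth
  have : 0 ≤ 96 * D ^ 2 / lam ^ 2 := by positivity
  linarith

theorem nodeRatio_pos {lam D : ℝ} (hlam : 0 < lam) (hD : lam ≤ D) : 0 < nodeRatio lam D := by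
  have h1 : 0 < D := hlam.trans_le hD
  have h2 := clusterGain_pos hlam hD
  have h3 := two_le_chebyshevGrowth (lam := lam) (D := D)
  unfold nodeRatio
  positivity

theorem nodeRatio_mul {lam D : ℝ} (hlam : 0 < lam) (hD : lam ≤ D) :
    nodeRatio lam D * chebyshevGrowth lam D = clusterGain lam D * (lam / D) / 8 := by
  have h1 : 0 < D := hlam.trans_le hD
  have h3 := two_le_chebyshevGrowth (lam := lam) (D := D)
  unfold nodeRatio
  field_simp

theorem nodeRatio_le {lam D : ℝ} (hlam : 0 < lam) (hD : lam ≤ D) :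
    nodeRatio lam D ≤ clusterGain lam D / 16 := by
  have h1 : 0 < D := hlam.trans_le hD
  have h2 := clusterGain_pos hlam hD
  have h3 := two_le_chebyshevGrowth (lam := lam) (D := D)
  have h4 := nodeRatio_mul hlam hD
  have h5 := nodeRatio_pos hlam hD
  have h6 : lam / D ≤ 1 := (div_le_one h1).2 hD
  have h7 : clusterGain lam D * (lam / D) ≤ clusterGain lam D * 1 :=
    mul_le_mul_of_nonneg_left h6 h2.le
  nlinarith

set_option maxHeartbeats 1000000 in
/-- The decay of the nodal polynomial along one band. In terms of the local coordinate `u`, the band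
is to the left of `0`, the gap has length `g`, and the outer parts of the nodal polynomial are
bounded by the two powers. -/
theorem band_ratio {lam D L M s g t κ θ δ S α : ℝ} {n k k' N : ℕ} {u w' : ℂ} (hlam : 0 < lam)
    (hL : lam ≤ L) (hM : lam ≤ M) (hLg : L + g ≤ D) (hg : 0 ≤ g) (ht : t = lam / 2)
    (hκ : κ = 2 / (t * (t + g))) (hs : 0 ≤ s) (hsL : s ≤ L) (hδ : 0 ≤ δ) (hS : 0 < S)
    (hS' : S ≤ lam / 4) (hδS : δ ≤ nodeRatio lam D * lam / (480 * D) * S)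
    (hδg : δ * (δ + g) ≤ nodeRatio lam D * lam / (480 * D) * S ^ 2)
    (hθ0 : 0 ≤ θ) (hθ : θ * (N + 1) = lam / 32)
    (hn : n ≤ nodeRatio lam D * (N + 1)) (hn' : nodeRatio lam D * (N + 1) - 1 ≤ n)
    (hN : 2 * n + k + k' = N + 1)
    (hαD : lam / D ≤ α) (hα : (1 - α) / M ≤ α / L) (hk : |k - α * (k + k')| ≤ 1)
    (hk' : |k' - (1 - α) * (k + k')| ≤ 1) (hure : |u.re + s| ≤ 2 * δ) (huim : |u.im| ≤ δ)
    (hw' : 1 + κ * S ^ 2 ≤ w'.re) :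
    ‖(Polynomial.Chebyshev.T ℂ n).eval (1 - κ * (u * (u - g)))‖ *
        ((L - s + (3 * δ + θ)) ^ k * (M + s + (3 * δ + θ)) ^ k') ≤
      2 * Real.exp (2 + 2 * D / lam) * Real.exp (-(nodeRatio lam D / (4 * D) * S * N)) *
        (‖(Polynomial.Chebyshev.T ℂ n).eval w'‖ * (L ^ k * M ^ k')) := by
  have hLD : L ≤ D := by linarith
  have hlD : lam ≤ D := hL.trans hLD
  have hD : 0 < D := hlam.trans_le hlD
  set ε := nodeRatio lam D with hε
  set G := clusterGain lam D with hG
  set R := chebyshevGrowth lam D with hR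
  have hε0 : 0 < ε := nodeRatio_pos hlam hlD
  have hεG : ε ≤ G / 16 := nodeRatio_le hlam hlD
  have hG0 : 0 < G := clusterGain_pos hlam hlD
  have hG1 : G ≤ 1 / 512 := clusterGain_le hlam hlD
  have hR2 : 2 ≤ R := two_le_chebyshevGrowth
  have hεR : ε * R = G * (lam / D) / 8 := nodeRatio_mul hlam hlD
  have hlD1 : lam / D ≤ 1 := (div_le_one hD).2 hlD
  have hlD0 : 0 < lam / D := by positivity
  have ht0 : 0 < t := by rw [ht]; linarith
  have hκ0 : 0 < κ := by rw [hκ]; positivity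
  have hε1 : ε * lam / (480 * D) ≤ 1 / 480 := by
    have e1 : ε * lam / (480 * D) = ε * (lam / D) / 480 := by field_simp
    have : ε * (lam / D) ≤ 1 * 1 := mul_le_mul (by linarith) hlD1 hlD0.le zero_le_one
    rw [e1]
    linarith
  have hδS' : δ ≤ S / 480 := by
    have := mul_le_mul_of_nonneg_right hε1 hS.le
    linarith
  have hN1 : (2 * n + k + k' : ℝ) = N + 1 := by exact_mod_cast hN
  have hN0 : (0 : ℝ) ≤ N := Nat.cast_nonneg N
  have hθl : θ ≤ lam / 32 := by
    have : θ ≤ θ * (N + 1) := le_mul_of_one_le_right hθ0 (by linarith)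
    linarith
  set e := 3 * δ + θ with he
  have he0 : 0 ≤ e := by positivity
  have hK : (k + k' : ℝ) ≤ N + 1 := by
    have : (0 : ℝ) ≤ n := Nat.cast_nonneg n
    linarith
  -- the contribution of the error `e` to the exponent
  have heK : e * (k + k') / lam ≤ ε / (160 * D) * S * (N + 1) + 1 / 32 := by
    have a1 : e * (k + k') ≤ e * (N + 1) := mul_le_mul_of_nonneg_left hK he0
    have a2 : e * (N + 1) ≤ (ε / (160 * D) * S * (N + 1) + 1 / 32) * lam := by
      have a3 : 3 * δ * (N + 1) ≤ 3 * (ε * lam / (480 * D) * S) * (N + 1) :=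
        mul_le_mul_of_nonneg_right (by linarith) (by positivity)
      have e1 : 3 * (ε * lam / (480 * D) * S) * (N + 1) = ε / (160 * D) * S * (N + 1) * lam := by
        field_simp
        norm_num
      have e2 : e * (N + 1) = 3 * δ * (N + 1) + θ * (N + 1) := by rw [he]; ring
      linarith
    rw [div_le_iff₀ hlam]
    exact a1.trans a2
  have hcl := cluster_pow_le hlam hL hM hLD hα hk hk' hs hsL he0
  have hTw' := norm_nonneg ((Polynomial.Chebyshev.T ℂ n).eval w')
  have hP1 : ‖(1 - κ * (u * (u - g)) : ℂ) - 1‖ = ‖(κ * (u * (u - g)) : ℂ)‖ := by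
    rw [← norm_neg]
    congr 1
    ring
  have hP2 : ‖(1 - κ * (u * (u - g)) : ℂ) + 1‖ = ‖(2 - κ * (u * (u - g)) : ℂ)‖ := by
    congr 1
    ring
  have hSD : S / D ≤ 1 / 4 := by
    rw [div_le_iff₀ hD]
    linarith
  have hpow : 0 ≤ (L - s + e) ^ k * (M + s + e) ^ k' :=
    mul_nonneg (pow_nonneg (by linarith) _) (pow_nonneg (by linarith) _)
  have hLM : 0 ≤ L ^ k * M ^ k' :=
    mul_nonneg (pow_nonneg (by linarith) _) (pow_nonneg (by linarith) _)
  have hre := abs_le.1 hure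
  have hSc : ε / (4 * D) * S * N ≤ ε / (4 * D) * S * (N + 1) :=
    mul_le_mul_of_nonneg_left (by linarith) (by positivity)
  rcases le_or_gt s (t / 4) with hst | hst
  · -- near the inner edge the Chebyshev factor decays
    have h1 : ‖(1 - κ * (u * (u - g)) : ℂ) - 1‖ + ‖(1 - κ * (u * (u - g)) : ℂ) + 1‖ ≤
        2 + κ * S ^ 2 / 8 := by
      rw [hP1, hP2]
      have h2 := norm_add_norm_two_sub_le (u := u) hg hδ ht0 hκ (by linarith) (by linarith)
        (by linarith) huim
      have h3 : δ * (δ + g) ≤ S ^ 2 / 480 := by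
        have := mul_le_mul_of_nonneg_right hε1 (sq_nonneg S)
        linarith
      have h4 : κ * (60 * (δ * (δ + g))) ≤ κ * (60 * (S ^ 2 / 480)) :=
        mul_le_mul_of_nonneg_left (by linarith) hκ0.le
      linarith
    have hx : κ * S ^ 2 ≤ 1 / 2 := by
      rw [hκ, div_mul_eq_mul_div, div_le_iff₀ (by positivity)]
      have a1 : S ^ 2 ≤ (t / 2) ^ 2 := pow_le_pow_left₀ hS.le (by linarith) 2
      have a2 := mul_nonneg ht0.le hg
      linarith
    have h5 := norm_eval_chebyshev_le_near (by positivity) hx h1 hw' n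
    set r := Real.sqrt (2 * (κ * S ^ 2)) with hr
    -- the growth rate of the Chebyshev polynomial is at least a multiple of `S`
    have hrS : 2 * (S / D) ≤ r := by
      refine Real.le_sqrt_of_sq_le ?_
      have h6 : t * (t + g) ≤ D ^ 2 := by
        rw [sq]
        exact mul_le_mul (by linarith) (by linarith) (by positivity) hD.le
      have h7 : 2 / D ^ 2 ≤ κ := by
        rw [hκ]
        exact div_le_div_of_nonneg_left (by norm_num) (by positivity) h6
      have h8 := mul_le_mul_of_nonneg_right h7 (sq_nonneg S)
      have e1 : (2 * (S / D)) ^ 2 = 2 * (2 / D ^ 2 * S ^ 2) := by ring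
      rw [e1]
      linarith
    have hnr : (ε * (N + 1) - 1) * (S / D / 2) ≤ n * r / 4 := by
      have a1 : (ε * (N + 1) - 1) * (S / D / 2) ≤ n * (S / D / 2) :=
        mul_le_mul_of_nonneg_right hn' (by positivity)
      have a2 : (n : ℝ) * (2 * (S / D)) ≤ n * r := mul_le_mul_of_nonneg_left hrS (Nat.cast_nonneg n)
      linarith
    calc _ ≤ (2 * Real.exp (-(n * r / 4)) * ‖(Polynomial.Chebyshev.T ℂ n).eval w'‖) *
          (L ^ k * M ^ k' * Real.exp (e * (k + k') / lam + 2 * D / lam)) :=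
          mul_le_mul h5 hcl.1 hpow (by positivity)
      _ = 2 * Real.exp (-(n * r / 4) + (e * (k + k') / lam + 2 * D / lam)) *
          (‖(Polynomial.Chebyshev.T ℂ n).eval w'‖ * (L ^ k * M ^ k')) := by
          rw [Real.exp_add (-(n * r / 4))]; ring
      _ ≤ 2 * (Real.exp (2 + 2 * D / lam) * Real.exp (-(ε / (4 * D) * S * N))) *
          (‖(Polynomial.Chebyshev.T ℂ n).eval w'‖ * (L ^ k * M ^ k')) := by
          refine mul_le_mul_of_nonneg_right (mul_le_mul_of_nonneg_left ?_ two_pos.le)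
            (mul_nonneg hTw' hLM)
          rw [← Real.exp_add]
          refine Real.exp_le_exp.2 ?_
          have e1 : (ε * (N + 1) - 1) * (S / D / 2) = 2 * (ε / (4 * D) * S * (N + 1)) - S / D / 2 := by
            field_simp
            ring
          have e2 : ε / (160 * D) * S * (N + 1) = (ε / (4 * D) * S * (N + 1)) / 40 := by
            field_simp
            ring
          have : 0 ≤ ε / (4 * D) * S * (N + 1) := by positivity
          linarith
      _ = _ := by ring
  · -- away from the inner edge the clusters beat the growth of the Chebyshev factor
    have hδD : 3 * δ ≤ D := by linarith
    have hu : ‖u‖ ≤ 2 * D := by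
      have a1 := Complex.norm_le_abs_re_add_abs_im u
      have a2 : |u.re| ≤ s + 2 * δ := by rw [abs_le]; constructor <;> linarith
      linarith
    have hug : ‖u - g‖ ≤ 3 * D := by
      have a1 := norm_sub_le u (g : ℂ)
      rw [norm_real, Real.norm_of_nonneg hg] at a1
      linarith
    have hP : ‖(κ * (u * (u - g)) : ℂ)‖ ≤ 48 * D ^ 2 / lam ^ 2 := by
      rw [norm_mul, norm_mul, norm_real, Real.norm_of_nonneg hκ0.le]
      have a1 : ‖u‖ * ‖u - g‖ ≤ 2 * D * (3 * D) :=
        mul_le_mul hu hug (norm_nonneg _) (by positivity)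
      have a2 : κ ≤ 8 / lam ^ 2 := by
        rw [hκ, ht, div_le_div_iff₀ (by positivity) (by positivity)]
        have := mul_nonneg hlam.le hg
        linarith
      calc _ ≤ 8 / lam ^ 2 * (2 * D * (3 * D)) := mul_le_mul a2 a1 (by positivity) (by positivity)
        _ = _ := by ring
    have h1 : ‖(1 - κ * (u * (u - g)) : ℂ) - 1‖ + ‖(1 - κ * (u * (u - g)) : ℂ) + 1‖ ≤ R := by
      rw [hP1, hP2]
      have a1 := norm_sub_le (2 : ℂ) (κ * (u * (u - g)) : ℂ)
      have a2 : ‖(2 : ℂ)‖ = 2 := by norm_num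
      rw [hR, chebyshevGrowth]
      have e1 : 96 * D ^ 2 / lam ^ 2 = 2 * (48 * D ^ 2 / lam ^ 2) := by ring
      linarith
    have hw1 : 1 ≤ w'.re := by
      have : 0 ≤ κ * S ^ 2 := by positivity
      linarith
    have h5 := norm_eval_chebyshev_le_far h1 hw1 n
    -- by the choice of `nodeRatio`, the Chebyshev factor grows by less than the clusters gain
    have hRn : R ^ n ≤ Real.exp (G * (lam / D) / 8 * (N + 1)) := by
      calc R ^ n ≤ Real.exp R ^ n :=
            pow_le_pow_left₀ (by linarith) (by linarith [Real.add_one_le_exp R]) n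
        _ = Real.exp (n * R) := (Real.exp_nat_mul _ _).symm
        _ ≤ _ := by
            refine Real.exp_le_exp.2 ?_
            have := mul_le_mul_of_nonneg_right hn (by linarith : (0 : ℝ) ≤ R)
            rw [← hεR]
            linarith
    have hes : e ≤ lam / 16 := by rw [he]; linarith
    -- at least a fixed proportion of the nodes is in the near cluster
    have hk2 : lam / D * ((N + 1) / 2) - 1 ≤ k := by
      have a1 : (N + 1 : ℝ) / 2 ≤ k + k' := by
        have : ε * (N + 1) ≤ 1 / 4 * (N + 1) :=
          mul_le_mul_of_nonneg_right (by linarith) (by linarith)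
        linarith
      have a2 : lam / D * ((N + 1) / 2) ≤ α * (k + k') :=
        mul_le_mul hαD a1 (by linarith) (hlD0.le.trans hαD)
      linarith [(abs_le.1 hk).1]
    have hgain : G * (lam / D * ((N + 1) / 2) - 1) ≤ k * (s - e) ^ 2 / (2 * D ^ 2) := by
      have a1 : (lam / 16) ^ 2 ≤ (s - e) ^ 2 := pow_le_pow_left₀ (by linarith) (by linarith) 2
      have a2 : G ≤ (s - e) ^ 2 / (2 * D ^ 2) := by
        have e1 : G = (lam / 16) ^ 2 / (2 * D ^ 2) := by
          rw [hG, clusterGain]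
          field_simp
          norm_num
        rw [e1]
        exact div_le_div_of_nonneg_right a1 (by positivity)
      calc _ ≤ G * k := mul_le_mul_of_nonneg_left hk2 hG0.le
        _ ≤ (s - e) ^ 2 / (2 * D ^ 2) * k := mul_le_mul_of_nonneg_right a2 (Nat.cast_nonneg k)
        _ = _ := by ring
    have hcl2 := hcl.2 (by linarith)
    calc _ ≤ (2 * R ^ n * ‖(Polynomial.Chebyshev.T ℂ n).eval w'‖) *
          (L ^ k * M ^ k' * Real.exp (e * (k + k') / lam + 2 * D / lam) *
          Real.exp (-(k * (s - e) ^ 2 / (2 * D ^ 2)))) :=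
          mul_le_mul h5 hcl2 hpow (by positivity)
      _ = 2 * (R ^ n * Real.exp (e * (k + k') / lam + 2 * D / lam) *
          Real.exp (-(k * (s - e) ^ 2 / (2 * D ^ 2)))) *
          (‖(Polynomial.Chebyshev.T ℂ n).eval w'‖ * (L ^ k * M ^ k')) := by ring
      _ ≤ 2 * (Real.exp (2 + 2 * D / lam) * Real.exp (-(ε / (4 * D) * S * N))) *
          (‖(Polynomial.Chebyshev.T ℂ n).eval w'‖ * (L ^ k * M ^ k')) := by
          refine mul_le_mul_of_nonneg_right (mul_le_mul_of_nonneg_left ?_ two_pos.le)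
            (mul_nonneg hTw' hLM)
          refine (mul_le_mul_of_nonneg_right (mul_le_mul_of_nonneg_right hRn (Real.exp_pos _).le)
            (Real.exp_pos _).le).trans ?_
          rw [← Real.exp_add, ← Real.exp_add, ← Real.exp_add]
          refine Real.exp_le_exp.2 ?_
          set Y := lam / D * (N + 1) with hY
          have hY0 : 0 ≤ Y := by positivity
          have a1 : ε / (4 * D) * S * (N + 1) ≤ G * Y / 16 := by
            have b1 : S / D ≤ lam / D := div_le_div_of_nonneg_right (by linarith) hD.le
            have b2 : ε / 4 * (S / D) ≤ G / 16 * (lam / D) :=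
              mul_le_mul (by linarith) b1 (by positivity) (by positivity)
            have b3 := mul_le_mul_of_nonneg_right b2 (show (0 : ℝ) ≤ N + 1 by linarith)
            have e1 : ε / (4 * D) * S * (N + 1) = ε / 4 * (S / D) * (N + 1) := by
              field_simp
            rw [e1, hY]
            linarith
          have e2 : ε / (160 * D) * S * (N + 1) = (ε / (4 * D) * S * (N + 1)) / 40 := by
            field_simp
            ring
          have e3 : G * (lam / D) / 8 * (N + 1) = G * Y / 8 := by rw [hY]; ring
          have e4 : G * (lam / D * ((N + 1) / 2) - 1) = G * Y / 2 - G := by rw [hY]; ring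
          have : 0 ≤ G * Y := by positivity
          linarith
      _ = _ := by ring

theorem exp_neg_two_mul_le {h : ℝ} (h0 : 0 ≤ h) (h1 : h ≤ 1 / 2) : Real.exp (-(2 * h)) ≤ 1 - h := by
  have h2 := Real.add_one_le_exp (2 * h)
  rw [Real.exp_neg, inv_le_comm₀ (Real.exp_pos _) (by linarith)]
  refine le_trans ?_ h2
  rw [inv_le_iff_one_le_mul₀ (by linarith)]
  nlinarith

/-- A lower bound at `ν + i y` for a cluster of nodes close to one point at distance `d` from `ν`. The
factor with the square root provides decay in `y`. -/
theorem le_prod_norm_sub {C : Finset ℝ} {ν y d lam D θ : ℝ} (hlam : 0 < lam) (hd : lam ≤ d)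
    (hdD : d ≤ D) (hθ : 0 ≤ θ) (hθl : θ ≤ lam / 2) (hC : ∀ x ∈ C, d - θ ≤ |ν - x| ∧ |ν - x| ≤ d) :
    (d * Real.exp (-(2 * θ / lam)) * Real.sqrt (1 + y ^ 2 / D ^ 2)) ^ C.card ≤
      ∏ x ∈ C, ‖(ν : ℂ) + y * I - x‖ := by
  have hd0 : 0 < d := hlam.trans_le hd
  have hD0 : 0 < D := hd0.trans_le hdD
  rw [← Finset.prod_const]
  refine Finset.prod_le_prod (fun _ _ => by positivity) fun x hx => ?_
  obtain ⟨h1, h2⟩ := hC x hx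
  have h3 : d * Real.exp (-(2 * θ / lam)) ≤ |ν - x| := by
    refine le_trans ?_ h1
    have h4 := exp_neg_two_mul_le (h := θ / lam) (by positivity)
      (by rw [div_le_iff₀ hlam]; linarith)
    have h5 : d * (1 - θ / lam) ≤ d - θ := by
      have : θ ≤ d * (θ / lam) := by
        rw [mul_div_assoc', le_div_iff₀ hlam]
        nlinarith
      linarith
    rw [mul_div_assoc]
    exact (mul_le_mul_of_nonneg_left h4 hd0.le).trans h5
  have e : ‖(ν : ℂ) + y * I - x‖ = Real.sqrt ((ν - x) ^ 2 + y ^ 2) := by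
    have : (ν : ℂ) + y * I - x = ((ν - x : ℝ) : ℂ) + y * I := by push_cast; ring
    rw [this, norm_add_mul_I]
  rw [e]
  refine (mul_le_mul_of_nonneg_right h3 (Real.sqrt_nonneg _)).trans ?_
  refine Real.le_sqrt_of_sq_le ?_
  rw [mul_pow, Real.sq_sqrt (by positivity), sq_abs, mul_add, mul_one]
  have h6 : (ν - x) ^ 2 ≤ D ^ 2 := by
    rw [← sq_abs]
    exact pow_le_pow_left₀ (abs_nonneg _) (h2.trans hdD) 2
  have h7 : (ν - x) ^ 2 * (y ^ 2 / D ^ 2) ≤ D ^ 2 * (y ^ 2 / D ^ 2) :=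
    mul_le_mul_of_nonneg_right h6 (by positivity)
  have e2 : D ^ 2 * (y ^ 2 / D ^ 2) = y ^ 2 := by field_simp
  linarith

end Nodes

section Nodes

open Complex

theorem exists_finset_Ioo {a b : ℝ} (h : a < b) (k : ℕ) :
    ∃ C : Finset ℝ, C.card = k ∧ ∀ x ∈ C, x ∈ Ioo a b := by
  obtain ⟨C, hC, hk⟩ := (Ioo_infinite h).exists_subset_card_eq k
  exact ⟨C, hk, fun x hx => hC hx⟩

theorem prod_norm_sub_le {C : Finset ℝ} {z : ℂ} {B : ℝ} (h : ∀ x ∈ C, ‖z - x‖ ≤ B) :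
    ∏ x ∈ C, ‖z - x‖ ≤ B ^ C.card := by
  rw [← Finset.prod_const]
  exact Finset.prod_le_prod (fun _ _ => norm_nonneg _) h

theorem norm_sub_ofReal_le {z : ℂ} {x₀ x δ : ℝ} (hre : |z.re - x₀| ≤ 2 * δ) (him : |z.im| ≤ δ) :
    ‖z - x‖ ≤ |x₀ - x| + 3 * δ := by
  have h1 := Complex.norm_le_abs_re_add_abs_im (z - x)
  simp only [sub_re, ofReal_re, sub_im, ofReal_im, sub_zero] at h1
  have h2 := abs_add_le (z.re - x₀) (x₀ - x)
  rw [sub_add_sub_cancel] at h2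
  linarith

set_option maxHeartbeats 1000000 in
/-- Interpolation nodes for which the nodal polynomial is exponentially smaller near the bands than
on the vertical line through any point `ν` of the gap. The rate is proportional to
`S`, where `S² = y² + (ν - p) (q - ν)` is the real part of `-(ζ - p) (ζ - q)` at `ζ = ν + i y`. -/
theorem exists_nodes {lam D : ℝ} (hlam : 0 < lam) (hlD : lam ≤ D) :
    ∃ ε₀ c C : ℝ, 0 < ε₀ ∧ ε₀ ≤ 1 / 480 ∧ 0 < c ∧ 0 < C ∧ ∀ a p q b : ℝ, lam ≤ p - a → p ≤ q →
      lam ≤ b - q → b - a ≤ D → ∀ N : ℕ, ∃ X : Finset ℝ, X.card = N + 1 ∧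
        (∀ x ∈ X, x ∈ Ioo a p ∪ Ioo q b) ∧
        (N ≠ 0 → ∀ ν S δ y : ℝ, ∀ z : ℂ, p ≤ ν → ν ≤ q → 0 < S → S ≤ lam / 4 →
          S ^ 2 ≤ y ^ 2 + (ν - p) * (q - ν) → 0 ≤ δ → δ ≤ ε₀ * S →
          δ * (δ + (q - p)) ≤ ε₀ * S ^ 2 → |z.im| ≤ δ →
          (∃ x₀ ∈ Icc a p ∪ Icc q b, |z.re - x₀| ≤ 2 * δ) →
          (∏ x ∈ X, ‖z - x‖) * (1 + y ^ 2) ≤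
            C * Real.exp (-(c * S * N)) * ∏ x ∈ X, ‖(ν : ℂ) + y * I - x‖) := by
  classical
  have hD : 0 < D := hlam.trans_le hlD
  set ε := nodeRatio lam D with hε
  have hε0 : 0 < ε := nodeRatio_pos hlam hlD
  have hε1 : ε ≤ 1 / 16 := by
    have h1 := nodeRatio_le hlam hlD
    have h2 := clusterGain_le hlam hlD
    linarith
  have hlD1 : lam / D ≤ 1 := (div_le_one hD).2 hlD
  have hlD0 : 0 < lam / D := by positivity
  refine ⟨ε * lam / (480 * D), ε / (4 * D),
    2 * Real.exp (2 + 2 * D / lam) * (D / lam) ^ 2 * Real.exp 1 * (1 + D ^ 2), by positivity, ?_,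
    by positivity, by positivity, ?_⟩
  · have e1 : ε * lam / (480 * D) = ε * (lam / D) / 480 := by field_simp
    have : ε * (lam / D) ≤ 1 * 1 := mul_le_mul (by linarith) hlD1 hlD0.le zero_le_one
    rw [e1]
    linarith
  intro a p q b hap hpq hqb hbD N
  have hN0 : (0 : ℝ) ≤ N := Nat.cast_nonneg N
  obtain ⟨α, hα1, hα2, hα3⟩ := exists_balancing_weight (a := a) (p := p) (q := q) (b := b)
    (by linarith) hpq (by linarith)
  have hpa0 : 0 < p - a := by linarith
  have hbq0 : 0 < b - q := by linarith
  have hbp0 : 0 < b - p := by linarith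
  have hqa0 : 0 < q - a := by linarith
  have hαl : lam / D ≤ α := by
    rw [div_le_div_iff₀ hbp0 hpa0] at hα1
    rw [div_le_iff₀ hD]
    have h1 : p - a ≤ α * (b - a) := by linarith
    have h2 : 0 ≤ α := by
      by_contra! h
      nlinarith
    have := mul_le_mul_of_nonneg_left hbD h2
    linarith
  have hαr : lam / D ≤ 1 - α := by
    rw [div_le_div_iff₀ hqa0 hbq0] at hα2
    rw [div_le_iff₀ hD]
    have h1 : b - q ≤ (1 - α) * (b - a) := by linarith
    have h2 : 0 ≤ 1 - α := by
      by_contra! h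
      nlinarith
    have := mul_le_mul_of_nonneg_left hbD h2
    linarith
  -- `2 n` nodes for the Chebyshev factor, `k` and `k'` nodes for the clusters
  set t := lam / 2 with ht
  set κ := 2 / (t * (t + (q - p))) with hκ
  have ht0 : 0 < t := by positivity
  set n := ⌊ε * (N + 1)⌋₊ with hn
  have hn1 : (n : ℝ) ≤ ε * (N + 1) := Nat.floor_le (by positivity)
  have hn2 : ε * (N + 1) - 1 ≤ n := by
    have := Nat.lt_floor_add_one (ε * (N + 1))
    linarith
  have hnN : 2 * n ≤ N + 1 := by
    have h1 : ε * (N + 1) ≤ 1 / 16 * (N + 1) := mul_le_mul_of_nonneg_right hε1 (by positivity)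
    have : (2 * n : ℝ) ≤ N + 1 := by linarith
    exact_mod_cast this
  obtain ⟨K, hK⟩ := Nat.exists_eq_add_of_le hnN
  have hKr : (2 * n + K : ℝ) = N + 1 := by exact_mod_cast hK.symm
  set k := ⌊α * K⌋₊ with hk
  have hα0 : 0 ≤ α := hlD0.le.trans hαl
  have hα1' : α ≤ 1 := by linarith
  have hkK : k ≤ K := by
    refine Nat.floor_le_of_le ?_
    exact mul_le_of_le_one_left (Nat.cast_nonneg K) hα1'
  obtain ⟨k', hk'⟩ := Nat.exists_eq_add_of_le hkK
  have hkr : (k + k' : ℝ) = K := by exact_mod_cast hk'.symm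
  have hk1 : |k - α * (k + k')| ≤ 1 := by
    rw [hkr, abs_le]
    have h1 : (k : ℝ) ≤ α * K := Nat.floor_le (by positivity)
    have h2 := Nat.lt_floor_add_one (α * (K : ℝ))
    constructor <;> linarith
  have hk2 : |k' - (1 - α) * (k + k')| ≤ 1 := by
    have : (k' : ℝ) - (1 - α) * (k + k') = -(k - α * (k + k')) := by ring
    rw [this, abs_neg]
    exact hk1
  -- the diameter `θ` of the clusters is `O(1 / N)`, so it costs a constant factor only
  set θ := lam / 32 / (N + 1) with hθ
  have hθ0 : 0 < θ := by positivity
  have hθN : θ * (N + 1) = lam / 32 := by rw [hθ]; field_simp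
  have hθl : θ ≤ lam / 32 := by
    have : θ ≤ θ * (N + 1) := le_mul_of_one_le_right hθ0.le (by linarith)
    linarith
  obtain ⟨T, hTc, hTm, A, hA, hT⟩ := exists_chebyshev_nodes hpq ht0 hκ n
  obtain ⟨C₁, hC₁c, hC₁⟩ := exists_finset_Ioo (a := a) (b := a + θ) (by linarith) k
  obtain ⟨C₂, hC₂c, hC₂⟩ := exists_finset_Ioo (a := b - θ) (b := b) (by linarith) k'
  have hd1 : Disjoint T C₁ := by
    rw [Finset.disjoint_left]
    intro x hx hx'
    have h2 := (hC₁ x hx').2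
    rcases hTm x hx with h | h
    · linarith [h.1]
    · linarith [h.1]
  have hd2 : Disjoint (T ∪ C₁) C₂ := by
    rw [Finset.disjoint_left]
    intro x hx hx'
    have h2 := (hC₂ x hx').1
    rcases Finset.mem_union.1 hx with hx | hx
    · rcases hTm x hx with h | h
      · linarith [h.2]
      · linarith [h.2]
    · have := (hC₁ x hx).2
      linarith
  refine ⟨T ∪ C₁ ∪ C₂, ?_, ?_, ?_⟩
  · rw [Finset.card_union_of_disjoint hd2, Finset.card_union_of_disjoint hd1, hTc, hC₁c, hC₂c]
    omega
  · intro x hx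
    rcases Finset.mem_union.1 hx with hx | hx
    · rcases Finset.mem_union.1 hx with hx | hx
      · rcases hTm x hx with h | h
        · exact Or.inl ⟨by linarith [h.1], h.2⟩
        · exact Or.inr ⟨h.1, by linarith [h.2]⟩
      · have h := hC₁ x hx
        exact Or.inl ⟨h.1, by linarith [h.2]⟩
    · have h := hC₂ x hx
      exact Or.inr ⟨by linarith [h.1], h.2⟩
  · intro hN ν S δ y z hpν hνq hS hS' hSy hδ hδS hδg him hx₀
    rw [Finset.prod_union hd2, Finset.prod_union hd1, Finset.prod_union hd2, Finset.prod_union hd1,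
      hT, hT]
    set w' : ℂ := 1 - κ * (((ν : ℂ) + y * I - p) * ((ν : ℂ) + y * I - q)) with hw'
    have hκ0 : 0 < κ := by
      have : 0 ≤ q - p := by linarith
      positivity
    have hw're : 1 + κ * S ^ 2 ≤ w'.re := by
      have e1 : w'.re = 1 + κ * (y ^ 2 + (ν - p) * (q - ν)) := by
        rw [hw']
        simp
        ring
      rw [e1]
      have := mul_le_mul_of_nonneg_left hSy hκ0.le
      linarith
    set w : ℂ := 1 - κ * ((z - p) * (z - q)) with hw
    set E := 2 * Real.exp (2 + 2 * D / lam) * Real.exp (-(ε / (4 * D) * S * N)) with hE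
    set e := 3 * δ + θ with he
    have hTw' := norm_nonneg ((Polynomial.Chebyshev.T ℂ n).eval w')
    have hgap := cluster_pow_gap_le hlam hap hqb hbD hpν hνq hα0 hα1' hα3 hk1 hk2
    -- `z` near the left or the right band; the latter is reflected to the situation of `band_ratio`
    have hnum : ‖(Polynomial.Chebyshev.T ℂ n).eval w‖ * (∏ x ∈ C₁, ‖z - x‖) * ∏ x ∈ C₂, ‖z - x‖ ≤
        E * (‖(Polynomial.Chebyshev.T ℂ n).eval w'‖ *
          ((D / lam) ^ 2 * ((ν - a) ^ k * (b - ν) ^ k'))) := by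
      obtain ⟨x₀, hx₀, hre⟩ := hx₀
      rw [mul_assoc]
      rcases hx₀ with hx | hx
      · have hb := band_ratio (u := z - p) (L := p - a) (M := b - p) (s := p - x₀) (N := N)
          (w' := w') hlam hap (by linarith)
          (by linarith) (by linarith) ht hκ (by linarith [hx.2]) (by linarith [hx.1]) hδ hS hS'
          hδS hδg hθ0.le hθN hn1 hn2 (by omega) hαl hα1 hk1 hk2
          (by simp only [sub_re, ofReal_re]; rwa [sub_add_sub_cancel])
          (by simpa using him) hw're
        have e1 : (1 - κ * ((z - p) * (z - p - (q - p : ℝ))) : ℂ) = w := by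
          rw [hw]; push_cast; ring
        rw [e1] at hb
        have h1 : ∏ x ∈ C₁, ‖z - x‖ ≤ (p - a - (p - x₀) + e) ^ k := by
          rw [← hC₁c]
          refine prod_norm_sub_le fun x hx' => (norm_sub_ofReal_le hre him).trans ?_
          have h2 := hC₁ x hx'
          have : |x₀ - x| ≤ x₀ - a + θ := by
            rw [abs_le]; constructor <;> linarith [h2.1, h2.2, hx.1]
          linarith
        have h2 : ∏ x ∈ C₂, ‖z - x‖ ≤ (b - p + (p - x₀) + e) ^ k' := by
          rw [← hC₂c]
          refine prod_norm_sub_le fun x hx' => (norm_sub_ofReal_le hre him).trans ?_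
          have h2 := hC₂ x hx'
          have : |x₀ - x| ≤ b - x₀ + θ := by
            rw [abs_le]; constructor <;> linarith [h2.1, h2.2, hx.2]
          linarith
        have h3 := mul_le_mul h1 h2 (Finset.prod_nonneg fun _ _ => norm_nonneg _)
          (pow_nonneg (by linarith [hx.1]) _)
        refine (mul_le_mul_of_nonneg_left h3 (norm_nonneg _)).trans (hb.trans ?_)
        exact mul_le_mul_of_nonneg_left (mul_le_mul_of_nonneg_left hgap.1 hTw') (by positivity)
      · have hb := band_ratio (u := q - z) (L := b - q) (M := q - a) (s := x₀ - q) (N := N)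
          (k := k') (k' := k) (α := 1 - α)
          (w' := w') hlam hqb (by linarith)
          (by linarith) (by linarith) ht hκ (by linarith [hx.1]) (by linarith [hx.2]) hδ hS hS'
          hδS hδg hθ0.le hθN hn1 hn2 (by omega) hαr (by simpa using hα2) (by rwa [add_comm (k' : ℝ)])
          (by rw [sub_sub_cancel, add_comm (k' : ℝ)]; exact hk1)
          (by
            simp only [sub_re, ofReal_re]
            rw [← abs_neg]
            have e0 : -(q - z.re + (x₀ - q)) = z.re - x₀ := by ring
            rw [e0]
            exact hre)
          (by simpa using him) hw're
        have e1 : (1 - κ * ((q - z) * (q - z - (q - p : ℝ))) : ℂ) = w := by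
          rw [hw]; push_cast; ring
        rw [e1] at hb
        have h1 : ∏ x ∈ C₁, ‖z - x‖ ≤ (q - a + (x₀ - q) + e) ^ k := by
          rw [← hC₁c]
          refine prod_norm_sub_le fun x hx' => (norm_sub_ofReal_le hre him).trans ?_
          have h2 := hC₁ x hx'
          have : |x₀ - x| ≤ x₀ - a + θ := by
            rw [abs_le]; constructor <;> linarith [h2.1, h2.2, hx.1]
          linarith
        have h2 : ∏ x ∈ C₂, ‖z - x‖ ≤ (b - q - (x₀ - q) + e) ^ k' := by
          rw [← hC₂c]
          refine prod_norm_sub_le fun x hx' => (norm_sub_ofReal_le hre him).trans ?_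
          have h2 := hC₂ x hx'
          have : |x₀ - x| ≤ b - x₀ + θ := by
            rw [abs_le]; constructor <;> linarith [h2.1, h2.2, hx.2]
          linarith
        have h3 := mul_le_mul h1 h2 (Finset.prod_nonneg fun _ _ => norm_nonneg _)
          (pow_nonneg (by linarith [hx.1]) _)
        rw [mul_comm ((q - a + (x₀ - q) + e) ^ k)] at h3
        refine (mul_le_mul_of_nonneg_left h3 (norm_nonneg _)).trans (hb.trans ?_)
        rw [mul_comm ((b - q) ^ k')]
        exact mul_le_mul_of_nonneg_left (mul_le_mul_of_nonneg_left hgap.2 hTw') (by positivity)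
    -- lower bound for the clusters on the vertical line
    have hden : ((ν - a) ^ k * (b - ν) ^ k') * (1 + y ^ 2) ≤ Real.exp 1 * (1 + D ^ 2) *
        ((∏ x ∈ C₁, ‖(ν : ℂ) + y * I - x‖) * ∏ x ∈ C₂, ‖(ν : ℂ) + y * I - x‖) := by
      have h1 := le_prod_norm_sub (C := C₁) (ν := ν) (y := y) (d := ν - a) (D := D) (θ := θ) hlam
        (by linarith) (by linarith) hθ0.le (by linarith) fun x hx => by
          have h2 := hC₁ x hx
          rw [abs_of_nonneg (by linarith [h2.2])]
          constructor <;> linarith [h2.1, h2.2]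
      have h2 := le_prod_norm_sub (C := C₂) (ν := ν) (y := y) (d := b - ν) (D := D) (θ := θ) hlam
        (by linarith) (by linarith) hθ0.le (by linarith) fun x hx => by
          have h2 := hC₂ x hx
          rw [abs_of_nonpos (by linarith [h2.1])]
          constructor <;> linarith [h2.1, h2.2]
      rw [hC₁c] at h1
      rw [hC₂c] at h2
      have hb0 : 0 ≤ b - ν := by linarith
      have ha0 : 0 ≤ ν - a := by linarith
      have h3 := mul_le_mul h1 h2 (by positivity) (Finset.prod_nonneg fun _ _ => norm_nonneg _)
      set Z := Real.sqrt (1 + y ^ 2 / D ^ 2) with hZ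
      have hZ2 : Z ^ 2 = 1 + y ^ 2 / D ^ 2 := Real.sq_sqrt (by positivity)
      have hZ1 : 1 ≤ Z := Real.one_le_sqrt.2 (by linarith [show 0 ≤ y ^ 2 / D ^ 2 by positivity])
      -- two cluster nodes provide the decay in `y`; this is where `N ≠ 0` is needed
      have hK2 : 2 ≤ K := by
        have h4 : ε * (N + 1) ≤ 1 / 16 * (N + 1) := mul_le_mul_of_nonneg_right hε1 (by positivity)
        have h5 : (1 : ℝ) ≤ N := by exact_mod_cast Nat.one_le_iff_ne_zero.2 hN
        have h6 : (1 : ℝ) < K := by linarith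
        have : 1 < K := by exact_mod_cast h6
        omega
      have hZK : 1 + y ^ 2 / D ^ 2 ≤ Z ^ K := hZ2 ▸ pow_le_pow_right₀ hZ1 hK2
      have hy : 1 + y ^ 2 ≤ (1 + D ^ 2) * (1 + y ^ 2 / D ^ 2) := by
        have e1 : D ^ 2 * (y ^ 2 / D ^ 2) = y ^ 2 := by field_simp
        have : 0 ≤ y ^ 2 / D ^ 2 := by positivity
        have e3 : (1 + D ^ 2) * (1 + y ^ 2 / D ^ 2) = 1 + D ^ 2 + y ^ 2 / D ^ 2 +
            D ^ 2 * (y ^ 2 / D ^ 2) := by ring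
        rw [e3, e1]
        linarith [sq_nonneg D]
      have hexp : 1 ≤ Real.exp 1 * Real.exp (-(2 * θ / lam)) ^ K := by
        rw [← Real.exp_nat_mul, ← Real.exp_add]
        refine Real.one_le_exp ?_
        have h4 : (K : ℝ) ≤ N + 1 := by
          have : (0 : ℝ) ≤ n := Nat.cast_nonneg n
          linarith
        have h5 : θ * K ≤ lam / 32 := (mul_le_mul_of_nonneg_left h4 hθ0.le).trans hθN.le
        have h6 : K * (2 * θ / lam) ≤ 1 / 16 := by
          rw [mul_div_assoc', div_le_iff₀ hlam]
          linarith
        linarith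
      have e2 : ((ν - a) * Real.exp (-(2 * θ / lam)) * Z) ^ k *
          ((b - ν) * Real.exp (-(2 * θ / lam)) * Z) ^ k' =
          ((ν - a) ^ k * (b - ν) ^ k') * Real.exp (-(2 * θ / lam)) ^ K * Z ^ K := by
        rw [hk']
        simp only [mul_pow, pow_add]
        ring
      rw [e2] at h3
      have hQ : 0 ≤ (ν - a) ^ k * (b - ν) ^ k' := by positivity
      calc ((ν - a) ^ k * (b - ν) ^ k') * (1 + y ^ 2)
          ≤ ((ν - a) ^ k * (b - ν) ^ k') * ((1 + D ^ 2) * Z ^ K) := by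
            refine mul_le_mul_of_nonneg_left (hy.trans ?_) hQ
            exact mul_le_mul_of_nonneg_left hZK (by positivity)
        _ ≤ ((ν - a) ^ k * (b - ν) ^ k') * ((1 + D ^ 2) * Z ^ K) *
            (Real.exp 1 * Real.exp (-(2 * θ / lam)) ^ K) :=
            le_mul_of_one_le_right (by positivity) hexp
        _ = Real.exp 1 * (1 + D ^ 2) *
            (((ν - a) ^ k * (b - ν) ^ k') * Real.exp (-(2 * θ / lam)) ^ K * Z ^ K) := by ring
        _ ≤ _ := mul_le_mul_of_nonneg_left h3 (by positivity)
    calc _ = A * (‖(Polynomial.Chebyshev.T ℂ n).eval w‖ * (∏ x ∈ C₁, ‖z - x‖) *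
          ∏ x ∈ C₂, ‖z - x‖) * (1 + y ^ 2) := by ring
      _ ≤ A * (E * (‖(Polynomial.Chebyshev.T ℂ n).eval w'‖ *
          ((D / lam) ^ 2 * ((ν - a) ^ k * (b - ν) ^ k')))) * (1 + y ^ 2) :=
          mul_le_mul_of_nonneg_right (mul_le_mul_of_nonneg_left hnum hA.le) (by positivity)
      _ = A * E * ‖(Polynomial.Chebyshev.T ℂ n).eval w'‖ * (D / lam) ^ 2 *
          (((ν - a) ^ k * (b - ν) ^ k') * (1 + y ^ 2)) := by ring
      _ ≤ A * E * ‖(Polynomial.Chebyshev.T ℂ n).eval w'‖ * (D / lam) ^ 2 *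
          (Real.exp 1 * (1 + D ^ 2) *
        ((∏ x ∈ C₁, ‖(ν : ℂ) + y * I - x‖) * ∏ x ∈ C₂, ‖(ν : ℂ) + y * I - x‖)) :=
          mul_le_mul_of_nonneg_left hden (by positivity)
      _ = _ := by rw [hE]; ring

end Nodes

/-! ### The interpolation error -/

section Error

open Complex Polynomial

/-- Lagrange's formula at complex arguments. -/
theorem eval_map_interp (X : Finset ℝ) (O : ℝ → ℝ) (z : ℂ) :
    ((interp X O).map (algebraMap ℝ ℂ)).eval z =
      ∑ x ∈ X, (O x : ℂ) * (Lagrange.basis X (fun x : ℝ => (x : ℂ)) x).eval z := by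
  have hinj : Set.InjOn (fun x : ℝ => (x : ℂ)) X := ofReal_injective.injOn
  have h := Lagrange.eq_interpolate_of_eval_eq (s := X) (v := fun x : ℝ => (x : ℂ))
    (fun x => (O x : ℂ)) (f := (interp X O).map (algebraMap ℝ ℂ)) hinj
    (by
      rw [degree_map]
      exact Lagrange.degree_interpolate_lt _ Function.injective_id.injOn)
    (fun x hx => by
      have h1 : (interp X O).eval x = O x :=
        Lagrange.eval_interpolate_at_node (v := id) O Function.injective_id.injOn hx
      have h2 := Polynomial.eval_map_apply (f := algebraMap ℝ ℂ) (p := interp X O) x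
      rw [h1] at h2
      exact h2)
  rw [h, Lagrange.interpolate_apply, eval_finsetSum]
  simp

/-- The error of Lagrange interpolation for the Cauchy kernel. -/
theorem cauchy_sub_sum_basis {X : Finset ℝ} {z ζ : ℂ}
    (hζ : ∀ x ∈ X, ζ ≠ x) (hz : z ≠ ζ) :
    (z - ζ)⁻¹ - ∑ x ∈ X, ((x : ℂ) - ζ)⁻¹ * (Lagrange.basis X (fun x : ℝ => (x : ℂ)) x).eval z =
      (∏ x ∈ X, (z - x)) / ((∏ x ∈ X, (ζ - x)) * (z - ζ)) := by
  have hinj : Set.InjOn (fun x : ℝ => (x : ℂ)) X := ofReal_injective.injOn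
  set W := Lagrange.nodal X (fun x : ℝ => (x : ℂ)) with hW
  have hWe : ∀ w : ℂ, W.eval w = ∏ x ∈ X, (w - x) := fun w => Lagrange.eval_nodal
  have hWζ : W.eval ζ ≠ 0 := by
    rw [hWe]
    exact Finset.prod_ne_zero_iff.2 fun x hx => sub_ne_zero.2 (hζ x hx)
  set Q := (W - C (W.eval ζ)) /ₘ (Polynomial.X - C ζ) with hQ
  have hQm : (Polynomial.X - C ζ) * Q = W - C (W.eval ζ) := by
    rw [hQ]
    refine mul_divByMonic_eq_iff_isRoot.2 ?_
    simp
  have hQe : ∀ w : ℂ, (w - ζ) * Q.eval w = W.eval w - W.eval ζ := fun w => by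
    have := congrArg (eval w) hQm
    simpa using this
  have hQd : (C (-(W.eval ζ)⁻¹) * Q).degree < X.card := by
    rcases X.eq_empty_or_nonempty with rfl | hne
    · have : Q = 0 := by
        rw [hQ, hW]
        simp
      rw [this]
      simp
    · have h1 : (C (-(W.eval ζ)⁻¹) * Q).degree ≤ Q.degree := by
        refine (degree_mul_le _ _).trans ?_
        exact (add_le_add_left degree_C_le _).trans (by simp)
      refine h1.trans_lt ?_
      have h3 : W.degree = X.card := Lagrange.degree_nodal
      have h4 : (0 : WithBot ℕ) < W.degree := by
        rw [h3]
        exact_mod_cast hne.card_pos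
      have h2 : (W - C (W.eval ζ)).degree = X.card := by
        rw [degree_sub_eq_left_of_degree_lt (degree_C_le.trans_lt h4), h3]
      have h5 : W - C (W.eval ζ) ≠ 0 := by
        intro h0
        rw [h0, degree_zero] at h2
        exact absurd h2 (by simp)
      rw [← h2, hQ]
      exact degree_divByMonic_lt _ _ h5
        (by rw [degree_X_sub_C]; exact zero_lt_one)
  have h := Lagrange.eq_interpolate_of_eval_eq (s := X) (v := fun x : ℝ => (x : ℂ))
    (fun x => ((x : ℂ) - ζ)⁻¹) (f := C (-(W.eval ζ)⁻¹) * Q) hinj hQd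
    (fun x hx => by
      have h1 := hQe x
      have h0 : W.eval (x : ℂ) = 0 := Lagrange.eval_nodal_at_node hx
      have hx' : (x : ℂ) - ζ ≠ 0 := sub_ne_zero.2 (hζ x hx).symm
      rw [h0] at h1
      rw [eval_mul, eval_C]
      field_simp
      linear_combination -h1)
  have h2 : ∑ x ∈ X, ((x : ℂ) - ζ)⁻¹ * (Lagrange.basis X (fun x : ℝ => (x : ℂ)) x).eval z =
      (C (-(W.eval ζ)⁻¹) * Q).eval z := by
    rw [h, Lagrange.interpolate_apply, eval_finsetSum]
    simp
  have hz' : z - ζ ≠ 0 := sub_ne_zero.2 hz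
  rw [h2, ← hWe, ← hWe, eval_mul, eval_C]
  have h3 := hQe z
  have h4 : Q.eval z = (W.eval z - W.eval ζ) / (z - ζ) := by
    rw [eq_div_iff hz']
    linear_combination h3
  rw [h4]
  field_simp
  ring

/-- Interpolation reproduces constants. -/
theorem sum_basis_eval {X : Finset ℝ} (hX : X.Nonempty) (z : ℂ) :
    ∑ x ∈ X, (Lagrange.basis X (fun x : ℝ => (x : ℂ)) x).eval z = 1 := by
  have h := Lagrange.sum_basis (s := X) (v := fun x : ℝ => (x : ℂ)) ofReal_injective.injOn hX
  have := congrArg (eval z) h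
  simpa [eval_finsetSum] using this

/-- Interpolation at two or more nodes reproduces affine functions. -/
theorem sum_mul_basis_eval {X : Finset ℝ} (hX : 1 < X.card) (z ν : ℂ) :
    ∑ x ∈ X, ((x : ℂ) - ν) * (Lagrange.basis X (fun x : ℝ => (x : ℂ)) x).eval z = z - ν := by
  have h := Lagrange.eq_interpolate_of_eval_eq (s := X) (v := fun x : ℝ => (x : ℂ))
    (fun x => ((x : ℂ) - ν)) (f := Polynomial.X - C ν) ofReal_injective.injOn
    (by rw [degree_X_sub_C]; exact_mod_cast hX) (fun x hx => by simp)
  have := congrArg (eval z) h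
  rw [Lagrange.interpolate_apply, eval_finsetSum] at this
  simpa using this.symm

/-- Partial fractions of the two kernels in terms of Cauchy kernels with poles `± i y`. -/
theorem div_sq_add_sq_eq {w : ℂ} {y : ℝ} (h1 : w - y * I ≠ 0) (h2 : w + y * I ≠ 0) :
    w / (w ^ 2 + y ^ 2) = 1 / 2 * ((w - y * I)⁻¹ + (w + y * I)⁻¹) ∧
      w ^ 2 / (w ^ 2 + y ^ 2) = 1 - y / (2 * I) * ((w - y * I)⁻¹ - (w + y * I)⁻¹) := by
  have e : w ^ 2 + (y : ℂ) ^ 2 = (w - y * I) * (w + y * I) := by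
    linear_combination (y : ℂ) ^ 2 * I_sq
  have hI := I_ne_zero
  constructor
  · rw [e]
    field_simp
    ring
  · rw [e]
    field_simp
    linear_combination (2 * (y : ℂ) ^ 2 * I) * I_sq

/-- A region around the bands stays away from the singularities `ν ± i y`, `y ≥ y₀`, of the
continued observable. -/
theorem singularity_separation {p q ν y₀ S δ ε₀ : ℝ} (hpν : p ≤ ν) (hνq : ν ≤ q)
    (hε₀ : 0 < ε₀) (hε₀' : ε₀ ≤ 1 / 480) (hδ : 0 < δ) (hS : S ^ 2 ≤ y₀ ^ 2 + (ν - p) * (q - ν))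
    (hδg : δ * (δ + (q - p)) ≤ ε₀ * S ^ 2) (hy₀ : 0 ≤ y₀) :
    2 * δ ≤ y₀ ∨ 3 * δ ≤ ν - p ∧ 3 * δ ≤ q - ν := by
  by_cases h : 2 * δ ≤ y₀
  · exact Or.inl h
  right
  push Not at h
  have h0 : y₀ ^ 2 ≤ 4 * δ ^ 2 := by nlinarith
  have hg : 0 ≤ q - p := by linarith
  have hS2 : ε₀ * S ^ 2 ≤ 1 / 480 * S ^ 2 := mul_le_mul_of_nonneg_right hε₀' (sq_nonneg _)
  have hδg0 : 0 ≤ δ * (q - p) := by positivity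
  have h1 : 480 * (δ * (δ + (q - p))) ≤ 4 * δ ^ 2 + (ν - p) * (q - ν) := by linarith
  have h2 : 3 * (δ * (q - p)) < (ν - p) * (q - ν) := by nlinarith [sq_pos_of_pos hδ]
  constructor
  · by_contra! h3
    have : (ν - p) * (q - ν) ≤ 3 * δ * (q - p) :=
      mul_le_mul h3.le (by linarith) (by linarith) (by positivity)
    linarith
  · by_contra! h3
    have : (ν - p) * (q - ν) ≤ (q - p) * (3 * δ) :=
      mul_le_mul (by linarith) h3.le (by linarith) (by linarith)
    linarith

/-- Distance of a neighbourhood of the bands from the singularities. The second bound is needed for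
decay in `y`. -/
theorem le_norm_sub_singularity {p q ν y₀ δ y : ℝ} {z : ℂ}
    (hsep : 2 * δ ≤ y₀ ∨ 3 * δ ≤ ν - p ∧ 3 * δ ≤ q - ν) (hy : y₀ ≤ |y|) (him : |z.im| ≤ δ)
    (hre : z.re ≤ p + 2 * δ ∨ q - 2 * δ ≤ z.re) :
    δ ≤ ‖z - (ν + y * I)‖ ∧ |y| / 2 ≤ ‖z - (ν + y * I)‖ := by
  have h1 := abs_re_le_norm (z - (ν + y * I))
  have h2 := abs_im_le_norm (z - (ν + y * I))
  simp only [sub_re, add_re, ofReal_re, mul_re, I_re, mul_zero, ofReal_im, I_im, sub_self, add_zero,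
    sub_im, add_im, mul_im, mul_one, zero_add] at h1 h2
  have h3 : |y| - δ ≤ |z.im - y| := by
    have := abs_sub_abs_le_abs_sub y z.im
    rw [abs_sub_comm] at this
    linarith
  have h4 : δ ≤ ‖z - (ν + y * I)‖ := by
    rcases hsep with h | h
    · linarith
    · refine le_trans ?_ h1
      rcases hre with h5 | h5
      · rw [le_abs]
        right
        linarith [h.1]
      · rw [le_abs]
        left
        linarith [h.2]
  refine ⟨h4, ?_⟩
  rcases le_or_gt (|y|) (2 * δ) with h5 | h5
  · linarith
  · linarith

/-- Bounds for the two kernels near the bands, with the decay in `y` required by the duality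
estimates; they suffice for a single node. -/
theorem norm_kernel_le {w : ℂ} {y δ D : ℝ} (hδ : 0 < δ) (hδD : δ ≤ D) (hw : ‖w‖ ≤ 2 * D) (hy : 0 < y)
    (h1 : δ ≤ ‖w - y * I‖) (h2 : δ ≤ ‖w + y * I‖) (h3 : y / 2 ≤ ‖w - y * I‖)
    (h4 : y / 2 ≤ ‖w + y * I‖) :
    ‖w / (w ^ 2 + y ^ 2)‖ ≤ (2 + 16 * D ^ 2) / δ / (1 + y ^ 2) ∧
      ‖w ^ 2 / (w ^ 2 + y ^ 2)‖ ≤ 2 * D * ((2 + 16 * D ^ 2) / δ / (1 + y ^ 2)) := by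
  have e : w ^ 2 + (y : ℂ) ^ 2 = (w - y * I) * (w + y * I) := by
    linear_combination (y : ℂ) ^ 2 * I_sq
  have hD : 0 < D := hδ.trans_le hδD
  have n1 : 0 < ‖w - y * I‖ := hδ.trans_le h1
  have n2 : 0 < ‖w + y * I‖ := hδ.trans_le h2
  have key : ‖w / (w ^ 2 + y ^ 2)‖ ≤ (2 + 16 * D ^ 2) / δ / (1 + y ^ 2) := by
    rw [e, norm_div, norm_mul, le_div_iff₀ (by positivity), div_mul_eq_mul_div,
      div_le_div_iff₀ (by positivity) hδ]
    rcases le_or_gt y 1 with h | h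
    · have a1 : 2 * ‖w‖ ≤ ‖w - y * I‖ + ‖w + y * I‖ := by
        have := norm_add_le (w - y * I) (w + y * I)
        rw [show w - y * I + (w + y * I) = 2 * w by ring, norm_mul] at this
        simpa using this
      have a2 : ‖w‖ * δ ≤ ‖w - y * I‖ * ‖w + y * I‖ := by nlinarith
      have a3 : 0 ≤ ‖w‖ * δ := by positivity
      have a4 : y ^ 2 ≤ 1 := pow_le_one₀ hy.le h
      have a5 := mul_le_mul_of_nonneg_left a4 a3
      calc ‖w‖ * (1 + y ^ 2) * δ ≤ 2 * (‖w‖ * δ) := by linarith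
        _ ≤ 2 * (‖w - y * I‖ * ‖w + y * I‖) := by linarith
        _ ≤ _ := by
          refine mul_le_mul_of_nonneg_right ?_ (by positivity)
          nlinarith
    · have a1 : y / 2 * (y / 2) ≤ ‖w - y * I‖ * ‖w + y * I‖ :=
        mul_le_mul h3 h4 (by positivity) n1.le
      have a2 : ‖w‖ * δ ≤ 2 * D * D := mul_le_mul hw hδD hδ.le (by positivity)
      calc ‖w‖ * (1 + y ^ 2) * δ = ‖w‖ * δ * (1 + y ^ 2) := by ring
        _ ≤ 2 * D * D * (2 * y ^ 2) := mul_le_mul a2 (by nlinarith) (by positivity) (by positivity)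
        _ = 16 * D ^ 2 * (y / 2 * (y / 2)) := by ring
        _ ≤ (2 + 16 * D ^ 2) * (‖w - y * I‖ * ‖w + y * I‖) :=
          mul_le_mul (by linarith) a1 (by positivity) (by positivity)
  refine ⟨key, ?_⟩
  rw [show w ^ 2 / (w ^ 2 + (y : ℂ) ^ 2) = w * (w / (w ^ 2 + (y : ℂ) ^ 2)) by ring, norm_mul]
  exact mul_le_mul hw key (norm_nonneg _) (by positivity)

end Error

/-! ### Interpolation of the observables -/

section Error

open Complex

/-- The values of a functional that kills constants on the two kernels, in terms of its values on the
Cauchy kernels. -/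
theorem sum_kernel_eq {ι : Type} [Fintype ι] {c z : ι → ℂ} {ν y : ℝ} (hc : ∑ i, c i = 0)
    (h1 : ∀ i, z i ≠ ν + y * I) (h2 : ∀ i, z i ≠ ν + (-y : ℝ) * I) :
    ∑ i, c i * ((z i - ν) / ((z i - ν) ^ 2 + y ^ 2)) =
        1 / 2 * (∑ i, c i * (z i - (ν + y * I))⁻¹ + ∑ i, c i * (z i - (ν + (-y : ℝ) * I))⁻¹) ∧
      ∑ i, c i * ((z i - ν) ^ 2 / ((z i - ν) ^ 2 + y ^ 2)) =
        -(y / (2 * I) * (∑ i, c i * (z i - (ν + y * I))⁻¹ -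
          ∑ i, c i * (z i - (ν + (-y : ℝ) * I))⁻¹)) := by
  have e1 : ∀ i, z i - ν - y * I = z i - (ν + y * I) := fun i => by ring
  have e2 : ∀ i, z i - ν + y * I = z i - (ν + (-y : ℝ) * I) := fun i => by push_cast; ring
  have h := fun i => div_sq_add_sq_eq (w := z i - ν) (y := y)
    (by rw [e1]; exact sub_ne_zero.2 (h1 i)) (by rw [e2]; exact sub_ne_zero.2 (h2 i))
  simp only [e1, e2] at h
  constructor
  · rw [← Finset.sum_add_distrib, Finset.mul_sum]
    refine Finset.sum_congr rfl fun i _ => ?_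
    rw [(h i).1]
    ring
  · rw [← Finset.sum_sub_distrib, Finset.mul_sum, ← Finset.sum_neg_distrib]
    have e3 : ∀ i, c i * ((z i - ν) ^ 2 / ((z i - ν) ^ 2 + y ^ 2)) =
        c i + -(y / (2 * I) * (c i * (z i - (ν + y * I))⁻¹ -
          c i * (z i - (ν + (-y : ℝ) * I))⁻¹)) := fun i => by
      rw [(h i).2]
      ring
    rw [Finset.sum_congr rfl fun i _ => e3 i, Finset.sum_add_distrib, hc, zero_add]

/-- The functional `f ↦ f z - (interpolant of f at z)` as a finite combination of point
evaluations. -/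
theorem sum_option_eq {X : Finset ℝ} (z : ℂ) (ℓ : ℝ → ℂ) (g : ℂ → ℂ) :
    ∑ i : Option X, (i.elim 1 fun x => -ℓ x) * g (i.elim z fun x => ((x : ℝ) : ℂ)) =
      g z - ∑ x ∈ X, g x * ℓ x := by
  rw [Fintype.sum_option]
  simp only [Option.elim_none, Option.elim_some, one_mul, neg_mul, Finset.sum_neg_distrib]
  rw [← sub_eq_add_neg, Finset.sum_coe_sort X fun x => ℓ x * g x]
  congr 1
  exact Finset.sum_congr rfl fun x _ => mul_comm _ _

set_option maxHeartbeats 1000000 in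
/-- Interpolation nodes whose interpolation error is exponentially small in a neighbourhood of the
bands, at the rate `S` up to a constant. The nodes depend neither on the observable nor on the
neighbourhood. -/
theorem exists_interpolation_error {lam D : ℝ} (hlam : 0 < lam) (hlD : lam ≤ D) :
    ∃ ε₀ c K : ℝ, 0 < ε₀ ∧ ε₀ ≤ 1 / 480 ∧ 0 < c ∧ 0 < K ∧ ∀ a p q b : ℝ, lam ≤ p - a → p ≤ q →
      lam ≤ b - q → b - a ≤ D → ∀ N : ℕ, ∃ X : Finset ℝ, X.card = N + 1 ∧
        (∀ x ∈ X, x ∈ Ioo a p ∪ Ioo q b) ∧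
        ∀ (β : ℝ≥0∞) (μ ν y₀ S δ : ℝ) (O : ℝ → ℝ), 0 < β →
          (O = fermiDirac β μ ∨ O = grandPotential β μ) → p ≤ μ → μ ≤ q → p ≤ ν → ν ≤ q →
          (if β = ∞ then y₀ = 0 else ν = μ ∧ y₀ = Real.pi / β.toReal) → 0 < S → S ≤ lam / 4 →
          S ^ 2 ≤ y₀ ^ 2 + (ν - p) * (q - ν) → 0 < δ → δ ≤ ε₀ * S →
          δ * (δ + (q - p)) ≤ ε₀ * S ^ 2 →
          ∃ f : ℂ → ℂ, DifferentiableOn ℂ f (cutPlane ν y₀) ∧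
            (β ≠ ∞ → ∀ x : ℝ, f x = O x) ∧
            (β = ∞ → ∀ x : ℝ, (x < μ ∧ x < ν ∨ μ < x ∧ ν < x) → f x = O x) ∧
            ∀ z : ℂ, |z.im| ≤ δ → (∃ x₀ ∈ Icc a p ∪ Icc q b, |z.re - x₀| ≤ 2 * δ) →
              z ∈ cutPlane ν y₀ ∧
                ‖f z - ((interp X O).map (algebraMap ℝ ℂ)).eval z‖ ≤
                  K / δ * Real.exp (-(c * S * N)) := by
  obtain ⟨ε₀, c, C, hε₀, hε₀', hc, hC, hnodes⟩ := exists_nodes hlam hlD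
  have hD : 0 < D := hlam.trans_le hlD
  refine ⟨ε₀, c, 2 * D ^ 2 + (1 + D) * (2 * (1 + 2 * D) * (2 + 16 * D ^ 2) + C * (1 + 2 * D)), hε₀,
    hε₀', hc, by positivity, ?_⟩
  intro a p q b hap hpq hqb hbD N
  obtain ⟨X, hXc, hX, hXω⟩ := hnodes a p q b hap hpq hqb hbD N
  refine ⟨X, hXc, hX, ?_⟩
  intro β μ ν y₀ S δ O hβ hO hpμ hμq hpν hνq hy₀ hS hSl hSσ hδ hδS hδg
  obtain ⟨f, hfd, hfE, hf1, hf2⟩ := exists_continuation hβ hO hy₀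
  have hy₀0 : 0 ≤ y₀ := by
    split_ifs at hy₀ with h
    · exact hy₀.ge
    · rw [hy₀.2]
      exact div_nonneg Real.pi_pos.le ENNReal.toReal_nonneg
  refine ⟨f, hfd, hf1, hf2, fun z him hx₀ => ?_⟩
  have hsep := singularity_separation hpν hνq hε₀ hε₀' hδ hSσ hδg hy₀0
  have hδlam : 3 * δ ≤ lam := by
    have : ε₀ * S ≤ 1 / 480 * S := mul_le_mul_of_nonneg_right hε₀' hS.le
    linarith
  -- facts valid at every point of the neighbourhood
  have hreg : ∀ w : ℂ, |w.im| ≤ δ → (∃ x₀ ∈ Icc a p ∪ Icc q b, |w.re - x₀| ≤ 2 * δ) →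
      w ∈ cutPlane ν y₀ ∧ ‖w - ν‖ ≤ 2 * D ∧ ∀ y : ℝ, y₀ ≤ |y| →
        δ ≤ ‖w - (ν + y * I)‖ ∧ |y| / 2 ≤ ‖w - (ν + y * I)‖ := by
    intro w hwim ⟨x₀, hx₀, hwre⟩
    have hre : w.re ≤ p + 2 * δ ∨ q - 2 * δ ≤ w.re := by
      rw [abs_le] at hwre
      rcases hx₀ with h | h
      · left; linarith [h.2]
      · right; linarith [h.1]
    refine ⟨?_, ?_, fun y hy => le_norm_sub_singularity hsep hy hwim hre⟩
    · rcases hsep with h | h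
      · right
        linarith
      · left
        rcases hre with h' | h'
        · exact ne_of_lt (by linarith [h.1])
        · exact ne_of_gt (by linarith [h.2])
    · have h1 := norm_sub_ofReal_le (x := ν) hwre hwim
      have h2 : |x₀ - ν| ≤ D := by
        rw [abs_le]
        rcases hx₀ with h | h <;> constructor <;> linarith [h.1, h.2]
      linarith
  have hXreg : ∀ x ∈ X, |((x : ℝ) : ℂ).im| ≤ δ ∧
      ∃ x₀ ∈ Icc a p ∪ Icc q b, |((x : ℝ) : ℂ).re - x₀| ≤ 2 * δ := by
    intro x hx
    refine ⟨by simpa using hδ.le, x, ?_, by simpa using hδ.le⟩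
    exact (hX x hx).imp (fun h => ⟨h.1.le, h.2.le⟩) fun h => ⟨h.1.le, h.2.le⟩
  have hfX : ∀ x ∈ X, f x = O x := by
    intro x hx
    by_cases hβ' : β = ∞
    · refine hf2 hβ' x ?_
      rcases hX x hx with h | h
      · exact Or.inl ⟨h.2.trans_le hpμ, h.2.trans_le hpν⟩
      · exact Or.inr ⟨hμq.trans_lt h.1, hνq.trans_lt h.1⟩
    · exact hf1 hβ' x
  obtain ⟨hzcut, hzD, hzy⟩ := hreg z him hx₀
  refine ⟨hzcut, ?_⟩
  -- the interpolation error as a linear functional on the continued observable `f`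
  set ℓ : ℝ → ℂ := fun x => (Lagrange.basis X (fun x : ℝ => (x : ℂ)) x).eval z with hℓ
  set cc : Option X → ℂ := fun i => i.elim 1 fun x => -ℓ x with hcc
  set zz : Option X → ℂ := fun i => i.elim z fun x => ((x : ℝ) : ℂ) with hzz
  have hsum : ∀ g : ℂ → ℂ, ∑ i, cc i * g (zz i) = g z - ∑ x ∈ X, g x * ℓ x := fun g =>
    sum_option_eq z ℓ g
  have hXne : X.Nonempty := by
    rw [← Finset.card_pos, hXc]
    omega
  have hc0 : ∑ i, cc i = 0 := by
    have := hsum fun _ => 1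
    simp only [mul_one, one_mul] at this
    rw [this, hℓ, sum_basis_eval hXne, sub_self]
  have hzzreg : ∀ i, zz i ∈ cutPlane ν y₀ ∧ ‖zz i - ν‖ ≤ 2 * D ∧ ∀ y : ℝ, y₀ ≤ |y| →
        δ ≤ ‖zz i - (ν + y * I)‖ ∧ |y| / 2 ≤ ‖zz i - (ν + y * I)‖ := by
    rintro (_ | x)
    · exact ⟨hzcut, hzD, hzy⟩
    · exact hreg _ (hXreg x x.2).1 (hXreg x x.2).2
  have herr : f z - ((interp X O).map (algebraMap ℝ ℂ)).eval z = ∑ i, cc i * f (zz i) := by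
    rw [hsum, eval_map_interp]
    congr 1
    refine Finset.sum_congr rfl fun x hx => ?_
    rw [hfX x hx]
  rw [herr]
  have hδD : δ ≤ D := by linarith
  have hνμ : |ν - μ| ≤ D := by rw [abs_le]; constructor <;> linarith
  rcases Nat.eq_zero_or_pos N with hN | hN
  · -- interpolation at a single node does not reproduce affine functions and gains no decay in
    -- `y`, but no smallness is required
    have hX1 : X.card = 1 := by rw [hXc, hN]
    obtain ⟨x₁, rfl⟩ := Finset.card_eq_one.1 hX1
    have hℓ1 : ℓ x₁ = 1 := by
      change Polynomial.eval z (Lagrange.basis {x₁} _ x₁) = 1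
      rw [Lagrange.basis_singleton, Polynomial.eval_one]
    have hsum1 : ∀ g : ℂ → ℂ, ∑ i, cc i * g (zz i) = g z - g x₁ := fun g => by
      rw [hsum]
      simp [hℓ1]
    obtain ⟨-, hxD, hxy⟩ := hzzreg (some ⟨x₁, Finset.mem_singleton_self _⟩)
    have hxD' : ‖((x₁ : ℝ) : ℂ) - ν‖ ≤ 2 * D := hxD
    have hxy' : ∀ y : ℝ, y₀ ≤ |y| → δ ≤ ‖((x₁ : ℝ) : ℂ) - (ν + y * I)‖ ∧
        |y| / 2 ≤ ‖((x₁ : ℝ) : ℂ) - (ν + y * I)‖ := hxy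
    have h := hfE (Option _) cc zz (2 * D) (2 * (1 + 2 * D) * (2 + 16 * D ^ 2) / δ)
      (fun i => (hzzreg i).1) (by positivity) hc0 ?_ ?_
    · refine h.trans ?_
      rw [hN]
      simp only [Nat.cast_zero, mul_zero, neg_zero, Real.exp_zero, mul_one]
      rw [le_div_iff₀ hδ, add_mul, mul_assoc (1 + |ν - μ|), div_mul_cancel₀ _ hδ.ne']
      have a1 : 2 * D * δ ≤ 2 * D ^ 2 := by nlinarith
      have a2 : (1 + |ν - μ|) * (2 * (1 + 2 * D) * (2 + 16 * D ^ 2)) ≤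
          (1 + D) * (2 * (1 + 2 * D) * (2 + 16 * D ^ 2)) :=
        mul_le_mul_of_nonneg_right (by linarith) (by positivity)
      have a3 : 0 ≤ (1 + D) * (C * (1 + 2 * D)) := by positivity
      linarith
    · rw [hsum1 fun w => w - ν]
      have h1 : z - ν - ((x₁ : ℂ) - ν) = z - x₁ := by ring
      rw [h1]
      obtain ⟨x₀, hx₀, hzre⟩ := hx₀
      have h2 := norm_sub_ofReal_le (x := x₁) hzre him
      have h3 : |x₀ - x₁| ≤ D := by
        have h4 := hX x₁ (Finset.mem_singleton_self _)
        rw [abs_le]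
        rcases hx₀ with h | h <;> rcases h4 with h' | h' <;> constructor <;>
          linarith [h.1, h.2, h'.1, h'.2]
      linarith
    · intro y hy hy'
      have hya : y₀ ≤ |y| := by rwa [abs_of_pos hy]
      have hya' : y₀ ≤ |(-y)| := by rwa [abs_neg]
      have hker : ∀ w : ℂ, ‖w - ν‖ ≤ 2 * D → (∀ y : ℝ, y₀ ≤ |y| → δ ≤ ‖w - (ν + y * I)‖ ∧
          |y| / 2 ≤ ‖w - (ν + y * I)‖) → ‖(w - ν) / ((w - ν) ^ 2 + y ^ 2)‖ ≤
            (2 + 16 * D ^ 2) / δ / (1 + y ^ 2) ∧ ‖(w - ν) ^ 2 / ((w - ν) ^ 2 + y ^ 2)‖ ≤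
            2 * D * ((2 + 16 * D ^ 2) / δ / (1 + y ^ 2)) := by
        intro w hwD hwy
        have e1 : w - ν - y * I = w - (ν + y * I) := by ring
        have e2 : w - ν + y * I = w - (ν + (-y : ℝ) * I) := by push_cast; ring
        refine norm_kernel_le hδ hδD hwD hy ?_ ?_ ?_ ?_
        · rw [e1]; exact (hwy y hya).1
        · rw [e2]; exact (hwy (-y) hya').1
        · rw [e1]; simpa [abs_of_pos hy] using (hwy y hya).2
        · rw [e2]; simpa [abs_of_pos hy] using (hwy (-y) hya').2
      have k1 := hker z hzD hzy
      have k2 := hker x₁ hxD' hxy'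
      set Q := (2 + 16 * D ^ 2) / δ / (1 + y ^ 2) with hQ
      have hQ0 : 0 ≤ Q := by positivity
      have eQ : 2 * (1 + 2 * D) * (2 + 16 * D ^ 2) / δ / (1 + y ^ 2) = 2 * (1 + 2 * D) * Q := by
        rw [hQ]; ring
      rw [eQ, hsum1 fun w => (w - ν) / ((w - ν) ^ 2 + y ^ 2),
        hsum1 fun w => (w - ν) ^ 2 / ((w - ν) ^ 2 + y ^ 2)]
      have hDQ : 0 ≤ D * Q := by positivity
      constructor
      · refine (norm_sub_le _ _).trans ?_
        linarith [k1.1, k2.1]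
      · refine (norm_sub_le _ _).trans ?_
        linarith [k1.2, k2.2]
  · set e := Real.exp (-(c * S * N)) with he
    have he0 : 0 < e := Real.exp_pos _
    have h := hfE (Option _) cc zz 0 (C * (1 + 2 * D) * e / δ)
      (fun i => (hzzreg i).1) (by positivity) hc0 ?_ ?_
    · refine h.trans ?_
      rw [zero_add, div_mul_eq_mul_div, mul_div_assoc']
      refine div_le_div_of_nonneg_right ?_ hδ.le
      rw [← mul_assoc]
      refine mul_le_mul_of_nonneg_right ?_ he0.le
      have a2 : (1 + |ν - μ|) * (C * (1 + 2 * D)) ≤ (1 + D) * (C * (1 + 2 * D)) :=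
        mul_le_mul_of_nonneg_right (by linarith) (by positivity)
      have a3 : 0 ≤ (1 + D) * (2 * (1 + 2 * D) * (2 + 16 * D ^ 2)) := by positivity
      have a4 : 0 ≤ 2 * D ^ 2 := by positivity
      linarith
    · rw [hsum fun w => w - ν, hℓ, sum_mul_basis_eval (by rw [hXc]; omega), sub_self, norm_zero]
    · intro y hy hy'
      have hya : y₀ ≤ |y| := by rwa [abs_of_pos hy]
      have hya' : y₀ ≤ |(-y)| := by rwa [abs_neg]
      have hne : ∀ y : ℝ, y₀ ≤ |y| → ∀ i, zz i ≠ ν + y * I := fun y hy i h => by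
        have := ((hzzreg i).2.2 y hy).1
        rw [h, sub_self, norm_zero] at this
        linarith
      -- the functional on a Cauchy kernel is a quotient of values of the nodal polynomial
      have hΛ : ∀ y : ℝ, y₀ ≤ |y| → ‖∑ i, cc i * (zz i - (ν + y * I))⁻¹‖ ≤
          C * e / (1 + y ^ 2) * ‖z - (ν + y * I)‖⁻¹ := by
        intro y hy
        have hζX : ∀ x ∈ X, (ν : ℂ) + y * I ≠ x := fun x hx h => by
          exact hne y hy (some ⟨x, hx⟩) h.symm
        have hzζ : z ≠ ν + y * I := hne y hy none
        rw [hsum fun w => (w - (ν + y * I))⁻¹, hℓ, cauchy_sub_sum_basis hζX hzζ, norm_div, norm_mul,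
          norm_prod, norm_prod]
        have hB : 0 < ∏ x ∈ X, ‖(ν : ℂ) + y * I - x‖ :=
          Finset.prod_pos fun x hx => norm_pos_iff.2 (sub_ne_zero.2 (hζX x hx))
        have hσy : S ^ 2 ≤ y ^ 2 + (ν - p) * (q - ν) := by
          have : y₀ ^ 2 ≤ y ^ 2 := by
            rw [← sq_abs y]
            exact pow_le_pow_left₀ hy₀0 hy 2
          linarith
        have hr := hXω hN.ne' ν S δ y z hpν hνq hS hSl hσy hδ.le hδS hδg him hx₀
        rw [div_mul_eq_div_div, div_eq_mul_inv _ ‖z - (ν + y * I)‖]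
        refine mul_le_mul_of_nonneg_right ?_ (inv_nonneg.2 (norm_nonneg _))
        rw [div_le_div_iff₀ hB (by positivity)]
        exact hr
      have l1 := hΛ y hya
      have l2 := hΛ (-y) hya'
      obtain ⟨d1, d1'⟩ := hzy y hya
      obtain ⟨d2, d2'⟩ := hzy (-y) hya'
      rw [abs_of_pos hy] at d1'
      rw [abs_neg, abs_of_pos hy] at d2'
      rw [neg_sq] at l2
      set Q := C * e / (1 + y ^ 2) with hQ
      have hQ0 : 0 ≤ Q := by positivity
      obtain ⟨s1, s2⟩ := sum_kernel_eq (c := cc) (z := zz) hc0 (hne y hya) (hne (-y) hya')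
      have eQ : C * (1 + 2 * D) * e / δ / (1 + y ^ 2) = (1 + 2 * D) / δ * Q := by
        rw [hQ]; ring
      have hhalf : ‖(1 / 2 : ℂ)‖ = 1 / 2 := by norm_num
      have hy2 : ‖((y : ℂ) / (2 * I))‖ = y / 2 := by
        rw [norm_div, norm_mul, norm_I, norm_real, Real.norm_of_nonneg hy.le]
        norm_num
      rw [eQ, s1, s2]
      have hQδ : 0 ≤ Q / δ := by positivity
      constructor
      · rw [norm_mul, hhalf]
        have a1 : Q * ‖z - (ν + y * I)‖⁻¹ ≤ Q * δ⁻¹ :=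
          mul_le_mul_of_nonneg_left (inv_anti₀ hδ d1) hQ0
        have a2 : Q * ‖z - (ν + (-y : ℝ) * I)‖⁻¹ ≤ Q * δ⁻¹ :=
          mul_le_mul_of_nonneg_left (inv_anti₀ hδ d2) hQ0
        have a3 := norm_add_le (∑ i, cc i * (zz i - (ν + y * I))⁻¹)
          (∑ i, cc i * (zz i - (ν + (-y : ℝ) * I))⁻¹)
        have a4 : (1 + 2 * D) / δ * Q = Q * δ⁻¹ + 2 * (D * (Q / δ)) := by ring
        have a5 : 0 ≤ D * (Q / δ) := by positivity
        rw [a4]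
        linarith
      · rw [norm_neg, norm_mul, hy2]
        have a1 : Q * ‖z - (ν + y * I)‖⁻¹ ≤ Q * (y / 2)⁻¹ :=
          mul_le_mul_of_nonneg_left (inv_anti₀ (by positivity) d1') hQ0
        have a2 : Q * ‖z - (ν + (-y : ℝ) * I)‖⁻¹ ≤ Q * (y / 2)⁻¹ :=
          mul_le_mul_of_nonneg_left (inv_anti₀ (by positivity) d2') hQ0
        have a3 := norm_sub_le (∑ i, cc i * (zz i - (ν + y * I))⁻¹)
          (∑ i, cc i * (zz i - (ν + (-y : ℝ) * I))⁻¹)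
        have a4 : y / 2 * (2 * (Q * (y / 2)⁻¹)) = 2 * Q := by field_simp
        have a5 : Q ≤ D * (Q / δ) := by
          rw [mul_div_assoc', le_div_iff₀ hδ]
          nlinarith
        have a6 : (1 + 2 * D) / δ * Q = Q / δ + 2 * (D * (Q / δ)) := by ring
        rw [a6]
        calc _ ≤ y / 2 * (2 * (Q * (y / 2)⁻¹)) :=
              mul_le_mul_of_nonneg_left (by linarith) (by positivity)
          _ = 2 * Q := a4
          _ ≤ _ := by linarith

end Error

/-! ### Estimates for the local observables -/

section Local

open Complex

variable {d Nb : ℕ} {S : Type u} {h₀ γ₀ : ℝ} {Λ : Type v} {M : TBModel d Nb S h₀ γ₀} {r₀ : ℝ}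
  {c : Config d S Λ}

/-- The constant in the derivative estimate, without the powers of the width `δ`. -/
def derivConst (d Nb : ℕ) (h₀ γ₀ r₀ : ℝ) : ℝ :=
  (h₀ * Real.exp (γ₀ * r₀) + 1) *
    ((Nb * packConst.{v} d (γ₀ / 4) r₀) ^ 2 * packConst.{v} d (γ₀ / 4) r₀)

theorem derivConst_nonneg (d Nb : ℕ) {h₀ : ℝ} (hh₀ : 0 ≤ h₀) (γ₀ r₀ : ℝ) :
    0 ≤ derivConst.{v} d Nb h₀ γ₀ r₀ := by
  have := packConst_pos.{v} d (γ₀ / 4) r₀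
  unfold derivConst
  positivity

theorem eval_map_ofReal (q : Polynomial ℝ) (x : ℝ) :
    (q.map (algebraMap ℝ ℂ)).eval (x : ℂ) = (q.eval x : ℝ) :=
  Polynomial.eval_map_apply (f := algebraMap ℝ ℂ) (p := q) x

/-- The derivative estimate for contours that consist of the boundaries of at most two rectangles,
each point of `U` being enclosed by exactly one of them, with the error of a holomorphic
continuation bounded by `E` on the rectangles. -/
theorem norm_fderiv_localObs_sub_le_of_rect (hγ₀ : 0 < γ₀) (hh₀ : 0 ≤ h₀) (hr₀ : 0 < r₀)
    (hc : c.IsRegular r₀) {O : ℝ → ℝ} {q : Polynomial ℝ} {U : Set ℝ} (hU : IsOpen U)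
    (hσ : realSpectrum (hamiltonian M c) ⊆ U) (hO : ContinuousOn O U) {ι : Type} [Fintype ι]
    (hι : Fintype.card ι ≤ 2) {l r : ι → ℝ} {f : ℂ → ℂ} {E δ η B : ℝ} (hδ : 0 < δ) (hE : 0 ≤ E)
    (hlr : ∀ i, l i ≤ r i) (hB : ∀ i, r i - l i + 2 * δ ≤ B) (hB0 : 0 ≤ B)
    (hf : ∀ i, DifferentiableOn ℂ f (Icc (l i) (r i) ×ℂ Icc (-δ) δ)) (hfO : ∀ x ∈ U, f x = O x)
    (hfE : ∀ i, ∀ z ∈ Icc (l i) (r i) ×ℂ Icc (-δ) δ,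
      ‖f z - (q.map (algebraMap ℝ ℂ)).eval z‖ ≤ E)
    (hdist : ∀ x ∈ U, ∀ i, δ ≤ |l i - x| ∧ δ ≤ |r i - x|)
    (hin : ∀ x ∈ U, ∃ i, l i < x ∧ x < r i ∧ ∀ j ≠ i, x ∉ Icc (l j) (r j))
    (hη : 0 ≤ η) (hηγ : η ≤ γ₀ / 8) (hηδ : η * weightConst.{v} d Nb h₀ γ₀ r₀ ≤ δ / 2) (ℓ m : Λ) :
    DifferentiableAt ℝ (fun y => localObs M O (c.move m y) ℓ) (c.coord m) ∧
    DifferentiableAt ℝ (fun y => localPoly M q (c.move m y) ℓ) (c.coord m) ∧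
    ‖fderiv ℝ (fun y => localObs M O (c.move m y) ℓ) (c.coord m)
      - fderiv ℝ (fun y => localPoly M q (c.move m y) ℓ) (c.coord m)‖ ≤
      Nb * (8 * (B * E * ((2 / δ) ^ 2 * derivConst.{v} d Nb h₀ γ₀ r₀))) *
        Real.exp (-η * c.r ℓ m) := by
  classical
  set e : ℂ → ℂ := fun z => f z - (q.map (algebraMap ℝ ℂ)).eval z with he
  have hed : ∀ i, DifferentiableOn ℂ e (Icc (l i) (r i) ×ℂ Icc (-δ) δ) := fun i =>
    (hf i).sub (Polynomial.differentiable _).differentiableOn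
  set γ : ι × Fin 4 → ℝ → ℂ := fun j => rectSide (l j.1) (r j.1) δ j.2 with hγdef
  set ψ : ι × Fin 4 → ℝ → ℂ := fun j t => (2 * Real.pi * I)⁻¹ * rectVelocity (l j.1) (r j.1) δ j.2 *
    e (rectSide (l j.1) (r j.1) δ j.2 t) with hψdef
  have hmem : ∀ j : ι × Fin 4, ∀ t ∈ Icc (0 : ℝ) 1, γ j t ∈ Icc (l j.1) (r j.1) ×ℂ Icc (-δ) δ :=
    fun j t ht => rectSide_mem (hlr j.1) hδ.le j.2 ht
  have hγc : ∀ j, ContinuousOn (γ j) (Icc 0 1) := fun j => (continuous_rectSide _ _ _ _).continuousOn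
  have hpi : ‖(2 * Real.pi * I : ℂ)⁻¹‖ ≤ 1 := by
    rw [norm_inv, norm_mul, norm_mul, norm_I, norm_real, Real.norm_of_nonneg Real.pi_pos.le]
    refine inv_le_one_of_one_le₀ ?_
    norm_num
    linarith [Real.pi_gt_three]
  have h := norm_fderiv_localObs_sub_le (M := M) (O := O) (q := q) hγ₀ hh₀ hr₀ hc hU hσ hO (γ := γ)
    (ψ := ψ) (Ψ := B * E) hδ hγc
    (fun j => continuousOn_const.mul ((hed j.1).continuousOn.comp (hγc j) (hmem j)))
    (fun j t ht => by
      rw [hψdef]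
      simp only [norm_mul]
      have h1 := (norm_rectVelocity_le (hlr j.1) hδ.le j.2).trans (hB j.1)
      have h2 := hfE j.1 _ (hmem j t ht)
      have h3 : ‖(2 * Real.pi * I : ℂ)⁻¹‖ * ‖rectVelocity (l j.1) (r j.1) δ j.2‖ ≤ 1 * B :=
        mul_le_mul hpi h1 (norm_nonneg _) zero_le_one
      rw [one_mul] at h3
      exact mul_le_mul h3 h2 (norm_nonneg _) hB0)
    (fun j t _ x hx => le_norm_rectSide_sub hδ.le (hdist x hx j.1).1 (hdist x hx j.1).2 j.2 t)
    (fun x hx => by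
      obtain ⟨i, hl, hr, hij⟩ := hin x hx
      have h1 : ((O x - q.eval x : ℝ) : ℂ) = e x := by
        rw [he]
        simp only [hfO x hx, eval_map_ofReal]
        push_cast
        rfl
      rw [h1, Fintype.sum_prod_type, Finset.sum_eq_single i]
      · exact (sum_rectSide_cauchy hl hr hδ (hed i)).symm
      · intro j _ hj
        exact sum_rectSide_cauchy_eq_zero (hlr j) (hij j hj) hδ.le (hed j)
      · exact fun h => absurd (Finset.mem_univ i) h) hη hηγ hηδ ℓ m
  refine ⟨h.1, h.2.1, h.2.2.trans ?_⟩
  have hd := derivConst_nonneg.{v} d Nb hh₀ γ₀ r₀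
  have hcard : (Fintype.card (ι × Fin 4) : ℝ) ≤ 8 := by
    rw [Fintype.card_prod, Fintype.card_fin]
    have : Fintype.card ι * 4 ≤ 8 := by omega
    exact_mod_cast this
  refine mul_le_mul_of_nonneg_right ?_ (Real.exp_pos _).le
  refine mul_le_mul_of_nonneg_left ?_ (Nat.cast_nonneg Nb)
  rw [mul_assoc ((2 / δ) ^ 2)]
  exact mul_le_mul_of_nonneg_right hcard (by
    refine mul_nonneg (mul_nonneg hB0 hE) (mul_nonneg (sq_nonneg _) hd))

/-- Error estimates for the local observables and their derivatives, for all admissible widths `δ`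
of the neighbourhood of the bands and all admissible rates `s`. -/
theorem exists_local_estimates (lam D : ℝ) :
    ∃ ε₀ k K : ℝ, 0 < ε₀ ∧ ε₀ ≤ 1 / 480 ∧ 0 < k ∧ 0 < K ∧ ∀ a p q b : ℝ, 0 < lam →
      lam ≤ p - a → p ≤ q → lam ≤ b - q → b - a ≤ D → ∀ N : ℕ, ∃ X : Finset ℝ, X.card = N + 1 ∧
        (∀ x ∈ X, x ∈ Ioo a p ∪ Ioo q b) ∧
        ∀ (β : ℝ≥0∞) (μ ν y₀ s δ : ℝ) (O : ℝ → ℝ), 0 < β →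
          (O = fermiDirac β μ ∨ O = grandPotential β μ) → p ≤ μ → μ ≤ q → p ≤ ν → ν ≤ q →
          (if β = ∞ then y₀ = 0 else ν = μ ∧ y₀ = Real.pi / β.toReal) → 0 < s → s ≤ lam / 4 →
          s ^ 2 ≤ y₀ ^ 2 + (ν - p) * (q - ν) → 0 < δ → δ ≤ ε₀ * s →
          δ * (δ + (q - p)) ≤ ε₀ * s ^ 2 →
          ∀ (d Nb : ℕ) (S : Type u) (h₀ γ₀ r₀ η : ℝ) (M : TBModel d Nb S h₀ γ₀) (Λ : Type v)
            (c : Config d S Λ), 0 < γ₀ → 0 ≤ h₀ → 0 < r₀ → c.IsRegular r₀ →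
            realSpectrum (hamiltonian M c) ⊆ Icc a p ∪ Icc q b →
            (β = ∞ → μ ∉ realSpectrum (hamiltonian M c)) →
            0 ≤ η → η ≤ γ₀ / 8 → η * weightConst.{v} d Nb h₀ γ₀ r₀ ≤ δ / 2 → ∀ ℓ : Λ,
            |localObs M O c ℓ - localPoly M (interp X O) c ℓ| ≤
              Nb * (K / δ * Real.exp (-(k * s * N))) ∧
            ∀ m : Λ,
              DifferentiableAt ℝ (fun y => localObs M O (c.move m y) ℓ) (c.coord m) ∧
              DifferentiableAt ℝ (fun y => localPoly M (interp X O) (c.move m y) ℓ) (c.coord m) ∧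
              ‖fderiv ℝ (fun y => localObs M O (c.move m y) ℓ) (c.coord m)
                - fderiv ℝ (fun y => localPoly M (interp X O) (c.move m y) ℓ) (c.coord m)‖ ≤
                Nb * (8 * (3 * D * (K / δ * Real.exp (-(k * s * N))) *
                  ((2 / δ) ^ 2 * derivConst.{v} d Nb h₀ γ₀ r₀))) * Real.exp (-η * c.r ℓ m) := by
  by_cases hlamD : 0 < lam ∧ lam ≤ D
  swap
  · refine ⟨1 / 480, 1, 1, by norm_num, le_rfl, one_pos, one_pos, ?_⟩
    intro a p q b hlam hap hpq hqb hbD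
    exact absurd ⟨hlam, by linarith⟩ hlamD
  obtain ⟨hlam, hlD⟩ := hlamD
  obtain ⟨ε₀, k, K, hε₀, hε₀', hk, hK, hmain⟩ := exists_interpolation_error hlam hlD
  refine ⟨ε₀, k, K, hε₀, hε₀', hk, hK, ?_⟩
  intro a p q b _ hap hpq hqb hbD N
  obtain ⟨X, hXc, hX, hXe⟩ := hmain a p q b hap hpq hqb hbD N
  refine ⟨X, hXc, hX, ?_⟩
  intro β μ ν y₀ s δ O hβ hO hpμ hμq hpν hνq hy₀ hs hsl hsσ hδ hδs hδg d Nb S h₀ γ₀ r₀ η M Λ c hγ₀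
    hh₀ hr₀ hc hσ hμσ hη hηγ hηδ ℓ
  obtain ⟨f, hfd, hf1, hf2, hfE⟩ :=
    hXe β μ ν y₀ s δ O hβ hO hpμ hμq hpν hνq hy₀ hs hsl hsσ hδ hδs hδg
  have hD : 0 < D := hlam.trans_le hlD
  set E := K / δ * Real.exp (-(k * s * N)) with hEdef
  have hE : 0 ≤ E := by positivity
  have hδlam : 3 * δ ≤ lam := by
    have : ε₀ * s ≤ 1 / 480 * s := mul_le_mul_of_nonneg_right hε₀' hs.le
    linarith
  -- at zero temperature the gap is wide compared with `δ`
  have hinf : β = ∞ → 3 * δ ≤ ν - p ∧ 3 * δ ≤ q - ν := by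
    intro hβ'
    rw [if_pos hβ'] at hy₀
    rcases singularity_separation hpν hνq hε₀ hε₀' hδ hsσ hδg hy₀.ge with h | h
    · linarith
    · exact h
  -- a neighbourhood of the spectrum on which the continuation coincides with the observable; at zero
  -- temperature this fails between `μ` and the line `Re z = ν`
  set U : Set ℝ := (Ioo (a - δ) (p + δ) ∩ {x | β = ∞ → x < μ}) ∪
    (Ioo (q - δ) (b + δ) ∩ {x | β = ∞ → μ < x}) with hU
  have hUo : IsOpen U := by
    by_cases hβ' : β = ∞
    · simp only [hU, hβ', forall_const]
      exact (isOpen_Ioo.inter isOpen_Iio).union (isOpen_Ioo.inter isOpen_Ioi)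
    · simp only [hU, hβ', IsEmpty.forall_iff, ofPred_true, inter_univ]
      exact isOpen_Ioo.union isOpen_Ioo
  have hUcases : ∀ x ∈ U, x ∈ Ioo (a - δ) (p + δ) ∨ x ∈ Ioo (q - δ) (b + δ) := fun x hx =>
    hx.imp (fun h => h.1) fun h => h.1
  have hσU : realSpectrum (hamiltonian M c) ⊆ U := by
    intro x hx
    rcases hσ hx with h | h
    · left
      refine ⟨⟨by linarith [h.1], by linarith [h.2]⟩, fun hβ' => ?_⟩
      exact lt_of_le_of_ne (h.2.trans hpμ) fun h0 => hμσ hβ' (h0 ▸ hx)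
    · right
      refine ⟨⟨by linarith [h.1], by linarith [h.2]⟩, fun hβ' => ?_⟩
      exact lt_of_le_of_ne (hμq.trans h.1) fun h0 => hμσ hβ' (h0 ▸ hx)
  have hfU : ∀ x ∈ U, f x = O x := by
    intro x hx
    by_cases hβ' : β = ∞
    · have h3 := hinf hβ'
      refine hf2 hβ' x ?_
      rcases hx with h | h
      · exact Or.inl ⟨h.2 hβ', by linarith [h.1.2, h3.1]⟩
      · exact Or.inr ⟨h.2 hβ', by linarith [h.1.1, h3.2]⟩
    · exact hf1 hβ' x
  have hUcut : ∀ x ∈ U, (x : ℂ) ∈ cutPlane ν y₀ := by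
    intro x hx
    refine (hfE x (by simpa using hδ.le) ?_).1
    simp only [ofReal_re]
    rcases hUcases x hx with h | h
    · rcases le_total x a with h1 | h1
      · refine ⟨a, Or.inl ⟨le_rfl, by linarith⟩, ?_⟩
        rw [abs_le]; constructor <;> linarith [h.1]
      rcases le_total x p with h2 | h2
      · exact ⟨x, Or.inl ⟨h1, h2⟩, by simpa using hδ.le⟩
      · refine ⟨p, Or.inl ⟨by linarith, le_rfl⟩, ?_⟩
        rw [abs_le]; constructor <;> linarith [h.2]
    · rcases le_total x q with h1 | h1
      · refine ⟨q, Or.inr ⟨le_rfl, by linarith⟩, ?_⟩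
        rw [abs_le]; constructor <;> linarith [h.1]
      rcases le_total x b with h2 | h2
      · exact ⟨x, Or.inr ⟨h1, h2⟩, by simpa using hδ.le⟩
      · refine ⟨b, Or.inr ⟨by linarith, le_rfl⟩, ?_⟩
        rw [abs_le]; constructor <;> linarith [h.2]
  have hOU : ContinuousOn O U := by
    have h1 : ContinuousOn (fun x : ℝ => (f x).re) U :=
      continuous_re.comp_continuousOn
        (hfd.continuousOn.comp continuous_ofReal.continuousOn hUcut)
    refine h1.congr fun x hx => ?_
    simp only [hfU x hx, ofReal_re]
  constructor
  · refine abs_localObs_sub_localPoly_le hγ₀ hr₀ hc (hOU.mono hσU) hE (fun x hx => ?_) ℓ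
    have h1 := (hfE x (by simpa using hδ.le) ⟨x, hσ hx, by simpa using hδ.le⟩).2
    rw [hfU x (hσU hx), eval_map_ofReal, ← ofReal_sub, norm_real] at h1
    exact h1
  · intro m
    have hrect : ∀ l r : ℝ, (∀ x ∈ Icc l r, ∃ x₀ ∈ Icc a p ∪ Icc q b, |x - x₀| ≤ 2 * δ) →
        DifferentiableOn ℂ f (Icc l r ×ℂ Icc (-δ) δ) ∧ ∀ z ∈ Icc l r ×ℂ Icc (-δ) δ,
          ‖f z - ((interp X O).map (algebraMap ℝ ℂ)).eval z‖ ≤ E := by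
      intro l r h
      have h1 := fun z (hz : z ∈ Icc l r ×ℂ Icc (-δ) δ) =>
        hfE z (abs_le.2 (mem_reProdIm.1 hz).2) (h _ (mem_reProdIm.1 hz).1)
      exact ⟨hfd.mono fun z hz => (h1 z hz).1, fun z hz => (h1 z hz).2⟩
    have hleft : ∀ x ∈ Icc (a - 2 * δ) (p + 2 * δ),
        ∃ x₀ ∈ Icc a p ∪ Icc q b, |x - x₀| ≤ 2 * δ := by
      intro x hx
      rcases le_total x a with h1 | h1
      · refine ⟨a, Or.inl ⟨le_rfl, by linarith⟩, ?_⟩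
        rw [abs_le]; constructor <;> linarith [hx.1]
      rcases le_total x p with h2 | h2
      · exact ⟨x, Or.inl ⟨h1, h2⟩, by simpa using hδ.le⟩
      · refine ⟨p, Or.inl ⟨by linarith, le_rfl⟩, ?_⟩
        rw [abs_le]; constructor <;> linarith [hx.2]
    have hright : ∀ x ∈ Icc (q - 2 * δ) (b + 2 * δ),
        ∃ x₀ ∈ Icc a p ∪ Icc q b, |x - x₀| ≤ 2 * δ := by
      intro x hx
      rcases le_total x q with h1 | h1
      · refine ⟨q, Or.inr ⟨le_rfl, by linarith⟩, ?_⟩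
        rw [abs_le]; constructor <;> linarith [hx.1]
      rcases le_total x b with h2 | h2
      · exact ⟨x, Or.inr ⟨h1, h2⟩, by simpa using hδ.le⟩
      · refine ⟨b, Or.inr ⟨by linarith, le_rfl⟩, ?_⟩
        rw [abs_le]; constructor <;> linarith [hx.2]
    rcases le_or_gt (q - p) (4 * δ) with hg | hg
    · -- the neighbourhoods of the two bands overlap: one rectangle around both bands
      have hone : ∀ x ∈ Icc (a - 2 * δ) (b + 2 * δ),
          ∃ x₀ ∈ Icc a p ∪ Icc q b, |x - x₀| ≤ 2 * δ := by
        intro x hx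
        rcases le_total x (p + 2 * δ) with h | h
        · exact hleft x ⟨hx.1, h⟩
        · exact hright x ⟨by linarith, hx.2⟩
      have h1 := hrect _ _ hone
      refine norm_fderiv_localObs_sub_le_of_rect (M := M) hγ₀ hh₀ hr₀ hc hUo hσU hOU (ι := Unit)
        (by simp) (l := fun _ => a - 2 * δ) (r := fun _ => b + 2 * δ) (f := f) hδ hE
        (fun _ => by linarith) (fun _ => by linarith) (by positivity) (fun _ => h1.1) hfU
        (fun _ => h1.2) (fun x hx _ => ?_) (fun x hx => ⟨(), ?_⟩) hη hηγ hηδ ℓ m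
      · rw [le_abs, le_abs]
        rcases hUcases x hx with h | h
        · exact ⟨Or.inr (by linarith [h.1]), Or.inl (by linarith [h.2])⟩
        · exact ⟨Or.inr (by linarith [h.1]), Or.inl (by linarith [h.2])⟩
      · refine ⟨?_, ?_, fun j hj => absurd rfl hj⟩
        · rcases hUcases x hx with h | h <;> linarith [h.1]
        · rcases hUcases x hx with h | h <;> linarith [h.2]
    · -- one rectangle around each band
      have h1 := hrect _ _ hleft
      have h2 := hrect _ _ hright
      refine norm_fderiv_localObs_sub_le_of_rect (M := M) hγ₀ hh₀ hr₀ hc hUo hσU hOU (ι := Bool)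
        (by simp) (l := fun i => if i then a - 2 * δ else q - 2 * δ)
        (r := fun i => if i then p + 2 * δ else b + 2 * δ) (f := f) (B := 3 * D) hδ hE
        ?_ ?_ (by positivity) ?_ hfU ?_ (fun x hx => ?_) (fun x hx => ?_) hη hηγ hηδ ℓ m
      · rintro (_ | _) <;> simp <;> linarith
      · rintro (_ | _) <;> simp <;> linarith
      · rintro (_ | _)
        · simpa using h2.1
        · simpa using h1.1
      · rintro (_ | _)
        · simpa using h2.2
        · simpa using h1.2
      · rintro (_ | _)
        · simp only [Bool.false_eq_true, if_false, le_abs]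
          rcases hUcases x hx with h | h
          · exact ⟨Or.inl (by linarith [h.2]), Or.inl (by linarith [h.2])⟩
          · exact ⟨Or.inr (by linarith [h.1]), Or.inl (by linarith [h.2])⟩
        · simp only [if_true, le_abs]
          rcases hUcases x hx with h | h
          · exact ⟨Or.inr (by linarith [h.1]), Or.inl (by linarith [h.2])⟩
          · exact ⟨Or.inr (by linarith [h.1]), Or.inr (by linarith [h.1])⟩
      · rcases hUcases x hx with h | h
        · refine ⟨true, ?_, ?_, ?_⟩
          · simp only [if_true]; linarith [h.1]
          · simp only [if_true]; linarith [h.2]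
          · rintro (_ | _) hj
            · simp only [Bool.false_eq_true, if_false]
              exact fun h' => by linarith [h'.1, h.2]
            · exact absurd rfl hj
        · refine ⟨false, ?_, ?_, ?_⟩
          · simp only [Bool.false_eq_true, if_false]; linarith [h.1]
          · simp only [Bool.false_eq_true, if_false]; linarith [h.2]
          · rintro (_ | _) hj
            · exact absurd rfl hj
            · simp only [if_true]
              exact fun h' => by linarith [h'.2, h.1]

end Local

/-! ### Length scales of a spectral window -/

namespace Window

/-- The midpoint of the gap. -/
def center (W : Window) : ℝ := (W.maxMinus + W.minPlus) / 2

/-- The distance of the outer endpoints. -/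
def diam (W : Window) : ℝ := W.maxPlus - W.minMinus

open Classical in
/-- A lower bound for the lengths of the two bands which, for narrow gaps, only depends on the outer
endpoints and on the midpoint of the gap. -/
def innerLength (W : Window) : ℝ :=
  if min (W.center - W.minMinus) (W.maxPlus - W.center) / 2 ≤
      min (W.maxMinus - W.minMinus) (W.maxPlus - W.minPlus)
  then min (W.center - W.minMinus) (W.maxPlus - W.center) / 2
  else min (W.maxMinus - W.minMinus) (W.maxPlus - W.minPlus)

theorem innerLength_pos (W : Window) : 0 < W.innerLength := by
  have h1 := W.minus_lt
  have h2 := W.plus_lt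
  have h3 := W.gap_nonneg
  unfold innerLength center
  split_ifs
  · exact half_pos (lt_min (by linarith) (by linarith))
  · exact lt_min (by linarith) (by linarith)

theorem innerLength_le (W : Window) : W.innerLength ≤ W.maxMinus - W.minMinus ∧
    W.innerLength ≤ W.maxPlus - W.minPlus := by
  rw [← le_min_iff]
  unfold innerLength
  split_ifs with h
  · exact h
  · exact le_rfl

theorem innerLength_le_diam (W : Window) : W.innerLength ≤ W.diam := by
  have h1 := W.innerLength_le.1
  have h2 := W.plus_lt
  have h3 := W.gap_nonneg
  unfold diam
  linarith

theorem gap_nonneg' (W : Window) : 0 ≤ W.gap := sub_nonneg.2 W.gap_nonneg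

/-- The real part of the singularities of the continued observable. At zero temperature the
observable is piecewise holomorphic, and the line separating the pieces is put in the middle of the
gap. -/
def lineRe (W : Window) (μ : ℝ) (β : ℝ≥0∞) : ℝ :=
  open Classical in if β = ∞ then W.center else μ

/-- The distance of the singularities of the continued observable from the real axis. -/
def lineIm (β : ℝ≥0∞) : ℝ :=
  open Classical in if β = ∞ then 0 else Real.pi / β.toReal

/-- The real part of `-(ζ - p) (ζ - q)` at the singularity `ζ` of the continued observable closest
to the real axis, where `p` and `q` are the inner band edges. Its square root is the rate of
interpolation, up to a constant; the root is comparable to `gap + β⁻¹` in the symmetric case. -/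
def sepSq (W : Window) (μ : ℝ) (β : ℝ≥0∞) : ℝ :=
  lineIm β ^ 2 + (W.lineRe μ β - W.maxMinus) * (W.minPlus - W.lineRe μ β)

/-- The rate of interpolation, up to a constant: the square root of `sepSq`, cut off at the scale of
the bands. -/
def sep (W : Window) (μ : ℝ) (β : ℝ≥0∞) : ℝ := min (Real.sqrt (W.sepSq μ β)) (W.innerLength / 4)

/-- The width of the neighbourhood of the bands that contains the contour. -/
def width (W : Window) (ε : ℝ) (μ : ℝ) (β : ℝ≥0∞) : ℝ :=
  ε * W.sep μ β ^ 2 / (W.gap + W.sep μ β)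

variable {W : Window} {μ : ℝ} {β : ℝ≥0∞}

theorem lineRe_mem (h1 : W.maxMinus ≤ μ) (h2 : μ ≤ W.minPlus) :
    W.maxMinus ≤ W.lineRe μ β ∧ W.lineRe μ β ≤ W.minPlus := by
  have := W.gap_nonneg
  unfold lineRe center
  split_ifs
  · constructor <;> linarith
  · exact ⟨h1, h2⟩

theorem lineRe_lineIm :
    if β = ∞ then lineIm β = 0 else W.lineRe μ β = μ ∧ lineIm β = Real.pi / β.toReal := by
  unfold lineRe lineIm
  split_ifs
  · rfl
  · exact ⟨rfl, rfl⟩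

theorem sepSq_pos (h1 : W.maxMinus ≤ μ) (h2 : μ ≤ W.minPlus) (hβ : 0 < β)
    (h : β < ∞ ∨ 0 < W.gap) : 0 < W.sepSq μ β := by
  have h3 := W.gap_nonneg
  unfold sepSq lineRe lineIm center
  split_ifs with hβ'
  · have h4 : 0 < W.minPlus - W.maxMinus := h.resolve_left (by simp [hβ'])
    nlinarith
  · have h4 := ENNReal.toReal_pos hβ.ne' hβ'
    have h5 : 0 < Real.pi / β.toReal := div_pos Real.pi_pos h4
    have h6 : 0 ≤ (μ - W.maxMinus) * (W.minPlus - μ) :=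
      mul_nonneg (by linarith) (by linarith)
    positivity

theorem sep_pos (h : 0 < W.sepSq μ β) : 0 < W.sep μ β :=
  lt_min (Real.sqrt_pos.2 h) (by linarith [W.innerLength_pos])

theorem sep_le : W.sep μ β ≤ W.innerLength / 4 := min_le_right _ _

theorem sep_sq_le (h : 0 < W.sepSq μ β) : W.sep μ β ^ 2 ≤ W.sepSq μ β := by
  rw [← Real.sq_sqrt h.le]
  exact pow_le_pow_left₀ (sep_pos h).le (min_le_left _ _) 2

theorem width_pos {ε : ℝ} (hε : 0 < ε) (h : 0 < W.sepSq μ β) : 0 < W.width ε μ β := by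
  have h1 := sep_pos h
  have h2 := W.gap_nonneg'
  unfold width
  positivity

theorem width_le {ε : ℝ} (hε : 0 < ε) (h : 0 < W.sepSq μ β) : W.width ε μ β ≤ ε * W.sep μ β := by
  have h1 := sep_pos h
  have h2 := W.gap_nonneg'
  unfold width
  rw [div_le_iff₀ (by positivity)]
  have : 0 ≤ ε * W.sep μ β * W.gap := by positivity
  linarith

theorem width_mul_le {ε : ℝ} (hε : 0 < ε) (hε' : ε ≤ 1) (h : 0 < W.sepSq μ β) :
    W.width ε μ β * (W.width ε μ β + W.gap) ≤ ε * W.sep μ β ^ 2 := by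
  have h1 := sep_pos h
  have h2 := W.gap_nonneg'
  have h3 : W.width ε μ β ≤ W.sep μ β :=
    (width_le hε h).trans (mul_le_of_le_one_left h1.le hε')
  calc W.width ε μ β * (W.width ε μ β + W.gap) ≤ W.width ε μ β * (W.gap + W.sep μ β) :=
        mul_le_mul_of_nonneg_left (by linarith) (width_pos hε h).le
    _ = _ := by
        unfold width
        field_simp

theorem sepSq_eq_of_symm (hsymm : μ - W.maxMinus = W.minPlus - μ) :
    W.sepSq μ β = (Real.pi * (β⁻¹).toReal) ^ 2 + (W.gap / 2) ^ 2 := by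
  unfold sepSq lineRe lineIm center gap
  split_ifs with h
  · rw [h]
    simp
    ring
  · rw [ENNReal.toReal_inv]
    have h1 : W.minPlus = 2 * μ - W.maxMinus := by linarith
    rw [h1]
    ring

/-- For a narrow gap symmetric about `μ`, the length scale of the bands is constant and the
separation is comparable to `gap + β⁻¹`. -/
theorem scales_of_symm {s : ℝ}
    (hsymm : μ - W.maxMinus = W.minPlus - μ) (hs : s = W.gap + (β⁻¹).toReal)
    (hs0 : 0 < s) (hs1 : s < min (μ - W.minMinus) (W.maxPlus - μ) / 32) :
    W.innerLength = min (μ - W.minMinus) (W.maxPlus - μ) / 2 ∧ 0 < W.sepSq μ β ∧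
      s / 4 ≤ W.sep μ β ∧ W.sep μ β ≤ 4 * s ∧ W.gap ≤ s := by
  set ρ := min (μ - W.minMinus) (W.maxPlus - μ) with hρ
  have hρ1 : ρ ≤ μ - W.minMinus := min_le_left _ _
  have hρ2 : ρ ≤ W.maxPlus - μ := min_le_right _ _
  have hτ : 0 ≤ (β⁻¹).toReal := ENNReal.toReal_nonneg
  have hg := W.gap_nonneg'
  have hgs : W.gap ≤ s := by linarith
  have hgdef : W.gap = W.minPlus - W.maxMinus := rfl
  have hcen : W.center = μ := by
    unfold center
    linarith
  have hlen : W.innerLength = ρ / 2 := by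
    unfold innerLength
    rw [hcen, ← hρ, if_pos]
    exact le_min (by linarith) (by linarith)
  have hsq := sepSq_eq_of_symm (β := β) hsymm
  have hpi := Real.pi_gt_three
  have hpi4 := Real.pi_le_four
  have hlow : (s / 4) ^ 2 ≤ W.sepSq μ β := by
    have h1 : (β⁻¹).toReal ^ 2 ≤ (Real.pi * (β⁻¹).toReal) ^ 2 :=
      pow_le_pow_left₀ hτ (le_mul_of_one_le_left hτ (by linarith)) 2
    rw [hsq, hs]
    nlinarith [sq_nonneg (W.gap - (β⁻¹).toReal)]
  have hup : W.sepSq μ β ≤ (4 * s) ^ 2 := by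
    have h1 : (Real.pi * (β⁻¹).toReal) ^ 2 ≤ (4 * (β⁻¹).toReal) ^ 2 :=
      pow_le_pow_left₀ (by positivity) (mul_le_mul_of_nonneg_right hpi4 hτ) 2
    rw [hsq, hs]
    nlinarith [mul_nonneg hg hτ]
  have hlow' : s / 4 ≤ Real.sqrt (W.sepSq μ β) := Real.le_sqrt_of_sq_le hlow
  have hup' : Real.sqrt (W.sepSq μ β) ≤ 4 * s := by
    rw [Real.sqrt_le_left (by linarith)]
    exact hup
  refine ⟨hlen, lt_of_lt_of_le (by positivity) hlow, le_min hlow' ?_, (min_le_left _ _).trans hup',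
    hgs⟩
  rw [hlen]
  linarith

end Window

end TightBinding

end

theorem mainTheorem1 :
    -- the interpolation sets depend only on the two intervals
    ∃ X : TightBinding.Window → ℕ → Finset ℝ,
      (∀ (W : TightBinding.Window) (N : ℕ),
        (X W N).card = N + 1 ∧ (X W N : Set ℝ) ⊆ W.bands) ∧
      ∀ (d Nb : ℕ) (h₀ γ₀ r₀ : ℝ), 0 < h₀ → 0 < γ₀ → 0 < r₀ →
        -- the constants, as functions of the intervals, the chemical potential and `β`
        ∃ (γN : TightBinding.Window → ℝ → ℝ≥0∞ → ℕ → ℝ)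
          (C₁ C₂ γ η : TightBinding.Window → ℝ → ℝ≥0∞ → ℝ),
          (∀ (W : TightBinding.Window) (μ : ℝ) (β : ℝ≥0∞),
            W.maxMinus ≤ μ → μ ≤ W.minPlus → 0 < β → (β < ∞ ∨ 0 < W.gap) →
            (∀ N, 0 < γN W μ β N) ∧
            Tendsto (γN W μ β) atTop (𝓝 (γ W μ β)) ∧ 0 < γ W μ β ∧
            0 < C₁ W μ β ∧ 0 < C₂ W μ β ∧ 0 < η W μ β ∧
            ∀ (S : Type u) (M : TightBinding.TBModel d Nb S h₀ γ₀) (O : ℝ → ℝ),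
              (O = TightBinding.fermiDirac β μ ∨ O = TightBinding.grandPotential β μ) →
              (∀ N, TightBinding.HasFiniteBodyOrder.{u, v} M (TightBinding.interp (X W N) O)) ∧
              ∀ (Λ : Type v) (c : TightBinding.Config d S Λ), c.IsRegular r₀ →
                TightBinding.realSpectrum (TightBinding.hamiltonian M c) ⊆ W.bands →
                (β = ∞ → μ ∉ TightBinding.realSpectrum (TightBinding.hamiltonian M c)) →
                ∀ (N : ℕ) (ℓ : Λ),
                  |TightBinding.localObs M O c ℓ
                      - TightBinding.localPoly M (TightBinding.interp (X W N) O) c ℓ|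
                    ≤ C₁ W μ β * Real.exp (-(γN W μ β N) * N) ∧
                  -- the derivative in `(r_m, v_m)`; the norm below dominates the Euclidean one
                  ∀ m : Λ,
                    DifferentiableAt ℝ
                      (fun y => TightBinding.localObs M O (c.move m y) ℓ) (c.coord m) ∧
                    DifferentiableAt ℝ
                      (fun y => TightBinding.localPoly M
                        (TightBinding.interp (X W N) O) (c.move m y) ℓ) (c.coord m) ∧
                    ‖fderiv ℝ (fun y => TightBinding.localObs M O (c.move m y) ℓ) (c.coord m)
                      - fderiv ℝ (fun y => TightBinding.localPoly M
                          (TightBinding.interp (X W N) O) (c.move m y) ℓ) (c.coord m)‖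
                      ≤ C₂ W μ β * Real.exp (-(1 / 2) * γN W μ β N * N)
                          * Real.exp (-(η W μ β) * c.r ℓ m)) ∧
          -- asymptotics as `gap + β⁻¹ → 0`, with a gap symmetric about `μ` and fixed outer endpoints
          (∀ a μ b : ℝ, a < μ → μ < b →
            ∃ c₁ c₂ s₀ : ℝ, 0 < c₁ ∧ 0 < c₂ ∧ 0 < s₀ ∧
              ∀ (W : TightBinding.Window) (β : ℝ≥0∞) (s : ℝ),
                W.minMinus = a → W.maxPlus = b → μ - W.maxMinus = W.minPlus - μ → 0 < β →
                s = W.gap + (β⁻¹).toReal → 0 < s → s < s₀ →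
                (c₁ * s⁻¹ ≤ C₁ W μ β ∧ C₁ W μ β ≤ c₂ * s⁻¹) ∧
                (c₁ * (s ^ 3)⁻¹ ≤ C₂ W μ β ∧ C₂ W μ β ≤ c₂ * (s ^ 3)⁻¹) ∧
                (c₁ * s ≤ γ W μ β ∧ γ W μ β ≤ c₂ * s) ∧
                (c₁ * s ≤ η W μ β ∧ η W μ β ≤ c₂ * s)) := by
  -- the constants of the general estimates, as functions of the length scales
  choose ε k K hε hε' hk hK hest using TightBinding.exists_local_estimates.{u, v}
  have hX := fun (W : TightBinding.Window) (N : ℕ) =>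
    hest W.innerLength W.diam W.minMinus W.maxMinus W.minPlus W.maxPlus W.innerLength_pos
      W.innerLength_le.1 W.gap_nonneg W.innerLength_le.2 le_rfl N
  choose X hXcard hXmem hXest using hX
  refine ⟨X, fun W N => ⟨hXcard W N, fun x hx => ?_⟩, ?_⟩
  · exact (hXmem W N x hx).imp (fun h => ⟨h.1.le, h.2.le⟩) fun h => ⟨h.1.le, h.2.le⟩
  intro d Nb h₀ γ₀ r₀ hh₀ hγ₀ hr₀
  have hw := TightBinding.weightConst_nonneg.{v} d Nb hh₀.le hγ₀ r₀
  have hdc := TightBinding.derivConst_nonneg.{v} d Nb hh₀.le γ₀ r₀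
  set w := TightBinding.weightConst.{v} d Nb h₀ γ₀ r₀ with hwdef
  set dc := TightBinding.derivConst.{v} d Nb h₀ γ₀ r₀ with hdcdef
  set δ : TightBinding.Window → ℝ → ℝ≥0∞ → ℝ := fun W μ β =>
    W.width (ε W.innerLength W.diam) μ β with hδdef
  -- the additional terms keep the constants positive when there are no orbitals
  set A₁ : ℝ → ℝ → ℝ := fun lam D => (Nb + 1) * K lam D with hA₁
  set A₂ : ℝ → ℝ → ℝ := fun lam D => Nb * (96 * D * K lam D * dc) + 1 with hA₂
  -- the decay rate of the derivatives is limited by that of the resolvents and of the Hamiltonian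
  set κ : ℝ → ℝ := fun D => min (1 / (2 * (w + 1))) (γ₀ / (8 * D)) with hκ
  have hdiam : ∀ W : TightBinding.Window, 0 < W.diam := fun W =>
    W.innerLength_pos.trans_le W.innerLength_le_diam
  have hκ0 : ∀ D : ℝ, 0 < D → 0 < κ D := fun D hD => lt_min (by positivity) (by positivity)
  have hA₁0 : ∀ lam D, 0 < A₁ lam D := fun lam D => by
    have := hK lam D
    positivity
  have hA₂0 : ∀ lam D : ℝ, 0 < D → 0 < A₂ lam D := fun lam D hD => by
    have := hK lam D
    positivity
  refine ⟨fun W μ β _ => k W.innerLength W.diam * W.sep μ β,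
    fun W μ β => A₁ W.innerLength W.diam / δ W μ β,
    fun W μ β => A₂ W.innerLength W.diam / δ W μ β ^ 3,
    fun W μ β => k W.innerLength W.diam * W.sep μ β,
    fun W μ β => κ W.diam * δ W μ β, ?_, ?_⟩
  · intro W μ β hμ₁ hμ₂ hβ hgap
    have hsep := TightBinding.Window.sepSq_pos hμ₁ hμ₂ hβ hgap
    have hs := TightBinding.Window.sep_pos hsep
    set lam := W.innerLength
    set D := W.diam
    have hD : 0 < D := hdiam W
    have hδ : 0 < δ W μ β := TightBinding.Window.width_pos (hε lam D) hsep
    have hδs : δ W μ β ≤ ε lam D * W.sep μ β := TightBinding.Window.width_le (hε lam D) hsep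
    have hε1 : ε lam D ≤ 1 := (hε' lam D).trans (by norm_num)
    have hδD : δ W μ β ≤ D := by
      have h1 : W.sep μ β ≤ lam / 4 := TightBinding.Window.sep_le
      have h2 : lam ≤ D := W.innerLength_le_diam
      have h3 : ε lam D * W.sep μ β ≤ W.sep μ β := mul_le_of_le_one_left hs.le hε1
      have h4 : 0 < lam := W.innerLength_pos
      linarith
    have hk0 := hk lam D
    have hK0 := hK lam D
    have hη0 : 0 < κ D * δ W μ β := mul_pos (hκ0 D hD) hδ
    refine ⟨fun _ => mul_pos hk0 hs, tendsto_const_nhds, mul_pos hk0 hs, div_pos (hA₁0 _ _) hδ,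
      div_pos (hA₂0 _ _ hD) (by positivity), hη0, ?_⟩
    intro S M O hO
    refine ⟨fun N => TightBinding.hasFiniteBodyOrder hγ₀ M _, ?_⟩
    intro Λ c hc hσ hμσ N ℓ
    have hν := TightBinding.Window.lineRe_mem (β := β) hμ₁ hμ₂
    have hηγ : κ D * δ W μ β ≤ γ₀ / 8 := by
      have h1 : κ D * δ W μ β ≤ γ₀ / (8 * D) * D :=
        mul_le_mul (min_le_right _ _) hδD hδ.le (by positivity)
      have e : γ₀ / (8 * D) * D = γ₀ / 8 := by field_simp
      linarith
    have hηδ : κ D * δ W μ β * w ≤ δ W μ β / 2 := by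
      have h1 : κ D * w ≤ 1 / (2 * (w + 1)) * (w + 1) :=
        mul_le_mul (min_le_left _ _) (by linarith) hw (by positivity)
      have e : 1 / (2 * (w + 1)) * (w + 1) = 1 / 2 := by field_simp
      have h2 := mul_le_mul_of_nonneg_right (h1.trans e.le) hδ.le
      linarith
    obtain ⟨h1, h2⟩ := hXest W N β μ (W.lineRe μ β) (TightBinding.Window.lineIm β) (W.sep μ β)
      (δ W μ β) O hβ hO hμ₁ hμ₂ hν.1 hν.2 TightBinding.Window.lineRe_lineIm hs
      TightBinding.Window.sep_le (TightBinding.Window.sep_sq_le hsep) hδ hδs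
      (TightBinding.Window.width_mul_le (hε lam D) hε1 hsep) d Nb S h₀ γ₀ r₀ (κ D * δ W μ β) M Λ c
      hγ₀ hh₀.le hr₀ hc hσ hμσ hη0.le hηγ hηδ ℓ
    set e := Real.exp (-(k lam D * W.sep μ β * N)) with he
    have he0 : 0 < e := Real.exp_pos _
    constructor
    · have e1 : Real.exp (-(k lam D * W.sep μ β) * N) = e := by rw [he, neg_mul]
      refine h1.trans ?_
      rw [e1]
      have e2 : A₁ lam D / δ W μ β * e = Nb * (K lam D / δ W μ β * e) + K lam D / δ W μ β * e := by
        rw [hA₁]; ring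
      rw [e2]
      have : 0 < K lam D / δ W μ β * e := by positivity
      linarith
    · intro m
      obtain ⟨h3, h4, h5⟩ := h2 m
      refine ⟨h3, h4, h5.trans ?_⟩
      refine mul_le_mul_of_nonneg_right ?_ (Real.exp_pos _).le
      have h6 : e ≤ Real.exp (-(1 / 2) * (k lam D * W.sep μ β) * N) := by
        refine Real.exp_le_exp.2 ?_
        have : 0 ≤ k lam D * W.sep μ β * N := by positivity
        linarith
      have e1 : (Nb : ℝ) * (8 * (3 * D * (K lam D / δ W μ β * e) * ((2 / δ W μ β) ^ 2 * dc))) =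
          Nb * (96 * D * K lam D * dc) / δ W μ β ^ 3 * e := by
        field_simp
        ring
      rw [e1]
      refine mul_le_mul ?_ h6 he0.le (by have := hA₂0 lam D hD; positivity)
      refine div_le_div_of_nonneg_right ?_ (by positivity)
      rw [hA₂]
      linarith
  · intro a μ b haμ hμb
    set ρ := min (μ - a) (b - μ) with hρ
    have hρ0 : 0 < ρ := lt_min (by linarith) (by linarith)
    set lam := ρ / 2 with hlam
    set D := b - a with hD
    have hD0 : 0 < D := by rw [hD]; linarith
    have hε0 := hε lam D
    have hk0 := hk lam D
    have h10 := hA₁0 lam D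
    have h20 := hA₂0 lam D hD0
    have h30 := hκ0 D hD0
    -- the width `δ` lies between `lo * s` and `up * s`
    set lo := ε lam D / 80 with hlo
    set up := 4 * ε lam D with hup
    have hlo0 : 0 < lo := by positivity
    have hup0 : 0 < up := by positivity
    set c₁ := min (min (A₁ lam D / up) (A₂ lam D / up ^ 3)) (min (k lam D / 4) (κ D * lo)) with hc₁
    set c₂ := max (max (A₁ lam D / lo) (A₂ lam D / lo ^ 3)) (max (4 * k lam D) (κ D * up)) with hc₂
    have c11 : c₁ ≤ A₁ lam D / up := (min_le_left _ _).trans (min_le_left _ _)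
    have c12 : c₁ ≤ A₂ lam D / up ^ 3 := (min_le_left _ _).trans (min_le_right _ _)
    have c13 : c₁ ≤ k lam D / 4 := (min_le_right _ _).trans (min_le_left _ _)
    have c14 : c₁ ≤ κ D * lo := (min_le_right _ _).trans (min_le_right _ _)
    have c21 : A₁ lam D / lo ≤ c₂ := (le_max_left _ _).trans (le_max_left _ _)
    have c22 : A₂ lam D / lo ^ 3 ≤ c₂ := (le_max_right _ _).trans (le_max_left _ _)
    have c23 : 4 * k lam D ≤ c₂ := (le_max_left _ _).trans (le_max_right _ _)
    have c24 : κ D * up ≤ c₂ := (le_max_right _ _).trans (le_max_right _ _)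
    refine ⟨c₁, c₂, ρ / 32, ?_, ?_, by positivity, ?_⟩
    · exact lt_min (lt_min (by positivity) (by positivity)) (lt_min (by positivity) (by positivity))
    · exact lt_of_lt_of_le (by positivity) c21
    intro W β s hWa hWb hsymm hβ hs hs0 hs1
    obtain ⟨hlen, hsep, hsl, hsu, hgs⟩ := TightBinding.Window.scales_of_symm (W := W) (β := β) hsymm
      hs hs0 (by rw [hWa, hWb]; exact hs1)
    have hlen' : W.innerLength = lam := by rw [hlen, hWa, hWb]
    have hdiam' : W.diam = D := by rw [TightBinding.Window.diam, hWa, hWb]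
    have hg := W.gap_nonneg'
    simp only [hδdef, hlen', hdiam']
    set t := W.sep μ β with ht
    have ht0 : 0 < t := by linarith
    set Δ := W.width (ε lam D) μ β with hΔ
    have hΔu : Δ ≤ up * s := by
      have := TightBinding.Window.width_le hε0 hsep
      have h2 := mul_le_mul_of_nonneg_left hsu hε0.le
      rw [hup]
      linarith
    have hΔl : lo * s ≤ Δ := by
      have h1 : (s / 4) ^ 2 ≤ t ^ 2 := pow_le_pow_left₀ (by positivity) hsl 2
      rw [hΔ, TightBinding.Window.width, ← ht, le_div_iff₀ (by positivity)]
      calc lo * s * (W.gap + t) ≤ lo * s * (5 * s) :=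
            mul_le_mul_of_nonneg_left (by linarith) (by positivity)
        _ = ε lam D * (s / 4) ^ 2 := by rw [hlo]; ring
        _ ≤ _ := mul_le_mul_of_nonneg_left h1 hε0.le
    have hls : 0 < lo * s := by positivity
    have hΔ0 : 0 < Δ := hls.trans_le hΔl
    have hsi : 0 ≤ s⁻¹ := by positivity
    have hsi3 : 0 ≤ (s ^ 3)⁻¹ := by positivity
    refine ⟨⟨?_, ?_⟩, ⟨?_, ?_⟩, ⟨?_, ?_⟩, ?_, ?_⟩
    · calc c₁ * s⁻¹ ≤ A₁ lam D / up * s⁻¹ := mul_le_mul_of_nonneg_right c11 hsi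
        _ = A₁ lam D / (up * s) := by rw [← div_eq_mul_inv, div_div]
        _ ≤ _ := div_le_div_of_nonneg_left h10.le hΔ0 hΔu
    · calc A₁ lam D / Δ ≤ A₁ lam D / (lo * s) := div_le_div_of_nonneg_left h10.le hls hΔl
        _ = A₁ lam D / lo * s⁻¹ := by rw [← div_eq_mul_inv, div_div]
        _ ≤ _ := mul_le_mul_of_nonneg_right c21 hsi
    · calc c₁ * (s ^ 3)⁻¹ ≤ A₂ lam D / up ^ 3 * (s ^ 3)⁻¹ := mul_le_mul_of_nonneg_right c12 hsi3
        _ = A₂ lam D / (up * s) ^ 3 := by rw [← div_eq_mul_inv, div_div, ← mul_pow]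
        _ ≤ _ := div_le_div_of_nonneg_left h20.le (by positivity)
          (pow_le_pow_left₀ hΔ0.le hΔu 3)
    · calc A₂ lam D / Δ ^ 3 ≤ A₂ lam D / (lo * s) ^ 3 :=
            div_le_div_of_nonneg_left h20.le (by positivity) (pow_le_pow_left₀ hls.le hΔl 3)
        _ = A₂ lam D / lo ^ 3 * (s ^ 3)⁻¹ := by rw [← div_eq_mul_inv, div_div, ← mul_pow]
        _ ≤ _ := mul_le_mul_of_nonneg_right c22 hsi3
    · calc c₁ * s ≤ k lam D / 4 * s := mul_le_mul_of_nonneg_right c13 hs0.le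
        _ = k lam D * (s / 4) := by ring
        _ ≤ _ := mul_le_mul_of_nonneg_left hsl hk0.le
    · calc k lam D * t ≤ k lam D * (4 * s) := mul_le_mul_of_nonneg_left hsu hk0.le
        _ = 4 * k lam D * s := by ring
        _ ≤ _ := mul_le_mul_of_nonneg_right c23 hs0.le
    · calc c₁ * s ≤ κ D * lo * s := mul_le_mul_of_nonneg_right c14 hs0.le
        _ = κ D * (lo * s) := by ring
        _ ≤ _ := mul_le_mul_of_nonneg_left hΔl h30.le
    · calc κ D * Δ ≤ κ D * (up * s) := mul_le_mul_of_nonneg_left hΔu h30.le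
        _ = κ D * up * s := by ring
        _ ≤ _ := mul_le_mul_of_nonneg_right c24 hs0.le
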